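/- Let $N\ge 2$, let $h$ be a formal parameter, and let $G=(g_{ij})$ be a nonsingular complex $N\times N$ matrix with $G^t=G$ (then $\mathfrak g_N=\mathfrak o_N$) or $G^t=-G$ (then $\mathfrak g_N=\mathfrak{sp}_N$). *Double Yangian.* Let $P$ be the permutation operator on $\mathbb C^N\otimes\mathbb C^N$, $R(u)=1-\frac hu P$ and $\overline R(u)=g(u/h)R(u)$, where $g(u)\in 1+u^{-1}\mathbb C[[u^{-1}]]$ is the unique series with $g(u+N)=g(u)(1-u^{-2})$; negative powers of linear expressions are expanded in negative powers of the leftmost variable. The superscript $t$ denotes transposition of matrices, and $\overline R^{\,t}$ is $\overline R$ transposed in one tensor factor. The double Yangian $\mathrm{DY}(\mathfrak{gl}_N)$ is the ($h$-torsion free) associative $\mathbb C[[h]]$-algebra generated by a central element $C$ and elements $t_{ij}^{(\pm r)}$ ($1\le i,j\le N$, $r\ge1$) subject to $$R(u-v)T_1(u)T_2(v)=T_2(v)T_1(u)R(u-v),\qquad R(u-v)T^+_1(u)T^+_2(v)=T^+_2(v)T^+_1(u)R(u-v),$$ $$\overline R(u-v+hC/2)\,T_1(u)T_2^+(v)=T_2^+(v)T_1(u)\,\overline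 R(u-v-hC/2),$$ where $T(u)$ and $T^+(u)$ are the matrices with entries $\delta_{ij}+h\sum_{r\ge1}t_{ij}^{(r)}u^{-r}$ and $\delta_{ij}-h\sum_{r\ge1}t_{ij}^{(-r)}u^{r-1}$. For $c\in\mathbb C$ let $\mathrm{DY}_c$ be its quotient by the ideal generated by $C-c$, and let $\mathcal V_c(\mathfrak{gl}_N)$ be the $h$-adic completion of the quotient of $\mathrm{DY}_c$ by the left ideal generated by all $t_{ij}^{(r)}$, $r\ge1$; let $1\in\mathcal V_c(\mathfrak{gl}_N)$ be the image of the unit. *Twisted Yangians.* Put $S(u)=T(u+hc)\,G\,T^t(-u)$ and $S^+(u)=T^+(u)\,G\,T^{+t}(-u)$, and write their entries as $s_{ij}(u)=g_{ij}+h\sum_{r\ge1}s_{ij}^{(r)}u^{-r}$ and $s^+_{ij}(u)=g_{ij}-h\sum_{r\ge1}s_{ij}^{(-r)}u^{r-1}$. Let $\mathrm A_c(\mathfrak g_N)\subset\mathrm{DY}_c$ be the subalgebra generated by all $s_{ij}^{(\pm r)}$, $r\ge 1$, and let $\mathcal M_c(\mathfrak g_N)\subset\mathcal V_c(\mathfrak{gl}_N)$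 be the $h$-adic completion of $\{v\in\mathcal V_c(\mathfrak{gl}_N): h^kv\in \mathrm A_c(\mathfrak g_N)1\text{ for some }k\ge0\}$. Its submodule of invariants is $$\mathfrak z(\mathcal M_c(\mathfrak g_N))=\{w\in\mathcal M_c(\mathfrak g_N): S(u)w=G\otimes w\}.$$ *The series $\mathbb M_\nu(u)$.* Let $\nu$ be a Young diagram with $n$ boxes and at most $N$ rows, and let $\mathcal U$ be a standard $\nu$-tableau with contents $c_1,\dots,c_n$ ($c_k=j-i$ if $k$ occupies the box $(i,j)$). Let $\mathcal E_{\mathcal U}$ be the image, under the permutation action of $\mathfrak S_n$ on $(\mathbb C^N)^{\otimes n}$, of the primitive idempotent of $\mathbb C[\mathfrak S_n]$ associated with $\mathcal U$ through the orthonormal Young bases. For $u=(u_1,\dots,u_n)$ put $$S^+_{[n]}(u)=\prod_{i=1}^{n}\Big(S_i^+(u_i)\,\overline R^{\,t}_{i,i+1}(-u_i-u_{i+1})\cdots\overline R^{\,t}_{in}(-u_i-u_n)\Big),$$ $$S_{[n]}(u)=\prod_{i=1}^{n}\Big(S_i(u_i)\,\overline R^{\,t}_{i,i+1}(-u_i-u_{i+1}-hc)\cdots\overline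 R^{\,t}_{in}(-u_i-u_n-hc)\Big),$$ the factors being ordered from left to right with increasing $i$. Let now $c=-N/2$ (the critical level), $u_\nu=(u+hc_1,\dots,u+hc_n)$, let $u_\nu-hN/4$ be obtained from $u_\nu$ by subtracting $hN/4$ from each member, and $$\mathbb A_\nu(u)=\mathrm{tr}_{1,\dots,n}\,\mathcal E_{\mathcal U}\,S^+_{[n]}(u_\nu)\,S_{[n]}(u_\nu-hN/4)^{-1},\qquad \mathbb M_\nu(u)=\mathbb A_\nu(u)1,$$ where the trace is over all $n$ copies of $\mathrm{End}\,\mathbb C^N$, the coefficients act on $\mathcal V_{-N/2}(\mathfrak{gl}_N)$ and infinite sums converge $h$-adically. **Statement.** The series $\mathbb M_\nu(u)$ is well defined, and all its coefficients belong to $\mathfrak z(\mathcal M_{-N/2}(\mathfrak g_N))$. -/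

import Mathlib

open PowerSeries

noncomputable section

namespace TwistedYangian

/-! ### The base ring and substitutions into formal series -/

/-- The base ring `ℂ[[h]]`. -/
abbrev K : Type := PowerSeries ℂ

/-- The formal parameter `h`. -/
abbrev h : K := PowerSeries.X

/-- A complex number as a constant of `ℂ[[h]]`. -/
abbrev cst (z : ℂ) : K := PowerSeries.C z

section Series

variable {B : Type*} [Ring B]

/-- The expansion of `(α u + β)⁻¹` in negative powers of `u`, that is
`∑_{m ≥ 1} α^{-m} (-β)^{m-1} u^{-m}`, written as a power series in the variable `u⁻¹`.
The first argument is `a = α⁻¹`. -/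
def linInv (a β : B) : PowerSeries B :=
  PowerSeries.mk fun m => if m = 0 then 0 else a ^ m * (-β) ^ (m - 1)

/-- For a series `f(u) = ∑ f_r u^{-r}` (a power series in `u⁻¹`), the series `f(α u + β)` expanded
in negative powers of `u`. The first argument is `a = α⁻¹`. -/
def subInv (a β : B) (f : PowerSeries B) : PowerSeries B :=
  PowerSeries.mk fun m =>
    ∑ r ∈ Finset.range (m + 1), PowerSeries.coeff r f * PowerSeries.coeff m (linInv a β ^ r)

/-- For a power series `f(u)`, the series `f(-u)`. -/
def negVar (f : PowerSeries B) : PowerSeries B :=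
  PowerSeries.mk fun r => (-1) ^ r * PowerSeries.coeff r f

theorem linInv_constCoeff (a β : B) : PowerSeries.coeff 0 (linInv a β) = 0 := by
  simp [linInv]

theorem subInv_add (a β : B) (f g : PowerSeries B) :
    subInv a β (f + g) = subInv a β f + subInv a β g := by
  ext m
  simp [subInv, add_mul, Finset.sum_add_distrib]

theorem subInv_one (a β : B) : subInv a β (1 : PowerSeries B) = 1 := by
  ext m
  simp only [subInv, PowerSeries.coeff_mk, PowerSeries.coeff_one, ite_mul, one_mul, zero_mul]
  rw [Finset.sum_ite_eq']
  simp [PowerSeries.coeff_one]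

theorem subInv_zero (a β : B) : subInv a β (0 : PowerSeries B) = 0 := by
  ext m
  simp [subInv]

theorem subInv_smul [Algebra K B] (a β : B) (z : K) (f : PowerSeries B) :
    subInv a β (z • f) = z • subInv a β f := by
  ext m
  simp [subInv, Finset.smul_sum]

theorem negVar_add (f g : PowerSeries B) : negVar (f + g) = negVar f + negVar g := by
  ext m
  simp [negVar, mul_add]

theorem negVar_sub (f g : PowerSeries B) : negVar (f - g) = negVar f - negVar g := by
  ext m
  simp [negVar, mul_sub]

theorem negVar_smul [Algebra K B] (z : K) (f : PowerSeries B) :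
    negVar (z • f) = z • negVar f := by
  ext m
  simp [negVar]

theorem negVar_one : negVar (1 : PowerSeries B) = 1 := by
  ext m
  simp only [negVar, PowerSeries.coeff_mk, PowerSeries.coeff_one]
  split_ifs with hm <;> simp [hm]

theorem negVar_zero : negVar (0 : PowerSeries B) = 0 := by
  ext m
  simp [negVar]

end Series

/-! ### The Yang `R`-matrix and its normalization -/

/-- The defining property of the normalizing series: `g(u) ∈ 1 + u⁻¹ ℂ[[u⁻¹]]` and
`g(u + N) = g(u) (1 - u⁻²)` (a power series in the variable `u⁻¹`). -/
def IsNormalizing (N : ℕ) (g : PowerSeries ℂ) : Prop :=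
  PowerSeries.coeff 0 g = 1 ∧ subInv 1 (N : ℂ) g = g * (1 - PowerSeries.X ^ 2)

/-- The coefficient of `u^{-m}` in `(u + N)^{-r}`. -/
def shiftCoeff (N r m : ℕ) : ℂ := PowerSeries.coeff m (linInv (1 : ℂ) (N : ℂ) ^ r)

/-- The coefficients of the normalizing series, obtained by solving
`g(u + N) = g(u) (1 - u⁻²)` recursively. -/
def normCoeff (N : ℕ) : ℕ → ℂ
  | 0 => 1
  | m + 1 => (normCoeff N m + ∑ r : Fin (m + 1), normCoeff N r * shiftCoeff N r (m + 2)) /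
      (((m : ℂ) + 1) * N)

/-- The unique series `g(u) ∈ 1 + u⁻¹ ℂ[[u⁻¹]]` with `g(u + N) = g(u) (1 - u⁻²)`, as a power
series in the variable `u⁻¹`. -/
def gSeries (N : ℕ) : PowerSeries ℂ := PowerSeries.mk (normCoeff N)

theorem linInv_eq_X_mul (b : ℂ) :
    linInv (1 : ℂ) b = PowerSeries.X * PowerSeries.mk fun m => (-b) ^ m := by
  ext m
  cases m with
  | zero => simp [linInv]
  | succ m => simp [linInv, PowerSeries.coeff_succ_X_mul]

theorem shiftCoeff_eq (N r d : ℕ) :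
    shiftCoeff N r (r + d) =
      PowerSeries.coeff d ((PowerSeries.mk fun m => (-(N : ℂ)) ^ m) ^ r) := by
  rw [shiftCoeff, linInv_eq_X_mul, mul_pow, add_comm, PowerSeries.coeff_X_pow_mul]

theorem shiftCoeff_self (N r : ℕ) : shiftCoeff N r r = 1 := by
  have := shiftCoeff_eq N r 0
  rw [add_zero] at this
  rw [this, PowerSeries.coeff_zero_eq_constantCoeff_apply, map_pow]
  simp [← PowerSeries.coeff_zero_eq_constantCoeff_apply]

theorem shiftCoeff_succ (N r : ℕ) : shiftCoeff N r (r + 1) = -(r * N) := by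
  rw [shiftCoeff_eq]
  induction r with
  | zero => simp [PowerSeries.coeff_one]
  | succ r ih =>
    rw [pow_succ, PowerSeries.coeff_mul, Finset.Nat.antidiagonal_succ]
    simp only [Finset.Nat.antidiagonal_zero, Finset.map_singleton, Finset.sum_cons,
      Finset.sum_singleton, Function.Embedding.prodMap, Function.Embedding.coeFn_mk, Prod.map,
      Nat.succ_eq_add_one, zero_add, Function.Embedding.refl_apply, ih, PowerSeries.coeff_mk]
    have h0 := shiftCoeff_eq N r 0
    rw [add_zero, shiftCoeff_self] at h0
    rw [← h0]
    push_cast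
    ring

/-- `gSeries N` has the defining property of the normalizing series. -/
theorem gSeries_isNormalizing (N : ℕ) (hN : N ≠ 0) : IsNormalizing N (gSeries N) := by
  refine ⟨by simp [gSeries, normCoeff], ?_⟩
  ext m
  have hs : ∀ r, PowerSeries.coeff m (linInv (1 : ℂ) (N : ℂ) ^ r) = shiftCoeff N r m :=
    fun _ => rfl
  simp only [subInv, gSeries, PowerSeries.coeff_mk, hs, mul_sub, mul_one, map_sub]
  rw [PowerSeries.coeff_mul_X_pow', Finset.sum_range_succ, shiftCoeff_self]
  match m with
  | 0 => simp
  | 1 => simpa using Or.inr (shiftCoeff_succ N 0)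
  | m + 2 =>
    have hN' : ((m : ℂ) + 1) * N ≠ 0 :=
      mul_ne_zero (by exact_mod_cast Nat.succ_ne_zero m) (by exact_mod_cast hN)
    have hrec : normCoeff N (m + 1) * (((m : ℂ) + 1) * N) =
        normCoeff N m + ∑ r : Fin (m + 1), normCoeff N r * shiftCoeff N r (m + 2) := by
      rw [normCoeff, div_mul_cancel₀ _ hN']
    rw [Fin.sum_univ_eq_sum_range fun r => normCoeff N r * shiftCoeff N r (m + 2)] at hrec
    rw [Finset.sum_range_succ, shiftCoeff_succ N (m + 1)]
    simp only [le_add_iff_nonneg_left, zero_le, if_true, Nat.add_sub_cancel,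
      PowerSeries.coeff_mk]
    push_cast
    linear_combination -hrec

/-- The series `g(u / h) = ∑ g_k h^k u^{-k}`, a power series in `u⁻¹` over `ℂ[[h]]`. -/
def gScaled (N : ℕ) : PowerSeries K :=
  PowerSeries.mk fun k => cst (PowerSeries.coeff k (gSeries N)) * h ^ k

/-- The permutation operator `P = ∑ e_{ij} ⊗ e_{ji}`. -/
def permP (N : ℕ) (R : Type*) [Ring R] : Matrix (Fin N × Fin N) (Fin N × Fin N) R :=
  Matrix.of fun p q => if p.1 = q.2 ∧ p.2 = q.1 then 1 else 0

/-- The transposition `e_{rs} ↦ e_{sr}` applied on the first tensor factor. -/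
def ptranspose {N : ℕ} {R : Type*} (M : Matrix (Fin N × Fin N) (Fin N × Fin N) R) :
    Matrix (Fin N × Fin N) (Fin N × Fin N) R :=
  Matrix.of fun p q => M (q.1, p.2) (p.1, q.2)

/-- The normalized `R`-matrix `R̄(w) = g(w/h) (1 - (h/w) P)` at `w = α u + β`, expanded in negative
powers of `u` (entries are power series in `u⁻¹`). The argument `a` is `α⁻¹`. -/
def Rbar (N : ℕ) {B : Type*} [Ring B] [Algebra K B] (a β : B) :
    Matrix (Fin N × Fin N) (Fin N × Fin N) (PowerSeries B) :=
  subInv a β ((gScaled N).map (algebraMap K B)) •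
    (1 - (h • linInv a β) • permP N (PowerSeries B))

/-! ### Copies of matrices in tensor products

`(End ℂ^N)^{⊗ n} ⊗ R` is the ring of matrices with entries in `R` whose rows and columns are indexed
by multi-indices `Fin n → Fin N`. -/

section Legs

variable {n N : ℕ} {R : Type*} [Ring R]

/-- The copy of the matrix `M` in the `i`-th tensor factor. -/
def leg (i : Fin n) (M : Matrix (Fin N) (Fin N) R) :
    Matrix (Fin n → Fin N) (Fin n → Fin N) R :=
  Matrix.of fun a b => if ∀ k, k ≠ i → a k = b k then M (a i) (b i) else 0

/-- The copy of the matrix `M ∈ End ℂ^N ⊗ End ℂ^N ⊗ R` in the tensor factors `i` and `j`. -/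
def leg₂ (i j : Fin n) (M : Matrix (Fin N × Fin N) (Fin N × Fin N) R) :
    Matrix (Fin n → Fin N) (Fin n → Fin N) R :=
  Matrix.of fun a b =>
    if ∀ k, k ≠ i → k ≠ j → a k = b k then M (a i, a j) (b i, b j) else 0

end Legs

/-! ### The double Yangian -/

/-- Generators of the double Yangian: the element `C`, the elements `t_{ij}^{(r+1)}` (`tpos i j r`)
and the elements `t_{ij}^{(-(r+1))}` (`tneg i j r`), where `r ≥ 0`. -/
inductive Gen (N : ℕ) : Type
  | C : Gen N
  | tpos (i j : Fin N) (r : ℕ) : Gen N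
  | tneg (i j : Fin N) (r : ℕ) : Gen N

section TMatrices

variable {N : ℕ} {A : Type*} [Ring A] [Algebra K A]

/-- The matrix with entries `∑_{r ≥ 1} t_{ij}^{(r)} u^{-r}` (power series in `u⁻¹`), where
`t i j r` stands for `t_{ij}^{(r+1)}`. -/
def tauMatrix (t : Fin N → Fin N → ℕ → A) : Matrix (Fin N) (Fin N) (PowerSeries A) :=
  Matrix.of fun i j => PowerSeries.mk fun r => if r = 0 then 0 else t i j (r - 1)

/-- The matrix with entries `∑_{r ≥ 1} t_{ij}^{(-r)} u^{r-1}` (power series in `u`), where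
`t i j r` stands for `t_{ij}^{(-(r+1))}`. -/
def tauPlusMatrix (t : Fin N → Fin N → ℕ → A) : Matrix (Fin N) (Fin N) (PowerSeries A) :=
  Matrix.of fun i j => PowerSeries.mk fun r => t i j r

/-- `T(u)`, with entries `δ_{ij} + h ∑_{r ≥ 1} t_{ij}^{(r)} u^{-r}` (power series in `u⁻¹`). -/
def TMatrix (t : Fin N → Fin N → ℕ → A) : Matrix (Fin N) (Fin N) (PowerSeries A) :=
  1 + h • tauMatrix t

/-- `T⁺(u)`, with entries `δ_{ij} - h ∑_{r ≥ 1} t_{ij}^{(-r)} u^{r-1}` (power series in `u`). -/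
def TPlusMatrix (t : Fin N → Fin N → ℕ → A) : Matrix (Fin N) (Fin N) (PowerSeries A) :=
  1 - h • tauPlusMatrix t

/-- A power series in the first (outer) variable, regarded as a series in two variables. -/
def inFst (f : PowerSeries A) : PowerSeries (PowerSeries A) := PowerSeries.map PowerSeries.C f

/-- A power series in the second (inner) variable, regarded as a series in two variables. -/
def inSnd (f : PowerSeries A) : PowerSeries (PowerSeries A) := PowerSeries.C f

end TMatrices

/-- The free `ℂ[[h]]`-algebra on the generators. -/
abbrev FreeGen (N : ℕ) : Type := FreeAlgebra K (Gen N)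

/-- The generators `C`, `t_{ij}^{(r+1)}`, `t_{ij}^{(-(r+1))}` in the free algebra. -/
abbrev freeC (N : ℕ) : FreeGen N := FreeAlgebra.ι K Gen.C

/-- `t_{ij}^{(r+1)}` in the free algebra. -/
abbrev freePos (N : ℕ) (i j : Fin N) (r : ℕ) : FreeGen N := FreeAlgebra.ι K (Gen.tpos i j r)

/-- `t_{ij}^{(-(r+1))}` in the free algebra. -/
abbrev freeNeg (N : ℕ) (i j : Fin N) (r : ℕ) : FreeGen N := FreeAlgebra.ι K (Gen.tneg i j r)

/-- Matrices in `End ℂ^N ⊗ End ℂ^N` with entries in series in two variables over the free algebra.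
The outer variable belongs to `u`, the inner one to `v`. -/
abbrev TwoVar (N : ℕ) : Type :=
  Matrix (Fin 2 → Fin N) (Fin 2 → Fin N) (PowerSeries (PowerSeries (FreeGen N)))

/-- The Yang `R`-matrix with cleared denominator in the variables `x = u⁻¹` (outer) and
`y = v⁻¹` (inner): `x y (u - v) R(u - v) = (y - x) - h x y P`. -/
def clearedRInv (N : ℕ) : TwoVar N :=
  (inSnd PowerSeries.X - inFst PowerSeries.X : PowerSeries (PowerSeries (FreeGen N))) • 1 -
    (h • (inFst PowerSeries.X * inSnd PowerSeries.X) :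
      PowerSeries (PowerSeries (FreeGen N))) • leg₂ 0 1 (permP N _)

/-- The Yang `R`-matrix with cleared denominator in the variables `u` (outer) and
`v` (inner): `(u - v) R(u - v) = (u - v) - h P`. -/
def clearedR (N : ℕ) : TwoVar N :=
  (inFst PowerSeries.X - inSnd PowerSeries.X : PowerSeries (PowerSeries (FreeGen N))) • 1 -
    (h • (1 : PowerSeries (PowerSeries (FreeGen N)))) • leg₂ 0 1 (permP N _)

/-- `R̄(u - v + b)` for an element `b`, expanded in negative powers of `u`; the outer variable is
`u⁻¹`, the inner one is `v`. -/
def RbarShift (N : ℕ) (b : FreeGen N) : TwoVar N :=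
  leg₂ 0 1 (Rbar N (B := PowerSeries (FreeGen N)) 1 (PowerSeries.C b - PowerSeries.X))

/-- The element `h C / 2`. -/
def halfC (N : ℕ) : FreeGen N := (h * cst (1 / 2)) • freeC N

/-- Left-hand side of `R(u-v) T₁(u) T₂(v) = T₂(v) T₁(u) R(u-v)`, multiplied by `u⁻¹ v⁻¹ (u - v)`. -/
def rttLeft (N : ℕ) : TwoVar N :=
  clearedRInv N * leg 0 ((TMatrix (freePos N)).map inFst) * leg 1 ((TMatrix (freePos N)).map inSnd)

/-- Right-hand side of `R(u-v) T₁(u) T₂(v) = T₂(v) T₁(u) R(u-v)`, multiplied as `rttLeft`. -/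
def rttRight (N : ℕ) : TwoVar N :=
  leg 1 ((TMatrix (freePos N)).map inSnd) * leg 0 ((TMatrix (freePos N)).map inFst) * clearedRInv N

/-- Left-hand side of `R(u-v) T₁⁺(u) T₂⁺(v) = T₂⁺(v) T₁⁺(u) R(u-v)`, multiplied by `u - v`. -/
def rttPlusLeft (N : ℕ) : TwoVar N :=
  clearedR N * leg 0 ((TPlusMatrix (freeNeg N)).map inFst) *
    leg 1 ((TPlusMatrix (freeNeg N)).map inSnd)

/-- Right-hand side of `R(u-v) T₁⁺(u) T₂⁺(v) = T₂⁺(v) T₁⁺(u) R(u-v)`, multiplied as `rttPlusLeft`. -/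
def rttPlusRight (N : ℕ) : TwoVar N :=
  leg 1 ((TPlusMatrix (freeNeg N)).map inSnd) * leg 0 ((TPlusMatrix (freeNeg N)).map inFst) *
    clearedR N

/-- Left-hand side of
`R̄(u-v+hC/2) T₁(u) T₂⁺(v) = T₂⁺(v) T₁(u) R̄(u-v-hC/2)`. -/
def rttMixedLeft (N : ℕ) : TwoVar N :=
  RbarShift N (halfC N) * leg 0 ((TMatrix (freePos N)).map inFst) *
    leg 1 ((TPlusMatrix (freeNeg N)).map inSnd)

/-- Right-hand side of `R̄(u-v+hC/2) T₁(u) T₂⁺(v) = T₂⁺(v) T₁(u) R̄(u-v-hC/2)`. -/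
def rttMixedRight (N : ℕ) : TwoVar N :=
  leg 1 ((TPlusMatrix (freeNeg N)).map inSnd) * leg 0 ((TMatrix (freePos N)).map inFst) *
    RbarShift N (-halfC N)

/-- The defining relations of the double Yangian: `C` is central, and all coefficients of all matrix
entries of the three `RTT` relations. -/
inductive DYRel (N : ℕ) : FreeGen N → FreeGen N → Prop
  | central (x : Gen N) : DYRel N (freeC N * FreeAlgebra.ι K x) (FreeAlgebra.ι K x * freeC N)
  | rtt (a b : Fin 2 → Fin N) (r s : ℕ) :
      DYRel N (PowerSeries.coeff s (PowerSeries.coeff r (rttLeft N a b)))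
        (PowerSeries.coeff s (PowerSeries.coeff r (rttRight N a b)))
  | rttPlus (a b : Fin 2 → Fin N) (r s : ℕ) :
      DYRel N (PowerSeries.coeff s (PowerSeries.coeff r (rttPlusLeft N a b)))
        (PowerSeries.coeff s (PowerSeries.coeff r (rttPlusRight N a b)))
  | rttMixed (a b : Fin 2 → Fin N) (r s : ℕ) :
      DYRel N (PowerSeries.coeff s (PowerSeries.coeff r (rttMixedLeft N a b)))
        (PowerSeries.coeff s (PowerSeries.coeff r (rttMixedRight N a b)))

/-- The quotient of the free algebra by the relations `DYRel`. -/
def PreDY (N : ℕ) : Type := RingQuot (DYRel N)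

instance (N : ℕ) : Ring (PreDY N) := inferInstanceAs (Ring (RingQuot (DYRel N)))
instance (N : ℕ) : Algebra K (PreDY N) := inferInstanceAs (Algebra K (RingQuot (DYRel N)))

/-- The double Yangian `DY(gl_N)` over `ℂ[[h]]`. Since `T(u)` and `T⁺(u)` are congruent to `1` modulo
`h`, all coefficients of the `RTT` relations between the generators `t_{ij}^{(±r)}` carry a power of
`h` as a common factor, which has to be cancelled (so that the algebra has no `h`-torsion and
satisfies the Poincaré–Birkhoff–Witt theorem): elements that become equal after multiplication by a
power of `h` are identified. -/
def DY (N : ℕ) : Type := RingQuot fun x y : PreDY N => ∃ k : ℕ, h ^ k • x = h ^ k • y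

instance (N : ℕ) : Ring (DY N) := inferInstanceAs (Ring (RingQuot _))
instance (N : ℕ) : Algebra K (DY N) := inferInstanceAs (Algebra K (RingQuot _))

/-- The projection of the free algebra to the double Yangian. -/
def toDY (N : ℕ) : FreeGen N →ₐ[K] DY N :=
  (RingQuot.mkAlgHom K fun x y : PreDY N => ∃ k : ℕ, h ^ k • x = h ^ k • y).comp
    (RingQuot.mkAlgHom K (DYRel N))

/-- The double Yangian `DY_c(gl_N)` at the level `c`: the quotient by the ideal generated by
`C - c`. -/
def DYc (N : ℕ) (c : ℂ) : Type :=
  RingQuot fun x y : DY N => x = toDY N (freeC N) ∧ y = algebraMap K (DY N) (cst c)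

instance (N : ℕ) (c : ℂ) : Ring (DYc N c) := inferInstanceAs (Ring (RingQuot _))
instance (N : ℕ) (c : ℂ) : Algebra K (DYc N c) := inferInstanceAs (Algebra K (RingQuot _))

/-- The projection of the free algebra to the double Yangian at the level `c`. -/
def toDYc (N : ℕ) (c : ℂ) : FreeGen N →ₐ[K] DYc N c :=
  (RingQuot.mkAlgHom K
    fun x y : DY N => x = toDY N (freeC N) ∧ y = algebraMap K (DY N) (cst c)).comp (toDY N)

/-- The element `t_{ij}^{(r+1)}` of `DY_c(gl_N)`. -/
def tPos (N : ℕ) (c : ℂ) (i j : Fin N) (r : ℕ) : DYc N c := toDYc N c (freePos N i j r)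

/-- The element `t_{ij}^{(-(r+1))}` of `DY_c(gl_N)`. -/
def tNeg (N : ℕ) (c : ℂ) (i j : Fin N) (r : ℕ) : DYc N c := toDYc N c (freeNeg N i j r)

/-! ### The vacuum module of the double Yangian -/

/-- The left ideal of `DY_c(gl_N)` generated by all `t_{ij}^{(r)}` with `r ≥ 1`. -/
def vacIdeal (N : ℕ) (c : ℂ) : Submodule (DYc N c) (DYc N c) :=
  Submodule.span (DYc N c) {x | ∃ i j r, x = tPos N c i j r}

/-- The quotient of `DY_c(gl_N)` by the left ideal `vacIdeal`. -/
abbrev PreVac (N : ℕ) (c : ℂ) : Type := DYc N c ⧸ vacIdeal N c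

/-- The ideal of `ℂ[[h]]` generated by `h`. -/
abbrev hIdeal : Ideal K := Ideal.span {h}

/-- The vacuum module `𝒱_c(gl_N)`: the `h`-adic completion of `PreVac`. -/
abbrev Vac (N : ℕ) (c : ℂ) : Type := AdicCompletion hIdeal (PreVac N c)

/-- The vacuum vector. -/
def vac (N : ℕ) (c : ℂ) : Vac N c :=
  AdicCompletion.of hIdeal (PreVac N c) (Submodule.Quotient.mk 1)

/-- The `ℂ[[h]]`-linear operators on the vacuum module. -/
abbrev VacEnd (N : ℕ) (c : ℂ) : Type := Module.End K (Vac N c)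

/-- The action of `DY_c(gl_N)` on the vacuum module: the extension of the left multiplication to the
completion. -/
def act (N : ℕ) (c : ℂ) : DYc N c →ₐ[K] VacEnd N c :=
  AlgHom.ofLinearMap
    { toFun := fun x =>
        (AdicCompletion.map hIdeal (Algebra.lsmul K K (PreVac N c) x)).restrictScalars K
      map_add' := by
        intro x y
        ext w k
        simp
      map_smul' := by
        intro z x
        ext w k
        simp [AdicCompletion.val_smul_apply] }
    (by
      ext w k
      simp)
    (by
      intro x y
      ext w k
      simp)

/-! ### Twisted Yangians -/

section Twisted

variable (N : ℕ) (c : ℂ) (G : Matrix (Fin N) (Fin N) ℂ)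

/-- The complex matrix `G` as a matrix with entries in a ring of series. -/
def constMatrix {N : ℕ} (G : Matrix (Fin N) (Fin N) ℂ) (A : Type*) [Ring A] [Algebra K A] :
    Matrix (Fin N) (Fin N) (PowerSeries A) :=
  G.map fun z => algebraMap K (PowerSeries A) (cst z)

/-- `S(u) = T(u + h c) G Tᵗ(-u)`, with entries in power series in `u⁻¹`. -/
def SMatrix : Matrix (Fin N) (Fin N) (PowerSeries (DYc N c)) :=
  (TMatrix (tPos N c)).map (subInv 1 (algebraMap K (DYc N c) (h * cst c))) *
    constMatrix G (DYc N c) *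
    (TMatrix (tPos N c)).transpose.map (subInv (-1) 0)

/-- `S⁺(u) = T⁺(u) G T⁺ᵗ(-u)`, with entries in power series in `u`. -/
def SPlusMatrix : Matrix (Fin N) (Fin N) (PowerSeries (DYc N c)) :=
  TPlusMatrix (tNeg N c) * constMatrix G (DYc N c) * (TPlusMatrix (tNeg N c)).transpose.map negVar

/-- The matrix with entries `∑_{r ≥ 1} s_{ij}^{(r)} u^{-r}`; see `SMatrix_eq`. -/
def sigmaMatrix : Matrix (Fin N) (Fin N) (PowerSeries (DYc N c)) :=
  (tauMatrix (tPos N c)).map (subInv 1 (algebraMap K (DYc N c) (h * cst c))) *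
      constMatrix G (DYc N c) +
    constMatrix G (DYc N c) * (tauMatrix (tPos N c)).transpose.map (subInv (-1) 0) +
    h • ((tauMatrix (tPos N c)).map (subInv 1 (algebraMap K (DYc N c) (h * cst c))) *
      constMatrix G (DYc N c) * (tauMatrix (tPos N c)).transpose.map (subInv (-1) 0))

/-- The matrix with entries `∑_{r ≥ 1} s_{ij}^{(-r)} u^{r-1}`; see `SPlusMatrix_eq`. -/
def sigmaPlusMatrix : Matrix (Fin N) (Fin N) (PowerSeries (DYc N c)) :=
  tauPlusMatrix (tNeg N c) * constMatrix G (DYc N c) +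
    constMatrix G (DYc N c) * (tauPlusMatrix (tNeg N c)).transpose.map negVar -
    h • (tauPlusMatrix (tNeg N c) * constMatrix G (DYc N c) *
      (tauPlusMatrix (tNeg N c)).transpose.map negVar)

theorem TMatrix_map_subInv {N : ℕ} {A : Type*} [Ring A] [Algebra K A] (a β : A)
    (t : Fin N → Fin N → ℕ → A) :
    (TMatrix t).map (subInv a β) = 1 + h • (tauMatrix t).map (subInv a β) := by
  ext1 i j
  simp only [TMatrix, Matrix.map_apply, Matrix.add_apply, Matrix.smul_apply, subInv_add,
    subInv_smul, Matrix.one_apply]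
  split_ifs
  · rw [subInv_one]
  · rw [subInv_zero]

theorem TMatrix_transpose_map_subInv {N : ℕ} {A : Type*} [Ring A] [Algebra K A] (a β : A)
    (t : Fin N → Fin N → ℕ → A) :
    (TMatrix t).transpose.map (subInv a β) =
      1 + h • (tauMatrix t).transpose.map (subInv a β) := by
  rw [Matrix.transpose_map, TMatrix_map_subInv, Matrix.transpose_add, Matrix.transpose_one,
    Matrix.transpose_smul, Matrix.transpose_map]

theorem TPlusMatrix_transpose_map_negVar {N : ℕ} {A : Type*} [Ring A] [Algebra K A]
    (t : Fin N → Fin N → ℕ → A) :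
    (TPlusMatrix t).transpose.map negVar = 1 - h • (tauPlusMatrix t).transpose.map negVar := by
  ext1 i j
  simp only [TPlusMatrix, Matrix.map_apply, Matrix.transpose_apply, Matrix.sub_apply,
    Matrix.smul_apply, negVar_sub, negVar_smul, Matrix.one_apply, eq_comm (a := j)]
  split_ifs
  · rw [negVar_one]
  · rw [negVar_zero]

/-- `s_{ij}(u) = g_{ij} + h ∑_{r ≥ 1} s_{ij}^{(r)} u^{-r}`. -/
theorem SMatrix_eq :
    SMatrix N c G = constMatrix G (DYc N c) + h • sigmaMatrix N c G := by
  simp only [SMatrix, sigmaMatrix, TMatrix_map_subInv, TMatrix_transpose_map_subInv]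
  simp only [add_mul, mul_add, one_mul, mul_one, smul_mul_assoc, mul_smul_comm, smul_add, add_assoc]

/-- `s_{ij}⁺(u) = g_{ij} - h ∑_{r ≥ 1} s_{ij}^{(-r)} u^{r-1}`. -/
theorem SPlusMatrix_eq :
    SPlusMatrix N c G = constMatrix G (DYc N c) - h • sigmaPlusMatrix N c G := by
  rw [SPlusMatrix, sigmaPlusMatrix, TPlusMatrix_transpose_map_negVar, TPlusMatrix]
  simp only [sub_mul, mul_sub, one_mul, mul_one, smul_mul_assoc, mul_smul_comm, smul_add, smul_sub]
  abel

/-- The subalgebra `A_c(g_N)` of `DY_c(gl_N)` generated by all `s_{ij}^{(r)}` and `s_{ij}^{(-r)}` with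
`r ≥ 1`. -/
def Asub : Subalgebra K (DYc N c) :=
  Algebra.adjoin K
    ({x | ∃ i j r, x = PowerSeries.coeff (r + 1) (sigmaMatrix N c G i j)} ∪
      {x | ∃ i j r, x = PowerSeries.coeff r (sigmaPlusMatrix N c G i j)})

/-- The `A_c(g_N)`-submodule of `𝒱_c(gl_N)` generated by the vacuum vector. -/
def MPrime : Submodule K (Vac N c) :=
  (Subalgebra.toSubmodule (Asub N c G)).map
    ((LinearMap.applyₗ (vac N c)).comp (act N c).toLinearMap)

/-- The elements `v` of `𝒱_c(gl_N)` with `hᵏ v ∈ MPrime` for some `k ≥ 0`. -/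
def MSat : Submodule K (Vac N c) where
  carrier := {v | ∃ k : ℕ, h ^ k • v ∈ MPrime N c G}
  zero_mem' := ⟨0, by simp⟩
  add_mem' := by
    rintro v w ⟨k, hk⟩ ⟨l, hl⟩
    refine ⟨k + l, ?_⟩
    rw [smul_add]
    refine Submodule.add_mem _ ?_ ?_
    · rw [pow_add, mul_comm, mul_smul]
      exact Submodule.smul_mem _ _ hk
    · rw [pow_add, mul_smul]
      exact Submodule.smul_mem _ _ hl
  smul_mem' := by
    rintro z v ⟨k, hk⟩
    refine ⟨k, ?_⟩
    rw [smul_comm]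
    exact Submodule.smul_mem _ _ hk

/-- The vacuum module `ℳ_c(g_N)`: the `h`-adic completion of `MSat`. As `MSat` is saturated
(`hᵏ v ∈ MSat` implies `v ∈ MSat`) its `h`-adic topology is induced from the `h`-adically complete
module `𝒱_c(gl_N)`, so that its completion is its closure in `𝒱_c(gl_N)`. -/
def MVac : Submodule K (Vac N c) where
  carrier := {v | ∀ k : ℕ, ∃ w ∈ MSat N c G, ∃ y : Vac N c, v - w = h ^ k • y}
  zero_mem' := fun _ => ⟨0, Submodule.zero_mem _, 0, by simp⟩
  add_mem' := by
    intro v v' hv hv' k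
    obtain ⟨w, hw, y, hy⟩ := hv k
    obtain ⟨w', hw', y', hy'⟩ := hv' k
    refine ⟨w + w', Submodule.add_mem _ hw hw', y + y', ?_⟩
    rw [smul_add, ← hy, ← hy']
    abel
  smul_mem' := by
    intro z v hv k
    obtain ⟨w, hw, y, hy⟩ := hv k
    refine ⟨z • w, Submodule.smul_mem _ _ hw, z • y, ?_⟩
    rw [← smul_sub, hy, smul_comm]

/-- The submodule of invariants `𝔷(ℳ_c(g_N)) = {w ∈ ℳ_c(g_N) : S(u) w = G ⊗ w}`: all coefficients of
all matrix entries of `S(u) w` and `G ⊗ w` agree. -/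
def invariants : Submodule K (Vac N c) where
  carrier := {w | w ∈ MVac N c G ∧ ∀ (i j : Fin N) (r : ℕ),
    act N c (PowerSeries.coeff r (SMatrix N c G i j)) w = if r = 0 then cst (G i j) • w else 0}
  zero_mem' := ⟨Submodule.zero_mem _, by simp⟩
  add_mem' := by
    rintro v w ⟨hv, hv'⟩ ⟨hw, hw'⟩
    refine ⟨Submodule.add_mem _ hv hw, fun i j r => ?_⟩
    rw [map_add, hv', hw']
    split_ifs <;> simp
  smul_mem' := by
    rintro z v ⟨hv, hv'⟩
    refine ⟨Submodule.smul_mem _ _ hv, fun i j r => ?_⟩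
    rw [map_smul, hv']
    split_ifs
    · rw [smul_comm]
    · simp

end Twisted

/-! ### `h`-adically convergent two-sided series -/

section HAdic

variable {M : Type*} [AddCommGroup M] [Module K M]

/-- Summability in the `h`-adic topology of a `ℂ[[h]]`-module. -/
def HSummable {ι : Type*} (f : ι → M) : Prop :=
  letI := hIdeal.adicModuleTopology M
  Summable f

/-- The sum of a series in the `h`-adic topology of a `ℂ[[h]]`-module. -/
def hsum {ι : Type*} (f : ι → M) : M :=
  letI := hIdeal.adicModuleTopology M
  ∑' i, f i

end HAdic

/-- Elements of `(End ℂ^N)^{⊗ n} ⊗ End 𝒱_c(gl_N) [[u^{±1}]]`: matrices of two-sided series, where the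
series `f : ℤ → End 𝒱_c(gl_N)` stands for `∑_m f(m) u^m`. -/
abbrev BiMatrix (N : ℕ) (c : ℂ) (n : ℕ) : Type :=
  Matrix (Fin n → Fin N) (Fin n → Fin N) (ℤ → VacEnd N c)

section BiSeries

variable {N : ℕ} {c : ℂ} {n : ℕ}

/-- The identity. -/
def BiMatrix.one : BiMatrix N c n :=
  Matrix.of fun a b m => if a = b ∧ m = 0 then 1 else 0

/-- The product of matrices of two-sided series; the sums over the exponents are `h`-adic. -/
def BiMatrix.mul (F H : BiMatrix N c n) : BiMatrix N c n :=
  Matrix.of fun a b m => ∑ d, hsum fun k : ℤ => F a d (m - k) * H d b k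

/-- All sums in the product of `F` and `H` converge. -/
def BiMatrix.MulConverges (F H : BiMatrix N c n) : Prop :=
  ∀ a d b m, HSummable fun k : ℤ => F a d (m - k) * H d b k

/-- The ordered product of a list of matrices of two-sided series. -/
def BiMatrix.listProd : List (BiMatrix N c n) → BiMatrix N c n
  | [] => BiMatrix.one
  | F :: l => BiMatrix.mul F (BiMatrix.listProd l)

/-- All sums in the ordered product of a list converge. -/
def BiMatrix.ListConverges : List (BiMatrix N c n) → Prop
  | [] => True
  | F :: l => BiMatrix.MulConverges F (BiMatrix.listProd l) ∧ BiMatrix.ListConverges l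

/-- A power series in `u⁻¹` over `DY_c(gl_N)` as a two-sided series of operators. -/
def ofNegSeries (f : PowerSeries (DYc N c)) : ℤ → VacEnd N c := fun m =>
  if m ≤ 0 then act N c (PowerSeries.coeff (-m).toNat f) else 0

/-- The `r`-th term of the coefficient of `u^m` in `f(u + β) = ∑_r f_r (u + β)^r`. -/
def shiftTerm (β : K) (f : PowerSeries (DYc N c)) (m r : ℕ) : VacEnd N c :=
  ((r.choose m : K) * β ^ (r - m)) • act N c (PowerSeries.coeff r f)

/-- For a power series `f(u)` over `DY_c(gl_N)` and `β ∈ h ℂ[[h]]`, the series `f(u + β)` of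
operators; its coefficients are `h`-adic sums. -/
def ofPosSeriesShift (β : K) (f : PowerSeries (DYc N c)) : ℤ → VacEnd N c := fun m =>
  if 0 ≤ m then hsum (shiftTerm β f m.toNat) else 0

end BiSeries

/-! ### The series `S⁺_{[n]}` and `S_{[n]}` -/

section Products

variable (N : ℕ) (c : ℂ) (G : Matrix (Fin N) (Fin N) ℂ) {n : ℕ}

/-- `R̄_{ij}ᵗ(-2u + β)` for `β ∈ ℂ[[h]]`, expanded in negative powers of `u`. -/
def RbarT (i j : Fin n) (β : K) :
    Matrix (Fin n → Fin N) (Fin n → Fin N) (PowerSeries (DYc N c)) :=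
  leg₂ i j (ptranspose (Rbar N (B := DYc N c) (algebraMap K _ (cst (-1 / 2))) (algebraMap K _ β)))

/-- The ordered list of the factors of
`S⁺_{[n]}(u₁, …, uₙ) = ∏_i (S_i⁺(u_i) R̄ᵗ_{i,i+1}(-u_i-u_{i+1}) ⋯ R̄ᵗ_{in}(-u_i-u_n))`
at `u_i = u + w_i`. -/
def SPlusFactors (w : Fin n → K) : List (BiMatrix N c n) :=
  (List.finRange n).flatMap fun i =>
    (Matrix.of fun a b m =>
      if ∀ k, k ≠ i → a k = b k then
        ofPosSeriesShift (w i) (SPlusMatrix N c G (a i) (b i)) m else 0) ::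
    ((List.finRange n).filter (i < ·)).map fun j =>
      (RbarT N c i j (-w i - w j)).map ofNegSeries

/-- `S⁺_{[n]}(u + w₁, …, u + wₙ)`. -/
def SPlusBracket (w : Fin n → K) : BiMatrix N c n := BiMatrix.listProd (SPlusFactors N c G w)

/-- `S_{[n]}(u₁, …, uₙ) = ∏_i (S_i(u_i) R̄ᵗ_{i,i+1}(-u_i-u_{i+1}-hc) ⋯ R̄ᵗ_{in}(-u_i-u_n-hc))` at
`u_i = u + w_i`, with entries in power series in `u⁻¹`. -/
def SBracket (w : Fin n → K) :
    Matrix (Fin n → Fin N) (Fin n → Fin N) (PowerSeries (DYc N c)) :=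
  ((List.finRange n).flatMap fun i =>
    leg i ((SMatrix N c G).map (subInv 1 (algebraMap K (DYc N c) (w i)))) ::
    ((List.finRange n).filter (i < ·)).map fun j =>
      RbarT N c i j (-w i - w j - h * cst c)).prod

end Products

/-! ### Young idempotents -/

/-- A standard tableau of shape `ν` with entries in `Fin n` (the entry `p` stands for `p + 1`): a
bijection between the entries and the boxes of `ν` such that the entries increase along the rows and
down the columns. -/
structure StdTableau (ν : YoungDiagram) (n : ℕ) where
  /-- The box occupied by an entry. -/
  box : Fin n ≃ ν.cells
  row_increasing : ∀ p q, (box p).1.1 = (box q).1.1 → (box p).1.2 < (box q).1.2 → p < q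
  col_increasing : ∀ p q, (box p).1.2 = (box q).1.2 → (box p).1.1 < (box q).1.1 → p < q

/-- The content `j - i` of the box `(i, j)` occupied by `p`. -/
def StdTableau.content {ν : YoungDiagram} {n : ℕ} (U : StdTableau ν n) (p : Fin n) : ℤ :=
  ((U.box p).1.2 : ℤ) - ((U.box p).1.1 : ℤ)

/-- The Jucys–Murphy element `∑_{i < p} (i p)` of the group algebra of the symmetric group. -/
def jucysMurphy {n : ℕ} (p : Fin n) : MonoidAlgebra ℂ (Equiv.Perm (Fin n)) :=
  ∑ i ∈ Finset.univ.filter (· < p), MonoidAlgebra.of ℂ (Equiv.Perm (Fin n)) (Equiv.swap i p)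

/-- The primitive idempotent `e_U` of the group algebra of the symmetric group associated with the
standard tableau `U`. It acts on each irreducible representation as the orthogonal projection to the
vector of the orthonormal Young basis labelled by `U` (zero if the representation does not correspond
to the shape of `U`). The vectors of Young bases are the common eigenvectors of the Jucys–Murphy
elements `x_p`, with eigenvalues the contents, which are integers between `-p` and `p` (for `p`
counted from `0`), so that the projection is given by the interpolation formula
`∏_p ∏_{a ≠ c_p} (x_p - a) / (c_p - a)`, where `a` runs over the integers between `-p` and `p`. -/
def youngIdempotent {ν : YoungDiagram} {n : ℕ} (U : StdTableau ν n) :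
    MonoidAlgebra ℂ (Equiv.Perm (Fin n)) :=
  (List.ofFn fun p : Fin n =>
    Polynomial.aeval (jucysMurphy p)
      (Lagrange.basis (Finset.Icc (-(p : ℤ)) p) (fun a : ℤ => (a : ℂ)) (U.content p))).prod

/-- The action of the symmetric group on `(ℂ^N)^{⊗ n}` by permutations of the tensor factors. -/
def permAction (N n : ℕ) :
    Equiv.Perm (Fin n) →* Matrix (Fin n → Fin N) (Fin n → Fin N) ℂ where
  toFun σ := Matrix.of fun a b => if a = b ∘ σ.symm then 1 else 0
  map_one' := by
    ext a b
    simp only [Matrix.of_apply, Matrix.one_apply]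
    rfl
  map_mul' σ τ := by
    ext a b
    simp only [Matrix.mul_apply, Matrix.of_apply, mul_ite, mul_one, mul_zero]
    rw [Finset.sum_ite_eq' Finset.univ (b ∘ τ.symm)]
    simp only [Finset.mem_univ, if_true]
    rfl

/-- The image `ℰ_U` of `e_U` under the action on `(ℂ^N)^{⊗ n}`. -/
def youngOperator (N : ℕ) {ν : YoungDiagram} {n : ℕ} (U : StdTableau ν n) :
    Matrix (Fin n → Fin N) (Fin n → Fin N) ℂ :=
  MonoidAlgebra.lift ℂ _ _ (permAction N n) (youngIdempotent U)

/-! ### The series `𝔸_ν(u)` and `𝕄_ν(u)` at the critical level -/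

section Critical

variable (N : ℕ) (G : Matrix (Fin N) (Fin N) ℂ) {ν : YoungDiagram} {n : ℕ} (U : StdTableau ν n)

/-- The critical level `c = -N/2`. -/
def critLevel : ℂ := -(N : ℂ) / 2

/-- The shifts `h c_k` of the family of variables `u_ν = (u + h c₁, …, u + h cₙ)`. -/
def nuShift (k : Fin n) : K := h * cst (U.content k)

/-- The shifts `h c_k - h N / 4` of the family of variables `u_ν - h N / 4`. -/
def nuShiftN (k : Fin n) : K := h * cst (U.content k) - h * cst ((N : ℂ) / 4)

/-- `S_{[n]}(u_ν - h N / 4)`. -/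
def SNu : Matrix (Fin n → Fin N) (Fin n → Fin N) (PowerSeries (DYc N (critLevel N))) :=
  SBracket N (critLevel N) G (nuShiftN N U)

/-- The `j`-th term of the coefficient of `u^m` in the `(b, d)` entry of `S⁺_{[n]}(u_ν)`
multiplied by the `(d, a)` entry of `S_{[n]}(u_ν - h N / 4)⁻¹`, applied to `w`. -/
def ATerm (m : ℤ) (w : Vac N (critLevel N)) (a b d : Fin n → Fin N) (j : ℕ) :
    Vac N (critLevel N) :=
  SPlusBracket N (critLevel N) G (nuShift U) b d (m + j)
    (act N (critLevel N) (PowerSeries.coeff j (Ring.inverse (SNu N G U) d a)) w)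

/-- The coefficient of `u^m` in `𝔸_ν(u) w`, where
`𝔸_ν(u) = tr_{1,…,n} ℰ_U S⁺_{[n]}(u_ν) S_{[n]}(u_ν - h N / 4)⁻¹` acts on the vacuum module at the
critical level. -/
def ANu (m : ℤ) (w : Vac N (critLevel N)) : Vac N (critLevel N) :=
  ∑ a, ∑ b, ∑ d, cst (youngOperator N U a b) • hsum (ATerm N G U m w a b d)

/-- The coefficient of `u^m` in `𝕄_ν(u) = 𝔸_ν(u) 1`. -/
def MNu (m : ℤ) : Vac N (critLevel N) := ANu N G U m (vac N (critLevel N))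

/-- The series `𝕄_ν(u)` is well defined: the inverse of `S_{[n]}(u_ν - h N / 4)` exists and all
`h`-adic sums which define the coefficients of `𝕄_ν(u)` converge. -/
def MNuWellDefined : Prop :=
  IsUnit (SNu N G U) ∧
  (∀ (k : Fin n) (i j : Fin N) (m : ℕ),
    HSummable (shiftTerm (nuShift U k) (SPlusMatrix N (critLevel N) G i j) m)) ∧
  BiMatrix.ListConverges (SPlusFactors N (critLevel N) G (nuShift U)) ∧
  ∀ (m : ℤ) (a b d : Fin n → Fin N), HSummable (ATerm N G U m (vac N (critLevel N)) a b d)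

end Critical

end TwistedYangian

end

open PowerSeries

noncomputable section

set_option linter.unusedSectionVars false

namespace TwistedYangian

/-! ### Operators on tensor powers with legs in an arbitrary finite type -/

section LegsOn

variable {ι κ : Type*} [Fintype ι] [DecidableEq ι] [Fintype κ] [DecidableEq κ] {N : ℕ}
  {R : Type*} [Ring R]

/-! On the vacuum `T(u)` acts as the identity, so `S_[n]` acts there as a matrix of scalars built
from `G` and R-matrices, and so does its inverse (`isVacMat_inverse`, `act_inverse_vac`). Thus
`𝕄_ν(u)` is `tr ℰ S⁺_[n] X` applied to the vacuum, with `X` a scalar matrix. Invariance means that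
`S(z)`, placed in an additional tensor factor 0, passes through this trace up to terms in the left
ideal that annihilates the vacuum.

The mixed RTT relation, transposed in one or both factors, together with the factorization of
`S⁺_[n]` into `T⁺`, constants and transposed `T⁺` (`sProd_eq`) and the reflection equation for `G`
(`IsForm.fused_reflection`), gives `S₀ Q₁ S⁺ = R₃' S⁺ Q₃ S₀ R₋` (`IsCriticalSystem.fused_exchange`),
where `Q₁`, `Q₃`, `R₃'`, `R₋` are ordered products of R-matrices joining the factor 0 with the
factors 1, …, n. On the vacuum the right-hand `S₀` may be replaced by `G₀`; the reflection equation
then carries `G₀` across `X` to the far right, and `S₀ ℰ Q₁ S⁺ X Q₃⁻¹` is congruent to `ℰ R₃' S⁺ X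
R₋ G₀`. Here the critical level is decisive: crossing symmetry relates R-matrices at points
differing by `hN`, and the points in `Q₁` and `Q₃`, as well as those in `R₃'` and `R₋`, differ by
`2hc = -hN`. Hence the partial transposes of `Q₃⁻¹` and `Q₁` in the factor 0 are inverse to each
other, as are those of `R₋` and `R₃'`, and both partial traces over 1, …, n collapse to `tr ℰ S⁺ X`
(`ptr_idempotent_mul`, `IsCriticalSystem.trace_mem`).

The collapse uses cyclicity of the trace and `ℰ F ℰ = ℰ F` for every factor `F = F(c₁, …, cₙ)`.
Instead of the fusion procedure, `ℰ` is treated as the projector to a joint eigenspace of the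
Jucys–Murphy elements. A form of the Yang–Baxter equation says that `(c_i - c_j) s + 1`, with `s`
the transposition of the adjacent factors `i`, `j`, intertwines `F` at permuted contents with `F`
(`Intertwines`). This intertwiner exchanges two eigenvalues, and an induction along the Jucys–Murphy
elements shows that `F` preserves joint eigenvectors (`eigenrow_mul`, `jmProjector_mul_mul`). The
induction needs that no joint eigenvector has equal adjacent eigenvalues, which follows from
semisimplicity: the Jucys–Murphy elements are Hermitian in the permutation representation
(`nodePoly_jm_eq_zero`).

All identities are proved modulo `h^k`. There `h` is nilpotent, two-sided series become Laurent
series in `u`, and the R-matrices are values of complex power series at nilpotent elements, so that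
everything takes place in power series in `z⁻¹` over Laurent series in `u` (`LaurentRing`,
`isCriticalSystem`). For `T⁺` at two points whose difference is an integral multiple of `h`, the RTT
relation must be divided by `h` before the points are substituted (`plus_relation_div`).
Completeness and separatedness of the vacuum module turn the congruences for all `k` into equalities
(`MNu_invariant`). Keeping track of representatives from the twisted Yangian through the reductions
gives membership in its vacuum module (`MNu_mem_MVac`). -/

/-- Matrices acting on the tensor power of `R^N` with factors indexed by `ι`. -/
abbrev TMat (ι : Type*) (N : ℕ) (R : Type*) : Type _ := Matrix (ι → Fin N) (ι → Fin N) R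

/-- The copy of a matrix in the factor `i`. -/
def legOn (i : ι) (M : Matrix (Fin N) (Fin N) R) : TMat ι N R :=
  Matrix.of fun a b => if ∀ k, k ≠ i → a k = b k then M (a i) (b i) else 0

/-- The operator permuting the factors. -/
def permOn (R : Type*) [Ring R] (N : ℕ) (σ : Equiv.Perm ι) : TMat ι N R :=
  Matrix.of fun a b => if a = b ∘ σ.symm then 1 else 0

/-- The partial transpose of the permutation of the factors `i` and `j`. -/
def qOn (R : Type*) [Ring R] (N : ℕ) (i j : ι) : TMat ι N R :=
  Matrix.of fun a b =>
    if a i = a j ∧ b i = b j ∧ ∀ k, k ≠ i → k ≠ j → a k = b k then 1 else 0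

/-- Transposition in the factor `i`. -/
def ptOn (i : ι) (M : TMat ι N R) : TMat ι N R :=
  Matrix.of fun a b => M (Function.update a i (b i)) (Function.update b i (a i))

theorem agree_off_iff (i : ι) (a b : ι → Fin N) :
    (∀ k, k ≠ i → a k = b k) ↔ b = Function.update a i (b i) := by
  constructor
  · intro h
    ext1 k
    by_cases hk : k = i
    · subst hk; simp
    · simp [hk, h k hk]
  · intro h k hk
    rw [h]; simp [hk]

theorem agree_off_iff' (i : ι) (a b : ι → Fin N) :
    (∀ k, k ≠ i → a k = b k) ↔ a = Function.update b i (a i) := by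
  rw [← agree_off_iff]
  exact forall₂_congr fun _ _ => eq_comm

/-- Only the multi-indices that differ from `a` at most at `i` contribute, so the sum collapses to
one index. -/
theorem legOn_mul_apply (i : ι) (M : Matrix (Fin N) (Fin N) R) (Z : TMat ι N R) (a b) :
    (legOn i M * Z) a b = ∑ x, M (a i) x * Z (Function.update a i x) b := by
  rw [Matrix.mul_apply]
  refine (Finset.sum_of_injOn (fun x => Function.update a i x) ?_ ?_ ?_ ?_).symm
  · intro x _ y _ hxy
    simpa using congrFun hxy i
  · intro x _; simp
  · intro d _ hd
    have : ¬ ∀ k, k ≠ i → a k = d k := by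
      rw [agree_off_iff]
      intro h
      exact hd ⟨d i, by simp, h.symm⟩
    simp [legOn, this]
  · intro x _
    have : ∀ k, k ≠ i → a k = Function.update a i x k := by
      intro k hk; simp [hk]
    simp only [legOn, Matrix.of_apply]
    rw [if_pos this]; simp

theorem mul_legOn_apply (i : ι) (M : Matrix (Fin N) (Fin N) R) (Z : TMat ι N R) (a b) :
    (Z * legOn i M) a b = ∑ x, Z a (Function.update b i x) * M x (b i) := by
  rw [Matrix.mul_apply]
  refine (Finset.sum_of_injOn (fun x => Function.update b i x) ?_ ?_ ?_ ?_).symm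
  · intro x _ y _ hxy
    simpa using congrFun hxy i
  · intro x _; simp
  · intro d _ hd
    have : ¬ ∀ k, k ≠ i → d k = b k := by
      rw [agree_off_iff']
      intro h
      exact hd ⟨d i, by simp, h.symm⟩
    simp [legOn, this]
  · intro x _
    have : ∀ k, k ≠ i → Function.update b i x k = b k := by
      intro k hk; simp [hk]
    simp only [legOn, Matrix.of_apply]
    rw [if_pos this]; simp

theorem legOn_one (i : ι) : legOn i (1 : Matrix (Fin N) (Fin N) R) = 1 := by
  ext a b
  simp only [legOn, Matrix.of_apply, Matrix.one_apply]
  by_cases h : a = b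
  · subst h; simp
  · rw [if_neg h]
    split_ifs with h1 h2
    · exact (h (funext fun k => if hk : k = i then hk ▸ h2 else h1 k hk)).elim
    · rfl
    · rfl

theorem legOn_mul (i : ι) (M M' : Matrix (Fin N) (Fin N) R) :
    legOn i (M * M') = legOn i M * legOn i M' := by
  ext a b
  rw [legOn_mul_apply]
  simp only [legOn, Matrix.of_apply]
  have : ∀ x, (∀ k, k ≠ i → Function.update a i x k = b k) ↔ ∀ k, k ≠ i → a k = b k := by
    intro x
    refine forall₂_congr fun k hk => ?_
    simp [hk]
  simp only [this]
  split_ifs <;> simp [Matrix.mul_apply]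

theorem legOn_add (i : ι) (M M' : Matrix (Fin N) (Fin N) R) :
    legOn i (M + M') = legOn i M + legOn i M' := by
  ext a b
  simp only [legOn, Matrix.of_apply, Matrix.add_apply]
  split_ifs <;> simp

/-- The commutation of two legs whose entries commute. -/
theorem legOn_comm {i j : ι} (hij : i ≠ j) (M M' : Matrix (Fin N) (Fin N) R)
    (h : ∀ a b c d, Commute (M a b) (M' c d)) :
    legOn i M * legOn j M' = legOn j M' * legOn i M := by
  ext a b
  rw [legOn_mul_apply, mul_legOn_apply]
  simp only [legOn, Matrix.of_apply]
  have h1 : ∀ x, (∀ k, k ≠ j → Function.update a i x k = b k) ↔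
      (∀ k, k ≠ i → k ≠ j → a k = b k) ∧ x = b i := by
    intro x
    constructor
    · intro H
      refine ⟨fun k hk hk' => by simpa [hk] using H k hk', by simpa using H i hij⟩
    · rintro ⟨H, rfl⟩ k hk
      by_cases hki : k = i
      · subst hki; simp
      · simpa [hki] using H k hki hk
  have h2 : ∀ x, (∀ k, k ≠ j → a k = Function.update b i x k) ↔
      (∀ k, k ≠ i → k ≠ j → a k = b k) ∧ a i = x := by
    intro x
    constructor
    · intro H
      refine ⟨fun k hk hk' => by simpa [hk] using H k hk', by simpa using H i hij⟩
    · rintro ⟨H, rfl⟩ k hk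
      by_cases hki : k = i
      · subst hki; simp
      · simpa [hki] using H k hki hk
  simp only [h1, h2]
  by_cases H : ∀ k, k ≠ i → k ≠ j → a k = b k
  · simp only [eq_true H, true_and]
    simp [hij.symm, hij, (h _ _ _ _).eq]
  · simp [H]

theorem permOn_mul_apply (σ : Equiv.Perm ι) (Z : TMat ι N R) (a b) :
    (permOn R N σ * Z) a b = Z (a ∘ σ) b := by
  rw [Matrix.mul_apply, Finset.sum_eq_single (a ∘ σ)]
  · simp [permOn, Function.comp_assoc]
  · intro d _ hd
    have : a ≠ d ∘ σ.symm := by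
      rintro rfl; exact hd (by simp [Function.comp_assoc])
    simp [permOn, this]
  · simp

theorem mul_permOn_apply (σ : Equiv.Perm ι) (Z : TMat ι N R) (a b) :
    (Z * permOn R N σ) a b = Z a (b ∘ σ.symm) := by
  rw [Matrix.mul_apply, Finset.sum_eq_single (b ∘ σ.symm)]
  · simp [permOn]
  · intro d _ hd
    simp [permOn, hd]
  · simp

theorem permOn_one : permOn R N (1 : Equiv.Perm ι) = 1 := by
  ext a b
  simp only [permOn, Matrix.of_apply, Matrix.one_apply]
  rfl

theorem permOn_mul (σ τ : Equiv.Perm ι) : permOn R N (σ * τ) = permOn R N σ * permOn R N τ := by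
  ext a b
  rw [mul_permOn_apply]
  simp only [permOn, Matrix.of_apply]
  rfl

theorem permOn_legOn (σ : Equiv.Perm ι) (i : ι) (M : Matrix (Fin N) (Fin N) R) :
    permOn R N σ * legOn i M = legOn (σ i) M * permOn R N σ := by
  ext a b
  rw [permOn_mul_apply, mul_permOn_apply]
  simp only [legOn, Matrix.of_apply, Function.comp_apply, Equiv.symm_apply_apply]
  refine if_congr ?_ rfl rfl
  constructor
  · intro H k hk
    have := H (σ.symm k) (by rintro rfl; simp at hk)
    simpa using this
  · intro H k hk
    have := H (σ k) (by simpa using hk)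
    simpa using this

theorem permOn_qOn (σ : Equiv.Perm ι) (i j : ι) :
    permOn R N σ * qOn R N i j = qOn R N (σ i) (σ j) * permOn R N σ := by
  ext a b
  rw [permOn_mul_apply, mul_permOn_apply]
  simp only [qOn, Matrix.of_apply, Function.comp_apply, Equiv.symm_apply_apply]
  refine if_congr (and_congr Iff.rfl (and_congr Iff.rfl ?_)) rfl rfl
  constructor
  · intro H k hk hk'
    have := H (σ.symm k) (by rintro rfl; simp at hk) (by rintro rfl; simp at hk')
    simpa using this
  · intro H k hk hk'
    have := H (σ k) (by simpa using hk) (by simpa using hk')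
    simpa using this

theorem qOn_comm (i j : ι) : qOn R N i j = qOn R N j i := by
  ext a b
  simp only [qOn, Matrix.of_apply]
  refine if_congr ⟨fun ⟨h1, h2, h3⟩ => ⟨h1.symm, h2.symm, fun k hk hk' => h3 k hk' hk⟩,
    fun ⟨h1, h2, h3⟩ => ⟨h1.symm, h2.symm, fun k hk hk' => h3 k hk' hk⟩⟩ rfl rfl

theorem qOn_mul_apply {i j : ι} (hij : i ≠ j) (Z : TMat ι N R) (a b) :
    (qOn R N i j * Z) a b =
      if a i = a j then ∑ x, Z (Function.update (Function.update a i x) j x) b else 0 := by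
  rw [Matrix.mul_apply]
  split_ifs with ha
  · refine (Finset.sum_of_injOn (fun x => Function.update (Function.update a i x) j x)
      ?_ ?_ ?_ ?_).symm
    · intro x _ y _ hxy
      simpa using congrFun hxy j
    · intro x _; simp
    · intro d _ hd
      have : ¬ (d i = d j ∧ ∀ k, k ≠ i → k ≠ j → a k = d k) := by
        rintro ⟨h1, h2⟩
        refine hd ⟨d i, by simp, ?_⟩
        ext1 k
        by_cases hk : k = j
        · subst hk; simp [h1]
        · by_cases hk' : k = i
          · subst hk'; simp [hk]
          · simp [hk, hk', h2 k hk' hk]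
      simp only [qOn, Matrix.of_apply]
      rw [if_neg (fun h => this h.2), zero_mul]
    · intro x _
      simp only [qOn, Matrix.of_apply]
      rw [if_pos, one_mul]
      refine ⟨ha, by simp [hij], fun k hk hk' => by simp [hk, hk']⟩
  · refine Finset.sum_eq_zero fun d _ => ?_
    simp [qOn, ha]

/-- `Q` contracts the two factors with the vector `∑ e_x ⊗ e_x`; the product contains one closed
loop, worth `N`. -/
theorem qOn_sq {i j : ι} (hij : i ≠ j) :
    qOn R N i j * qOn R N i j = (N : R) • qOn R N i j := by
  ext a b
  rw [qOn_mul_apply hij]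
  simp only [qOn, Matrix.of_apply, Matrix.smul_apply]
  have : ∀ x, ((Function.update (Function.update a i x) j x i =
      Function.update (Function.update a i x) j x j) ∧ b i = b j ∧
      ∀ k, k ≠ i → k ≠ j → Function.update (Function.update a i x) j x k = b k) ↔
      (b i = b j ∧ ∀ k, k ≠ i → k ≠ j → a k = b k) := by
    intro x
    constructor
    · rintro ⟨-, h1, h2⟩
      exact ⟨h1, fun k hk hk' => by simpa [hk, hk'] using h2 k hk hk'⟩
    · rintro ⟨h1, h2⟩
      exact ⟨by simp [hij], h1, fun k hk hk' => by simpa [hk, hk'] using h2 k hk hk'⟩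
  simp only [this]
  split_ifs <;> simp_all

/-- This is the partial transpose in `k` of `P_{jk} P_{ik} = P_{ik} P_{ij}`. -/
theorem qOn_mul_qOn {i j k : ι} (hij : i ≠ j) (hik : i ≠ k) (hjk : j ≠ k) :
    qOn R N i k * qOn R N j k = qOn R N i k * permOn R N (Equiv.swap i j) := by
  ext a b
  rw [qOn_mul_apply hik, mul_permOn_apply]
  simp only [qOn, Matrix.of_apply, Function.comp_apply, Equiv.symm_swap, Equiv.swap_apply_left,
    Equiv.swap_apply_of_ne_of_ne hik.symm hjk.symm]
  have h1 : ∀ x, ((Function.update (Function.update a i x) k x j =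
      Function.update (Function.update a i x) k x k) ∧ b j = b k ∧
      ∀ l, l ≠ j → l ≠ k → Function.update (Function.update a i x) k x l = b l) ↔
      (x = a j ∧ (a j = b i ∧ b j = b k ∧ ∀ l, l ≠ i → l ≠ j → l ≠ k → a l = b l)) := by
    intro x
    constructor
    · rintro ⟨h0, h1, h2⟩
      have h0' : x = a j := by simpa [hjk, hij.symm] using h0.symm
      refine ⟨h0', ?_, h1, fun l hl hl' hl'' => by simpa [hl, hl', hl''] using h2 l hl' hl''⟩
      rw [← h0']; simpa [hik] using h2 i hij hik
    · rintro ⟨rfl, h0, h1, h2⟩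
      refine ⟨by simp [hjk, hij.symm], h1, fun l hl hl' => ?_⟩
      by_cases hli : l = i
      · subst hli; simpa [hik] using h0
      · simpa [hli, hl'] using h2 l hli hl hl'
  have h2 : (a i = a k ∧ b j = b k ∧
      ∀ l, l ≠ i → l ≠ k → a l = b ((Equiv.swap i j) l)) ↔
      (a i = a k ∧ (a j = b i ∧ b j = b k ∧ ∀ l, l ≠ i → l ≠ j → l ≠ k → a l = b l)) := by
    refine and_congr Iff.rfl ?_
    constructor
    · rintro ⟨h1, h2⟩
      refine ⟨by simpa using h2 j hij.symm hjk, h1, fun l hl hl' hl'' => ?_⟩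
      simpa [Equiv.swap_apply_of_ne_of_ne hl hl'] using h2 l hl hl''
    · rintro ⟨h0, h1, h2⟩
      refine ⟨h1, fun l hl hl' => ?_⟩
      by_cases hlj : l = j
      · subst hlj; simpa using h0
      · simpa [Equiv.swap_apply_of_ne_of_ne hl hlj] using h2 l hl hlj hl'
  simp only [h1, h2]
  by_cases ha : a i = a k
  · simp only [ha, if_true, true_and]
    by_cases hr : (a j = b i ∧ b j = b k ∧ ∀ l, l ≠ i → l ≠ j → l ≠ k → a l = b l)
    · rw [if_pos hr]; simp only [eq_true hr, and_true]; simp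
    · rw [if_neg hr]; simp [hr]
  · simp [ha]

/-- The image of `Q` is spanned by `∑ e_x ⊗ e_x`, on which a matrix in one factor acts as its
transpose in the other. Each entry of `M` is met only once, so no commutativity is needed. -/
theorem legOn_qOn {i j : ι} (hij : i ≠ j) (M : Matrix (Fin N) (Fin N) R) :
    legOn i M * qOn R N i j = legOn j M.transpose * qOn R N i j := by
  ext a b
  rw [legOn_mul_apply, legOn_mul_apply]
  simp only [qOn, Matrix.of_apply, Matrix.transpose_apply]
  have h1 : ∀ x, ((Function.update a i x i = Function.update a i x j) ∧ b i = b j ∧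
      ∀ l, l ≠ i → l ≠ j → Function.update a i x l = b l) ↔
      (x = a j ∧ (b i = b j ∧ ∀ l, l ≠ i → l ≠ j → a l = b l)) := by
    intro x
    refine and_congr (by simp [hij.symm]) (and_congr Iff.rfl ?_)
    exact forall₃_congr fun l hl hl' => by simp [hl]
  have h2 : ∀ x, ((Function.update a j x i = Function.update a j x j) ∧ b i = b j ∧
      ∀ l, l ≠ i → l ≠ j → Function.update a j x l = b l) ↔
      (x = a i ∧ (b i = b j ∧ ∀ l, l ≠ i → l ≠ j → a l = b l)) := by
    intro x
    refine and_congr (by simp [hij, eq_comm]) (and_congr Iff.rfl ?_)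
    exact forall₃_congr fun l hl hl' => by simp [hl']
  simp only [h1, h2]
  by_cases hr : (b i = b j ∧ ∀ l, l ≠ i → l ≠ j → a l = b l)
  · simp only [eq_true hr, and_true]; simp
  · simp [hr]

/-! #### Partial transposition -/

theorem ptOn_sub (i : ι) (M M' : TMat ι N R) : ptOn i (M - M') = ptOn i M - ptOn i M' := rfl

theorem ptOn_smul {S : Type*} [SMul S R] (i : ι) (z : S) (M : TMat ι N R) :
    ptOn i (z • M) = z • ptOn i M := rfl

theorem ptOn_one (i : ι) : ptOn i (1 : TMat ι N R) = 1 := by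
  ext a b
  simp only [ptOn, Matrix.of_apply, Matrix.one_apply]
  refine if_congr ⟨fun h => ?_, fun h => by subst h; rfl⟩ rfl rfl
  ext1 k
  have h1 := congrFun h k
  by_cases hk : k = i
  · subst hk; simpa using h1.symm
  · simpa [hk] using h1

theorem ptOn_ptOn (i : ι) (M : TMat ι N R) : ptOn i (ptOn i M) = M := by
  ext a b
  simp [ptOn]

theorem ptOn_mul_legOn_of_ne {i j : ι} (hij : i ≠ j) (Z : TMat ι N R)
    (M : Matrix (Fin N) (Fin N) R) : ptOn i (Z * legOn j M) = ptOn i Z * legOn j M := by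
  ext a b
  simp only [ptOn, Matrix.of_apply, mul_legOn_apply]
  simp [hij, hij.symm, Function.update_comm hij]

theorem ptOn_legOn_mul_of_ne {i j : ι} (hij : i ≠ j) (Z : TMat ι N R)
    (M : Matrix (Fin N) (Fin N) R) : ptOn i (legOn j M * Z) = legOn j M * ptOn i Z := by
  ext a b
  simp only [ptOn, Matrix.of_apply, legOn_mul_apply]
  simp [hij, hij.symm, Function.update_comm hij]

/-- Partial transposition reverses products within its factor; over a noncommutative ring this is
legitimate only if the entries of the two matrices commute. -/
theorem ptOn_mul_legOn (i : ι) (Z : TMat ι N R) (M : Matrix (Fin N) (Fin N) R)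
    (h : ∀ a b c d, Commute (Z a b) (M c d)) :
    ptOn i (Z * legOn i M) = legOn i M.transpose * ptOn i Z := by
  ext a b
  simp only [ptOn, Matrix.of_apply, mul_legOn_apply, legOn_mul_apply, Matrix.transpose_apply]
  refine Finset.sum_congr rfl fun x _ => ?_
  simp [(h _ _ _ _).eq]

theorem ptOn_legOn_mul (i : ι) (Z : TMat ι N R) (M : Matrix (Fin N) (Fin N) R)
    (h : ∀ a b c d, Commute (Z a b) (M c d)) :
    ptOn i (legOn i M * Z) = ptOn i Z * legOn i M.transpose := by
  ext a b
  simp only [ptOn, Matrix.of_apply, mul_legOn_apply, legOn_mul_apply, Matrix.transpose_apply]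
  refine Finset.sum_congr rfl fun x _ => ?_
  simp [(h _ _ _ _).eq]

theorem permOn_swap_apply {i j : ι} (hij : i ≠ j) (a b : ι → Fin N) :
    permOn R N (Equiv.swap i j) a b =
      if a i = b j ∧ a j = b i ∧ ∀ k, k ≠ i → k ≠ j → a k = b k then 1 else 0 := by
  simp only [permOn, Matrix.of_apply]
  refine if_congr ⟨?_, ?_⟩ rfl rfl
  · rintro rfl
    refine ⟨by simp, by simp, fun k hk hk' => ?_⟩
    simp [Equiv.swap_apply_of_ne_of_ne hk hk']
  · rintro ⟨h1, h2, h3⟩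
    ext1 k
    by_cases hk : k = i
    · subst hk; simpa using h1
    · by_cases hk' : k = j
      · subst hk'; simpa using h2
      · simpa [Equiv.swap_apply_of_ne_of_ne hk hk'] using h3 k hk hk'

theorem ptOn_permOn {i j : ι} (hij : i ≠ j) :
    ptOn i (permOn R N (Equiv.swap i j)) = qOn R N i j := by
  ext a b
  simp only [ptOn, qOn, Matrix.of_apply, permOn_swap_apply hij]
  refine if_congr ?_ rfl rfl
  simp only [Function.update_self, Function.update_of_ne hij.symm]
  constructor
  · rintro ⟨h1, h2, h3⟩
    exact ⟨h2.symm, h1, fun k hk hk' => by simpa [hk] using h3 k hk hk'⟩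
  · rintro ⟨h1, h2, h3⟩
    exact ⟨h2, h1.symm, fun k hk hk' => by simpa [hk] using h3 k hk hk'⟩

theorem ptOn_permOn' {i j : ι} (hij : i ≠ j) :
    ptOn j (permOn R N (Equiv.swap i j)) = qOn R N i j := by
  rw [Equiv.swap_comm, ptOn_permOn hij.symm, qOn_comm]

theorem ptOn_qOn' {i j : ι} (hij : i ≠ j) :
    ptOn j (qOn R N i j) = permOn R N (Equiv.swap i j) := by
  rw [← ptOn_permOn' hij, ptOn_ptOn]

/-! #### Embeddings of legs -/

/-- The operator on the factors `f k` given by an operator on the factors `k`. -/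
def embOn (f : κ → ι) (M : TMat κ N R) : TMat ι N R :=
  Matrix.of fun a b => if ∀ l, (∀ k, f k ≠ l) → a l = b l then M (a ∘ f) (b ∘ f) else 0

theorem embOn_mul {f : κ → ι} (hf : Function.Injective f) (M M' : TMat κ N R) :
    embOn f (M * M') = embOn f M * embOn f M' := by
  ext a b
  rw [Matrix.mul_apply]
  have key : ∀ c : κ → Fin N, Function.extend f c a ∘ f = c := fun c => by
    ext1 k; simp [hf.extend_apply]
  have off : ∀ (c : κ → Fin N) l, (∀ k, f k ≠ l) → Function.extend f c a l = a l := by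
    intro c l hl
    exact Function.extend_apply' _ _ _ (by rintro ⟨k, hk⟩; exact hl k hk)
  -- The only contributing intermediate multi-indices agree with `a` off the range of `f`;
  -- `Function.extend f c a` parametrizes them by their values `c` on that range.
  trans ∑ c : κ → Fin N, embOn f M a (Function.extend f c a) * embOn f M' (Function.extend f c a) b
  · simp only [embOn, Matrix.of_apply, key]
    have h1 : ∀ c, (∀ l, (∀ k, f k ≠ l) → a l = Function.extend f c a l) := fun c l hl =>
      (off c l hl).symm
    have h2 : ∀ c, (∀ l, (∀ k, f k ≠ l) → Function.extend f c a l = b l) ↔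
        (∀ l, (∀ k, f k ≠ l) → a l = b l) := fun c =>
      forall₂_congr fun l hl => by rw [off c l hl]
    simp only [h2]
    split_ifs with H
    · rw [Matrix.mul_apply]
      exact Finset.sum_congr rfl fun c _ => by rw [if_pos (h1 c)]
    · simp
  · refine Finset.sum_of_injOn (fun c => Function.extend f c a) ?_ ?_ ?_ ?_
    · intro c _ c' _ h
      rw [← key c, ← key c']
      exact congrArg (· ∘ f) h
    · intro x _; simp
    · intro d _ hd
      have : ¬ ∀ l, (∀ k, f k ≠ l) → a l = d l := by
        intro H
        refine hd ⟨d ∘ f, by simp, ?_⟩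
        ext1 l
        by_cases hl : ∃ k, f k = l
        · obtain ⟨k, rfl⟩ := hl
          simp [hf.extend_apply]
        · push Not at hl
          simp only [off _ l hl, H l hl]
      simp only [embOn, Matrix.of_apply]
      rw [if_neg this, zero_mul]
    · intro c _; rfl

theorem embOn_smul {S : Type*} [SMulZeroClass S R] (f : κ → ι) (z : S) (M : TMat κ N R) :
    embOn f (z • M) = z • embOn f M := by
  ext a b
  simp only [embOn, Matrix.of_apply, Matrix.smul_apply]
  split_ifs <;> simp

theorem embOn_sub (f : κ → ι) (M M' : TMat κ N R) :
    embOn f (M - M') = embOn f M - embOn f M' := by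
  ext a b
  simp only [embOn, Matrix.of_apply, Matrix.sub_apply]
  split_ifs <;> simp

theorem embOn_legOn {f : κ → ι} (hf : Function.Injective f) (k : κ)
    (M : Matrix (Fin N) (Fin N) R) : embOn f (legOn k M) = legOn (f k) M := by
  ext a b
  simp only [embOn, legOn, Matrix.of_apply, Function.comp_apply]
  by_cases h : ∀ l, l ≠ f k → a l = b l
  · rw [if_pos h, if_pos, if_pos]
    · exact fun l hl => h _ (fun h' => hl (hf h'))
    · exact fun l hl => h l (hl k).symm
  · rw [if_neg h]
    split_ifs with h1 h2
    · exfalso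
      refine h fun l hl => ?_
      by_cases hl' : ∃ k', f k' = l
      · obtain ⟨k', rfl⟩ := hl'
        exact h2 k' (fun h' => hl (by rw [h']))
      · push Not at hl'
        exact h1 l hl'
    · rfl
    · rfl

theorem embOn_one (f : κ → ι) : embOn f (1 : TMat κ N R) = 1 := by
  ext a b
  simp only [embOn, Matrix.of_apply, Matrix.one_apply]
  by_cases h : a = b
  · subst h; simp
  · rw [if_neg h]
    split_ifs with h1 h2
    · exfalso
      refine h (funext fun l => ?_)
      by_cases hl' : ∃ k', f k' = l
      · obtain ⟨k', rfl⟩ := hl'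
        exact congrFun h2 k'
      · push Not at hl'
        exact h1 l hl'
    · rfl
    · rfl

theorem embOn_permOn {f : κ → ι} (hf : Function.Injective f) {i j : κ} (hij : i ≠ j) :
    embOn f (permOn R N (Equiv.swap i j)) = permOn R N (Equiv.swap (f i) (f j)) := by
  ext a b
  simp only [embOn, Matrix.of_apply]
  rw [permOn_swap_apply hij, permOn_swap_apply (hf.ne hij)]
  simp only [Function.comp_apply]
  rw [← ite_and]
  refine if_congr ⟨?_, ?_⟩ rfl rfl
  · rintro ⟨h0, h1, h2, h3⟩
    refine ⟨h1, h2, fun l hl hl' => ?_⟩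
    by_cases hk : ∃ k', f k' = l
    · obtain ⟨k', rfl⟩ := hk
      exact h3 k' (fun h => hl (by rw [h])) (fun h => hl' (by rw [h]))
    · push Not at hk
      exact h0 l hk
  · rintro ⟨h1, h2, h3⟩
    exact ⟨fun l hl => h3 l (hl i).symm (hl j).symm, h1, h2,
      fun k hk hk' => h3 _ (hf.ne hk) (hf.ne hk')⟩

/-! #### Change of the ring of coefficients -/

variable {R' : Type*} [Ring R'] (φ : R →+* R')

theorem legOn_map (i : ι) (M : Matrix (Fin N) (Fin N) R) :
    (legOn i M).map φ = legOn i (M.map φ) := by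
  ext a b
  simp only [legOn, Matrix.of_apply, Matrix.map_apply]
  split_ifs <;> simp

theorem permOn_map (σ : Equiv.Perm ι) : (permOn R N σ).map φ = permOn R' N σ := by
  ext a b
  simp only [permOn, Matrix.of_apply, Matrix.map_apply]
  split_ifs <;> simp

theorem qOn_map (i j : ι) : (qOn R N i j).map φ = qOn R' N i j := by
  ext a b
  simp only [qOn, Matrix.of_apply, Matrix.map_apply]
  split_ifs <;> simp

end LegsOn

/-! ### Ordered products over lists -/

section Lists

variable {α A : Type*} [Ring A]

/-- The product in the order of the list. -/
def fwd (f : α → A) (l : List α) : A := (l.map f).prod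

/-- The product in the order opposite to the order of the list. -/
def bwd (f : α → A) (l : List α) : A := (l.reverse.map f).prod

@[simp] theorem fwd_nil (f : α → A) : fwd f [] = 1 := rfl
@[simp] theorem bwd_nil (f : α → A) : bwd f [] = 1 := rfl

theorem fwd_cons (f : α → A) (i : α) (l : List α) : fwd f (i :: l) = f i * fwd f l := by
  simp [fwd]

theorem bwd_cons (f : α → A) (i : α) (l : List α) : bwd f (i :: l) = bwd f l * f i := by
  simp [bwd]

theorem fwd_append (f : α → A) (l l' : List α) : fwd f (l ++ l') = fwd f l * fwd f l' := by
  simp [fwd]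

theorem bwd_append (f : α → A) (l l' : List α) : bwd f (l ++ l') = bwd f l' * bwd f l := by
  simp [bwd]

theorem commute_fwd {f : α → A} {x : A} {l : List α} (h : ∀ i ∈ l, Commute x (f i)) :
    Commute x (fwd f l) := by
  induction l with
  | nil => simp
  | cons i l ih =>
    rw [fwd_cons]
    exact (h i (by simp)).mul_right (ih fun j hj => h j (by simp [hj]))

theorem commute_bwd {f : α → A} {x : A} {l : List α} (h : ∀ i ∈ l, Commute x (f i)) :
    Commute x (bwd f l) := by
  induction l with
  | nil => simp
  | cons i l ih =>
    rw [bwd_cons]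
    exact (ih fun j hj => h j (by simp [hj])).mul_right (h i (by simp))

theorem fwd_mul_bwd_eq_one {f g : α → A} (h : ∀ i, f i * g i = 1) (l : List α) :
    fwd f l * bwd g l = 1 := by
  induction l with
  | nil => simp
  | cons i l ih =>
    rw [fwd_cons, bwd_cons, mul_assoc, ← mul_assoc (fwd f l), ih, one_mul, h]

theorem bwd_mul_fwd_eq_one {f g : α → A} (h : ∀ i, f i * g i = 1) (l : List α) :
    bwd f l * fwd g l = 1 := by
  induction l with
  | nil => simp
  | cons i l ih =>
    rw [fwd_cons, bwd_cons, mul_assoc, ← mul_assoc (f i), h, one_mul, ih]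

/-- The usual train argument: `t i` passes the tail of the `r`, is exchanged with `r i` across `a`,
and the resulting `r' i` passes the tail of the `t`. -/
theorem exchange_bwd {r r' t : α → A} {a : A} {l : List α} (hl : l.Nodup)
    (h : ∀ i ∈ l, r i * a * t i = t i * a * r' i)
    (hr : ∀ i ∈ l, ∀ j ∈ l, i ≠ j → Commute (t i) (r j))
    (hr' : ∀ i ∈ l, ∀ j ∈ l, i ≠ j → Commute (t i) (r' j)) :
    bwd r l * a * fwd t l = fwd t l * a * bwd r' l := by
  induction l with
  | nil => simp
  | cons i l ih =>
    obtain ⟨hi, hl⟩ := List.nodup_cons.1 hl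
    have h1 : Commute (t i) (bwd r l) :=
      commute_bwd fun j hj => hr i (by simp) j (by simp [hj]) (by rintro rfl; exact hi hj)
    have h2 : Commute (r' i) (fwd t l) :=
      commute_fwd fun j hj =>
        (hr' j (by simp [hj]) i (by simp) (by rintro rfl; exact hi hj)).symm
    have ih' := ih hl (fun j hj => h j (by simp [hj]))
      (fun j hj k hk => hr j (by simp [hj]) k (by simp [hk]))
      (fun j hj k hk => hr' j (by simp [hj]) k (by simp [hk]))
    simp only [bwd_cons, fwd_cons]
    calc bwd r l * r i * a * (t i * fwd t l) = bwd r l * (r i * a * t i) * fwd t l := by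
          noncomm_ring
      _ = bwd r l * t i * a * (r' i * fwd t l) := by rw [h i (by simp)]; noncomm_ring
      _ = t i * (bwd r l * a * fwd t l) * r' i := by
          rw [h2.eq, ← h1.eq]; noncomm_ring
      _ = _ := by rw [ih']; noncomm_ring

/-- The train argument for relations in which `r` stands between `a` and `t`, as happens after a
partial transposition. -/
theorem exchange_fwd {r r' t : α → A} {a : A} {l : List α} (hl : l.Nodup)
    (h : ∀ i ∈ l, a * r i * t i = t i * r' i * a)
    (hr : ∀ i ∈ l, ∀ j ∈ l, i ≠ j → Commute (t i) (r j))
    (hr' : ∀ i ∈ l, ∀ j ∈ l, i ≠ j → Commute (t i) (r' j)) :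
    a * fwd r l * fwd t l = fwd t l * fwd r' l * a := by
  induction l with
  | nil => simp
  | cons i l ih =>
    obtain ⟨hi, hl⟩ := List.nodup_cons.1 hl
    have h1 : Commute (t i) (fwd r l) :=
      commute_fwd fun j hj => hr i (by simp) j (by simp [hj]) (by rintro rfl; exact hi hj)
    have h2 : Commute (r' i) (fwd t l) :=
      commute_fwd fun j hj =>
        (hr' j (by simp [hj]) i (by simp) (by rintro rfl; exact hi hj)).symm
    have ih' := ih hl (fun j hj => h j (by simp [hj]))
      (fun j hj k hk => hr j (by simp [hj]) k (by simp [hk]))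
      (fun j hj k hk => hr' j (by simp [hj]) k (by simp [hk]))
    simp only [fwd_cons]
    calc a * (r i * fwd r l) * (t i * fwd t l)
        = a * r i * (fwd r l * t i) * fwd t l := by noncomm_ring
      _ = (a * r i * t i) * fwd r l * fwd t l := by rw [← h1.eq]; noncomm_ring
      _ = t i * r' i * (a * fwd r l * fwd t l) := by
          rw [h i (by simp)]; noncomm_ring
      _ = t i * (r' i * fwd t l) * fwd r' l * a := by rw [ih']; noncomm_ring
      _ = _ := by rw [h2.eq]; noncomm_ring

/-- Merging of two ordered products. -/
theorem fwd_mul_fwd {f g : α → A} {l : List α} (hl : l.Nodup)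
    (h : ∀ i ∈ l, ∀ j ∈ l, i ≠ j → Commute (f i) (g j)) :
    fwd f l * fwd g l = fwd (fun i => f i * g i) l := by
  induction l with
  | nil => simp
  | cons i l ih =>
    obtain ⟨hi, hl⟩ := List.nodup_cons.1 hl
    have h1 : Commute (g i) (fwd f l) :=
      commute_fwd fun j hj => (h j (by simp [hj]) i (by simp) (by rintro rfl; exact hi hj)).symm
    have ih' := ih hl (fun j hj k hk => h j (by simp [hj]) k (by simp [hk]))
    simp only [fwd_cons]
    calc f i * fwd f l * (g i * fwd g l) = f i * (fwd f l * g i) * fwd g l := by noncomm_ring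
      _ = f i * g i * (fwd f l * fwd g l) := by rw [← h1.eq]; noncomm_ring
      _ = _ := by rw [ih']

theorem sandwich {M a b b' c : A} (ha : Commute M a) (hc : Commute M c) (hb : M * b' = b * M) :
    M * (a * b' * c) = a * b * c * M := by
  calc M * (a * b' * c) = (M * a) * b' * c := by noncomm_ring
    _ = a * (M * b') * c := by rw [ha.eq]; noncomm_ring
    _ = a * b * (M * c) := by rw [hb]; noncomm_ring
    _ = _ := by rw [hc.eq]; noncomm_ring

end Lists

/-! ### The Yang R-matrix acting on two legs -/

section RMat

variable {ι : Type*} [Fintype ι] [DecidableEq ι] {N : ℕ} {S Z : Type*} [CommRing S] [Ring Z]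
  [Algebra S Z]

theorem qOn_eq_sum {i j : ι} (hij : i ≠ j) :
    qOn Z N i j = ∑ x : Fin N, ∑ y : Fin N,
      legOn i (Matrix.single x y (1 : Z)) * legOn j (Matrix.single x y (1 : Z)) := by
  ext a b
  simp only [Matrix.sum_apply, legOn_mul_apply]
  simp only [legOn, Matrix.of_apply, Matrix.single_apply, ite_mul, one_mul, zero_mul]
  have h1 : ∀ z, (∀ k, k ≠ j → Function.update a i z k = b k) ↔
      (z = b i ∧ ∀ k, k ≠ i → k ≠ j → a k = b k) := by
    intro x
    constructor
    · intro H
      refine ⟨by simpa using H i hij, fun k hk hk' => by simpa [hk] using H k hk'⟩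
    · rintro ⟨rfl, H⟩ k hk
      by_cases hki : k = i
      · subst hki; simp
      · simpa [hki] using H k hki hk
  simp only [h1, qOn, Matrix.of_apply]
  by_cases H : ∀ k, k ≠ i → k ≠ j → a k = b k
  · simp only [eq_true H, and_true]
    simp only [Function.update_of_ne hij.symm]
    rw [Finset.sum_eq_single (a i) (by intro x _ hx; simp [hx]) (by simp)]
    rw [Finset.sum_eq_single (b i)
      (by
        intro y _ hy
        refine Finset.sum_eq_zero fun z _ => ?_
        by_cases hz : z = b i
        · simp [hz, hy]
        · simp [hz]) (by simp)]
    simp [eq_comm]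
  · simp [H]

/-- Obtained from the expansion of `Q` by transposing the factor `j`. Expansions into matrix units
reduce statements about `P` and `Q` to statements about single factors. -/
theorem permOn_eq_sum {i j : ι} (hij : i ≠ j) :
    permOn Z N (Equiv.swap i j) = ∑ x : Fin N, ∑ y : Fin N,
      legOn i (Matrix.single x y (1 : Z)) * legOn j (Matrix.single y x (1 : Z)) := by
  have h := congrArg (ptOn j) (qOn_eq_sum (Z := Z) (N := N) hij)
  rw [ptOn_qOn' hij] at h
  rw [h]
  have hadd : ∀ (f : Fin N → TMat ι N Z) (s : Finset (Fin N)),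
      ptOn j (∑ x ∈ s, f x) = ∑ x ∈ s, ptOn j (f x) := by
    intro f s
    ext a b
    simp [ptOn, Matrix.sum_apply]
  rw [hadd]
  refine Finset.sum_congr rfl fun x _ => ?_
  rw [hadd]
  refine Finset.sum_congr rfl fun y _ => ?_
  rw [ptOn_legOn_mul_of_ne hij.symm]
  congr 1
  have := ptOn_mul_legOn j (1 : TMat ι N Z) (Matrix.single x y 1) (by
    intro a b c d
    rw [Matrix.one_apply]
    split_ifs <;> simp)
  rw [one_mul, ptOn_one, mul_one] at this
  rw [this, Matrix.transpose_single]

theorem qOn_legOn_commute {i j k : ι} (hki : k ≠ i) (hkj : k ≠ j)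
    (M : Matrix (Fin N) (Fin N) Z) (hij : i ≠ j) : Commute (legOn k M) (qOn Z N i j) := by
  have h1 : legOn k M * permOn Z N (Equiv.swap i j) = permOn Z N (Equiv.swap i j) * legOn k M := by
    rw [permOn_legOn, Equiv.swap_apply_of_ne_of_ne hki hkj]
  have h2 := congrArg (ptOn i) h1
  rwa [ptOn_legOn_mul_of_ne hki.symm, ptOn_mul_legOn_of_ne hki.symm, ptOn_permOn hij] at h2

theorem permOn_legOn_commute {i j k : ι} (hki : k ≠ i) (hkj : k ≠ j)
    (M : Matrix (Fin N) (Fin N) Z) : Commute (legOn k M) (permOn Z N (Equiv.swap i j)) := by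
  rw [Commute, SemiconjBy, permOn_legOn, Equiv.swap_apply_of_ne_of_ne hki hkj]

theorem qOn_qOn_commute {i j k l : ι} (hij : i ≠ j) (hkl : k ≠ l) (hik : i ≠ k) (hil : i ≠ l)
    (hjk : j ≠ k) (hjl : j ≠ l) : Commute (qOn Z N i j) (qOn Z N k l) := by
  rw [qOn_eq_sum hij]
  refine Commute.sum_left _ _ _ fun x _ => Commute.sum_left _ _ _ fun y _ => ?_
  exact (qOn_legOn_commute hik hil _ hkl).mul_left (qOn_legOn_commute hjk hjl _ hkl)

theorem permOn_qOn_commute {i j k l : ι} (hik : i ≠ k) (hil : i ≠ l)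
    (hjk : j ≠ k) (hjl : j ≠ l) : Commute (permOn Z N (Equiv.swap i j)) (qOn Z N k l) := by
  rw [Commute, SemiconjBy, permOn_qOn, Equiv.swap_apply_of_ne_of_ne hik.symm hjk.symm,
    Equiv.swap_apply_of_ne_of_ne hil.symm hjl.symm]

/-- `γ (1 - y P_{ij})` for a pair `p = (γ, y)`. -/
def RP (N : ℕ) (Z : Type*) [Ring Z] [Algebra S Z] (i j : ι) (p : S × S) : TMat ι N Z :=
  p.1 • (1 - p.2 • permOn Z N (Equiv.swap i j))

/-- `γ (1 - y Q_{ij})` for a pair `p = (γ, y)`. -/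
def RT (N : ℕ) (Z : Type*) [Ring Z] [Algebra S Z] (i j : ι) (p : S × S) : TMat ι N Z :=
  p.1 • (1 - p.2 • qOn Z N i j)

theorem RT_comm (i j : ι) (p : S × S) : RT N Z i j p = RT N Z j i p := by
  rw [RT, qOn_comm, RT]

theorem RP_comm (i j : ι) (p : S × S) : RP N Z i j p = RP N Z j i p := by
  rw [RP, Equiv.swap_comm, RP]

theorem ptOn_RP {i j : ι} (hij : i ≠ j) (p : S × S) : ptOn i (RP N Z i j p) = RT N Z i j p := by
  rw [RP, RT, ptOn_smul, ptOn_sub, ptOn_smul, ptOn_one, ptOn_permOn hij]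

theorem ptOn_RP' {i j : ι} (hij : i ≠ j) (p : S × S) : ptOn j (RP N Z i j p) = RT N Z i j p := by
  rw [RP_comm, ptOn_RP hij.symm, RT_comm]

theorem ptOn_RT' {i j : ι} (hij : i ≠ j) (p : S × S) : ptOn j (RT N Z i j p) = RP N Z i j p := by
  rw [← ptOn_RP' hij, ptOn_ptOn]

theorem commute_smul_one_sub {x A : TMat ι N Z} (h : Commute x A) (p : S × S) :
    Commute x (p.1 • (1 - p.2 • A)) :=
  (((Commute.one_right x).sub_right (h.smul_right _)).smul_right _)

theorem legOn_RP_commute {i j k : ι} (hki : k ≠ i) (hkj : k ≠ j)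
    (M : Matrix (Fin N) (Fin N) Z) (p : S × S) : Commute (legOn k M) (RP N Z i j p) :=
  commute_smul_one_sub (permOn_legOn_commute hki hkj M) p

theorem legOn_RT_commute {i j k : ι} (hki : k ≠ i) (hkj : k ≠ j) (hij : i ≠ j)
    (M : Matrix (Fin N) (Fin N) Z) (p : S × S) : Commute (legOn k M) (RT N Z i j p) :=
  commute_smul_one_sub (qOn_legOn_commute hki hkj M hij) p

theorem RT_RT_commute {i j k l : ι} (hij : i ≠ j) (hkl : k ≠ l) (hik : i ≠ k) (hil : i ≠ l)
    (hjk : j ≠ k) (hjl : j ≠ l) (p q : S × S) : Commute (RT N Z i j p) (RT N Z k l q) :=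
  commute_smul_one_sub
    (commute_smul_one_sub (qOn_qOn_commute hij hkl hik hil hjk hjl).symm p).symm q

theorem RP_RT_commute {i j k l : ι} (hik : i ≠ k) (hil : i ≠ l)
    (hjk : j ≠ k) (hjl : j ≠ l) (p q : S × S) : Commute (RP N Z i j p) (RT N Z k l q) :=
  commute_smul_one_sub
    (commute_smul_one_sub (permOn_qOn_commute hik hil hjk hjl).symm p).symm q

theorem permOn_RP (σ : Equiv.Perm ι) (i j : ι) (p : S × S) :
    permOn Z N σ * RP N Z i j p = RP N Z (σ i) (σ j) p * permOn Z N σ := by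
  have h : permOn Z N σ * permOn Z N (Equiv.swap i j) =
      permOn Z N (Equiv.swap (σ i) (σ j)) * permOn Z N σ := by
    rw [← permOn_mul, ← permOn_mul, Equiv.mul_swap_eq_swap_mul]
  simp only [RP, mul_smul_comm, smul_mul_assoc, mul_sub, sub_mul, mul_one, one_mul, h]

theorem permOn_RT (σ : Equiv.Perm ι) (i j : ι) (p : S × S) :
    permOn Z N σ * RT N Z i j p = RT N Z (σ i) (σ j) p * permOn Z N σ := by
  simp only [RT, mul_smul_comm, smul_mul_assoc, mul_sub, sub_mul, mul_one, one_mul, permOn_qOn]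

theorem permOn_swap_sq (i j : ι) :
    permOn Z N (Equiv.swap i j) * permOn Z N (Equiv.swap i j) = 1 := by
  rw [← permOn_mul, Equiv.swap_mul_self, permOn_one]

/-- Since `P² = 1`, `(1 - yP)(1 + yP) = 1 - y²`. -/
theorem RP_unitarity (i j : ι) {p q : S × S} (h1 : q.2 = -p.2)
    (h2 : p.1 * q.1 * (1 - p.2 ^ 2) = 1) : RP N Z i j p * RP N Z i j q = 1 := by
  have : RP N Z i j p * RP N Z i j q = (p.1 * q.1 * (1 - p.2 ^ 2)) • (1 : TMat ι N Z) := by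
    simp only [RP, mul_smul_comm, smul_mul_assoc, mul_sub, sub_mul, mul_one, one_mul,
      permOn_swap_sq, h1]
    module
  rw [this, h2, one_smul]

/-- Since `Q² = NQ`, `(1 - yQ)(1 - y'Q) = 1 - (y + y' - N y y') Q`. For `y = h/w` and `y' = h/w'`
the condition reads `w + w' = hN`. -/
theorem RT_crossing {i j : ι} (hij : i ≠ j) {p q : S × S} (h1 : p.2 + q.2 = N * (p.2 * q.2))
    (h2 : p.1 * q.1 = 1) : RT N Z i j p * RT N Z i j q = 1 := by
  have hq : qOn Z N i j * qOn Z N i j = (N : S) • qOn Z N i j := by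
    rw [qOn_sq hij]
    ext a b
    simp [Algebra.smul_def]
  have : RT N Z i j p * RT N Z i j q =
      (p.1 * q.1) • ((1 : TMat ι N Z) - (p.2 + q.2 - N * (p.2 * q.2)) • qOn Z N i j) := by
    simp only [RT, mul_smul_comm, smul_mul_assoc, mul_sub, sub_mul, mul_one, one_mul, hq]
    module
  rw [this, h1, h2, one_smul, sub_self, zero_smul, sub_zero]

/-- With second components `h/w`, the hypothesis says, without denominators, that the parameter of
the third matrix is the sum of the other two. The normalizing factors are arbitrary, since they
cancel from the identity. -/
theorem yang_baxter {i j k : ι} (hij : i ≠ j) (hik : i ≠ k) (hjk : j ≠ k) {p q r : S × S}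
    (h : p.2 * q.2 = r.2 * (p.2 + q.2)) :
    RP N Z i j p * RT N Z i k q * RT N Z j k r = RT N Z j k r * RT N Z i k q * RP N Z i j p := by
  set P := permOn Z N (Equiv.swap i j) with hP
  set A := qOn Z N i k with hA
  set B := qOn Z N j k with hB
  have hPP : P * P = 1 := permOn_swap_sq i j
  have hPA : P * A = B * P := by
    rw [hP, hA, permOn_qOn, Equiv.swap_apply_left, Equiv.swap_apply_of_ne_of_ne hik.symm hjk.symm]
  have hPB : P * B = A * P := by
    rw [hP, hB, permOn_qOn, Equiv.swap_apply_right, Equiv.swap_apply_of_ne_of_ne hik.symm hjk.symm]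
  have hAB : A * B = A * P := qOn_mul_qOn hij hik hjk
  have hBA : B * A = B * P := by
    rw [hP, Equiv.swap_comm]; exact qOn_mul_qOn hij.symm hjk hik
  have hBPP : B * P * P = B := by rw [mul_assoc, hPP, mul_one]
  have hBPB : B * P * B = B := by rw [mul_assoc, hPB, ← mul_assoc, hBA, hBPP]
  simp only [RP, RT, ← hP, ← hA, ← hB, mul_smul_comm, smul_mul_assoc, mul_sub, sub_mul, mul_one,
    one_mul, hAB, hBA, hPA, hPB, hBPP, hBPB]
  linear_combination (norm := module) (p.1 * q.1 * r.1 * h) • (B * P - A * P)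

end RMat

/-! ### Jucys–Murphy elements in a representation of the symmetric group -/

section JM

variable {n : ℕ} {A : Type*} [Ring A] (ρ : Equiv.Perm (Fin n) →* A)

/-- The image of a Jucys–Murphy element. -/
def jm (p : Fin n) : A := ∑ i ∈ Finset.univ.filter (· < p), ρ (Equiv.swap i p)

theorem rho_swap_sq (i j : Fin n) : ρ (Equiv.swap i j) * ρ (Equiv.swap i j) = 1 := by
  rw [← map_mul, Equiv.swap_mul_self, map_one]

/-- Conjugation by `σ` permutes the summands `(i p)`. -/
theorem rho_mul_jm (σ : Equiv.Perm (Fin n)) (p : Fin n) (hp : σ p = p)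
    (h : ∀ i, i < p → σ i < p) : Commute (ρ σ) (jm ρ p) := by
  rw [Commute, SemiconjBy, jm, Finset.mul_sum, Finset.sum_mul]
  refine Finset.sum_nbij' (fun i => σ i) (fun i => σ.symm i) ?_ ?_ ?_ ?_ ?_
  · intro i hi
    simpa using h i (by simpa using hi)
  · intro i hi
    simp only [Finset.mem_filter, Finset.mem_univ, true_and] at hi ⊢
    -- The hypothesis concerns `σ` alone; its inverse is one of its powers and therefore preserves
    -- the indices below `p` as well.
    have hfin : ∀ k, (σ ^ k) i < p := by
      intro k
      induction k with
      | zero => simpa using hi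
      | succ k ih => rw [pow_succ', Equiv.Perm.mul_apply]; exact h _ ih
    have : σ.symm i = (σ ^ (orderOf σ - 1)) i := by
      have : σ⁻¹ = σ ^ (orderOf σ - 1) := by
        rw [_root_.inv_eq_iff_mul_eq_one, ← pow_succ', Nat.sub_add_cancel (orderOf_pos σ),
          pow_orderOf_eq_one]
      rw [← this]; rfl
    rw [this]
    exact hfin _
  · intro i _; simp
  · intro i _; simp
  · intro i _
    rw [← map_mul, ← map_mul, Equiv.mul_swap_eq_swap_mul, hp]

theorem jm_commute_of_lt {p q : Fin n} (hqp : q < p) : Commute (jm ρ q) (jm ρ p) := by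
  rw [jm]
  refine Commute.sum_left _ _ _ fun i hi => rho_mul_jm ρ _ p ?_ ?_
  · have hi : i < q := by simpa using hi
    exact Equiv.swap_apply_of_ne_of_ne (hi.trans hqp).ne' hqp.ne'
  · intro j hj
    have hi : i < q := by simpa using hi
    rw [Equiv.swap_apply_def]
    split_ifs
    · exact hqp
    · exact hi.trans hqp
    · exact hj

theorem jm_commute (p q : Fin n) : Commute (jm ρ p) (jm ρ q) := by
  rcases lt_trichotomy p q with h | rfl | h
  · exact jm_commute_of_lt ρ h
  · exact Commute.refl _
  · exact (jm_commute_of_lt ρ h).symm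

theorem swap_jm_commute {i j k : Fin n} (hj : (j : ℕ) = i + 1) (hki : k ≠ i) (hkj : k ≠ j) :
    Commute (ρ (Equiv.swap i j)) (jm ρ k) := by
  by_cases hk : k < i
  · rw [Commute, SemiconjBy, jm, Finset.mul_sum, Finset.sum_mul]
    refine Finset.sum_congr rfl fun l hl => ?_
    have hl : l < k := by simpa using hl
    rw [← map_mul, ← map_mul, Equiv.mul_swap_eq_swap_mul, Equiv.swap_apply_of_ne_of_ne,
      Equiv.swap_apply_of_ne_of_ne hki hkj]
    · exact (hl.trans hk).ne
    · have : (l : ℕ) < i := hl.trans hk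
      intro h; rw [h] at this; omega
  · refine rho_mul_jm ρ _ k (Equiv.swap_apply_of_ne_of_ne hki hkj) ?_
    intro l hl
    have h1 : (i : ℕ) ≠ k := fun h => hki (Fin.ext h.symm)
    have h2 : (j : ℕ) ≠ k := fun h => hkj (Fin.ext h.symm)
    have h3 : ¬ (k : ℕ) < i := hk
    have h4 : (l : ℕ) < k := hl
    rw [Equiv.swap_apply_def]
    split_ifs
    · show (j : ℕ) < k; omega
    · show (i : ℕ) < k; omega
    · exact hl

/-- The relation of the degenerate affine Hecke algebra: conjugation by `s` carries the summands of
one element into those of the next, all but the summand `s` itself. -/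
theorem jm_succ {i j : Fin n} (hj : (j : ℕ) = i + 1) :
    jm ρ j = ρ (Equiv.swap i j) * jm ρ i * ρ (Equiv.swap i j) + ρ (Equiv.swap i j) := by
  have hij : i < j := by show (i : ℕ) < j; omega
  have : Finset.univ.filter (· < j) = insert i (Finset.univ.filter (· < i)) := by
    ext k
    simp only [Finset.mem_filter, Finset.mem_univ, true_and, Finset.mem_insert]
    constructor
    · intro h
      have h : (k : ℕ) < j := h
      rcases eq_or_ne k i with h' | h'
      · exact Or.inl h'
      · have : (k : ℕ) ≠ i := fun h'' => h' (Fin.ext h'')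
        exact Or.inr (show (k : ℕ) < i by omega)
    · rintro (rfl | h)
      · exact hij
      · exact h.trans hij
  rw [jm, this, Finset.sum_insert (by simp), add_comm, jm, Finset.mul_sum, Finset.sum_mul]
  congr 1
  refine Finset.sum_congr rfl fun k hk => ?_
  have hk : k < i := by simpa using hk
  rw [← map_mul, ← map_mul, Equiv.mul_swap_eq_swap_mul (Equiv.swap i j) k i, mul_assoc,
    Equiv.swap_mul_self, mul_one, Equiv.swap_apply_left, Equiv.swap_apply_of_ne_of_ne hk.ne (hk.trans hij).ne]

variable {ρ}

theorem swap_mul_jm {i j : Fin n} (hj : (j : ℕ) = i + 1) :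
    ρ (Equiv.swap i j) * jm ρ j = jm ρ i * ρ (Equiv.swap i j) + 1 := by
  rw [jm_succ ρ hj, mul_add, ← mul_assoc, ← mul_assoc, rho_swap_sq, one_mul]

theorem swap_mul_jm' {i j : Fin n} (hj : (j : ℕ) = i + 1) :
    ρ (Equiv.swap i j) * jm ρ i = jm ρ j * ρ (Equiv.swap i j) - 1 := by
  rw [jm_succ ρ hj, add_mul, mul_assoc _ (ρ _) (ρ _), rho_swap_sq, mul_one, add_sub_cancel_right]

/-- A family of elements labelled by contents which is compatible with the elementary intertwiners
of the degenerate affine Hecke algebra. -/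
def Intertwines (ρ : Equiv.Perm (Fin n) →* A) (F : (Fin n → ℤ) → A) : Prop :=
  ∀ i j : Fin n, (j : ℕ) = i + 1 → ∀ c : Fin n → ℤ, c i ≠ c j →
    ((c i - c j) • ρ (Equiv.swap i j) + 1) * F (c ∘ Equiv.swap i j) =
      F c * ((c i - c j) • ρ (Equiv.swap i j) + 1)

theorem Intertwines.mul {F H : (Fin n → ℤ) → A} (hF : Intertwines ρ F) (hH : Intertwines ρ H) :
    Intertwines ρ fun c => F c * H c := by
  intro i j hj c hc
  rw [← mul_assoc, hF i j hj c hc, mul_assoc, hH i j hj c hc, mul_assoc]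

theorem Intertwines.inv {F H : (Fin n → ℤ) → A} (hF : Intertwines ρ F)
    (h1 : ∀ c, F c * H c = 1) (h2 : ∀ c, H c * F c = 1) : Intertwines ρ H := by
  intro i j hj c hc
  have h := hF i j hj c hc
  calc _ = H c * F c * ((c i - c j) • ρ (Equiv.swap i j) + 1) * H (c ∘ Equiv.swap i j) := by
        rw [h2, one_mul]
    _ = H c * (F c * ((c i - c j) • ρ (Equiv.swap i j) + 1)) * H (c ∘ Equiv.swap i j) := by
        noncomm_ring
    _ = H c * ((c i - c j) • ρ (Equiv.swap i j) + 1) *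
        (F (c ∘ Equiv.swap i j) * H (c ∘ Equiv.swap i j)) := by rw [← h]; noncomm_ring
    _ = _ := by rw [h1, mul_one]

/-- The nodes of the interpolation in the definition of the Young idempotents. -/
def contentNodes (p : Fin n) : Finset ℤ := Finset.Icc (-(p : ℤ)) p

/-- The polynomial with simple zeros at the nodes. -/
def nodePoly (p : Fin n) : Polynomial ℂ :=
  ∏ a ∈ contentNodes p, (Polynomial.X - Polynomial.C (a : ℂ))

variable [Algebra ℂ A]

theorem zsmul_eq_zero_of_ne {d : ℤ} (hd : d ≠ 0) {x : A} (h : d • x = 0) : x = 0 := by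
  rw [← Int.cast_smul_eq_zsmul ℂ] at h
  have hd' : (d : ℂ) ≠ 0 := by exact_mod_cast hd
  have := congrArg (fun y => (d : ℂ)⁻¹ • y) h
  simpa [smul_smul, inv_mul_cancel₀ hd'] using this

theorem mul_aeval_of_eigen {r x : A} {a : ℂ} (h : r * x = a • r) (f : Polynomial ℂ) :
    r * Polynomial.aeval x f = f.eval a • r := by
  induction f using Polynomial.induction_on' with
  | add f g hf hg => rw [map_add, mul_add, hf, hg, Polynomial.eval_add, add_smul]
  | monomial k z =>
    rw [Polynomial.aeval_monomial, Polynomial.eval_monomial]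
    induction k with
    | zero => simp [Algebra.smul_def, (Algebra.commutes z r)]
    | succ k ih =>
      rw [pow_succ, ← mul_assoc, ← mul_assoc, mul_assoc r, ih, smul_mul_assoc, h, smul_smul, pow_succ,
        mul_assoc]

/-- With `a = c i = c j`, the relation between `s` and the Jucys–Murphy elements gives `r s (x_j -
a) = r` and `r (x_j - a) = 0`. For `r ≠ 0` this is a Jordan block of size two, impossible for an
element annihilated by a polynomial with simple zeros. -/
theorem eigenrow_eq_zero (hnode : ∀ p, Polynomial.aeval (jm ρ p) (nodePoly p) = 0)
    {i j : Fin n} (hj : (j : ℕ) = i + 1) {c : Fin n → ℤ} (hc : c i = c j) {r : A}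
    (hr : ∀ p, r * jm ρ p = c p • r) : r = 0 := by
  set a := c j with ha
  have hrj : r * jm ρ j = (a : ℂ) • r := by rw [hr, Int.cast_smul_eq_zsmul]
  have hq : r * ρ (Equiv.swap i j) * (jm ρ j - algebraMap ℂ A a) = r := by
    rw [mul_sub, mul_assoc, swap_mul_jm hj, mul_add, ← mul_assoc, hr, hc, mul_one,
      ← Algebra.commutes, ← Algebra.smul_def, Int.cast_smul_eq_zsmul, smul_mul_assoc,
      add_sub_cancel_left]
  -- If `a` is a node, one factor of the annihilating polynomial turns `r s` into `r` and the others
  -- act on `r` by nonzero scalars. If not, the whole polynomial already acts on `r` by a nonzero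
  -- scalar.
  by_cases hmem : a ∈ contentNodes j
  · have hf : nodePoly j = (Polynomial.X - Polynomial.C (a : ℂ)) *
        ∏ b ∈ (contentNodes j).erase a, (Polynomial.X - Polynomial.C (b : ℂ)) := by
      rw [nodePoly,
        Finset.mul_prod_erase _ (fun b : ℤ => Polynomial.X - Polynomial.C (b : ℂ)) hmem]
    have h0 := hnode j
    rw [hf, map_mul] at h0
    have h1 := congrArg (fun y => r * ρ (Equiv.swap i j) * y) h0
    simp only [map_sub, Polynomial.aeval_X, Polynomial.aeval_C, mul_zero] at h1
    rw [← mul_assoc, hq, mul_aeval_of_eigen hrj, Polynomial.eval_prod] at h1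
    have hne : (∏ b ∈ (contentNodes j).erase a,
        Polynomial.eval (a : ℂ) (Polynomial.X - Polynomial.C (b : ℂ))) ≠ 0 := by
      refine Finset.prod_ne_zero_iff.2 fun b hb => ?_
      simp only [Polynomial.eval_sub, Polynomial.eval_X, Polynomial.eval_C]
      rw [sub_ne_zero]
      exact_mod_cast (Finset.ne_of_mem_erase hb).symm
    have := congrArg (fun y => (∏ b ∈ (contentNodes j).erase a,
        Polynomial.eval (a : ℂ) (Polynomial.X - Polynomial.C (b : ℂ)))⁻¹ • y) h1
    simpa only [smul_smul, inv_mul_cancel₀ hne, one_smul, smul_zero] using this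
  · have h1 := mul_aeval_of_eigen hrj (nodePoly j)
    rw [hnode, mul_zero, nodePoly, Polynomial.eval_prod] at h1
    have hne : (∏ b ∈ contentNodes j,
        Polynomial.eval (a : ℂ) (Polynomial.X - Polynomial.C (b : ℂ))) ≠ 0 := by
      refine Finset.prod_ne_zero_iff.2 fun b hb => ?_
      simp only [Polynomial.eval_sub, Polynomial.eval_X, Polynomial.eval_C]
      rw [sub_ne_zero]
      intro h
      have h : a = b := by exact_mod_cast h
      exact hmem (h ▸ hb)
    have := congrArg (fun y => (∏ b ∈ contentNodes j,
        Polynomial.eval (a : ℂ) (Polynomial.X - Polynomial.C (b : ℂ)))⁻¹ • y) h1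
    simpa only [smul_smul, inv_mul_cancel₀ hne, one_smul, smul_zero] using this.symm

/-- The elementary intertwiner exchanges the eigenvalues `c i` and `c j`. The product with `r` may
vanish, which does no harm below. -/
theorem eigenrow_mul_intertwiner {i j : Fin n} (hj : (j : ℕ) = i + 1) {c : Fin n → ℤ} {r : A}
    (hr : ∀ p, r * jm ρ p = c p • r) (p : Fin n) :
    r * ((c i - c j) • ρ (Equiv.swap i j) + 1) * jm ρ p =
      (c ∘ Equiv.swap i j) p • (r * ((c i - c j) • ρ (Equiv.swap i j) + 1)) := by
  have hij : i ≠ j := by rintro rfl; omega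
  set s := ρ (Equiv.swap i j)
  set d := c i - c j with hd
  have hexp : r * (d • s + 1) * jm ρ p = d • (r * (s * jm ρ p)) + r * jm ρ p := by
    rw [mul_add, add_mul, mul_one, mul_smul_comm, smul_mul_assoc, mul_assoc]
  have hexp' : r * (d • s + 1) = d • (r * s) + r := by
    rw [mul_add, mul_one, mul_smul_comm]
  rw [hexp, hexp', Function.comp_apply]
  by_cases hpi : p = i
  · subst hpi
    rw [swap_mul_jm' hj, Equiv.swap_apply_left, mul_sub, ← mul_assoc, hr, hr, mul_one, hd,
      smul_mul_assoc]
    module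
  · by_cases hpj : p = j
    · subst hpj
      rw [swap_mul_jm hj, Equiv.swap_apply_right, mul_add, ← mul_assoc, hr, hr, mul_one, hd,
        smul_mul_assoc]
      module
    · rw [Equiv.swap_apply_of_ne_of_ne hpi hpj, (swap_jm_commute ρ hj hpi hpj).eq, ← mul_assoc, hr,
        smul_mul_assoc]
      module

/-- Multiplication by an intertwining family preserves common eigenvectors of the Jucys–Murphy
elements. -/
theorem eigenrow_mul (hnode : ∀ p, Polynomial.aeval (jm ρ p) (nodePoly p) = 0)
    {F : (Fin n → ℤ) → A} (hF : Intertwines ρ F) (k : ℕ) :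
    ∀ (p : Fin n), (p : ℕ) = k → ∀ (c : Fin n → ℤ) (r : A), (∀ p, r * jm ρ p = c p • r) →
      r * F c * jm ρ p = c p • (r * F c) := by
  induction k with
  | zero =>
    intro p hp c r hr
    have h0 : jm ρ p = 0 := by
      rw [jm, Finset.sum_eq_zero]
      intro i hi
      have hi : i < p := by simpa using hi
      have : (i : ℕ) < p := hi
      omega
    have := hr p
    rw [h0, mul_zero] at this ⊢
    rw [← smul_mul_assoc, ← this, zero_mul]
  | succ k ih =>
    intro j hj c r hr
    have hk : k < n := by have := j.2; omega
    obtain ⟨i, hi⟩ : ∃ i : Fin n, (i : ℕ) = k := ⟨⟨k, hk⟩, rfl⟩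
    have hj' : (j : ℕ) = i + 1 := by omega
    -- The intertwining property is available for `c i ≠ c j` only; in the excluded case `r`
    -- vanishes.
    by_cases hc : c i = c j
    · rw [eigenrow_eq_zero hnode hj' hc hr]; simp
    set s := ρ (Equiv.swap i j) with hs
    set d := c i - c j with hd
    have hd0 : d ≠ 0 := sub_ne_zero.2 hc
    -- The induction hypothesis for `x_i` is used for `r` and also for `r` times the intertwiner
    -- with exchanged contents; by the intertwining property the latter becomes a statement about `r
    -- * F c`.
    have h1 := ih i hi (c ∘ Equiv.swap i j) _ (eigenrow_mul_intertwiner hj' hr)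
    rw [mul_assoc r, ← hs, ← hd, hF i j hj' c hc, ← mul_assoc r] at h1
    have h2 := ih i hi c r hr
    rw [Function.comp_apply, Equiv.swap_apply_left] at h1
    set W := r * F c with hW
    rw [← hs, ← hd] at h1
    -- Comparing the two gives the action of `x_i` on `W s` up to the factor `d`, which is
    -- cancelled; then `x_j = s x_i s + s` yields the eigenvalue `c j` of `W`.
    have h3 : d • (W * s * jm ρ i - c j • (W * s) + W) = 0 := by
      have e1 : W * (d • s + 1) * jm ρ i = d • (W * s * jm ρ i) + W * jm ρ i := by
        rw [mul_add, add_mul, mul_one, mul_smul_comm, smul_mul_assoc]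
      have e2 : W * (d • s + 1) = d • (W * s) + W := by
        rw [mul_add, mul_one, mul_smul_comm]
      rw [e1, e2, h2] at h1
      have e3 : d • (W * s * jm ρ i) = c j • (d • (W * s) + W) - c i • W := by
        rw [← h1]; abel
      rw [smul_add, smul_sub, e3, hd]
      module
    have h4 := zsmul_eq_zero_of_ne hd0 h3
    have h5 : W * s * jm ρ i = c j • (W * s) - W := by
      rw [← sub_eq_zero, ← h4]; abel
    rw [jm_succ ρ hj', ← hs, mul_add, ← mul_assoc, ← mul_assoc, h5, sub_mul, smul_mul_assoc,
      mul_assoc W, hs, rho_swap_sq, mul_one, sub_add_cancel]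

/-- The product of the interpolation polynomials in the Jucys–Murphy elements. -/
def jmProjector (ρ : Equiv.Perm (Fin n) →* A) (c : Fin n → ℤ) : A :=
  (List.ofFn fun p : Fin n =>
    Polynomial.aeval (jm ρ p)
      (Lagrange.basis (contentNodes p) (fun a : ℤ => (a : ℂ)) (c p))).prod

theorem basis_eval_self (s : Finset ℤ) (c : ℤ) :
    (Lagrange.basis s (fun a : ℤ => (a : ℂ)) c).eval (c : ℂ) = 1 := by
  rw [Lagrange.basis, Polynomial.eval_prod]
  refine Finset.prod_eq_one fun b hb => ?_
  have : (c : ℂ) ≠ b := by exact_mod_cast (Finset.ne_of_mem_erase hb).symm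
  exact Lagrange.eval_basisDivisor_left_of_ne this

/-- Each interpolation polynomial takes the value 1 at the corresponding eigenvalue. -/
theorem eigenrow_mul_jmProjector {c : Fin n → ℤ} {r : A} (hr : ∀ p, r * jm ρ p = c p • r) :
    r * jmProjector ρ c = r := by
  rw [jmProjector]
  have : ∀ l : List A, (∀ x ∈ l, r * x = r) → r * l.prod = r := by
    intro l
    induction l with
    | nil => simp
    | cons x l ih =>
      intro h
      rw [List.prod_cons, ← mul_assoc, h x (by simp), ih fun y hy => h y (by simp [hy])]
  refine this _ fun x hx => ?_
  obtain ⟨p, rfl⟩ := (List.mem_ofFn' _ _).1 hx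
  have hrj : r * jm ρ p = ((c p : ℤ) : ℂ) • r := by rw [hr, Int.cast_smul_eq_zsmul]
  rw [mul_aeval_of_eigen hrj, basis_eval_self, one_smul]

/-- The Lagrange polynomial contains the factors of all nodes other than `c`, and `X - c` supplies
the remaining one. If `c` is not a node, the Lagrange polynomial alone is divisible. -/
theorem basis_mul_sub (p : Fin n) (c : ℤ) :
    nodePoly p ∣ Lagrange.basis (contentNodes p) (fun a : ℤ => (a : ℂ)) c *
      (Polynomial.X - Polynomial.C (c : ℂ)) := by
  have h : ∀ s : Finset ℤ, (∀ b ∈ s, b ≠ c) → (∏ b ∈ s, (Polynomial.X - Polynomial.C (b : ℂ))) ∣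
      ∏ b ∈ s, Lagrange.basisDivisor (c : ℂ) (b : ℂ) := by
    intro s hs
    refine Finset.prod_dvd_prod_of_dvd _ _ fun b hb => ?_
    rw [Lagrange.basisDivisor]
    exact dvd_mul_left _ _
  rw [Lagrange.basis, nodePoly]
  by_cases hc : c ∈ contentNodes p
  · rw [← Finset.prod_erase_mul _ _ hc]
    exact mul_dvd_mul (h _ fun b hb => Finset.ne_of_mem_erase hb) dvd_rfl
  · refine Dvd.dvd.mul_right ?_ _
    rw [Finset.erase_eq_of_notMem hc]
    exact h _ fun b hb h => hc (h ▸ hb)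

/-- Together with `eigenrow_mul_jmProjector`, this makes `jmProjector` act from the right as the
projector to the joint eigenrows with eigenvalues `c`. -/
theorem jmProjector_mul_jm (hnode : ∀ p, Polynomial.aeval (jm ρ p) (nodePoly p) = 0)
    (c : Fin n → ℤ) (p : Fin n) : jmProjector ρ c * jm ρ p = c p • jmProjector ρ c := by
  rw [← sub_eq_zero]
  have hz : ∀ x : A, x * jm ρ p - c p • x = x * (jm ρ p - algebraMap ℂ A (c p)) := by
    intro x
    rw [mul_sub, ← Algebra.commutes, ← Algebra.smul_def, Int.cast_smul_eq_zsmul]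
  rw [hz, jmProjector]
  set y := jm ρ p - algebraMap ℂ A (c p) with hy
  have hcomm : ∀ (q : Fin n) (f : Polynomial ℂ), Commute (Polynomial.aeval (jm ρ q) f) y := by
    intro q f
    have h0 : Commute (jm ρ q) y :=
      (jm_commute ρ q p).sub_right (Algebra.commutes _ _).symm
    have : ∀ z ∈ Algebra.adjoin ℂ {jm ρ q}, Commute z y := by
      intro z hz
      induction hz using Algebra.adjoin_induction with
      | mem x hx => rw [Set.mem_singleton_iff] at hx; rw [hx]; exact h0
      | algebraMap a => exact Algebra.commutes _ _
      | add x x' _ _ h h' => exact h.add_left h'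
      | mul x x' _ _ h h' => exact h.mul_left h'
    exact this _ (Polynomial.aeval_mem_adjoin_singleton _ _)
  -- The factor `x_p - c_p` commutes through the list to the `p`-th polynomial, where it completes a
  -- multiple of the annihilating polynomial of `x_p`.
  have key : ∀ l : List (Fin n), p ∈ l →
      (l.map fun q => Polynomial.aeval (jm ρ q)
        (Lagrange.basis (contentNodes q) (fun a : ℤ => (a : ℂ)) (c q))).prod * y = 0 := by
    intro l
    induction l with
    | nil => simp
    | cons q l ih =>
      intro hq
      rw [List.map_cons, List.prod_cons]
      rcases List.mem_cons.1 hq with rfl | hq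
      · have hl : Commute (List.map (fun q => Polynomial.aeval (jm ρ q)
            (Lagrange.basis (contentNodes q) (fun a : ℤ => (a : ℂ)) (c q))) l).prod y := by
          refine Commute.list_prod_left _ _ fun x hx => ?_
          obtain ⟨q, -, rfl⟩ := List.mem_map.1 hx
          exact hcomm _ _
        rw [mul_assoc, hl.eq, ← mul_assoc]
        have : Polynomial.aeval (jm ρ p)
            (Lagrange.basis (contentNodes p) (fun a : ℤ => (a : ℂ)) (c p)) * y = 0 := by
          obtain ⟨g, hg⟩ := basis_mul_sub p (c p)
          have h2 := congrArg (Polynomial.aeval (jm ρ p)) hg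
          rw [map_mul, map_mul, hnode, zero_mul, map_sub, Polynomial.aeval_X,
            Polynomial.aeval_C] at h2
          exact h2
        rw [this, zero_mul]
      · rw [mul_assoc, ih hq, mul_zero]
  rw [List.ofFn_eq_map]
  exact key _ (List.mem_finRange p)

/-- Multiplication by an intertwining family preserves the image of the projector. -/
theorem jmProjector_mul_mul (hnode : ∀ p, Polynomial.aeval (jm ρ p) (nodePoly p) = 0)
    {F : (Fin n → ℤ) → A} (hF : Intertwines ρ F) (c : Fin n → ℤ) :
    jmProjector ρ c * F c * jmProjector ρ c = jmProjector ρ c * F c :=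
  eigenrow_mul_jmProjector fun p =>
    eigenrow_mul hnode hF p p rfl c _ (jmProjector_mul_jm hnode c)

theorem jmProjector_map {B : Type*} [Ring B] [Algebra ℂ B] (φ : A →ₐ[ℂ] B) (c : Fin n → ℤ) :
    φ (jmProjector ρ c) = jmProjector ((φ : A →* B).comp ρ) c := by
  have h : ∀ p, φ (jm ρ p) = jm ((φ : A →* B).comp ρ) p := by
    intro p; simp [jm]
  rw [jmProjector, jmProjector, map_list_prod, List.map_ofFn]
  congr 2
  ext p
  simp only [Function.comp_apply, ← Polynomial.aeval_algHom_apply, h]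

end JM

/-! ### Eigenvalues and semisimplicity of the Jucys–Murphy elements. -/

section Spectrum

variable {n : ℕ} {m : Type*} [Fintype m] [DecidableEq m]

/-- The eigenvalues of Jucys–Murphy elements are integers in the range of contents. -/
theorem jm_eigenvalue (ρ : Equiv.Perm (Fin n) →* Matrix m m ℂ) (k : ℕ) :
    ∀ p : Fin n, (p : ℕ) = k → ∀ (μ : ℂ) (v : m → ℂ), v ≠ 0 → (jm ρ p).mulVec v = μ • v →
      ∃ a ∈ contentNodes p, μ = (a : ℂ) := by
  induction k with
  | zero =>
    intro p hp μ v hv h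
    have h0 : jm ρ p = 0 := by
      rw [jm, Finset.sum_eq_zero]
      intro i hi
      have hi : i < p := by simpa using hi
      have : (i : ℕ) < p := hi
      omega
    rw [h0, Matrix.zero_mulVec] at h
    refine ⟨0, by simp [contentNodes], ?_⟩
    simpa [hv] using h.symm
  | succ k ih =>
    intro j hj μ v hv h
    have hk : k < n := by have := j.2; omega
    obtain ⟨i, hi⟩ : ∃ i : Fin n, (i : ℕ) = k := ⟨⟨k, hk⟩, rfl⟩
    have hj' : (j : ℕ) = i + 1 := by omega
    set f : Module.End ℂ (m → ℂ) := Matrix.toLin' (jm ρ i)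
    set g : Module.End ℂ (m → ℂ) := Matrix.toLin' (jm ρ j)
    have hfg : Commute g f := by
      rw [Commute, SemiconjBy, Module.End.mul_eq_comp, Module.End.mul_eq_comp,
        ← Matrix.toLin'_mul, ← Matrix.toLin'_mul, (jm_commute ρ j i).eq]
    -- Two consecutive Jucys–Murphy elements commute, so the `μ`-eigenspace of the later one
    -- contains an eigenvector of the earlier one.
    obtain ⟨w, a, hw0, hwj, hwi⟩ : ∃ (w : m → ℂ) (a : ℂ), w ≠ 0 ∧
        (jm ρ j).mulVec w = μ • w ∧ (jm ρ i).mulVec w = a • w := by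
      have hmaps : Set.MapsTo f (g.eigenspace μ) (g.eigenspace μ) :=
        Module.End.mapsTo_genEigenspace_of_comm hfg μ 1
      have hvmem : v ∈ g.eigenspace μ := Module.End.mem_eigenspace_iff.2 h
      have : Nontrivial (g.eigenspace μ) :=
        ⟨⟨⟨v, hvmem⟩, 0, fun h => hv (congrArg Subtype.val h)⟩⟩
      obtain ⟨a, ha⟩ := Module.End.exists_eigenvalue (f.restrict hmaps)
      obtain ⟨w, hw⟩ := ha.exists_hasEigenvector
      refine ⟨w, a, fun h => hw.2 (Subtype.ext h), Module.End.mem_eigenspace_iff.1 w.2, ?_⟩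
      exact congrArg Subtype.val hw.apply_eq_smul
    obtain ⟨b, hb, rfl⟩ := ih i hi a w hw0 hwi
    set s := ρ (Equiv.swap i j) with hs
    have hss : ∀ y, s.mulVec (s.mulVec y) = y := by
      intro y
      rw [Matrix.mulVec_mulVec, hs, rho_swap_sq, Matrix.one_mulVec]
    have h1 : (jm ρ i).mulVec (s.mulVec w) = μ • s.mulVec w - w := by
      have := congrArg (fun M => Matrix.mulVec M w) (swap_mul_jm (ρ := ρ) hj')
      simp only [← Matrix.mulVec_mulVec, Matrix.add_mulVec, Matrix.one_mulVec, hwj,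
        Matrix.mulVec_smul] at this
      rw [this]; abel
    -- The intertwiner applied to `w`: if nonzero, it is an eigenvector of `x_i` with the eigenvalue
    -- `μ` of `x_j`, and induction applies to `μ` itself.
    set w' := (μ - b) • s.mulVec w - w with hw'
    have h2 : (jm ρ i).mulVec w' = μ • w' := by
      rw [hw', Matrix.mulVec_sub, Matrix.mulVec_smul, h1, hwi]
      module
    simp only [contentNodes, Finset.mem_Icc] at hb ⊢
    by_cases hw0' : w' = 0
    -- If it vanishes, then `w` is an eigenvector of the involution `s`, so `(μ - b)² = 1` and `μ =
    -- b ± 1` stays within the range enlarged by one.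
    · have h3 : (μ - b) • s.mulVec w = w := sub_eq_zero.1 hw0'
      have h4 : ((μ - b) ^ 2) • w = w := by
        conv_rhs => rw [← h3]
        have h5 := congrArg (fun y => (μ - b) • s.mulVec y) h3
        simp only [Matrix.mulVec_smul, hss] at h5
        rw [← h5, pow_two, smul_smul]
      have h6 : (μ - b) ^ 2 = 1 := by
        have : ((μ - b) ^ 2 - 1) • w = 0 := by rw [sub_smul, h4, one_smul, sub_self]
        rcases smul_eq_zero.1 this with h | h
        · linear_combination h
        · exact absurd h hw0
      have h7 : (μ - b - 1) * (μ - b + 1) = 0 := by linear_combination h6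
      rcases mul_eq_zero.1 h7 with h | h
      · exact ⟨b + 1, by omega, by push_cast; linear_combination h⟩
      · exact ⟨b - 1, by omega, by push_cast; linear_combination h⟩
    · obtain ⟨a', ha', h'⟩ := ih i hi μ w' hw0' h2
      simp only [contentNodes, Finset.mem_Icc] at ha'
      exact ⟨a', by omega, h'⟩

/-- Hermitian matrices are annihilated by polynomials with zeros at all eigenvalues. -/
theorem aeval_eq_zero_of_isHermitian {M : Matrix m m ℂ} (hM : M.IsHermitian) (f : Polynomial ℂ)
    (hf : ∀ (μ : ℂ) (v : m → ℂ), v ≠ 0 → M.mulVec v = μ • v → f.eval μ = 0) :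
    Polynomial.aeval M f = 0 := by
  have hb : ∀ i, (Polynomial.aeval M f).mulVec (hM.eigenvectorBasis i) = 0 := by
    intro i
    have h1 := hM.mulVec_eigenvectorBasis i
    have hne : (hM.eigenvectorBasis i : m → ℂ) ≠ 0 := by
      intro h
      refine hM.eigenvectorBasis.orthonormal.ne_zero i ?_
      ext k; exact congrFun h k
    have h2 : ∀ g : Polynomial ℂ, (Polynomial.aeval M g).mulVec (hM.eigenvectorBasis i) =
        g.eval (hM.eigenvalues i : ℂ) • (hM.eigenvectorBasis i : m → ℂ) := by
      intro g
      induction g using Polynomial.induction_on' with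
      | add g g' hg hg' => rw [map_add, Matrix.add_mulVec, hg, hg', Polynomial.eval_add, add_smul]
      | monomial k z =>
        rw [Polynomial.aeval_monomial, Polynomial.eval_monomial, ← Matrix.mulVec_mulVec,
          Algebra.algebraMap_eq_smul_one, Matrix.smul_mulVec, Matrix.one_mulVec, mul_smul]
        congr 1
        induction k with
        | zero => simp
        | succ k ih =>
          rw [pow_succ', ← Matrix.mulVec_mulVec, ih, Matrix.mulVec_smul, h1, pow_succ, mul_smul]
          rfl
    rw [h2, hf _ _ hne (by rw [h1]; rfl), zero_smul]
  have : Matrix.toLin' (Polynomial.aeval M f) = 0 := by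
    refine (hM.eigenvectorBasis.toBasis.map (WithLp.linearEquiv 2 ℂ (m → ℂ))).ext fun i => ?_
    simpa using hb i
  simpa using this

/-- A sum of Hermitian transpositions is Hermitian, hence diagonalizable, and each of its
eigenvalues is a node. -/
theorem nodePoly_jm_eq_zero (ρ : Equiv.Perm (Fin n) →* Matrix m m ℂ)
    (hρ : ∀ i j, (ρ (Equiv.swap i j)).conjTranspose = ρ (Equiv.swap i j)) (p : Fin n) :
    Polynomial.aeval (jm ρ p) (nodePoly p) = 0 := by
  refine aeval_eq_zero_of_isHermitian ?_ _ fun μ v hv h => ?_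
  · rw [Matrix.IsHermitian, jm, Matrix.conjTranspose_sum]
    exact Finset.sum_congr rfl fun i _ => hρ i p
  · obtain ⟨a, ha, rfl⟩ := jm_eigenvalue ρ p p rfl μ v hv h
    rw [nodePoly, Polynomial.eval_prod]
    exact Finset.prod_eq_zero ha (by simp)

end Spectrum

/-! ### The permutation representation on all tensor factors but the auxiliary one. -/

section PermRep

variable {n N : ℕ} (Z : Type*) [Ring Z]

/-- The action of the symmetric group on all factors but the additional one. -/
def permRep (n N : ℕ) : Equiv.Perm (Fin n) →* TMat (Option (Fin n)) N Z where
  toFun σ := permOn Z N (Equiv.optionCongr σ)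
  map_one' := by
    rw [← permOn_one]
    congr 1
    ext x; cases x <;> rfl
  map_mul' σ τ := by
    rw [← permOn_mul]
    congr 1
    ext x; cases x <;> rfl

theorem permRep_swap (i j : Fin n) :
    permRep Z n N (Equiv.swap i j) = permOn Z N (Equiv.swap (some i) (some j)) := by
  show permOn Z N _ = _
  congr 1
  exact Equiv.optionCongr_swap i j

theorem permRep_conjTranspose (i j : Fin n) :
    (permRep ℂ n N (Equiv.swap i j)).conjTranspose = permRep ℂ n N (Equiv.swap i j) := by
  rcases eq_or_ne i j with rfl | hij
  · rw [Equiv.swap_self]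
    have : permRep ℂ n N (Equiv.refl _) = 1 := (permRep ℂ n N).map_one
    rw [this, Matrix.conjTranspose_one]
  rw [permRep_swap]
  have hij' : (some i : Option (Fin n)) ≠ some j := by simpa using hij
  ext a b
  rw [Matrix.conjTranspose_apply, permOn_swap_apply hij', permOn_swap_apply hij', apply_ite star,
    star_one, star_zero]
  refine if_congr ⟨fun ⟨h1, h2, h3⟩ => ⟨h2.symm, h1.symm, fun k hk hk' => (h3 k hk hk').symm⟩,
    fun ⟨h1, h2, h3⟩ => ⟨h2.symm, h1.symm, fun k hk hk' => (h3 k hk hk').symm⟩⟩ rfl rfl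

/-- The spectral theorem is applied over `ℂ`, and the resulting polynomial identity is carried to
the coefficient ring `Z`. -/
theorem nodePoly_permRep [Algebra ℂ Z] (p : Fin n) :
    Polynomial.aeval (jm (permRep Z n N) p) (nodePoly p) = 0 := by
  have h := nodePoly_jm_eq_zero (permRep ℂ n N) permRep_conjTranspose p
  set φ : TMat (Option (Fin n)) N ℂ →ₐ[ℂ] TMat (Option (Fin n)) N Z :=
    (Algebra.ofId ℂ Z).mapMatrix
  have hφ : jm (permRep Z n N) p = φ (jm (permRep ℂ n N) p) := by
    simp only [jm, map_sum]
    refine Finset.sum_congr rfl fun i _ => ?_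
    rw [permRep_swap, permRep_swap]
    exact (permOn_map (algebraMap ℂ Z) _).symm
  rw [hφ, Polynomial.aeval_algHom_apply, h, map_zero]

end PermRep

/-! ### Fused relations -/

section Fused

variable {ι : Type*} [Fintype ι] [DecidableEq ι] {N : ℕ} {S Z : Type*} [CommRing S] [Ring Z]
  [Algebra S Z]

theorem qOn_legOn {i j : ι} (hij : i ≠ j) (M : Matrix (Fin N) (Fin N) Z) :
    qOn Z N i j * legOn i M = qOn Z N i j * legOn j M.transpose := by
  ext a b
  rw [mul_legOn_apply, mul_legOn_apply]
  simp only [qOn, Matrix.of_apply, Matrix.transpose_apply]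
  have h1 : ∀ x, (a i = a j ∧ (Function.update b i x i = Function.update b i x j) ∧
      ∀ l, l ≠ i → l ≠ j → a l = Function.update b i x l) ↔
      (x = b j ∧ (a i = a j ∧ ∀ l, l ≠ i → l ≠ j → a l = b l)) := by
    intro x
    rw [← and_assoc, and_comm (a := a i = a j), and_assoc]
    refine and_congr (by simp [hij.symm]) (and_congr Iff.rfl ?_)
    exact forall₃_congr fun l hl hl' => by simp [hl]
  have h2 : ∀ x, (a i = a j ∧ (Function.update b j x i = Function.update b j x j) ∧
      ∀ l, l ≠ i → l ≠ j → a l = Function.update b j x l) ↔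
      (x = b i ∧ (a i = a j ∧ ∀ l, l ≠ i → l ≠ j → a l = b l)) := by
    intro x
    rw [← and_assoc, and_comm (a := a i = a j), and_assoc]
    refine and_congr (by simp [hij, eq_comm]) (and_congr Iff.rfl ?_)
    exact forall₃_congr fun l hl hl' => by simp [hl']
  simp only [h1, h2]
  by_cases hr : (a i = a j ∧ ∀ l, l ≠ i → l ≠ j → a l = b l)
  · simp only [eq_true hr, and_true]; simp
  · simp [hr]

/-- A matrix which is symmetric or skew-symmetric and has central entries. -/
structure IsForm (G : Matrix (Fin N) (Fin N) Z) : Prop where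
  central : ∀ a b z, Commute (G a b) z
  symm : G.transpose = G ∨ G.transpose = -G

variable {G : Matrix (Fin N) (Fin N) Z}

theorem legOn_neg (i : ι) (M : Matrix (Fin N) (Fin N) Z) : legOn i (-M) = -legOn i M := by
  ext a b
  simp only [legOn, Matrix.of_apply, Matrix.neg_apply]
  split_ifs <;> simp

theorem IsForm.legOn_comm (hG : IsForm G) {i j : ι} (hij : i ≠ j)
    (M : Matrix (Fin N) (Fin N) Z) : Commute (legOn i G) (legOn j M) :=
  TwistedYangian.legOn_comm hij G M fun a b _ _ => hG.central a b _

/-- Moving both matrices to the factor `j` gives `Gᵗ Q G` on one side and `G Q Gᵗ` on the other; for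
`Gᵗ = ±G` the sign is the same on both sides. -/
theorem IsForm.sandwich_qOn (hG : IsForm G) {i j : ι} (hij : i ≠ j) :
    legOn i G * qOn Z N i j * legOn j G = legOn j G * qOn Z N i j * legOn i G := by
  have h1 : legOn i G * qOn Z N i j * legOn j G =
      legOn j G.transpose * qOn Z N i j * legOn j G := by rw [legOn_qOn hij]
  have h2 : legOn j G * qOn Z N i j * legOn i G =
      legOn j G * qOn Z N i j * legOn j G.transpose := by
    rw [mul_assoc, mul_assoc, qOn_legOn hij]
  rw [h1, h2]
  rcases hG.symm with h | h
  · rw [h]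
  · rw [h, legOn_neg]; noncomm_ring

theorem IsForm.sandwich_RT (hG : IsForm G) {i j : ι} (hij : i ≠ j) (p : S × S) :
    legOn i G * RT N Z i j p * legOn j G = legOn j G * RT N Z i j p * legOn i G := by
  simp only [RT, mul_smul_comm, smul_mul_assoc, mul_sub, sub_mul, mul_one,
    hG.sandwich_qOn hij, (hG.legOn_comm hij G).eq]

/-- The reflection equation for a constant matrix. -/
theorem IsForm.reflection (hG : IsForm G) {i j : ι} (hij : i ≠ j) (p q : S × S) :
    RP N Z i j p * legOn i G * RT N Z i j q * legOn j G =
      legOn j G * RT N Z i j q * legOn i G * RP N Z i j p := by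
  -- Conjugation by the permutation exchanges the two copies of `G`, and the sandwich identity
  -- restores their order; so the product commutes with `P`, and with every `RP` on these factors.
  have h1 : permOn Z N (Equiv.swap i j) * (legOn i G * RT N Z i j q * legOn j G) =
      (legOn i G * RT N Z i j q * legOn j G) * permOn Z N (Equiv.swap i j) := by
    rw [← mul_assoc, ← mul_assoc, permOn_legOn, mul_assoc (legOn _ G), permOn_RT, mul_assoc,
      mul_assoc (RT _ _ _ _ _), permOn_legOn, Equiv.swap_apply_left, Equiv.swap_apply_right,
      RT_comm, hG.sandwich_RT hij, RT_comm]
    simp only [mul_assoc]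
  have h2 : RP N Z i j p * (legOn i G * RT N Z i j q * legOn j G) =
      (legOn i G * RT N Z i j q * legOn j G) * RP N Z i j p :=
    (commute_smul_one_sub (p := p) (x := legOn i G * RT N Z i j q * legOn j G) h1.symm).symm
  rw [← hG.sandwich_RT hij, ← h2]
  noncomm_ring

variable {α : Type*} (e : α → ι)

/-- `∏_i (G_i ∏_{j > i} R_{ij}ᵗ)`. -/
def gProd (G : Matrix (Fin N) (Fin N) Z) (r : α → α → S × S) : List α → TMat ι N Z
  | [] => 1
  | i :: l => legOn (e i) G * fwd (fun j => RT N Z (e i) (e j) (r i j)) l * gProd G r l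

/-- `∏_i (M_i ∏_{j > i} R_{ij}ᵗ)`. -/
def sProd (M : α → Matrix (Fin N) (Fin N) Z) (r : α → α → S × S) : List α → TMat ι N Z
  | [] => 1
  | i :: l => legOn (e i) (M i) * fwd (fun j => RT N Z (e i) (e j) (r i j)) l * sProd M r l

variable {e}

theorem commute_gProd {x : TMat ι N Z} {r : α → α → S × S} {l : List α} (hl : l.Nodup)
    (h1 : ∀ i ∈ l, Commute x (legOn (e i) G))
    (h2 : ∀ i ∈ l, ∀ j ∈ l, i ≠ j → Commute x (RT N Z (e i) (e j) (r i j))) :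
    Commute x (gProd e G r l) := by
  induction l with
  | nil => exact Commute.one_right x
  | cons i l ih =>
    obtain ⟨hi, hl⟩ := List.nodup_cons.1 hl
    refine ((h1 i (by simp)).mul_right (commute_fwd fun j hj => ?_)).mul_right ?_
    · exact h2 i (by simp) j (by simp [hj]) (by rintro rfl; exact hi hj)
    · exact ih hl (fun j hj => h1 j (by simp [hj]))
        fun j hj k hk => h2 j (by simp [hj]) k (by simp [hk])

/-- The fused reflection equation for constant matrices. -/
theorem IsForm.fused_reflection (hG : IsForm G) (he : Function.Injective e) {o : ι}
    {l : List α} (hl : l.Nodup) (ho : ∀ i, o ≠ e i) {p q : α → S × S} {r : α → α → S × S}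
    (h1 : ∀ i j, (p i).2 * (q j).2 = (r i j).2 * ((p i).2 + (q j).2))
    (h2 : ∀ i j, (p j).2 * (q i).2 = (r i j).2 * ((p j).2 + (q i).2)) :
    bwd (fun i => RP N Z o (e i) (p i)) l * legOn o G * fwd (fun i => RT N Z o (e i) (q i)) l *
        gProd e G r l =
      gProd e G r l * fwd (fun i => RT N Z o (e i) (q i)) l * legOn o G *
        bwd (fun i => RP N Z o (e i) (p i)) l := by
  induction l with
  | nil => simp [gProd]
  | cons i l ih =>
    obtain ⟨hi, hl⟩ := List.nodup_cons.1 hl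
    have hne : ∀ j ∈ l, e i ≠ e j := fun j hj h => hi (he h ▸ hj)
    simp only [gProd, bwd_cons, fwd_cons]
    set B := bwd (fun i => RP N Z o (e i) (p i)) l
    set F := fwd (fun i => RT N Z o (e i) (q i)) l with hF
    set K := fwd (fun j => RT N Z (e i) (e j) (r i j)) l with hK
    set g := gProd e G r l
    set R := RP N Z o (e i) (p i) with hR
    set Rt := RT N Z o (e i) (q i) with hRt
    set G0 := legOn o G
    set Gi := legOn (e i) G
    have c1 : Commute Gi F := commute_fwd fun j hj =>
      legOn_RT_commute (ho i).symm (hne j hj) (ho j) G (q j)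
    have c2 : Commute G0 K := commute_fwd fun j hj =>
      legOn_RT_commute (ho i) (ho j) (hne j hj) G (r i j)
    have c3 : Commute Gi B := commute_bwd fun j hj =>
      legOn_RP_commute (ho i).symm (hne j hj) G (p j)
    have c4 : Commute R g := commute_gProd hl
      (fun j hj => (legOn_RP_commute (ho j).symm (hne j hj).symm G (p i)).symm)
      fun j hj k hk hjk => RP_RT_commute (ho j) (ho k) (hne j hj) (hne k hk) _ _
    have c5 : Commute Rt g := commute_gProd hl
      (fun j hj => (legOn_RT_commute (ho j).symm (hne j hj).symm (ho i) G (q i)).symm)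
      fun j hj k hk hjk =>
        RT_RT_commute (ho i) (he.ne hjk) (ho j) (ho k) (hne j hj) (hne k hk) _ _
    -- For the first leg `i` of the list, `K` is carried across the auxiliary R-matrices by the
    -- Yang–Baxter equation, in `e1` on one side of `G₀` and in `e2` on the other; `e3` is the
    -- reflection equation of the legs `o` and `i`, and the remaining legs are left to the
    -- induction.
    have e1 : R * F * K = K * F * R := by
      refine exchange_fwd hl (fun j hj => ?_) (fun j hj k hk hjk => ?_) fun j hj k hk hjk => ?_
      · exact yang_baxter (ho i) (ho j) (hne j hj) (h1 i j)
      all_goals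
        exact (RT_RT_commute (ho k) (hne j hj) (ho i) (ho j) (hne k hk).symm (he.ne hjk).symm
          _ _).symm
    have e2 : B * Rt * K = K * Rt * B := by
      refine exchange_bwd hl (fun j hj => ?_) (fun j hj k hk hjk => ?_) fun j hj k hk hjk => ?_
      · have := yang_baxter (Z := Z) (N := N) (ho j) (ho i) (hne j hj).symm
          (p := p j) (q := q i) (r := r i j) (h2 i j)
        rwa [RT_comm (e j)] at this
      all_goals exact (RP_RT_commute (ho i) (ho j) (hne k hk).symm (fun h => hjk (he h.symm)) _ _).symm
    have e3 : R * G0 * Rt * Gi = Gi * Rt * G0 * R := hG.reflection (ho i) _ _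
    have ih' := ih hl
    calc B * R * G0 * (Rt * F) * (Gi * K * g)
        = B * R * G0 * Rt * (F * Gi) * K * g := by noncomm_ring
      _ = B * (R * G0 * Rt * Gi) * F * K * g := by rw [← c1.eq]; noncomm_ring
      _ = B * Gi * Rt * G0 * (R * F * K) * g := by rw [e3]; noncomm_ring
      _ = B * Gi * Rt * (G0 * K) * F * (R * g) := by rw [e1]; noncomm_ring
      _ = (B * Gi) * Rt * K * G0 * F * g * R := by rw [c2.eq, c4.eq]; noncomm_ring
      _ = Gi * (B * Rt * K) * G0 * F * g * R := by rw [← c3.eq]; noncomm_ring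
      _ = Gi * K * Rt * (B * G0 * F * g) * R := by rw [e2]; noncomm_ring
      _ = Gi * K * (Rt * g) * F * G0 * B * R := by rw [ih']; noncomm_ring
      _ = Gi * K * g * (Rt * F) * G0 * (B * R) := by rw [c5.eq]; noncomm_ring

/-- Factorization of the fused matrix `S_{[n]}`. -/
theorem sProd_eq (hG : IsForm G) (he : Function.Injective e) {T T' : α → Matrix (Fin N) (Fin N) Z}
    {r : α → α → S × S} {l : List α} (hl : l.Nodup)
    (h : ∀ i ∈ l, ∀ j ∈ l, i ≠ j →
      legOn (e i) (T' i) * RT N Z (e i) (e j) (r i j) * legOn (e j) (T j) =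
        legOn (e j) (T j) * RT N Z (e i) (e j) (r i j) * legOn (e i) (T' i)) :
    sProd e (fun i => T i * G * T' i) r l =
      fwd (fun i => legOn (e i) (T i)) l * gProd e G r l * fwd (fun i => legOn (e i) (T' i)) l := by
  induction l with
  | nil => simp [gProd, sProd]
  | cons i l ih =>
    obtain ⟨hi, hl⟩ := List.nodup_cons.1 hl
    have hne : ∀ j ∈ l, e i ≠ e j := fun j hj h => hi (he h ▸ hj)
    have ih' := ih hl fun j hj k hk => h j (by simp [hj]) k (by simp [hk])
    simp only [gProd, sProd, fwd_cons, ih', legOn_mul]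
    set K := fwd (fun j => RT N Z (e i) (e j) (r i j)) l
    set F := fwd (fun i => legOn (e i) (T i)) l
    set g := gProd e G r l
    set F' := fwd (fun i => legOn (e i) (T' i)) l
    set Ti := legOn (e i) (T i)
    set Gi := legOn (e i) G
    set Ti' := legOn (e i) (T' i)
    have c1 : Commute Gi F := commute_fwd fun j hj => hG.legOn_comm (hne j hj) _
    have c2 : Commute Ti' g := commute_gProd hl
      (fun j hj => (hG.legOn_comm (hne j hj).symm _).symm)
      fun j hj k hk hjk => legOn_RT_commute (hne j hj) (hne k hk) (fun h => hjk (he h)) _ _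
    have e1 : Ti' * K * F = F * K * Ti' := by
      refine exchange_fwd hl (fun j hj => ?_) (fun j hj k hk hjk => ?_) fun j hj k hk hjk => ?_
      · exact h i (by simp) j (by simp [hj]) (by rintro rfl; exact hi hj)
      all_goals exact legOn_RT_commute (hne j hj).symm (fun h => hjk (he h)) (hne k hk) _ _
    calc Ti * Gi * Ti' * K * (F * g * F') = Ti * Gi * (Ti' * K * F) * g * F' := by noncomm_ring
      _ = Ti * (Gi * F) * K * (Ti' * g) * F' := by rw [e1]; noncomm_ring
      _ = _ := by rw [c1.eq, c2.eq]; noncomm_ring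

/-! #### Intertwining relations -/

/-- The Yang–Baxter equation in which the R-matrix at the difference of the two parameters is
multiplied by its permutation and freed of its denominator. With `a.2 = h/w` and `b.2 = h/w'` the
hypothesis is `w' - w = d h`. The form remains valid for `d = ±1`, where the intertwiner is not
invertible. -/
theorem RP_intertwine {o p q : ι} (hop : o ≠ p) (hoq : o ≠ q) (hpq : p ≠ q) (d : ℤ) {a b : S × S}
    (h : a.2 - b.2 = d * (a.2 * b.2)) :
    (d • permOn Z N (Equiv.swap p q) + 1) * (RP N Z o q a * RP N Z o p b) =
      RP N Z o q b * RP N Z o p a * (d • permOn Z N (Equiv.swap p q) + 1) := by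
  set s := permOn Z N (Equiv.swap p q) with hs
  set A := permOn Z N (Equiv.swap o p) with hA
  set B := permOn Z N (Equiv.swap o q) with hB
  have hsA : s * A = B * s := by
    rw [hs, hA, hB, ← permOn_mul, ← permOn_mul, Equiv.mul_swap_eq_swap_mul (Equiv.swap p q),
      Equiv.swap_apply_left, Equiv.swap_apply_of_ne_of_ne hop hoq]
  have hsB : s * B = A * s := by
    rw [hs, hA, hB, ← permOn_mul, ← permOn_mul, Equiv.mul_swap_eq_swap_mul (Equiv.swap p q),
      Equiv.swap_apply_right, Equiv.swap_apply_of_ne_of_ne hop hoq]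
  have hAA : A * A = 1 := permOn_swap_sq o p
  have hBB : B * B = 1 := permOn_swap_sq o q
  have hAs : A * s = B * A := by
    rw [hs, hA, hB, ← permOn_mul, ← permOn_mul, Equiv.mul_swap_eq_swap_mul (Equiv.swap o p),
      Equiv.swap_apply_right, Equiv.swap_apply_of_ne_of_ne hoq.symm hpq.symm]
  have hBs : B * s = A * B := by
    rw [hs, hA, hB, ← permOn_mul, ← permOn_mul, Equiv.mul_swap_eq_swap_mul (Equiv.swap o q),
      Equiv.swap_apply_right, Equiv.swap_apply_of_ne_of_ne hop.symm hpq, Equiv.swap_comm p o]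
  have hsBA : s * (B * A) = B := by rw [← mul_assoc, hsB, mul_assoc, hsA, hBs, ← mul_assoc, hAA, one_mul]
  have hBAs : B * A * s = A := by rw [mul_assoc, hAs, ← mul_assoc, hBB, one_mul]
  rw [← Int.cast_smul_eq_zsmul S]
  simp only [RP, ← hA, ← hB, mul_smul_comm, smul_mul_assoc, mul_sub, sub_mul, mul_add, add_mul,
    mul_one, one_mul, hsBA, hBAs]
  simp only [hsA, hsB, hAs, hBs]
  linear_combination (norm := module) (a.1 * b.1 * h) • (A - B)

theorem RT_intertwine {o p q : ι} (hop : o ≠ p) (hoq : o ≠ q) (hpq : p ≠ q) (d : ℤ) {a b : S × S}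
    (h : a.2 - b.2 = d * (a.2 * b.2)) :
    (d • permOn Z N (Equiv.swap p q) + 1) * (RT N Z o p b * RT N Z o q a) =
      RT N Z o p a * RT N Z o q b * (d • permOn Z N (Equiv.swap p q) + 1) := by
  set s := permOn Z N (Equiv.swap p q) with hs
  set A := qOn Z N o p with hA
  set B := qOn Z N o q with hB
  have hsA : s * A = B * s := by
    rw [hs, hA, hB, permOn_qOn, Equiv.swap_apply_left, Equiv.swap_apply_of_ne_of_ne hop hoq]
  have hsB : s * B = A * s := by
    rw [hs, hA, hB, permOn_qOn, Equiv.swap_apply_right, Equiv.swap_apply_of_ne_of_ne hop hoq]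
  have hss : s * s = 1 := permOn_swap_sq p q
  have hBA : B * A = B * s := by
    rw [hs, hA, hB, qOn_comm o q, qOn_comm o p, Equiv.swap_comm p q]
    have := qOn_mul_qOn (N := N) (R := Z) hpq.symm hoq.symm hop.symm
    exact this
  have hAB : A * B = A * s := by
    have := qOn_mul_qOn (N := N) (R := Z) hpq hop.symm hoq.symm
    rw [hs, hA, hB, qOn_comm o q, qOn_comm o p]
    exact this
  have hAss : A * s * s = A := by rw [mul_assoc, hss, mul_one]
  have hsAs : s * (A * s) = B := by rw [← mul_assoc, hsA, mul_assoc, hss, mul_one]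
  rw [← Int.cast_smul_eq_zsmul S]
  simp only [RT, ← hA, ← hB, mul_smul_comm, smul_mul_assoc, mul_sub, sub_mul, mul_add, add_mul,
    mul_one, one_mul, hAB, hAss, hsAs]
  simp only [hsA, hsB]
  linear_combination (norm := module) (a.1 * b.1 * h) • (A - B)

end Fused

/-! ### Intertwining of ordered products that differ in two adjacent places. -/

section IntertwineLists

variable {α A : Type*} [Ring A]

theorem intertwine_fwd {M : A} {f f' : α → A} {i j : α} {l1 l2 : List α}
    (h1 : ∀ k ∈ l1, f' k = f k ∧ Commute M (f k)) (h2 : ∀ k ∈ l2, f' k = f k ∧ Commute M (f k))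
    (h : M * (f' i * f' j) = f i * f j * M) :
    M * fwd f' (l1 ++ i :: j :: l2) = fwd f (l1 ++ i :: j :: l2) * M := by
  have e1 : fwd f' l1 = fwd f l1 := by
    rw [fwd, fwd, List.map_congr_left fun k hk => (h1 k hk).1]
  have e2 : fwd f' l2 = fwd f l2 := by
    rw [fwd, fwd, List.map_congr_left fun k hk => (h2 k hk).1]
  simp only [fwd_append, fwd_cons, e1, e2]
  have := sandwich (commute_fwd fun k hk => (h1 k hk).2) (commute_fwd fun k hk => (h2 k hk).2) h
  simpa only [mul_assoc] using this

theorem intertwine_bwd {M : A} {f f' : α → A} {i j : α} {l1 l2 : List α}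
    (h1 : ∀ k ∈ l1, f' k = f k ∧ Commute M (f k)) (h2 : ∀ k ∈ l2, f' k = f k ∧ Commute M (f k))
    (h : M * (f' j * f' i) = f j * f i * M) :
    M * bwd f' (l1 ++ i :: j :: l2) = bwd f (l1 ++ i :: j :: l2) * M := by
  have e1 : bwd f' l1 = bwd f l1 := by
    rw [bwd, bwd, List.map_congr_left fun k hk => (h1 k (List.mem_reverse.1 hk)).1]
  have e2 : bwd f' l2 = bwd f l2 := by
    rw [bwd, bwd, List.map_congr_left fun k hk => (h2 k (List.mem_reverse.1 hk)).1]
  simp only [bwd_append, bwd_cons, e1, e2]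
  have := sandwich (commute_bwd fun k hk => (h2 k hk).2) (commute_bwd fun k hk => (h1 k hk).2) h
  simpa only [mul_assoc] using this

theorem intertwine_fwd_pointwise {M : A} {f f' : α → A} {l : List α}
    (h : ∀ k ∈ l, M * f' k = f k * M) : M * fwd f' l = fwd f l * M := by
  induction l with
  | nil => simp
  | cons k l ih =>
    rw [fwd_cons, fwd_cons, ← mul_assoc, h k (by simp), mul_assoc,
      ih fun m hm => h m (by simp [hm]), mul_assoc]

theorem finRange_split {n : ℕ} {i j : Fin n} (hj : (j : ℕ) = i + 1) :
    ∃ l1 l2, List.finRange n = l1 ++ i :: j :: l2 := by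
  refine ⟨(List.finRange n).take i, (List.finRange n).drop (j + 1), ?_⟩
  have h1 : (i : ℕ) < (List.finRange n).length := by simp
  have h2 : (j : ℕ) < (List.finRange n).length := by simp
  conv_lhs => rw [← List.take_append_drop (i : ℕ) (List.finRange n)]
  rw [List.drop_eq_getElem_cons h1, ← hj, List.drop_eq_getElem_cons h2]
  simp

end IntertwineLists

/-! ### The families of R-matrices, T-matrices and constant matrices intertwine. -/

section IntertwineFamilies

variable {n N : ℕ} {S Z : Type*} [CommRing S] [Ring Z] [Algebra S Z]

theorem commute_zsmul_add_one {A : Type*} [Ring A] {s x : A} (h : Commute s x) (d : ℤ) :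
    Commute (d • s + 1) x :=
  (h.smul_left d).add_left (Commute.one_left x)

theorem mem_split_ne {α : Type*} {l1 l2 : List α} {i j : α} (h : (l1 ++ i :: j :: l2).Nodup) :
    i ≠ j ∧ (∀ k ∈ l1, k ≠ i ∧ k ≠ j) ∧ (∀ k ∈ l2, k ≠ i ∧ k ≠ j) := by
  rw [List.nodup_append] at h
  obtain ⟨-, h2, h3⟩ := h
  rw [List.nodup_cons, List.nodup_cons] at h2
  refine ⟨fun h => h2.1 (by simp [h]), fun k hk => ⟨h3 k hk i (by simp), h3 k hk j (by simp)⟩,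
    fun k hk => ⟨?_, ?_⟩⟩
  · rintro rfl; exact h2.1 (by simp [hk])
  · rintro rfl; exact h2.2.1 hk

theorem intertwines_fwd {A : Type*} [Ring A] {ρ : Equiv.Perm (Fin n) →* A} {f : Fin n → ℤ → A}
    (hcomm : ∀ i j k : Fin n, (j : ℕ) = i + 1 → k ≠ i → k ≠ j → ∀ x,
      Commute (ρ (Equiv.swap i j)) (f k x))
    (hloc : ∀ i j : Fin n, (j : ℕ) = i + 1 → ∀ x y, x ≠ y →
      ((x - y) • ρ (Equiv.swap i j) + 1) * (f i y * f j x) =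
        f i x * f j y * ((x - y) • ρ (Equiv.swap i j) + 1)) :
    Intertwines ρ fun c => fwd (fun k => f k (c k)) (List.finRange n) := by
  intro i j hj c hc
  obtain ⟨l1, l2, hl⟩ := finRange_split hj
  obtain ⟨hij, h1, h2⟩ := mem_split_ne (hl ▸ List.nodup_finRange n)
  simp only [hl]
  refine intertwine_fwd (fun k hk => ?_) (fun k hk => ?_) ?_
  · obtain ⟨hki, hkj⟩ := h1 k hk
    rw [Function.comp_apply, Equiv.swap_apply_of_ne_of_ne hki hkj]
    exact ⟨rfl, commute_zsmul_add_one (hcomm i j k hj hki hkj _) _⟩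
  · obtain ⟨hki, hkj⟩ := h2 k hk
    rw [Function.comp_apply, Equiv.swap_apply_of_ne_of_ne hki hkj]
    exact ⟨rfl, commute_zsmul_add_one (hcomm i j k hj hki hkj _) _⟩
  · rw [Function.comp_apply, Function.comp_apply, Equiv.swap_apply_left, Equiv.swap_apply_right]
    exact hloc i j hj _ _ hc

theorem intertwines_bwd {A : Type*} [Ring A] {ρ : Equiv.Perm (Fin n) →* A} {f : Fin n → ℤ → A}
    (hcomm : ∀ i j k : Fin n, (j : ℕ) = i + 1 → k ≠ i → k ≠ j → ∀ x,
      Commute (ρ (Equiv.swap i j)) (f k x))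
    (hloc : ∀ i j : Fin n, (j : ℕ) = i + 1 → ∀ x y, x ≠ y →
      ((x - y) • ρ (Equiv.swap i j) + 1) * (f j x * f i y) =
        f j y * f i x * ((x - y) • ρ (Equiv.swap i j) + 1)) :
    Intertwines ρ fun c => bwd (fun k => f k (c k)) (List.finRange n) := by
  intro i j hj c hc
  obtain ⟨l1, l2, hl⟩ := finRange_split hj
  obtain ⟨hij, h1, h2⟩ := mem_split_ne (hl ▸ List.nodup_finRange n)
  simp only [hl]
  refine intertwine_bwd (fun k hk => ?_) (fun k hk => ?_) ?_
  · obtain ⟨hki, hkj⟩ := h1 k hk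
    rw [Function.comp_apply, Equiv.swap_apply_of_ne_of_ne hki hkj]
    exact ⟨rfl, commute_zsmul_add_one (hcomm i j k hj hki hkj _) _⟩
  · obtain ⟨hki, hkj⟩ := h2 k hk
    rw [Function.comp_apply, Equiv.swap_apply_of_ne_of_ne hki hkj]
    exact ⟨rfl, commute_zsmul_add_one (hcomm i j k hj hki hkj _) _⟩
  · rw [Function.comp_apply, Function.comp_apply, Equiv.swap_apply_left, Equiv.swap_apply_right]
    exact hloc i j hj _ _ hc

/-- The property of the pairs `(g(w / h), h / w)` at `w = w₀ - h x` for integers `x`. -/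
def IsSpectral (f : ℤ → S × S) : Prop :=
  ∀ x y, (f x).2 - (f y).2 = ((x - y : ℤ) : S) * ((f x).2 * (f y).2)

theorem intertwines_RP {f : ℤ → S × S} (hf : IsSpectral f) :
    Intertwines (permRep Z n N)
      fun c => bwd (fun k => RP N Z none (some k) (f (c k))) (List.finRange n) := by
  refine intertwines_bwd (f := fun k x => RP N Z none (some k) (f x)) ?_ ?_
  · intro i j k hj hki hkj x
    rw [permRep_swap, Commute, SemiconjBy, permOn_RP, Equiv.swap_apply_of_ne_of_ne (by simp)
      (by simp), Equiv.swap_apply_of_ne_of_ne (by simpa using hki) (by simpa using hkj)]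
  · intro i j hj x y hxy
    have hij : i ≠ j := by rintro rfl; omega
    rw [permRep_swap]
    exact RP_intertwine (by simp) (by simp) (by simpa using hij) _ (hf x y)

theorem intertwines_RT {f : ℤ → S × S} (hf : IsSpectral f) :
    Intertwines (permRep Z n N)
      fun c => fwd (fun k => RT N Z none (some k) (f (c k))) (List.finRange n) := by
  refine intertwines_fwd (f := fun k x => RT N Z none (some k) (f x)) ?_ ?_
  · intro i j k hj hki hkj x
    rw [permRep_swap, Commute, SemiconjBy, permOn_RT, Equiv.swap_apply_of_ne_of_ne (by simp)
      (by simp), Equiv.swap_apply_of_ne_of_ne (by simpa using hki) (by simpa using hkj)]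
  · intro i j hj x y hxy
    have hij : i ≠ j := by rintro rfl; omega
    rw [permRep_swap]
    exact RT_intertwine (by simp) (by simp) (by simpa using hij) _ (hf x y)

/-- The hypothesis is the RTT relation at two points whose difference is an integral multiple of
`h`, divided by `h`. -/
theorem intertwines_leg {T : ℤ → Matrix (Fin N) (Fin N) Z}
    (h : ∀ i j : Option (Fin n), i ≠ j → ∀ x y, x ≠ y →
      ((x - y) • 1 - permOn Z N (Equiv.swap i j)) * legOn i (T x) * legOn j (T y) =
        legOn j (T y) * legOn i (T x) * ((x - y) • 1 - permOn Z N (Equiv.swap i j))) :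
    Intertwines (permRep Z n N)
      fun c => fwd (fun k => legOn (some k) (T (c k))) (List.finRange n) := by
  refine intertwines_fwd (f := fun k x => legOn (some k) (T x)) ?_ ?_
  · intro i j k hj hki hkj x
    rw [permRep_swap, Commute, SemiconjBy, permOn_legOn,
      Equiv.swap_apply_of_ne_of_ne (by simpa using hki) (by simpa using hkj)]
  · intro i j hj x y hxy
    have hij : (some i : Option (Fin n)) ≠ some j := by
      intro h; have := Option.some.inj h; subst this; omega
    rw [permRep_swap]
    -- With `x` and `y` exchanged and multiplied by `s` from the left, the relation becomes the
    -- intertwining relation up to an overall sign.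
    have h1 := h _ _ hij y x hxy.symm
    have h2 := congrArg (fun M => permOn Z N (Equiv.swap (some i) (some j)) * M) h1
    set s := permOn Z N (Equiv.swap (some i : Option (Fin n)) (some j)) with hs
    have hss : s * s = 1 := permOn_swap_sq _ _
    have hsT : s * (legOn (some j) (T x) * legOn (some i) (T y)) =
        legOn (some i) (T x) * legOn (some j) (T y) * s := by
      rw [← mul_assoc, hs, permOn_legOn, mul_assoc, permOn_legOn, Equiv.swap_apply_left,
        Equiv.swap_apply_right, mul_assoc]
    set X := legOn (some i : Option (Fin n)) (T y) * legOn (some j) (T x)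
    have e1 : s * (((y - x) • 1 - s) * legOn (some i) (T y) * legOn (some j) (T x)) =
        -(((x - y) • s + 1) * X) := by
      have : s * (((y - x) • 1 - s) * legOn (some i) (T y) * legOn (some j) (T x)) =
          (y - x) • (s * X) - s * s * X := by
        simp only [X, sub_mul, mul_sub, smul_mul_assoc, mul_smul_comm, one_mul, mul_assoc]
      rw [this, hss, add_mul, smul_mul_assoc]
      module
    have e2 : s * (legOn (some j) (T x) * legOn (some i) (T y) * ((y - x) • 1 - s)) =
        -(legOn (some i) (T x) * legOn (some j) (T y) * ((x - y) • s + 1)) := by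
      rw [← mul_assoc, hsT, mul_assoc _ s, mul_sub, hss, mul_smul_comm, mul_one, mul_sub,
        mul_add, mul_smul_comm, mul_smul_comm]
      module
    rw [e1, e2, neg_inj] at h2
    exact h2

theorem gProd_congr {ι α : Type*} [Fintype ι] [DecidableEq ι] {e : α → ι}
    {G : Matrix (Fin N) (Fin N) Z} {r r' : α → α → S × S} {l : List α}
    (h : ∀ i ∈ l, ∀ j ∈ l, r i j = r' i j) : gProd e G r l = gProd e G r' l := by
  induction l with
  | nil => rfl
  | cons i l ih =>
    rw [gProd, gProd, ih fun j hj k hk => h j (by simp [hj]) k (by simp [hk]), fwd, fwd,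
      List.map_congr_left fun j hj => by rw [h i (by simp) j (by simp [hj])]]

/-- A factor before the pair `i`, `j` meets it through `R_{ki} R_{kj}`, which `RT_intertwine`
handles; the same works behind the pair after regrouping. The block `G_i R_{ij} G_j` depends on `c i
+ c j` only and commutes with the permutation because `G` is symmetric or skew-symmetric. -/
theorem gProd_intertwine {ι α : Type*} [Fintype ι] [DecidableEq ι] {e : α → ι}
    (he : Function.Injective e) {G : Matrix (Fin N) (Fin N) Z} (hG : IsForm G)
    {f : ℤ → S × S} (hf : IsSpectral f) {i j : α} {c c' : α → ℤ} (hi : c' i = c j)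
    (hj : c' j = c i) (hc : ∀ k, k ≠ i → k ≠ j → c' k = c k) (l1 l2 : List α)
    (hl : (l1 ++ i :: j :: l2).Nodup) :
    ((c i - c j) • permOn Z N (Equiv.swap (e i) (e j)) + 1) *
        gProd e G (fun k m => f (c' k + c' m)) (l1 ++ i :: j :: l2) =
      gProd e G (fun k m => f (c k + c m)) (l1 ++ i :: j :: l2) *
        ((c i - c j) • permOn Z N (Equiv.swap (e i) (e j)) + 1) := by
  set s := permOn Z N (Equiv.swap (e i) (e j)) with hs
  have hsf : ∀ k, k ≠ i → k ≠ j → (Equiv.swap (e i) (e j)) (e k) = e k := fun k hk hk' =>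
    Equiv.swap_apply_of_ne_of_ne (he.ne hk) (he.ne hk')
  obtain ⟨hij, hl1, hl2⟩ := mem_split_ne hl
  have hij' : e i ≠ e j := he.ne hij
  have hsG : ∀ k, k ≠ i → k ≠ j → Commute s (legOn (e k) G) := by
    intro k hk hk'
    rw [Commute, SemiconjBy, hs, permOn_legOn, hsf k hk hk']
  have hsR : ∀ k m, k ≠ i → k ≠ j → m ≠ i → m ≠ j → ∀ p : S × S,
      Commute s (RT N Z (e k) (e m) p) := by
    intro k m hk hk' hm hm' p
    rw [Commute, SemiconjBy, hs, permOn_RT, hsf k hk hk', hsf m hm hm']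
  have hloc : ∀ k, k ≠ i → k ≠ j →
      ((c i - c j) • s + 1) * (RT N Z (e k) (e i) (f (c' k + c' i)) *
        RT N Z (e k) (e j) (f (c' k + c' j))) =
      RT N Z (e k) (e i) (f (c k + c i)) * RT N Z (e k) (e j) (f (c k + c j)) *
        ((c i - c j) • s + 1) := by
    intro k hk hk'
    rw [hi, hj, hc k hk hk']
    refine RT_intertwine (he.ne hk) (he.ne hk') hij' _ ?_
    rw [hf]; congr 2; ring
  induction l1 with
  | nil =>
    rw [List.nil_append] at hl ⊢
    obtain ⟨hi0, hl'⟩ := List.nodup_cons.1 hl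
    obtain ⟨hj0, hl''⟩ := List.nodup_cons.1 hl'
    -- With the pair in front, `G_j` is moved next to `R_{ij}`, and the two rows of R-matrices merge
    -- into one product over the later legs.
    have hform : ∀ d : α → ℤ, gProd e G (fun k m => f (d k + d m)) (i :: j :: l2) =
        (legOn (e i) G * RT N Z (e i) (e j) (f (d i + d j)) * legOn (e j) G) *
        fwd (fun k => RT N Z (e k) (e i) (f (d k + d i)) * RT N Z (e k) (e j) (f (d k + d j))) l2 *
        gProd e G (fun k m => f (d k + d m)) l2 := by
      intro d
      have c1 : Commute (legOn (e j) G) (fwd (fun m => RT N Z (e i) (e m) (f (d i + d m))) l2) :=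
        commute_fwd fun m hm => legOn_RT_commute hij'.symm (he.ne (hl2 m hm).2.symm)
          (he.ne (hl2 m hm).1.symm) _ _
      have c2 : fwd (fun m => RT N Z (e i) (e m) (f (d i + d m))) l2 *
          fwd (fun m => RT N Z (e j) (e m) (f (d j + d m))) l2 =
          fwd (fun k => RT N Z (e k) (e i) (f (d k + d i)) *
            RT N Z (e k) (e j) (f (d k + d j))) l2 := by
        rw [fwd_mul_fwd hl'']
        · congr 1
          ext1 k
          rw [RT_comm, RT_comm (e j), add_comm, add_comm (d j)]
        · intro k hk m hm hkm
          exact RT_RT_commute (he.ne (hl2 k hk).1.symm) (he.ne (hl2 m hm).2.symm) hij'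
            (he.ne (hl2 m hm).1.symm) (he.ne (hl2 k hk).2) (he.ne hkm) _ _
      rw [← c2, gProd, gProd, fwd_cons]
      calc _ = legOn (e i) G * RT N Z (e i) (e j) (f (d i + d j)) *
            (fwd (fun m => RT N Z (e i) (e m) (f (d i + d m))) l2 * legOn (e j) G) *
            fwd (fun m => RT N Z (e j) (e m) (f (d j + d m))) l2 *
            gProd e G (fun k m => f (d k + d m)) l2 := by noncomm_ring
        _ = _ := by rw [← c1.eq]; noncomm_ring
    rw [hform, hform]
    have hg : gProd e G (fun k m => f (c' k + c' m)) l2 =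
        gProd e G (fun k m => f (c k + c m)) l2 :=
      gProd_congr fun k hk m hm => by
        rw [hc k (hl2 k hk).1 (hl2 k hk).2, hc m (hl2 m hm).1 (hl2 m hm).2]
    rw [hg, hi, hj, add_comm (c j) (c i)]
    have k1 : Commute s (legOn (e i) G * RT N Z (e i) (e j) (f (c i + c j)) * legOn (e j) G) := by
      rw [Commute, SemiconjBy, hs, ← mul_assoc, ← mul_assoc, permOn_legOn, mul_assoc (legOn _ G),
        permOn_RT, mul_assoc, mul_assoc (RT _ _ _ _ _), permOn_legOn, Equiv.swap_apply_left,
        Equiv.swap_apply_right, hG.sandwich_RT hij', RT_comm]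
      simp only [mul_assoc]
    have k2 := commute_zsmul_add_one k1 (c i - c j)
    have k3 : Commute ((c i - c j) • s + 1) (gProd e G (fun k m => f (c k + c m)) l2) :=
      commute_zsmul_add_one (commute_gProd hl'' (fun k hk => hsG k (hl2 k hk).1 (hl2 k hk).2)
        fun k hk m hm _ => hsR k m (hl2 k hk).1 (hl2 k hk).2 (hl2 m hm).1 (hl2 m hm).2 _) _
    exact sandwich k2 k3
      (intertwine_fwd_pointwise fun k hk => by
        have := hloc k (hl2 k hk).1 (hl2 k hk).2
        rwa [hi, hj] at this)
  | cons k l1 ih =>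
    rw [List.cons_append] at hl ⊢
    obtain ⟨hk0, hl'⟩ := List.nodup_cons.1 hl
    obtain ⟨-, hl1', -⟩ := mem_split_ne hl'
    have hk := hl1 k (by simp)
    have ih' := ih hl' hl1'
    rw [gProd, gProd]
    have k1 : ((c i - c j) • s + 1) *
        fwd (fun m => RT N Z (e k) (e m) (f (c' k + c' m))) (l1 ++ i :: j :: l2) =
        fwd (fun m => RT N Z (e k) (e m) (f (c k + c m))) (l1 ++ i :: j :: l2) *
        ((c i - c j) • s + 1) := by
      refine intertwine_fwd (fun m hm => ?_) (fun m hm => ?_) (hloc k hk.1 hk.2)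
      · rw [hc k hk.1 hk.2, hc m (hl1' m hm).1 (hl1' m hm).2]
        exact ⟨rfl, commute_zsmul_add_one
          (hsR k m hk.1 hk.2 (hl1' m hm).1 (hl1' m hm).2 _) _⟩
      · rw [hc k hk.1 hk.2, hc m (hl2 m hm).1 (hl2 m hm).2]
        exact ⟨rfl, commute_zsmul_add_one
          (hsR k m hk.1 hk.2 (hl2 m hm).1 (hl2 m hm).2 _) _⟩
    rw [mul_assoc, ← mul_assoc, (commute_zsmul_add_one (hsG k hk.1 hk.2) _).eq, mul_assoc,
      ← mul_assoc _ _ (gProd e G _ _), k1, mul_assoc, ih']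
    simp only [mul_assoc]

theorem intertwines_gProd {G : Matrix (Fin N) (Fin N) Z} (hG : IsForm G)
    {f : ℤ → S × S} (hf : IsSpectral f) :
    Intertwines (permRep Z n N)
      fun c => gProd some G (fun i j => f (c i + c j)) (List.finRange n) := by
  intro i j hj c _
  obtain ⟨l1, l2, hl⟩ := finRange_split hj
  have hnd := hl ▸ List.nodup_finRange n
  rw [hl, permRep_swap]
  exact gProd_intertwine (Option.some_injective _) hG hf (by simp) (by simp)
    (fun k hk hk' => by rw [Function.comp_apply, Equiv.swap_apply_of_ne_of_ne hk hk']) l1 l2 hnd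

end IntertwineFamilies

/-! ### Matrices with central entries -/

section Scalar

variable {ι κ : Type*} [Fintype ι] [DecidableEq ι] [Fintype κ] [DecidableEq κ] {N : ℕ}
  {S Z : Type*} [CommRing S] [Ring Z] [Algebra S Z]

/-- All entries are central. -/
def IsScalar {m : Type*} (M : Matrix m m Z) : Prop := ∀ a b z, Commute (M a b) z

section General

variable {m : Type*} [Fintype m] [DecidableEq m] {M M' : Matrix m m Z}

theorem IsScalar.one : IsScalar (1 : Matrix m m Z) := fun a b z => by
  rw [Matrix.one_apply]; split_ifs <;> simp

theorem IsScalar.mul (h : IsScalar M) (h' : IsScalar M') : IsScalar (M * M') := fun a b z => by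
  rw [Matrix.mul_apply]
  exact Commute.sum_left _ _ _ fun c _ => (h a c z).mul_left (h' c b z)

theorem IsScalar.sub (h : IsScalar M) (h' : IsScalar M') : IsScalar (M - M') := fun a b z =>
  (h a b z).sub_left (h' a b z)

theorem IsScalar.smul (s : S) (h : IsScalar M) : IsScalar (s • M) := fun a b z =>
  (h a b z).smul_left s

theorem IsScalar.map_algebraMap (M : Matrix m m S) : IsScalar (M.map (algebraMap S Z)) :=
  fun _ _ z => Algebra.commutes _ z

variable {α : Type*} {f : α → Matrix m m Z}

theorem IsScalar.fwd {l : List α} (h : ∀ i ∈ l, IsScalar (f i)) :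
    IsScalar (fwd f l) := by
  induction l with
  | nil => exact IsScalar.one
  | cons i l ih =>
    rw [fwd_cons]
    exact (h i (by simp)).mul (ih fun j hj => h j (by simp [hj]))

theorem IsScalar.bwd {l : List α} (h : ∀ i ∈ l, IsScalar (f i)) :
    IsScalar (bwd f l) := by
  induction l with
  | nil => exact IsScalar.one
  | cons i l ih =>
    rw [bwd_cons]
    exact (ih fun j hj => h j (by simp [hj])).mul (h i (by simp))

end General

theorem IsScalar.legOn {M : Matrix (Fin N) (Fin N) Z} (h : IsScalar M) (i : ι) :
    IsScalar (legOn i M) := fun a b z => by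
  simp only [TwistedYangian.legOn, Matrix.of_apply]
  split_ifs
  · exact h _ _ z
  · exact Commute.zero_left z

theorem isScalar_permOn (σ : Equiv.Perm ι) : IsScalar (permOn Z N σ) := fun a b z => by
  simp only [permOn, Matrix.of_apply]
  split_ifs <;> simp

theorem isScalar_qOn (i j : ι) : IsScalar (qOn Z N i j) := fun a b z => by
  simp only [qOn, Matrix.of_apply]
  split_ifs <;> simp

theorem isScalar_RP (i j : ι) (p : S × S) : IsScalar (RP N Z i j p) :=
  (IsScalar.one.sub ((isScalar_permOn _).smul _)).smul _

theorem isScalar_RT (i j : ι) (p : S × S) : IsScalar (RT N Z i j p) :=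
  (IsScalar.one.sub ((isScalar_qOn i j).smul _)).smul _

theorem IsScalar.ptOn {M : TMat ι N Z} (h : IsScalar M) (i : ι) : IsScalar (ptOn i M) :=
  fun _ _ z => h _ _ z

theorem isScalar_single (x y : Fin N) : IsScalar (Matrix.single x y (1 : Z)) := fun a b z => by
  rw [Matrix.single_apply]; split_ifs <;> simp

/-! ### Transposition of exchange relations -/

section Transposition

variable {i j : ι} {X Y : Matrix (Fin N) (Fin N) Z} {a b a' b' : TMat ι N Z}

theorem ptOn_scalar_mul_legOn (ha : IsScalar a) (i : ι) (X : Matrix (Fin N) (Fin N) Z) :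
    ptOn i (a * legOn i X) = legOn i X.transpose * ptOn i a :=
  ptOn_mul_legOn i a X fun _ _ _ _ => ha _ _ _

theorem ptOn_legOn_mul_scalar (ha : IsScalar a) (i : ι) (X : Matrix (Fin N) (Fin N) Z) :
    ptOn i (legOn i X * a) = ptOn i a * legOn i X.transpose :=
  ptOn_legOn_mul i a X fun _ _ _ _ => ha _ _ _

/-- Apply partial transposition in `i`: on each side the leg `i` is adjacent to a scalar matrix, up
to a leg in another factor, so reversing the order is permitted. -/
theorem exchange_transpose_fst (hij : i ≠ j) (ha : IsScalar a) (hb : IsScalar b)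
    (h : a * legOn i X * legOn j Y = legOn j Y * legOn i X * b) :
    legOn i X.transpose * ptOn i a * legOn j Y = legOn j Y * ptOn i b * legOn i X.transpose := by
  have := congrArg (ptOn i) h
  rwa [ptOn_mul_legOn_of_ne hij, ptOn_scalar_mul_legOn ha, mul_assoc (legOn j Y),
    ptOn_legOn_mul_of_ne hij, ptOn_legOn_mul_scalar hb, ← mul_assoc] at this

/-- In the given form the leg `j` is separated from the R-matrix by the leg `i`, whose entries need
not commute with it. The R-matrices are first moved to the opposite sides, and this is why their
inverses appear in the result. -/
theorem exchange_transpose_snd (hij : i ≠ j) (ha : IsScalar a') (hb : IsScalar b')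
    (haa : a' * a = 1) (hbb : b * b' = 1)
    (h : a * legOn i X * legOn j Y = legOn j Y * legOn i X * b) :
    legOn i X * ptOn j b' * legOn j Y.transpose = legOn j Y.transpose * ptOn j a' * legOn i X := by
  have h1 : legOn i X * (legOn j Y * b') = a' * legOn j Y * legOn i X := by
    calc legOn i X * (legOn j Y * b') = a' * (a * legOn i X * legOn j Y) * b' := by
          rw [mul_assoc a, ← mul_assoc a', haa, one_mul, mul_assoc]
      _ = a' * legOn j Y * legOn i X := by
          rw [h, mul_assoc, mul_assoc, hbb, mul_one, mul_assoc]
  have := congrArg (ptOn j) h1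
  rwa [ptOn_legOn_mul_of_ne hij.symm, ptOn_legOn_mul_scalar hb, ptOn_mul_legOn_of_ne hij.symm,
    ptOn_scalar_mul_legOn ha, ← mul_assoc] at this

theorem exchange_transpose_both (hij : i ≠ j) (ha : IsScalar a) (hb : IsScalar b)
    (hpa : ptOn j (ptOn i a) = a) (hpb : ptOn j (ptOn i b) = b)
    (h : a * legOn i X * legOn j Y = legOn j Y * legOn i X * b) :
    legOn i X.transpose * legOn j Y.transpose * a =
      b * legOn j Y.transpose * legOn i X.transpose := by
  have := congrArg (ptOn j) (exchange_transpose_fst hij ha hb h)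
  rwa [mul_assoc, ptOn_legOn_mul_of_ne hij.symm, ptOn_scalar_mul_legOn (ha.ptOn i), hpa,
    ptOn_mul_legOn_of_ne hij.symm, ptOn_legOn_mul_scalar (hb.ptOn i), hpb, ← mul_assoc] at this

theorem ptOn_sum {α : Type*} (i : ι) (f : α → TMat ι N Z) (s : Finset α) :
    ptOn i (∑ x ∈ s, f x) = ∑ x ∈ s, ptOn i (f x) := by
  ext a b
  simp [ptOn, Matrix.sum_apply]

theorem ptOn_permOn_mul (hij : i ≠ j) (hb : IsScalar b)
    (h : ∀ x y, Commute (legOn j (Matrix.single x y (1 : Z))) b) :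
    ptOn i (permOn Z N (Equiv.swap i j) * b) = ptOn i b * qOn Z N i j := by
  rw [permOn_eq_sum hij, qOn_eq_sum hij, Finset.sum_comm]
  simp only [Finset.sum_mul, Finset.mul_sum, ptOn_sum]
  refine Finset.sum_congr rfl fun x _ => Finset.sum_congr rfl fun y _ => ?_
  rw [mul_assoc, (h x y).eq, ptOn_legOn_mul_scalar (hb.mul ((isScalar_single _ _).legOn _)),
    ptOn_mul_legOn_of_ne hij, Matrix.transpose_single, mul_assoc,
    TwistedYangian.legOn_comm hij (Matrix.single x y 1) (Matrix.single x y 1)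
      fun a c _ _ => isScalar_single x y a c _]

theorem ptOn_RP_mul (hij : i ≠ j) (hb : IsScalar b)
    (h : ∀ x y, Commute (legOn j (Matrix.single x y (1 : Z))) b) (p : S × S) :
    ptOn i (RP N Z i j p * b) = ptOn i b * RT N Z i j p := by
  simp only [RP, RT, smul_mul_assoc, mul_smul_comm, sub_mul, mul_sub, one_mul, mul_one, ptOn_smul,
    ptOn_sub, ptOn_permOn_mul hij hb h]

theorem ptOn_mul_permOn (hij : i ≠ j)
    (h : ∀ x y, Commute (legOn j (Matrix.single x y (1 : Z))) b) :
    ptOn i (b * permOn Z N (Equiv.swap i j)) = qOn Z N i j * ptOn i b := by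
  rw [permOn_eq_sum hij, qOn_eq_sum hij, Finset.sum_comm]
  simp only [Finset.sum_mul, Finset.mul_sum, ptOn_sum]
  refine Finset.sum_congr rfl fun x _ => Finset.sum_congr rfl fun y _ => ?_
  rw [TwistedYangian.legOn_comm hij (Matrix.single y x 1) (Matrix.single x y 1)
      fun a c _ _ => isScalar_single y x a c _,
    ← mul_assoc, ← (h x y).eq, mul_assoc, ptOn_legOn_mul_of_ne hij,
    ptOn_mul_legOn i _ _ fun _ _ c d => (isScalar_single _ _ c d _).symm,
    Matrix.transpose_single, ← mul_assoc,
    TwistedYangian.legOn_comm hij (Matrix.single x y 1) (Matrix.single x y 1)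
      fun a c _ _ => isScalar_single x y a c _]

theorem ptOn_mul_RP (hij : i ≠ j)
    (h : ∀ x y, Commute (legOn j (Matrix.single x y (1 : Z))) b) (p : S × S) :
    ptOn i (b * RP N Z i j p) = RT N Z i j p * ptOn i b := by
  simp only [RP, RT, smul_mul_assoc, mul_smul_comm, sub_mul, mul_sub, one_mul, mul_one, ptOn_smul,
    ptOn_sub, ptOn_mul_permOn hij h]

variable {α : Type*} {e : α → ι}

/-- All factors share only the leg `o`, so transposition there acts as an antihomomorphism and
reverses the product. This is the mechanism that interchanges unitarity and crossing for the ordered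
products. -/
theorem ptOn_fwd_RP {o : ι} (ho : ∀ i, o ≠ e i) (he : Function.Injective e) (p : α → S × S)
    {l : List α} (hl : l.Nodup) :
    ptOn o (fwd (fun i => RP N Z o (e i) (p i)) l) = bwd (fun i => RT N Z o (e i) (p i)) l := by
  induction l with
  | nil => simp [ptOn_one]
  | cons i l ih =>
    obtain ⟨hi, hl⟩ := List.nodup_cons.1 hl
    rw [fwd_cons, bwd_cons, ptOn_RP_mul (ho i) (IsScalar.fwd fun j _ => isScalar_RP _ _ _), ih hl]
    exact fun x y => commute_fwd fun j hj =>
      legOn_RP_commute (ho i).symm (fun h => hi (he h ▸ hj)) _ _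

theorem ptOn_bwd_RP {o : ι} (ho : ∀ i, o ≠ e i) (he : Function.Injective e) (p : α → S × S)
    {l : List α} (hl : l.Nodup) :
    ptOn o (bwd (fun i => RP N Z o (e i) (p i)) l) = fwd (fun i => RT N Z o (e i) (p i)) l := by
  induction l with
  | nil => simp [ptOn_one]
  | cons i l ih =>
    obtain ⟨hi, hl⟩ := List.nodup_cons.1 hl
    rw [fwd_cons, bwd_cons, ptOn_mul_RP (ho i), ih hl]
    exact fun x y => commute_bwd fun j hj =>
      legOn_RP_commute (ho i).symm (fun h => hi (he h ▸ hj)) _ _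

theorem ptOn_fwd_RT {o : ι} (ho : ∀ i, o ≠ e i) (he : Function.Injective e) (p : α → S × S)
    {l : List α} (hl : l.Nodup) :
    ptOn o (fwd (fun i => RT N Z o (e i) (p i)) l) = bwd (fun i => RP N Z o (e i) (p i)) l := by
  rw [← ptOn_bwd_RP ho he p hl, ptOn_ptOn]

theorem ptOn_bwd_RT {o : ι} (ho : ∀ i, o ≠ e i) (he : Function.Injective e) (p : α → S × S)
    {l : List α} (hl : l.Nodup) :
    ptOn o (bwd (fun i => RT N Z o (e i) (p i)) l) = fwd (fun i => RP N Z o (e i) (p i)) l := by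
  rw [← ptOn_fwd_RP ho he p hl, ptOn_ptOn]

end Transposition

theorem embOn_add (f : κ → ι) (M M' : TMat κ N Z) :
    embOn f (M + M') = embOn f M + embOn f M' := by
  ext a b
  simp only [embOn, Matrix.of_apply, Matrix.add_apply]
  split_ifs <;> simp

theorem embOn_ptOn {f : κ → ι} (hf : Function.Injective f) (k : κ) (M : TMat κ N Z) :
    embOn f (ptOn k M) = ptOn (f k) (embOn f M) := by
  ext a b
  simp only [embOn, ptOn, Matrix.of_apply, Function.update_comp_eq_of_injective _ hf,
    Function.comp_apply]
  refine if_congr (forall₂_congr fun l hl => ?_) rfl rfl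
  rw [Function.update_of_ne (hl k).symm, Function.update_of_ne (hl k).symm]

theorem embOn_qOn {f : κ → ι} (hf : Function.Injective f) {i j : κ} (hij : i ≠ j) :
    embOn f (qOn Z N i j) = qOn Z N (f i) (f j) := by
  rw [← ptOn_permOn hij, embOn_ptOn hf, embOn_permOn hf hij, ptOn_permOn (hf.ne hij)]

theorem embOn_RT {f : κ → ι} (hf : Function.Injective f) {i j : κ} (hij : i ≠ j) (p : S × S) :
    embOn f (RT N Z i j p) = RT N Z (f i) (f j) p := by
  rw [RT, RT, embOn_smul, embOn_sub, embOn_smul, embOn_one, embOn_qOn hf hij]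

theorem embOn_RP {f : κ → ι} (hf : Function.Injective f) {i j : κ} (hij : i ≠ j) (p : S × S) :
    embOn f (RP N Z i j p) = RP N Z (f i) (f j) p := by
  rw [RP, RP, embOn_smul, embOn_sub, embOn_smul, embOn_one, embOn_permOn hf hij]

theorem embOn_fwd {α : Type*} {f : κ → ι} (hf : Function.Injective f) (g : α → TMat κ N Z)
    (l : List α) : embOn f (fwd g l) = fwd (fun i => embOn f (g i)) l := by
  induction l with
  | nil => simp [embOn_one]
  | cons i l ih => rw [fwd_cons, fwd_cons, embOn_mul hf, ih]

theorem embOn_sProd {α : Type*} {e : α → κ} {f : κ → ι} (he : Function.Injective e)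
    (hf : Function.Injective f)
    (M : α → Matrix (Fin N) (Fin N) Z) (r : α → α → S × S) {l : List α} (hl : l.Nodup) :
    embOn f (sProd e M r l) = sProd (f ∘ e) M r l := by
  induction l with
  | nil => simp [sProd, embOn_one]
  | cons i l ih =>
    obtain ⟨hi, hl⟩ := List.nodup_cons.1 hl
    rw [sProd, sProd, embOn_mul hf, embOn_mul hf, ih hl, embOn_legOn hf, embOn_fwd hf, fwd, fwd,
      List.map_congr_left fun j hj => embOn_RT hf (he.ne fun h : i = j => hi (by rwa [h])) (r i j)]
    rfl

end Scalar

/-! ### Partial traces -/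

section PartialTrace

variable {κ : Type*} [Fintype κ] [DecidableEq κ] {N : ℕ} {Z : Type*} [Ring Z]

/-- The multi-index with a component added. -/
def optCons (x : Fin N) (k : κ → Fin N) : Option κ → Fin N := fun o => o.elim x k

@[simp] theorem optCons_none (x : Fin N) (k : κ → Fin N) : optCons x k none = x := rfl
@[simp] theorem optCons_some (x : Fin N) (k : κ → Fin N) (i : κ) : optCons x k (some i) = k i := rfl

theorem sum_optCons {M : Type*} [AddCommMonoid M] (f : (Option κ → Fin N) → M) :
    ∑ c, f c = ∑ x, ∑ k, f (optCons x k) := by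
  rw [← Fintype.sum_prod_type']
  refine Fintype.sum_equiv ⟨fun c => (c none, fun i => c (some i)), fun p => optCons p.1 p.2,
    fun c => ?_, fun p => rfl⟩ _ _ fun c => ?_
  · ext1 o; cases o <;> rfl
  · show f c = f (optCons (c none) fun i => c (some i))
    congr 1
    ext1 o; cases o <;> rfl

/-- The trace over all tensor factors except for the one labelled by `none`. -/
def ptr (M : TMat (Option κ) N Z) : Matrix (Fin N) (Fin N) Z :=
  Matrix.of fun x y => ∑ k, M (optCons x k) (optCons y k)

theorem embOn_some_apply (M : TMat κ N Z) (x y : Fin N) (k l : κ → Fin N) :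
    embOn some M (optCons x k) (optCons y l) = if x = y then M k l else 0 := by
  simp only [embOn, Matrix.of_apply]
  refine if_congr ⟨fun h => h none (by simp), ?_⟩ rfl rfl
  rintro rfl (_ | i) h
  · rfl
  · exact absurd rfl (h i)

theorem legOn_none_apply (M : Matrix (Fin N) (Fin N) Z) (x y : Fin N) (k l : κ → Fin N) :
    legOn none M (optCons x k) (optCons y l) = if k = l then M x y else 0 := by
  simp only [legOn, Matrix.of_apply]
  refine if_congr ⟨fun h => funext fun i => h (some i) (by simp), ?_⟩ rfl rfl
  rintro rfl (_ | i) h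
  · exact absurd rfl h
  · rfl

theorem ptOn_none_apply (M : TMat (Option κ) N Z) (x y : Fin N) (k l : κ → Fin N) :
    ptOn none M (optCons x k) (optCons y l) = M (optCons y k) (optCons x l) := by
  simp only [ptOn, Matrix.of_apply]
  congr 1 <;> (ext1 o; cases o <;> simp)

theorem ptr_add (M M' : TMat (Option κ) N Z) : ptr (M + M') = ptr M + ptr M' := by
  ext x y; simp [ptr, Finset.sum_add_distrib]

theorem ptr_legOn_mul (M : Matrix (Fin N) (Fin N) Z) (Y : TMat (Option κ) N Z) :
    ptr (legOn none M * Y) = M * ptr Y := by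
  ext x y
  simp only [ptr, Matrix.of_apply, Matrix.mul_apply, sum_optCons, legOn_none_apply, ite_mul,
    zero_mul, Finset.sum_ite_eq, Finset.mem_univ, if_true, Finset.mul_sum]
  exact Finset.sum_comm

theorem ptr_mul_legOn (M : Matrix (Fin N) (Fin N) Z) (Y : TMat (Option κ) N Z) :
    ptr (Y * legOn none M) = ptr Y * M := by
  ext x y
  simp only [ptr, Matrix.of_apply, Matrix.mul_apply, sum_optCons, legOn_none_apply, mul_ite,
    mul_zero, Finset.sum_ite_eq', Finset.mem_univ, if_true, Finset.sum_mul]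
  exact Finset.sum_comm

theorem ptr_embOn_mul_comm {E : TMat κ N Z} (hE : IsScalar E) (Y : TMat (Option κ) N Z) :
    ptr (embOn some E * Y) = ptr (Y * embOn some E) := by
  ext x y
  simp only [ptr, Matrix.of_apply, Matrix.mul_apply, sum_optCons, embOn_some_apply, ite_mul,
    zero_mul, mul_ite, mul_zero, Finset.sum_ite_irrel, Finset.sum_const_zero, Finset.sum_ite_eq,
    Finset.sum_ite_eq', Finset.mem_univ, if_true]
  rw [Finset.sum_comm]
  exact Finset.sum_congr rfl fun k _ => Finset.sum_congr rfl fun l _ => hE _ _ _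

theorem sum_reverse_four {α β γ δ M : Type*} [Fintype α] [Fintype β] [Fintype γ] [Fintype δ]
    [AddCommMonoid M] (f : α → β → γ → δ → M) :
    ∑ i, ∑ z, ∑ l, ∑ k, f i z l k = ∑ k, ∑ l, ∑ z, ∑ i, f i z l k := by
  have h : ∀ i, ∑ z, ∑ l, ∑ k, f i z l k = ∑ k, ∑ l, ∑ z, f i z l k := fun i =>
    calc _ = ∑ l, ∑ z, ∑ k, f i z l k := Finset.sum_comm
      _ = ∑ l, ∑ k, ∑ z, f i z l k := Finset.sum_congr rfl fun l _ => Finset.sum_comm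
      _ = _ := Finset.sum_comm
  simp only [h]
  rw [Finset.sum_comm]
  refine Finset.sum_congr rfl fun k _ => ?_
  rw [Finset.sum_comm]
  exact Finset.sum_congr rfl fun l _ => Finset.sum_comm

/-- The scalar entries of `M` may be moved to the right of those of `M'`. The sum over the inner
indices is then an entry of the product of the partial transposes, a Kronecker delta, and only the
trace of `Y` remains. -/
theorem ptr_mul_embOn_mul {M M' : TMat (Option κ) N Z} (hM : IsScalar M)
    (h : ptOn none M' * ptOn none M = 1) (Y : TMat κ N Z) :
    ptr (M * embOn some Y * M') = Matrix.scalar (Fin N) Y.trace := by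
  ext x y
  have key : ∀ k l, ∑ z, ∑ i, M' (optCons z l) (optCons y i) * M (optCons x i) (optCons z k) =
      if l = k then if y = x then 1 else 0 else 0 := by
    intro k l
    have := congrFun (congrFun h (optCons y l)) (optCons x k)
    rw [Matrix.mul_apply, sum_optCons] at this
    simp only [ptOn_none_apply] at this
    rw [this, Matrix.one_apply, ← ite_and]
    refine if_congr ⟨fun h => ⟨?_, congrFun h none⟩, ?_⟩ rfl rfl
    · exact funext fun i => congrFun h (some i)
    · rintro ⟨rfl, rfl⟩; rfl
  simp only [ptr, Matrix.of_apply, Matrix.mul_apply, sum_optCons, embOn_some_apply, mul_ite,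
    mul_zero, Finset.sum_mul, ite_mul, zero_mul]
  calc _ = ∑ k, ∑ l, Y k l *
        ∑ z, ∑ i, M' (optCons z l) (optCons y i) * M (optCons x i) (optCons z k) := by
        simp only [Finset.sum_ite_irrel, Finset.sum_const_zero, Finset.mul_sum,
          Finset.sum_ite_eq', Finset.mem_univ, if_true]
        rw [sum_reverse_four]
        refine Finset.sum_congr rfl fun k _ => Finset.sum_congr rfl fun l _ =>
          Finset.sum_congr rfl fun z _ => Finset.sum_congr rfl fun i _ => ?_
        rw [(hM _ _ _).eq, mul_assoc, (hM _ _ _).eq]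
    _ = _ := by
        simp only [key, mul_ite, mul_one, mul_zero]
        rw [Matrix.scalar_apply, Matrix.diagonal_apply]
        simp [Matrix.trace, eq_comm]

/-- Invariance creates copies of `e` around `z`; cyclicity carries the leading `e` to the end, where
it is absorbed again. -/
theorem trace_idempotent_aux {A B : Type*} [Ring A] (t : A → B) {e m z m' : A}
    (hc : ∀ y, t (e * y) = t (y * e)) (h1 : e * m * e = e * m) (h2 : e * m' * e = e * m')
    (h3 : e * z * e = e * z) : t (e * m * z * m') = t (m * (e * z * e) * m') := by
  calc t (e * m * z * m') = t (e * (m * (e * z * e) * m')) := by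
        congr 1
        rw [h3, ← mul_assoc, ← mul_assoc, ← mul_assoc, h1]
    _ = t (m * (e * z * e) * m' * e) := hc _
    _ = t (m * (e * z * e) * m') := by
        congr 1
        rw [mul_assoc, mul_assoc m, mul_assoc m, mul_assoc (e * z), ← mul_assoc e m', h2,
          ← mul_assoc (e * z)]

/-- The main property of traces with an idempotent under which all factors are invariant. -/
theorem ptr_idempotent_mul {E ZZ : TMat κ N Z} (hE : IsScalar E)
    {M M' : TMat (Option κ) N Z} (hM : IsScalar M)
    (h : ptOn none M' * ptOn none M = 1) (hEZ : E * ZZ * E = E * ZZ)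
    (h1 : embOn some E * M * embOn some E = embOn some E * M)
    (h2 : embOn some E * M' * embOn some E = embOn some E * M') :
    ptr (embOn some E * M * embOn some ZZ * M') = Matrix.scalar (Fin N) (E * ZZ).trace := by
  have hs : Function.Injective (some : κ → Option κ) := Option.some_injective _
  rw [← hEZ, ← ptr_mul_embOn_mul hM h, embOn_mul hs, embOn_mul hs]
  refine trace_idempotent_aux ptr (ptr_embOn_mul_comm hE) h1 h2 ?_
  rw [← embOn_mul hs, ← embOn_mul hs, hEZ, embOn_mul hs]

end PartialTrace

/-! ### Invariance at the critical level -/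

section Inverse

variable {ι κ α : Type*} [Fintype ι] [DecidableEq ι] [Fintype κ] [DecidableEq κ] {N : ℕ}
  {S Z : Type*} [CommRing S] [Ring Z] [Algebra S Z]

/-- The inverse of `gProd`. -/
def gInv (e : α → ι) (G' : Matrix (Fin N) (Fin N) Z) (r : α → α → S × S) : List α → TMat ι N Z
  | [] => 1
  | i :: l => gInv e G' r l * bwd (fun j => RT N Z (e i) (e j) (r i j)) l * legOn (e i) G'

theorem isScalar_gInv {G' : Matrix (Fin N) (Fin N) Z} (hG' : IsScalar G') (e : α → ι)
    (r : α → α → S × S) (l : List α) : IsScalar (gInv e G' r l) := by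
  induction l with
  | nil => exact IsScalar.one
  | cons i l ih => exact (ih.mul (IsScalar.bwd fun j _ => isScalar_RT _ _ _)).mul (hG'.legOn _)

theorem fwd_mul_bwd_eq_one_of_mem {A : Type*} [Ring A] {f g : α → A} {l : List α}
    (h : ∀ i ∈ l, f i * g i = 1) : fwd f l * bwd g l = 1 := by
  induction l with
  | nil => simp
  | cons i l ih =>
    rw [fwd_cons, bwd_cons, mul_assoc, ← mul_assoc (fwd f l), ih fun j hj => h j (by simp [hj]),
      one_mul, h i (by simp)]

theorem bwd_mul_fwd_eq_one_of_mem {A : Type*} [Ring A] {f g : α → A} {l : List α}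
    (h : ∀ i ∈ l, f i * g i = 1) : bwd f l * fwd g l = 1 := by
  induction l with
  | nil => simp
  | cons i l ih =>
    rw [fwd_cons, bwd_cons, mul_assoc, ← mul_assoc (f i), h i (by simp), one_mul,
      ih fun j hj => h j (by simp [hj])]

variable {e : α → ι} {G G' : Matrix (Fin N) (Fin N) Z} {r r' : α → α → S × S}

theorem gProd_mul_gInv (hG : G * G' = 1) {l : List α} (hl : l.Nodup)
    (h : ∀ i ∈ l, ∀ j ∈ l, i ≠ j →
      RT N Z (e i) (e j) (r i j) * RT N Z (e i) (e j) (r' i j) = 1) :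
    gProd e G r l * gInv e G' r' l = 1 := by
  induction l with
  | nil => simp [gProd, gInv]
  | cons i l ih =>
    obtain ⟨hi, hl⟩ := List.nodup_cons.1 hl
    have ih' := ih hl fun j hj k hk => h j (by simp [hj]) k (by simp [hk])
    have h1 := fwd_mul_bwd_eq_one_of_mem (l := l) (f := fun j => RT N Z (e i) (e j) (r i j))
      (g := fun j => RT N Z (e i) (e j) (r' i j))
      fun j hj => h i (by simp) j (by simp [hj]) (by rintro rfl; exact hi hj)
    have h2 : legOn (e i) G * legOn (e i) G' = 1 := by rw [← legOn_mul, hG, legOn_one]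
    rw [gProd, gInv]
    calc _ = legOn (e i) G * (fwd (fun j => RT N Z (e i) (e j) (r i j)) l *
          (gProd e G r l * gInv e G' r' l) * bwd (fun j => RT N Z (e i) (e j) (r' i j)) l) *
          legOn (e i) G' := by simp only [mul_assoc]
      _ = 1 := by rw [ih', mul_one, h1, mul_one, h2]

theorem gInv_mul_gProd (hG : G' * G = 1) {l : List α} (hl : l.Nodup)
    (h : ∀ i ∈ l, ∀ j ∈ l, i ≠ j →
      RT N Z (e i) (e j) (r' i j) * RT N Z (e i) (e j) (r i j) = 1) :
    gInv e G' r' l * gProd e G r l = 1 := by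
  induction l with
  | nil => simp [gProd, gInv]
  | cons i l ih =>
    obtain ⟨hi, hl⟩ := List.nodup_cons.1 hl
    have ih' := ih hl fun j hj k hk => h j (by simp [hj]) k (by simp [hk])
    have h1 := bwd_mul_fwd_eq_one_of_mem (l := l) (f := fun j => RT N Z (e i) (e j) (r' i j))
      (g := fun j => RT N Z (e i) (e j) (r i j))
      fun j hj => h i (by simp) j (by simp [hj]) (by rintro rfl; exact hi hj)
    have h2 : legOn (e i) G' * legOn (e i) G = 1 := by rw [← legOn_mul, hG, legOn_one]
    rw [gProd, gInv]
    calc _ = gInv e G' r' l * (bwd (fun j => RT N Z (e i) (e j) (r' i j)) l *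
          (legOn (e i) G' * legOn (e i) G) * fwd (fun j => RT N Z (e i) (e j) (r i j)) l) *
          gProd e G r l := by simp only [mul_assoc]
      _ = 1 := by rw [h2, mul_one, h1, mul_one, ih']

theorem embOn_bwd {f : κ → ι} (hf : Function.Injective f) (g : α → TMat κ N Z)
    (l : List α) : embOn f (bwd g l) = bwd (fun i => embOn f (g i)) l := by
  induction l with
  | nil => simp [embOn_one]
  | cons i l ih => rw [bwd_cons, bwd_cons, embOn_mul hf, ih]

theorem embOn_gInv {e : α → κ} {f : κ → ι} (he : Function.Injective e) (hf : Function.Injective f)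
    (G : Matrix (Fin N) (Fin N) Z) (r : α → α → S × S) {l : List α} (hl : l.Nodup) :
    embOn f (gInv e G r l) = gInv (f ∘ e) G r l := by
  induction l with
  | nil => simp [gInv, embOn_one]
  | cons i l ih =>
    obtain ⟨hi, hl⟩ := List.nodup_cons.1 hl
    rw [gInv, gInv, embOn_mul hf, embOn_mul hf, ih hl, embOn_legOn hf, embOn_bwd hf, bwd, bwd,
      List.map_congr_left fun j hj => embOn_RT hf
        (he.ne fun h : i = j => hi (by rw [h]; exact List.mem_reverse.1 hj)) (r i j)]
    rfl

theorem inv_conj_aux {A : Type*} [Ring A] {x g r g0 q : A} (h1 : x * g = 1) (h2 : g * x = 1)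
    (h : r * g0 * q * g = g * q * g0 * r) : q * g0 * r * x = x * r * g0 * q := by
  calc q * g0 * r * x = x * (g * q * g0 * r) * x := by
        rw [← mul_assoc, ← mul_assoc, ← mul_assoc, h1, one_mul]
    _ = x * r * g0 * q * (g * x) := by rw [← h]; simp only [mul_assoc]
    _ = _ := by rw [h2, mul_one]

/-- The algebra of the invariance proof: `s` stands for `S₀(z)`, `g` for its value on the vacuum and
`d` for the difference. After the exchange relation the `g`-part is reflected across `x`, which
brings `q3` next to its inverse `q3'`; the `d`-part is left with the factors `rm`, `x`, `q3'` on its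
right. -/
theorem trace_exchange_aux {A : Type*} [Ring A] {e s g d q1 q3 q3' r3 rm w x : A}
    (hcomm : s * e = e * s) (fex : s * q1 * w = r3 * w * q3 * s * rm) (hs : s = g + d)
    (hrefl : q3 * g * rm * x = x * rm * g * q3) (hq : q3 * q3' = 1) :
    s * (e * q1 * (w * x) * q3') =
      e * r3 * (w * x) * rm * g + e * r3 * w * q3 * d * (rm * x * q3') := by
  calc s * (e * q1 * (w * x) * q3') = s * e * q1 * (w * x) * q3' := by simp only [mul_assoc]
    _ = e * (s * q1 * w) * x * q3' := by rw [hcomm]; simp only [mul_assoc]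
    _ = e * r3 * w * (q3 * g * rm * x) * q3' + e * r3 * w * q3 * d * (rm * x * q3') := by
      rw [fex, hs]; simp only [mul_add, add_mul, mul_assoc]
    _ = e * r3 * (w * x) * rm * g * (q3 * q3') + e * r3 * w * q3 * d * (rm * x * q3') := by
      rw [hrefl]; simp only [mul_assoc]
    _ = _ := by rw [hq, mul_one]

theorem embOn_some_injective (x : Fin N) :
    Function.Injective (embOn some : TMat κ N Z → TMat (Option κ) N Z) := by
  intro M M' h
  ext k l
  have := congrFun (congrFun h (optCons x k)) (optCons x l)
  rwa [embOn_some_apply, embOn_some_apply, if_pos rfl, if_pos rfl] at this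

theorem legOn_none_embOn_comm (M : Matrix (Fin N) (Fin N) Z) {E : TMat κ N Z} (hE : IsScalar E) :
    legOn none M * embOn some E = embOn some E * legOn none M := by
  ext a b
  obtain ⟨x, k, rfl⟩ : ∃ x k, a = optCons x k :=
    ⟨a none, fun i => a (some i), by ext1 o; cases o <;> rfl⟩
  obtain ⟨y, l, rfl⟩ : ∃ x k, b = optCons x k :=
    ⟨b none, fun i => b (some i), by ext1 o; cases o <;> rfl⟩
  rw [Matrix.mul_apply, Matrix.mul_apply, sum_optCons, sum_optCons]
  simp [legOn_none_apply, embOn_some_apply, (hE k l (M x y)).eq]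

/-- Entries of the scalar matrix `B` can be pulled to the left of those of `D`, so a left ideal
suffices. -/
theorem mul_legOn_mul_mem (𝓙 : Submodule Z Z) (Y : TMat ι N Z) (o : ι)
    {D : Matrix (Fin N) (Fin N) Z} (hD : ∀ i j, D i j ∈ 𝓙) {B : TMat ι N Z} (hB : IsScalar B)
    (a b : ι → Fin N) : (Y * legOn o D * B) a b ∈ 𝓙 := by
  rw [Matrix.mul_apply]
  refine Submodule.sum_mem _ fun k _ => ?_
  rw [← (hB _ _ _).eq]
  refine 𝓙.smul_mem _ ?_
  rw [Matrix.mul_apply]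
  refine Submodule.sum_mem _ fun l _ => 𝓙.smul_mem _ ?_
  simp only [legOn, Matrix.of_apply]
  split_ifs
  · exact hD _ _
  · exact 𝓙.zero_mem

end Inverse

/-! ### Invariance of the trace from the exchange relations at the critical level. -/

section Critical

variable {n N : ℕ} {S Z : Type*} [CommRing S] [Ring Z] [Algebra S Z] [Algebra ℂ Z]

/-- The values `(g(w/h), h/w)` at `w = w₀ + k h c / 2 - h d` with `c = -N/2` (denoted by `p k d`) and
at the opposite points (denoted by `q k d`). -/
structure IsRFamily (N : ℕ) (p q : ℤ → ℤ → S × S) : Prop where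
  spectral : ∀ k, IsSpectral (p k)
  neg : ∀ k d, (q k d).2 = -(p k d).2
  unit : ∀ k d, (p k d).1 * (q k d).1 * (1 - (p k d).2 ^ 2) = 1
  crossing_fst : ∀ k d, (q k d).1 * (p (k - 4) d).1 = 1
  crossing_snd : ∀ k d, (q k d).2 + (p (k - 4) d).2 = N * ((q k d).2 * (p (k - 4) d).2)

namespace IsRFamily

variable {p q : ℤ → ℤ → S × S} {ι : Type*} [Fintype ι] [DecidableEq ι] {i j : ι}

theorem RP_mul (h : IsRFamily N p q) (i j : ι) (k d : ℤ) :
    RP N Z i j (p k d) * RP N Z i j (q k d) = 1 :=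
  RP_unitarity i j (h.neg k d) (h.unit k d)

theorem RP_mul' (h : IsRFamily N p q) (i j : ι) (k d : ℤ) :
    RP N Z i j (q k d) * RP N Z i j (p k d) = 1 :=
  RP_unitarity i j (by rw [h.neg, neg_neg]) (by rw [h.neg, neg_sq, mul_comm (q k d).1, h.unit])

theorem RT_mul (h : IsRFamily N p q) (hij : i ≠ j) (k d : ℤ) :
    RT N Z i j (q k d) * RT N Z i j (p (k - 4) d) = 1 :=
  RT_crossing hij (h.crossing_snd k d) (h.crossing_fst k d)

theorem RT_mul' (h : IsRFamily N p q) (hij : i ≠ j) (k d : ℤ) :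
    RT N Z i j (p (k - 4) d) * RT N Z i j (q k d) = 1 :=
  RT_crossing hij (by rw [add_comm, h.crossing_snd, mul_comm (q k d).2])
    (by rw [mul_comm, h.crossing_fst])

end IsRFamily

/-- The relations between the matrices `T(z + h c)`, `T(-z)`, `T⁺(u + h d)`, `T⁺(-u - h d)`. -/
structure IsCriticalSystem (n : ℕ) (pA qA pB qB pC qC : ℤ → ℤ → S × S)
    (T T' : Matrix (Fin N) (Fin N) Z) (Tp Tm : ℤ → Matrix (Fin N) (Fin N) Z) : Prop where
  famA : IsRFamily N pA qA
  famB : IsRFamily N pB qB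
  famC : IsRFamily N pC qC
  add : ∀ k l d e, (pA k d).2 * (pB l e).2 = (pC (k + l) (d + e)).2 * ((pA k d).2 + (pB l e).2)
  -- The first index counts multiples of `hc/2`: the argument `z + hc` contributes 2 and the mixed
  -- relation ±1, hence 3 and 1; for `T(-z)` only ±1 remain. For `T⁺(-u - hd)` the values are taken
  -- at the opposite points.
  T_Tp : ∀ i j : Option (Fin n), i ≠ j → ∀ d,
    RP N Z i j (pA 3 d) * legOn i T * legOn j (Tp d) =
      legOn j (Tp d) * legOn i T * RP N Z i j (pA 1 d)
  T'_Tp : ∀ i j : Option (Fin n), i ≠ j → ∀ d,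
    RP N Z i j (pB 1 d) * legOn i T' * legOn j (Tp d) =
      legOn j (Tp d) * legOn i T' * RP N Z i j (pB (-1) d)
  T_Tm : ∀ i j : Option (Fin n), i ≠ j → ∀ d,
    RP N Z i j (qB (-3) d) * legOn i T * legOn j (Tm d) =
      legOn j (Tm d) * legOn i T * RP N Z i j (qB (-1) d)
  T'_Tm : ∀ i j : Option (Fin n), i ≠ j → ∀ d,
    RP N Z i j (qA (-1) d) * legOn i T' * legOn j (Tm d) =
      legOn j (Tm d) * legOn i T' * RP N Z i j (qA 1 d)
  Tp_Tp : ∀ i j : Option (Fin n), i ≠ j → ∀ x y, x ≠ y →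
    ((x - y) • 1 - permOn Z N (Equiv.swap i j)) * legOn i (Tp x) * legOn j (Tp y) =
      legOn j (Tp y) * legOn i (Tp x) * ((x - y) • 1 - permOn Z N (Equiv.swap i j))
  Tm_Tm : ∀ i j : Option (Fin n), i ≠ j → ∀ x y, x ≠ y →
    ((y - x) • 1 - permOn Z N (Equiv.swap i j)) * legOn i (Tm x) * legOn j (Tm y) =
      legOn j (Tm y) * legOn i (Tm x) * ((y - x) • 1 - permOn Z N (Equiv.swap i j))
  Tm_Tp : ∀ i j : Option (Fin n), i ≠ j → ∀ d e,
    RP N Z i j (pC 0 (d + e)) * legOn i (Tm d) * legOn j (Tp e) =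
      legOn j (Tp e) * legOn i (Tm d) * RP N Z i j (pC 0 (d + e))

namespace IsCriticalSystem

variable {pA qA pB qB pC qC : ℤ → ℤ → S × S}
  {T T' : Matrix (Fin N) (Fin N) Z} {Tp Tm : ℤ → Matrix (Fin N) (Fin N) Z}
  (H : IsCriticalSystem n pA qA pB qB pC qC T T' Tp Tm)
  {G : Matrix (Fin N) (Fin N) Z} (hG : IsForm G) (c : Fin n → ℤ)

include H

theorem T'_Tp_transpose (c : ℤ) {i j : Option (Fin n)} (hij : i ≠ j) :
    legOn i T'.transpose * RT N Z i j (pB 1 c) * legOn j (Tp c) =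
      legOn j (Tp c) * RT N Z i j (pB (-1) c) * legOn i T'.transpose := by
  have := exchange_transpose_fst hij (isScalar_RP _ _ _) (isScalar_RP _ _ _) (H.T'_Tp i j hij c)
  rwa [ptOn_RP hij, ptOn_RP hij] at this

theorem T_Tm_transpose (c : ℤ) {i j : Option (Fin n)} (hij : i ≠ j) :
    legOn i T * RT N Z i j (pB (-1) c) * legOn j (Tm c).transpose =
      legOn j (Tm c).transpose * RT N Z i j (pB (-3) c) * legOn i T := by
  have := exchange_transpose_snd hij (isScalar_RP _ _ _) (isScalar_RP _ _ _)
    (H.famB.RP_mul i j (-3) c) (H.famB.RP_mul' i j (-1) c) (H.T_Tm i j hij c)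
  rwa [ptOn_RP' hij, ptOn_RP' hij] at this

theorem T'_Tm_transpose (c : ℤ) {i j : Option (Fin n)} (hij : i ≠ j) :
    RP N Z i j (pA 1 c) * legOn i T'.transpose * legOn j (Tm c).transpose =
      legOn j (Tm c).transpose * legOn i T'.transpose * RP N Z i j (pA (-1) c) := by
  have h := exchange_transpose_both hij (isScalar_RP _ _ _) (isScalar_RP _ _ _)
    (by rw [ptOn_RP hij, ptOn_RT' hij]) (by rw [ptOn_RP hij, ptOn_RT' hij]) (H.T'_Tm i j hij c)
  have h1 := H.famA.RP_mul (Z := Z) i j 1 c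
  have h2 := H.famA.RP_mul' (Z := Z) i j (-1) c
  calc _ = RP N Z i j (pA 1 c) * (legOn i T'.transpose * legOn j (Tm c).transpose *
        RP N Z i j (qA (-1) c)) * RP N Z i j (pA (-1) c) := by
        rw [mul_assoc, mul_assoc, mul_assoc _ _ (RP N Z i j (pA (-1) c)), h2, mul_one]
    _ = _ := by
        rw [h, ← mul_assoc, ← mul_assoc, h1, one_mul]

theorem Tm_Tp_transpose (d e : ℤ) {i j : Option (Fin n)} (hij : i ≠ j) :
    legOn i (Tm d).transpose * RT N Z i j (pC 0 (d + e)) * legOn j (Tp e) =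
      legOn j (Tp e) * RT N Z i j (pC 0 (d + e)) * legOn i (Tm d).transpose := by
  have := exchange_transpose_fst hij (isScalar_RP _ _ _) (isScalar_RP _ _ _) (H.Tm_Tp i j hij d e)
  rwa [ptOn_RP hij] at this

theorem Tm_Tm_transpose {i j : Option (Fin n)} (hij : i ≠ j) (x y : ℤ) (hxy : x ≠ y) :
    ((x - y) • 1 - permOn Z N (Equiv.swap i j)) * legOn i (Tm x).transpose *
        legOn j (Tm y).transpose =
      legOn j (Tm y).transpose * legOn i (Tm x).transpose *
        ((x - y) • 1 - permOn Z N (Equiv.swap i j)) := by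
  have hs : IsScalar ((x - y) • 1 - permOn Z N (Equiv.swap j i)) := by
    refine IsScalar.sub ?_ (isScalar_permOn _)
    rw [← Int.cast_smul_eq_zsmul S]
    exact IsScalar.one.smul _
  have hp : ptOn i (ptOn j ((x - y) • 1 - permOn Z N (Equiv.swap j i))) =
      ((x - y) • 1 - permOn Z N (Equiv.swap j i)) := by
    rw [ptOn_sub, ptOn_smul, ptOn_one, ptOn_permOn hij.symm, ptOn_sub, ptOn_smul, ptOn_one,
      ptOn_qOn' hij.symm]
  have := exchange_transpose_both hij.symm hs hs hp hp (H.Tm_Tm j i hij.symm y x hxy.symm)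
  rw [Equiv.swap_comm j i] at this
  exact this.symm

/-- The fused exchange relation between `S(z)` and `S⁺_{[n]}(u)`. -/
theorem fused_exchange (hS : IsForm G) :
    legOn none (T * G * T'.transpose) *
        fwd (fun k => RT N Z none (some k) (pB 1 (c k))) (List.finRange n) *
        sProd some (fun k => Tp (c k) * G * (Tm (c k)).transpose)
          (fun i j => pC 0 (c i + c j)) (List.finRange n) =
      fwd (fun k => RP N Z none (some k) (qA 3 (c k))) (List.finRange n) *
        sProd some (fun k => Tp (c k) * G * (Tm (c k)).transpose)
          (fun i j => pC 0 (c i + c j)) (List.finRange n) *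
        fwd (fun k => RT N Z none (some k) (pB (-3) (c k))) (List.finRange n) *
        legOn none (T * G * T'.transpose) *
        bwd (fun k => RP N Z none (some k) (pA (-1) (c k))) (List.finRange n) := by
  have hi : Function.Injective (some : Fin n → Option (Fin n)) := Option.some_injective _
  have ho : ∀ k : Fin n, (none : Option (Fin n)) ≠ some k := fun k => by simp
  have hnd := List.nodup_finRange n
  rw [sProd_eq (T := fun k => Tp (c k)) (T' := fun k => (Tm (c k)).transpose) hS hi hnd
    fun i _ j _ hij => H.Tm_Tp_transpose _ _ (hi.ne hij), legOn_mul, legOn_mul]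
  -- The levels 1 and -1 of the two rows add up to the level 0 of the R-matrices inside `S⁺_[n]`, as
  -- the Yang–Baxter equation requires.
  have hfl := hS.fused_reflection (l := List.finRange n) hi hnd ho
    (p := fun i => pA 1 (c i)) (q := fun i => pB (-1) (c i)) (r := fun i j => pC 0 (c i + c j))
    (fun i j => by simpa using H.add 1 (-1) (c i) (c j))
    (fun i j => by simpa [add_comm (c i)] using H.add 1 (-1) (c j) (c i))
  set l := List.finRange n
  have ea : bwd (fun k => RP N Z none (some k) (pA 3 (c k))) l * legOn none T *
      fwd (fun k => legOn (some k) (Tp (c k))) l =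
      fwd (fun k => legOn (some k) (Tp (c k))) l * legOn none T *
        bwd (fun k => RP N Z none (some k) (pA 1 (c k))) l :=
    exchange_bwd hnd (fun k _ => H.T_Tp _ _ (ho k) _)
      (fun i _ j _ hij => legOn_RP_commute (ho i).symm (hi.ne hij) _ _)
      (fun i _ j _ hij => legOn_RP_commute (ho i).symm (hi.ne hij) _ _)
  have eb : legOn none T'.transpose * fwd (fun k => RT N Z none (some k) (pB 1 (c k))) l *
      fwd (fun k => legOn (some k) (Tp (c k))) l =
      fwd (fun k => legOn (some k) (Tp (c k))) l *
        fwd (fun k => RT N Z none (some k) (pB (-1) (c k))) l * legOn none T'.transpose :=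
    exchange_fwd hnd (fun k _ => H.T'_Tp_transpose _ (ho k))
      (fun i _ j _ hij => legOn_RT_commute (ho i).symm (hi.ne hij) (ho j) _ _)
      (fun i _ j _ hij => legOn_RT_commute (ho i).symm (hi.ne hij) (ho j) _ _)
  have ec : legOn none T * fwd (fun k => RT N Z none (some k) (pB (-1) (c k))) l *
      fwd (fun k => legOn (some k) (Tm (c k)).transpose) l =
      fwd (fun k => legOn (some k) (Tm (c k)).transpose) l *
        fwd (fun k => RT N Z none (some k) (pB (-3) (c k))) l * legOn none T :=
    exchange_fwd hnd (fun k _ => H.T_Tm_transpose _ (ho k))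
      (fun i _ j _ hij => legOn_RT_commute (ho i).symm (hi.ne hij) (ho j) _ _)
      (fun i _ j _ hij => legOn_RT_commute (ho i).symm (hi.ne hij) (ho j) _ _)
  have ed : bwd (fun k => RP N Z none (some k) (pA 1 (c k))) l * legOn none T'.transpose *
      fwd (fun k => legOn (some k) (Tm (c k)).transpose) l =
      fwd (fun k => legOn (some k) (Tm (c k)).transpose) l * legOn none T'.transpose *
        bwd (fun k => RP N Z none (some k) (pA (-1) (c k))) l :=
    exchange_bwd hnd (fun k _ => H.T'_Tm_transpose _ (ho k))
      (fun i _ j _ hij => legOn_RP_commute (ho i).symm (hi.ne hij) _ _)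
      (fun i _ j _ hij => legOn_RP_commute (ho i).symm (hi.ne hij) _ _)
  -- `R3' * R3 = 1` is inserted in front of `T`, since the relation `ea` can be applied only after
  -- `R3`.
  have hr : fwd (fun k => RP N Z none (some k) (qA 3 (c k))) l *
      bwd (fun k => RP N Z none (some k) (pA 3 (c k))) l = 1 :=
    fwd_mul_bwd_eq_one (fun k => H.famA.RP_mul' _ _ _ _) l
  have hcg : ∀ M : Matrix (Fin N) (Fin N) Z, Commute (legOn none M)
      (gProd some G (fun i j => pC 0 (c i + c j)) l) := fun M =>
    commute_gProd hnd (fun i _ => (hS.legOn_comm (ho i).symm _).symm)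
      fun i _ j _ hij => legOn_RT_commute (ho i) (ho j) (hi.ne hij) _ _
  have hG1 : Commute (legOn none G) (fwd (fun k => legOn (some k) (Tp (c k))) l) :=
    commute_fwd fun k _ => hS.legOn_comm (ho k) _
  have hG2 : Commute (legOn none G) (fwd (fun k => legOn (some k) (Tm (c k)).transpose) l) :=
    commute_fwd fun k _ => hS.legOn_comm (ho k) _
  have c1 := hcg T
  have c2 := hcg T'.transpose
  clear hcg
  generalize fwd (fun k => legOn (some k) (Tp (c k))) l = TT at *
  generalize fwd (fun k => legOn (some k) (Tm (c k)).transpose) l = TT' at *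
  generalize gProd some G (fun i j => pC 0 (c i + c j)) l = g at *
  generalize fwd (fun k => RP N Z none (some k) (qA 3 (c k))) l = R3' at *
  generalize bwd (fun k => RP N Z none (some k) (pA 3 (c k))) l = R3 at *
  generalize bwd (fun k => RP N Z none (some k) (pA 1 (c k))) l = R1 at *
  generalize bwd (fun k => RP N Z none (some k) (pA (-1) (c k))) l = Rm at *
  generalize fwd (fun k => RT N Z none (some k) (pB 1 (c k))) l = Q1 at *
  generalize fwd (fun k => RT N Z none (some k) (pB (-1) (c k))) l = Qm at *
  generalize fwd (fun k => RT N Z none (some k) (pB (-3) (c k))) l = Q3 at *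
  generalize (legOn none T : TMat (Option (Fin n)) N Z) = t at *
  generalize (legOn none G : TMat (Option (Fin n)) N Z) = G0 at *
  generalize (legOn none T'.transpose : TMat (Option (Fin n)) N Z) = t' at *
  calc t * G0 * t' * Q1 * (TT * g * TT')
      = t * G0 * (t' * Q1 * TT) * g * TT' := by noncomm_ring
    _ = t * (G0 * TT) * Qm * (t' * g) * TT' := by rw [eb]; noncomm_ring
    _ = R3' * R3 * t * TT * G0 * Qm * g * t' * TT' := by
        rw [hG1.eq, c2.eq, hr]; noncomm_ring
    _ = R3' * (R3 * t * TT) * G0 * Qm * g * t' * TT' := by noncomm_ring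
    _ = R3' * TT * t * (R1 * G0 * Qm * g) * t' * TT' := by rw [ea]; noncomm_ring
    _ = R3' * TT * (t * g) * Qm * G0 * (R1 * t' * TT') := by rw [hfl]; noncomm_ring
    _ = R3' * TT * g * t * Qm * (G0 * TT') * t' * Rm := by rw [ed, c1.eq]; noncomm_ring
    _ = R3' * TT * g * (t * Qm * TT') * G0 * t' * Rm := by rw [hG2.eq]; noncomm_ring
    _ = _ := by rw [ec]; noncomm_ring

/-- By `sProd_eq` the product splits into the `T⁺` at `u + hc_k`, the constant part and the
transposed `T⁺` at the opposite points; each of the three intertwines. -/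
theorem intertwines_sProd (hS : IsForm G) :
    Intertwines (permRep Z n N) fun c =>
      sProd some (fun k => Tp (c k) * G * (Tm (c k)).transpose)
        (fun i j => pC 0 (c i + c j)) (List.finRange n) := by
  have hi : Function.Injective (some : Fin n → Option (Fin n)) := Option.some_injective _
  have h : ∀ c : Fin n → ℤ, sProd some (fun k => Tp (c k) * G * (Tm (c k)).transpose)
      (fun i j => pC 0 (c i + c j)) (List.finRange n) = _ := fun c =>
    sProd_eq (T := fun k => Tp (c k)) (T' := fun k => (Tm (c k)).transpose) hS hi
      (List.nodup_finRange n) fun i _ j _ hij => H.Tm_Tp_transpose _ _ (hi.ne hij)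
  simp only [h]
  exact ((intertwines_leg H.Tp_Tp).mul (intertwines_gProd hS (H.famC.spectral 0))).mul
    (intertwines_leg (T := fun d => (Tm d).transpose) fun i j hij x y hxy =>
      H.Tm_Tm_transpose hij x y hxy)

/-- The invariance property of the trace. -/
theorem trace_mem (hS : IsForm G) {G' : Matrix (Fin N) (Fin N) Z} (hG1 : G * G' = 1)
    (hG2 : G' * G = 1) (hG' : IsScalar G') (𝓙 : Submodule Z Z)
    (hvac : ∀ a b, (T * G * T'.transpose) a b - G a b ∈ 𝓙)
    {E : TMat (Fin n) N Z} (hE : IsScalar E)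
    (hEs : embOn some E = jmProjector (permRep Z n N) c) (a b : Fin N) :
    (T * G * T'.transpose) a b * (E * (sProd id (fun k => Tp (c k) * G * (Tm (c k)).transpose)
        (fun i j => pC 0 (c i + c j)) (List.finRange n) *
        gInv id G' (fun i j => qC 0 (c i + c j)) (List.finRange n))).trace -
      G a b * (E * (sProd id (fun k => Tp (c k) * G * (Tm (c k)).transpose)
        (fun i j => pC 0 (c i + c j)) (List.finRange n) *
        gInv id G' (fun i j => qC 0 (c i + c j)) (List.finRange n))).trace ∈ 𝓙 := by
  have hi : Function.Injective (some : Fin n → Option (Fin n)) := Option.some_injective _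
  have ho : ∀ k : Fin n, (none : Option (Fin n)) ≠ some k := fun k => by simp
  have hnd := List.nodup_finRange n
  have hnode := nodePoly_permRep (N := N) (n := n) Z
  set ZZ := sProd id (fun k => Tp (c k) * G * (Tm (c k)).transpose)
        (fun i j => pC 0 (c i + c j)) (List.finRange n) *
        gInv id G' (fun i j => qC 0 (c i + c j)) (List.finRange n) with hZZ
  set w : (Fin n → ℤ) → TMat (Option (Fin n)) N Z := fun c =>
    sProd some (fun k => Tp (c k) * G * (Tm (c k)).transpose)
      (fun i j => pC 0 (c i + c j)) (List.finRange n) with hw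
  set x : (Fin n → ℤ) → TMat (Option (Fin n)) N Z := fun c =>
    gInv some G' (fun i j => qC 0 (c i + c j)) (List.finRange n) with hx
  have hZ : embOn some ZZ = w c * x c := by
    rw [hZZ, embOn_mul hi, embOn_sProd Function.injective_id hi _ _ hnd,
      embOn_gInv Function.injective_id hi _ _ hnd]
    rfl
  -- Crossing: the constant product at level -4 is inverted by R-matrices at the points opposite to
  -- level 0.
  have hxg : ∀ c : Fin n → ℤ, x c * gProd some G (fun i j => pC (-4) (c i + c j))
      (List.finRange n) = 1 := fun c => gInv_mul_gProd hG2 hnd fun i _ j _ hij =>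
    H.famC.RT_mul (hi.ne hij) 0 _
  have hgx : ∀ c : Fin n → ℤ, gProd some G (fun i j => pC (-4) (c i + c j))
      (List.finRange n) * x c = 1 := fun c => gProd_mul_gInv hG1 hnd fun i _ j _ hij =>
    H.famC.RT_mul' (hi.ne hij) 0 _
  have iw : Intertwines (permRep Z n N) w := H.intertwines_sProd hS
  have ix : Intertwines (permRep Z n N) x :=
    (intertwines_gProd hS (H.famC.spectral (-4))).inv hgx hxg
  set R3' : (Fin n → ℤ) → TMat (Option (Fin n)) N Z := fun c =>
    fwd (fun k => RP N Z none (some k) (qA 3 (c k))) (List.finRange n) with hR3'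
  set Rm : (Fin n → ℤ) → TMat (Option (Fin n)) N Z := fun c =>
    bwd (fun k => RP N Z none (some k) (pA (-1) (c k))) (List.finRange n) with hRm
  set Q1 : (Fin n → ℤ) → TMat (Option (Fin n)) N Z := fun c =>
    fwd (fun k => RT N Z none (some k) (pB 1 (c k))) (List.finRange n) with hQ1
  set Q3 : (Fin n → ℤ) → TMat (Option (Fin n)) N Z := fun c =>
    fwd (fun k => RT N Z none (some k) (pB (-3) (c k))) (List.finRange n) with hQ3
  set Q3' : (Fin n → ℤ) → TMat (Option (Fin n)) N Z := fun c =>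
    bwd (fun k => RT N Z none (some k) (qB 1 (c k))) (List.finRange n) with hQ3'
  have iR3' : Intertwines (permRep Z n N) R3' :=
    (intertwines_RP (H.famA.spectral 3)).inv
      (fun c => bwd_mul_fwd_eq_one (fun k => H.famA.RP_mul _ _ _ _) _)
      (fun c => fwd_mul_bwd_eq_one (fun k => H.famA.RP_mul' _ _ _ _) _)
  have iRm : Intertwines (permRep Z n N) Rm := intertwines_RP (H.famA.spectral (-1))
  have iQ1 : Intertwines (permRep Z n N) Q1 := intertwines_RT (H.famB.spectral 1)
  -- The levels 1 and -3 differ by 4, that is, by the crossing shift `2hc = -hN`. So `Q3'`, defined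
  -- through the points opposite to level 1, inverts `Q3`.
  have hQQ : ∀ c, Q3 c * Q3' c = 1 := fun c =>
    fwd_mul_bwd_eq_one (fun k => H.famB.RT_mul' (ho k) 1 _) _
  have iQ3' : Intertwines (permRep Z n N) Q3' :=
    (intertwines_RT (H.famB.spectral (-3))).inv hQQ
      (fun c => bwd_mul_fwd_eq_one (fun k => H.famB.RT_mul (ho k) 1 _) _)
  have inv : ∀ {F : (Fin n → ℤ) → TMat (Option (Fin n)) N Z}, Intertwines (permRep Z n N) F →
      embOn some E * F c * embOn some E = embOn some E * F c := by
    intro F hF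
    rw [hEs]
    exact jmProjector_mul_mul hnode hF c
  have hEZ : E * ZZ * E = E * ZZ := by
    refine embOn_some_injective a ?_
    rw [embOn_mul hi, embOn_mul hi, hZ]
    exact inv (F := fun c => w c * x c) (iw.mul ix)
  set s := T * G * T'.transpose with hs
  have fex : legOn none s * Q1 c * w c = R3' c * w c * Q3 c * legOn none s * Rm c :=
    H.fused_exchange c hS
  -- Transposition in the auxiliary factor turns `Q1` and `Q3'` into products of `RP` at opposite
  -- points of the same level, inverse to each other by unitarity.
  have tr1 : ptr (embOn some E * Q1 c * embOn some ZZ * Q3' c) =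
      Matrix.scalar (Fin N) (E * ZZ).trace := by
    refine ptr_idempotent_mul hE (IsScalar.fwd fun _ _ => isScalar_RT _ _ _) ?_ hEZ (inv iQ1)
      (inv iQ3')
    rw [hQ3', hQ1, ptOn_bwd_RT ho hi _ hnd, ptOn_fwd_RT ho hi _ hnd]
    exact fwd_mul_bwd_eq_one (fun k => H.famB.RP_mul' _ _ _ _) _
  -- Here transposition yields products of `RT` at levels 3 and -1, again four apart, so crossing
  -- gives the inverse.
  have tr2 : ptr (embOn some E * R3' c * embOn some ZZ * Rm c) =
      Matrix.scalar (Fin N) (E * ZZ).trace := by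
    refine ptr_idempotent_mul hE (IsScalar.fwd fun _ _ => isScalar_RP _ _ _) ?_ hEZ (inv iR3')
      (inv iRm)
    rw [hRm, hR3', ptOn_bwd_RP ho hi _ hnd, ptOn_fwd_RP ho hi _ hnd]
    exact fwd_mul_bwd_eq_one (fun k => H.famA.RT_mul' (ho k) 3 _) _
  -- The reflection equation at levels -1 and -3, whose sum -4 is the level of the product that `x
  -- c` inverts.
  have hrefl : Q3 c * legOn none G * Rm c * x c = x c * Rm c * legOn none G * Q3 c := by
    have hfl : Rm c * legOn none G * Q3 c * _ = _ * Q3 c * legOn none G * Rm c :=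
      hS.fused_reflection (l := List.finRange n) hi hnd ho
        (p := fun i => pA (-1) (c i)) (q := fun i => pB (-3) (c i))
        (r := fun i j => pC (-4) (c i + c j))
        (fun i j => by simpa using H.add (-1) (-3) (c i) (c j))
        (fun i j => by simpa [add_comm (c i)] using H.add (-1) (-3) (c j) (c i))
    exact inv_conj_aux (hxg c) (hgx c) hfl
  rw [hZ] at tr1 tr2
  have hcomm : legOn none s * embOn some E = embOn some E * legOn none s := legOn_none_embOn_comm s hE
  have hsplit : (legOn none s : TMat (Option (Fin n)) N Z) = legOn none G + legOn none (s - G) := by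
    rw [← legOn_add (none : Option (Fin n)), add_sub_cancel]
  have key : s * ptr (embOn some E * Q1 c * (w c * x c) * Q3' c) =
      ptr (embOn some E * R3' c * (w c * x c) * Rm c) * G +
      ptr (embOn some E * R3' c * w c * Q3 c * legOn none (s - G) * (Rm c * x c * Q3' c)) := by
    rw [← ptr_legOn_mul, ← ptr_mul_legOn, ← ptr_add]
    congr 1
    exact trace_exchange_aux hcomm fex hsplit hrefl (hQQ c)
  rw [tr1, tr2] at key
  have kab := congrFun (congrFun key a) b
  -- The trace need not commute with operators, but it commutes with the central entries of `G`;
  -- this brings the `G`-term into the form that is subtracted in the statement.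
  have hcen : Matrix.scalar (Fin N) (E * ZZ).trace * G = G * Matrix.scalar (Fin N) (E * ZZ).trace := by
    ext i j
    rw [Matrix.scalar_apply, Matrix.diagonal_mul, Matrix.mul_diagonal, (hS.central _ _ _).eq]
  rw [hcen, Matrix.add_apply, Matrix.scalar_apply, Matrix.mul_diagonal, Matrix.mul_diagonal] at kab
  rw [kab, add_sub_cancel_left]
  refine Submodule.sum_mem _ fun k _ => mul_legOn_mul_mem 𝓙 _ (none : Option (Fin n)) (fun i j => hvac i j) ?_ _ _
  exact ((IsScalar.bwd fun _ _ => isScalar_RP _ _ _).mul (isScalar_gInv hG' _ _ _)).mul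
    (IsScalar.bwd fun _ _ => isScalar_RT _ _ _)

end IsCriticalSystem

end Critical

/-! ### Evaluation of power series -/

section Evaluation

variable {B C : Type*} [Ring B] [Ring C]

/-- A power series whose powers tend to zero. -/
def IsSmall (x : C⟦X⟧) : Prop := ∃ k, ∀ m r, k * (m + 1) ≤ r → coeff m (x ^ r) = 0

theorem antidiagonal_fst_le {m : ℕ} {p : ℕ × ℕ} (hp : p ∈ Finset.HasAntidiagonal.antidiagonal m) :
    p.1 ≤ m := by
  rw [Finset.HasAntidiagonal.mem_antidiagonal] at hp; omega

theorem antidiagonal_snd_le {m : ℕ} {p : ℕ × ℕ} (hp : p ∈ Finset.HasAntidiagonal.antidiagonal m) :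
    p.2 ≤ m := by
  rw [Finset.HasAntidiagonal.mem_antidiagonal] at hp; omega

theorem coeff_mul_eq_zero_of_le {x y : C⟦X⟧} {m : ℕ} (h : ∀ i ≤ m, coeff i x = 0) :
    coeff m (x * y) = 0 := by
  rw [coeff_mul]
  exact Finset.sum_eq_zero fun p hp => by
    rw [h _ (antidiagonal_fst_le hp), zero_mul]

theorem coeff_mul_eq_zero_of_le' {x y : C⟦X⟧} {m : ℕ} (h : ∀ i ≤ m, coeff i y = 0) :
    coeff m (x * y) = 0 := by
  rw [coeff_mul]
  exact Finset.sum_eq_zero fun p hp => by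
    rw [h _ (antidiagonal_snd_le hp), mul_zero]

theorem coeff_pow_eq_zero_of_constantCoeff {y : C⟦X⟧} (hy : coeff 0 y = 0) {m r : ℕ} (h : m < r) :
    coeff m (y ^ r) = 0 := by
  induction r generalizing m with
  | zero => omega
  | succ r ih =>
    rw [pow_succ, coeff_mul]
    refine Finset.sum_eq_zero fun p hp => ?_
    rw [Finset.HasAntidiagonal.mem_antidiagonal] at hp
    rcases Nat.eq_zero_or_pos p.2 with h0 | h0
    · rw [h0, hy, mul_zero]
    · rw [ih (by omega), zero_mul]

/-- If `x ^ k` has zero constant term, the `(m + 1)`-st power of it has no coefficients up to `m`.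
-/
theorem isSmall_of_isNilpotent {x : C⟦X⟧} (h : IsNilpotent (coeff 0 x)) : IsSmall x := by
  obtain ⟨k, hk⟩ := h
  refine ⟨k, fun m r hr => ?_⟩
  have h0 : coeff 0 (x ^ k) = 0 := by
    rw [coeff_zero_eq_constantCoeff_apply] at hk ⊢
    rw [map_pow, hk]
  rw [← Nat.add_sub_of_le hr, pow_add, pow_mul]
  exact coeff_mul_eq_zero_of_le fun i hi =>
    coeff_pow_eq_zero_of_constantCoeff h0 (by omega)

theorem isSmall_of_coeff_zero {x : C⟦X⟧} (h : coeff 0 x = 0) : IsSmall x :=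
  isSmall_of_isNilpotent (by rw [h]; exact IsNilpotent.zero)

variable (φ : B →+* C⟦X⟧) (x : C⟦X⟧)

/-- The bound for the exponents which contribute to a coefficient. -/
def smallBound {x : C⟦X⟧} (hx : IsSmall x) (m : ℕ) : ℕ := hx.choose * (m + 1)

theorem coeff_pow_of_smallBound {x : C⟦X⟧} (hx : IsSmall x) {m r : ℕ} (h : smallBound hx m ≤ r)
    {i : ℕ} (hi : i ≤ m) : coeff i (x ^ r) = 0 :=
  hx.choose_spec i r ((Nat.mul_le_mul_left _ (by omega)).trans h)

theorem coeff_eval₂_eq {x : C⟦X⟧} (hx : IsSmall x) {m : ℕ} {p q : Polynomial B}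
    (h : ∀ r < smallBound hx m, p.coeff r = q.coeff r) :
    coeff m (p.eval₂ φ x) = coeff m (q.eval₂ φ x) := by
  have hz : ∀ p : Polynomial B, (∀ r < smallBound hx m, p.coeff r = 0) →
      coeff m (p.eval₂ φ x) = 0 := by
    intro p hp
    rw [Polynomial.eval₂_eq_sum, Polynomial.sum, map_sum]
    refine Finset.sum_eq_zero fun r _ => ?_
    by_cases hr : r < smallBound hx m
    · rw [hp r hr, map_zero, zero_mul, map_zero]
    · exact coeff_mul_eq_zero_of_le' fun i hi => coeff_pow_of_smallBound hx (not_lt.1 hr) hi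
  have := hz (p - q) fun r hr => by rw [Polynomial.coeff_sub, h r hr, sub_self]
  rwa [Polynomial.eval₂_sub, map_sub, sub_eq_zero] at this

variable {x}

/-- The ring homomorphism `∑ f_r X^r ↦ ∑ φ(f_r) x^r`. -/
def ev (hx : IsSmall x) (hφ : ∀ b, Commute (φ b) x) : B⟦X⟧ →+* C⟦X⟧ where
  toFun f := PowerSeries.mk fun m => coeff m ((trunc (smallBound hx m) f).eval₂ φ x)
  map_one' := by
    ext m
    rw [coeff_mk, ← Polynomial.eval₂_one φ x]
    refine coeff_eval₂_eq φ hx fun r hr => ?_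
    rw [coeff_trunc, if_pos hr, Polynomial.coeff_one, coeff_one]
  map_mul' f g := by
    ext m
    rw [coeff_mk, coeff_mul]
    -- All coefficients with index at most `m` can be computed from the truncation chosen for `m`,
    -- so multiplicativity reduces to that of polynomial evaluation.
    have h1 : ∀ p ∈ Finset.HasAntidiagonal.antidiagonal m,
        coeff p.1 (PowerSeries.mk fun m => coeff m ((trunc (smallBound hx m) f).eval₂ φ x)) *
          coeff p.2 (PowerSeries.mk fun m => coeff m ((trunc (smallBound hx m) g).eval₂ φ x)) =
        coeff p.1 ((trunc (smallBound hx m) f).eval₂ φ x) *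
          coeff p.2 ((trunc (smallBound hx m) g).eval₂ φ x) := by
      intro p hp
      rw [coeff_mk, coeff_mk]
      have hle : ∀ i ≤ m, ∀ f : B⟦X⟧, coeff i ((trunc (smallBound hx i) f).eval₂ φ x) =
          coeff i ((trunc (smallBound hx m) f).eval₂ φ x) := by
        intro i hi f
        refine coeff_eval₂_eq φ hx fun r hr => ?_
        have hr' : r < smallBound hx m := hr.trans_le (Nat.mul_le_mul_left _ (by omega))
        rw [coeff_trunc, coeff_trunc, if_pos hr, if_pos hr']
      rw [hle _ (antidiagonal_fst_le hp), hle _ (antidiagonal_snd_le hp)]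
    rw [Finset.sum_congr rfl h1, ← coeff_mul,
      ← Polynomial.eval₂_mul_noncomm φ x fun k => hφ _]
    refine coeff_eval₂_eq φ hx fun r hr => ?_
    rw [coeff_trunc, if_pos hr, coeff_mul, Polynomial.coeff_mul]
    refine Finset.sum_congr rfl fun p hp => ?_
    rw [coeff_trunc, coeff_trunc, if_pos ((antidiagonal_fst_le hp).trans_lt hr),
      if_pos ((antidiagonal_snd_le hp).trans_lt hr)]
  map_zero' := by
    ext m
    rw [coeff_mk, map_zero, Polynomial.eval₂_zero]
  map_add' f g := by
    ext m
    simp only [coeff_mk, map_add, Polynomial.eval₂_add]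

variable {φ}

theorem coeff_ev (hx : IsSmall x) (hφ : ∀ b, Commute (φ b) x) (f : B⟦X⟧) (m : ℕ) {R : ℕ}
    (hR : ∀ i ≤ m, ∀ r, R ≤ r → coeff i (x ^ r) = 0) :
    coeff m (ev φ hx hφ f) = ∑ r ∈ Finset.range R, coeff m (φ (coeff r f) * x ^ r) := by
  have h0 : coeff m (ev φ hx hφ f) = coeff m ((trunc (smallBound hx m) f).eval₂ φ x) := by
    show coeff m (PowerSeries.mk fun m => coeff m ((trunc (smallBound hx m) f).eval₂ φ x)) = _
    rw [coeff_mk]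
  rw [h0]
  have h1 : coeff m ((trunc (smallBound hx m) f).eval₂ φ x) =
      coeff m ((trunc (max R (smallBound hx m)) f).eval₂ φ x) := by
    refine coeff_eval₂_eq φ hx fun r hr => ?_
    rw [coeff_trunc, coeff_trunc, if_pos hr, if_pos (hr.trans_le (le_max_right _ _))]
  rw [h1, eval₂_trunc_eq_sum_range, map_sum]
  refine (Finset.sum_subset (Finset.range_mono (le_max_left _ _)) fun r _ hr => ?_).symm
  rw [Finset.mem_range, not_lt] at hr
  exact coeff_mul_eq_zero_of_le' fun i hi => hR i hi r hr

theorem eq_sum_add (f : B⟦X⟧) (R : ℕ) :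
    ∃ g : B⟦X⟧, f = ∑ r ∈ Finset.range R, PowerSeries.C (coeff r f) * X ^ r + X ^ R * g := by
  refine ⟨PowerSeries.mk fun i => coeff (i + R) f, ?_⟩
  ext m
  rw [map_add, map_sum]
  simp only [coeff_C_mul, coeff_X_pow, mul_ite, mul_one, mul_zero, Finset.sum_ite_eq,
    Finset.mem_range]
  rw [coeff_X_pow_mul', coeff_mk]
  split_ifs with h1 h2 h2
  · omega
  · rw [add_zero]
  · rw [Nat.sub_add_cancel h2, zero_add]
  · omega

theorem map_series_eq {D : Type*} [Ring D] (F : B⟦X⟧ →+* D) (f : B⟦X⟧) (R : ℕ) :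
    ∃ g, F f = ∑ r ∈ Finset.range R, F (PowerSeries.C (coeff r f)) * F X ^ r + F X ^ R * F g := by
  obtain ⟨g, hg⟩ := eq_sum_add f R
  refine ⟨g, ?_⟩
  conv_lhs => rw [hg]
  simp only [map_add, map_sum, map_mul, map_pow]

theorem coeff_map_series (F : B⟦X⟧ →+* C⟦X⟧) (f : B⟦X⟧) {m R : ℕ}
    (h : ∀ i ≤ m, coeff i (F X ^ R) = 0) :
    coeff m (F f) = ∑ r ∈ Finset.range R, coeff m (F (PowerSeries.C (coeff r f)) * F X ^ r) := by
  obtain ⟨g, hg⟩ := map_series_eq F f R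
  rw [hg, map_add, coeff_mul_eq_zero_of_le h, add_zero, map_sum]

/-- No continuity is assumed: `f` is a polynomial plus `X ^ R * g`, and whatever the image of `g`,
its product with a high power of the small element `F X` does not affect the given coefficient. This
is the tool for comparing compositions of substitutions. -/
theorem hom_eq_of_isSmall {F F' : B⟦X⟧ →+* C⟦X⟧} (hs : IsSmall (F X))
    (hC : ∀ b, F (PowerSeries.C b) = F' (PowerSeries.C b)) (hX : F X = F' X) : F = F' := by
  ext f m
  have h : ∀ i ≤ m, coeff i (F X ^ smallBound hs m) = 0 := fun i hi =>
    coeff_pow_of_smallBound hs le_rfl hi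
  have h' : ∀ i ≤ m, coeff i (F' X ^ smallBound hs m) = 0 := by rwa [← hX]
  rw [coeff_map_series F f h, coeff_map_series F' f h']
  simp only [hC, hX]

theorem hom_eq_of_isNilpotent {D : Type*} [Ring D] {F F' : B⟦X⟧ →+* D} (hs : IsNilpotent (F X))
    (hC : ∀ b, F (PowerSeries.C b) = F' (PowerSeries.C b)) (hX : F X = F' X) : F = F' := by
  ext f
  obtain ⟨k, hk⟩ := hs
  obtain ⟨g, hg⟩ := map_series_eq F f k
  obtain ⟨g', hg'⟩ := map_series_eq F' f k
  rw [hg, hg', ← hX, hk, zero_mul, zero_mul]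
  simp only [hC]

@[simp] theorem ev_C (hx : IsSmall x) (hφ : ∀ b, Commute (φ b) x) (b : B) :
    ev φ hx hφ (PowerSeries.C b) = φ b := by
  ext m
  rw [coeff_ev hx hφ _ m (R := smallBound hx m + 1) fun i hi r hr =>
    coeff_pow_of_smallBound hx (by omega) hi]
  rw [Finset.sum_range_succ']
  simp [coeff_C]

@[simp] theorem ev_X (hx : IsSmall x) (hφ : ∀ b, Commute (φ b) x) : ev φ hx hφ X = x := by
  ext m
  rw [coeff_ev hx hφ _ m (R := smallBound hx m + 2) fun i hi r hr =>
    coeff_pow_of_smallBound hx (by omega) hi]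
  rw [Finset.sum_range_succ', Finset.sum_range_succ']
  simp [coeff_X]

end Evaluation

/-! ### Substitutions as homomorphisms -/

section Substitution

variable {B C : Type*} [Ring B] [Ring C]

/-- The expansion of `1/(αu + β)` written as `l (1 + aβ u⁻¹) = a u⁻¹`; homomorphisms preserve this
equation, so it characterizes the expansion after substitutions. -/
theorem linInv_mul {a β : B} (h : Commute a β) :
    linInv a β * (1 + PowerSeries.C (a * β) * X) = PowerSeries.C a * X := by
  ext m
  rw [mul_add, mul_one, ← mul_assoc, map_add, coeff_C_mul]
  cases m with
  | zero => simp [linInv]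
  | succ m =>
    rw [coeff_succ_mul_X, coeff_mul_C, linInv, coeff_mk, coeff_mk, coeff_X]
    rcases m with _ | m
    · simp
    · simp only [Nat.add_eq_zero_iff, one_ne_zero, and_false, if_false, Nat.add_sub_cancel,
        Nat.add_eq_right, mul_zero]
      have h1 : Commute (-β) (a * β) := (h.symm.mul_right (Commute.refl β)).neg_left
      rw [mul_assoc, ((h1.pow_left m)).eq, ← mul_assoc, ← mul_assoc, ← pow_succ, pow_succ (-β),
        mul_assoc]
      have h2 : β * (-β) ^ m = - ((-β) ^ m * -β) := by
        rw [mul_neg, neg_neg]; exact ((Commute.refl β).neg_right.pow_right m).eq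
      rw [h2]; simp

theorem subInv_eq_ev (a β : B) (h : ∀ b, Commute (PowerSeries.C b) (linInv a β)) (f : B⟦X⟧) :
    subInv a β f =
      ev PowerSeries.C (isSmall_of_coeff_zero (linInv_constCoeff a β)) h f := by
  ext m
  rw [coeff_ev _ _ _ m (R := m + 1) fun i hi r hr =>
    coeff_pow_eq_zero_of_constantCoeff (linInv_constCoeff a β) (by omega)]
  simp [subInv]

theorem commute_C_linInv {a β : B} (ha : ∀ b, Commute a b) (hβ : ∀ b, Commute β b) (b : B) :
    Commute (PowerSeries.C b) (linInv a β) := by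
  ext m
  rw [coeff_C_mul, coeff_mul_C, linInv, coeff_mk]
  split_ifs
  · simp
  · exact (((ha b).pow_left _).mul_left ((hβ b).neg_left.pow_left _)).symm.eq

/-- The substitution `u ↦ α u + β` for central elements. -/
def subInvHom (a β : B) (ha : ∀ b, Commute a b) (hβ : ∀ b, Commute β b) : B⟦X⟧ →+* B⟦X⟧ :=
  ev PowerSeries.C (isSmall_of_coeff_zero (linInv_constCoeff a β)) (commute_C_linInv ha hβ)

theorem subInvHom_apply {a β : B} (ha : ∀ b, Commute a b) (hβ : ∀ b, Commute β b) (f : B⟦X⟧) :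
    subInvHom a β ha hβ f = subInv a β f := (subInv_eq_ev a β _ f).symm

theorem linInv_map (φ : B →+* C) (a β : B) :
    (linInv a β).map φ = linInv (φ a) (φ β) := by
  ext m
  simp only [linInv, coeff_map, coeff_mk]
  split_ifs <;> simp

theorem subInv_map (φ : B →+* C) (a β : B) (f : B⟦X⟧) :
    (subInv a β f).map φ = subInv (φ a) (φ β) (f.map φ) := by
  ext m
  simp only [subInv, coeff_map, coeff_mk, map_sum, map_mul, ← linInv_map, ← map_pow]

theorem ev_negVar {φ : B →+* C⟦X⟧} {x : C⟦X⟧} (hx : IsSmall x) (hφ : ∀ b, Commute (φ b) x)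
    (hx' : IsSmall (-x)) (hφ' : ∀ b, Commute (φ b) (-x)) (f : B⟦X⟧) :
    ev φ hx hφ (negVar f) = ev φ hx' hφ' f := by
  ext m
  rw [coeff_ev hx hφ _ m (R := max (smallBound hx m) (smallBound hx' m)) fun i hi r hr =>
      coeff_pow_of_smallBound hx ((le_max_left _ _).trans hr) hi,
    coeff_ev hx' hφ' _ m (R := max (smallBound hx m) (smallBound hx' m)) fun i hi r hr =>
      coeff_pow_of_smallBound hx' ((le_max_right _ _).trans hr) hi]
  refine Finset.sum_congr rfl fun r _ => ?_
  rw [negVar, coeff_mk, neg_pow x, map_mul φ, map_pow φ, map_neg φ, map_one φ]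
  rcases neg_one_pow_eq_or (C⟦X⟧) r with h | h <;> rw [h] <;> simp

end Substitution

/-! ### The normalizing series -/

section NormalizingSeries

variable {N : ℕ}

/-- If the coefficients of `u⁻¹, …, u^{-(m-1)}` vanish, the coefficient of `u^{-m-1}` in `f(u + N) -
f(u)` is `-mN` times that of `u^{-m}` in `f`. -/
theorem shift_invariant_eq_one (hN : N ≠ 0) {f : ℂ⟦X⟧} (h0 : coeff 0 f = 1)
    (h : subInv 1 (N : ℂ) f = f) : f = 1 := by
  ext m
  induction m using Nat.strong_induction_on with
  | _ m ih =>
    rcases Nat.eq_zero_or_pos m with rfl | hm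
    · rw [h0, coeff_zero_one]
    · have h1 := congrArg (coeff (m + 1)) h
      have hs : ∀ r, coeff (m + 1) (linInv (1 : ℂ) (N : ℂ) ^ r) = shiftCoeff N r (m + 1) :=
        fun _ => rfl
      simp only [subInv, coeff_mk, hs] at h1
      rw [Finset.sum_range_succ, Finset.sum_range_succ, shiftCoeff_self, shiftCoeff_succ,
        Finset.sum_eq_single_of_mem 0 (by simpa using hm), mul_one] at h1
      · have h2 : shiftCoeff N 0 (m + 1) = 0 := by simp [shiftCoeff, coeff_one]
        rw [h2, mul_zero, zero_add, add_eq_right] at h1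
        have hm' : (m : ℂ) ≠ 0 := by exact_mod_cast hm.ne'
        have hN' : (N : ℂ) ≠ 0 := by exact_mod_cast hN
        rw [coeff_one, if_neg hm.ne']
        rcases mul_eq_zero.1 h1 with h | h
        · exact h
        · exact absurd h (neg_ne_zero.2 (mul_ne_zero hm' hN'))
      · intro r hr hr0
        rw [ih r (Finset.mem_range.1 hr), coeff_one, if_neg hr0, zero_mul]

/-- The substitution `u ↦ -u`. -/
def negHom : ℂ⟦X⟧ →+* ℂ⟦X⟧ :=
  ev PowerSeries.C (x := -X) (isSmall_of_coeff_zero (by simp)) fun _ => Commute.all _ _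

theorem negHom_apply (f : ℂ⟦X⟧) : negHom f = negVar f := by
  ext m
  rw [negHom, coeff_ev _ _ _ m (R := m + 1) fun i hi r hr =>
    coeff_pow_eq_zero_of_constantCoeff (by simp) (by omega)]
  have h1 : ∀ r, (-1 : ℂ⟦X⟧) ^ r = PowerSeries.C ((-1) ^ r) := fun r => by simp
  simp only [neg_pow X, coeff_C_mul, negVar, coeff_mk, h1, coeff_X_pow, mul_ite, mul_one, mul_zero,
    Finset.sum_ite_eq, Finset.mem_range, Nat.lt_succ_self, if_true]
  exact mul_comm _ _

/-- The substitution `u ↦ u + N`. -/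
def shiftHom (N : ℕ) : ℂ⟦X⟧ →+* ℂ⟦X⟧ :=
  subInvHom 1 (N : ℂ) (fun _ => Commute.all _ _) fun _ => Commute.all _ _

theorem linInv_one_mul (b : ℂ) : linInv 1 b * (1 + PowerSeries.C b * X) = X := by
  have := linInv_mul (Commute.all 1 b)
  rwa [one_mul, map_one, one_mul] at this

theorem shiftHom_X : shiftHom N X = linInv 1 (N : ℂ) :=
  ev_X _ fun _ => Commute.all _ _

theorem shiftHom_C (b : ℂ) : shiftHom N (PowerSeries.C b) = PowerSeries.C b :=
  ev_C _ (fun _ => Commute.all _ _) _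

theorem negHom_X : negHom X = -X := ev_X _ _

theorem negHom_C (b : ℂ) : negHom (PowerSeries.C b) = PowerSeries.C b := ev_C _ _ _

/-- The unitarity property of the normalizing series. -/
theorem gSeries_unitarity (hN : N ≠ 0) :
    gSeries N * negHom (gSeries N) * (1 - X ^ 2) = 1 := by
  obtain ⟨hg0, hg⟩ := gSeries_isNormalizing N hN
  set g := gSeries N
  have hσ : shiftHom N g = g * (1 - X ^ 2) := by
    rw [← hg]; exact subInvHom_apply _ _ _
  -- The product `g(u) g(-u) (1 - u⁻²)` has constant term 1 and is invariant under `u ↦ u + N`.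
  refine shift_invariant_eq_one hN ?_ ?_
  · rw [coeff_zero_eq_constantCoeff_apply] at hg0 ⊢
    have : constantCoeff (negHom g) = 1 := by
      rw [negHom_apply, ← coeff_zero_eq_constantCoeff_apply, negVar, coeff_mk,
        coeff_zero_eq_constantCoeff_apply, hg0]
      simp
    simp [hg0, this]
  · have hl := linInv_one_mul (N : ℂ)
    -- The shift, the reflection `u ↦ -u` and the shift again compose to the reflection; this turns
    -- the functional equation of `g` into one for `g(-u)`.
    have hcomp : ((shiftHom N).comp negHom).comp (shiftHom N) = negHom := by
      refine hom_eq_of_isSmall ?_ ?_ ?_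
      · refine isSmall_of_coeff_zero ?_
        rw [RingHom.comp_apply, RingHom.comp_apply, shiftHom_X]
        have h1 := congrArg (fun f => constantCoeff (((shiftHom N).comp negHom) f)) hl
        simp only [map_mul, map_add, map_one, RingHom.comp_apply, negHom_C, shiftHom_C, negHom_X,
          map_neg, shiftHom_X] at h1
        have h2 : constantCoeff (linInv 1 (N : ℂ)) = 0 :=
          (coeff_zero_eq_constantCoeff_apply _).symm.trans (linInv_constCoeff _ _)
        rw [h2] at h1
        simpa using h1
      · intro b
        simp [shiftHom_C, negHom_C]
      · rw [RingHom.comp_apply, RingHom.comp_apply, shiftHom_X, negHom_X]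
        have h1 := congrArg (fun f => ((shiftHom N).comp negHom) f) hl
        simp only [map_mul, map_add, map_one, RingHom.comp_apply, negHom_C, shiftHom_C, negHom_X,
          map_neg, shiftHom_X] at h1
        set l := linInv 1 (N : ℂ)
        set y := shiftHom N (negHom l)
        have h3 : y * (1 - PowerSeries.C (N : ℂ) * l) = -X * (1 - PowerSeries.C (N : ℂ) * l) := by
          linear_combination h1 - hl
        refine mul_right_cancel₀ ?_ h3
        intro h4
        have h5 := congrArg constantCoeff h4
        have h2 : constantCoeff l = 0 :=
          (coeff_zero_eq_constantCoeff_apply _).symm.trans (linInv_constCoeff _ _)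
        simp [h2] at h5
    have h1 := congrArg (fun f => shiftHom N (negHom f)) hσ
    have h2 : shiftHom N (negHom (shiftHom N g)) = negHom g := RingHom.congr_fun hcomp g
    simp only [h2, map_mul, map_sub, map_one, map_pow, negHom_X, neg_sq] at h1
    have h3 : subInv 1 (N : ℂ) (g * negHom g * (1 - X ^ 2)) =
        shiftHom N (g * negHom g * (1 - X ^ 2)) := (subInvHom_apply _ _ _).symm
    rw [h3, map_mul, map_mul, hσ, map_sub, map_pow, map_one, mul_assoc, ← h1]
    ring

end NormalizingSeries

/-! ### Evaluation at nilpotent elements -/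

section Nilpotent

variable {S S' : Type*} [CommRing S] [Algebra ℂ S] [CommRing S'] [Algebra ℂ S']

/-- The evaluation of power series at a nilpotent element. -/
def nev (y : S) (hy : IsNilpotent y) : ℂ⟦X⟧ →+* S :=
  constantCoeff.comp (ev (PowerSeries.C.comp (algebraMap ℂ S)) (x := PowerSeries.C y)
    (isSmall_of_isNilpotent (by simpa using hy)) fun _ => Commute.all _ _)

@[simp] theorem nev_X (y : S) (hy : IsNilpotent y) : nev y hy X = y := by
  rw [nev, RingHom.comp_apply, ev_X, constantCoeff_C]

@[simp] theorem nev_C (y : S) (hy : IsNilpotent y) (b : ℂ) :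
    nev y hy (PowerSeries.C b) = algebraMap ℂ S b := by
  rw [nev, RingHom.comp_apply, ev_C, RingHom.comp_apply, constantCoeff_C]

theorem hom_eq_nev {y : S} (hy : IsNilpotent y) {F : ℂ⟦X⟧ →+* S}
    (hC : ∀ b, F (PowerSeries.C b) = algebraMap ℂ S b) (hX : F X = y) : F = nev y hy :=
  hom_eq_of_isNilpotent (by rwa [hX]) (by simpa using hC) (by simpa using hX)

theorem nev_eq_sum (y : S) (hy : IsNilpotent y) {k : ℕ} (hk : y ^ k = 0) (f : ℂ⟦X⟧) :
    nev y hy f = ∑ r ∈ Finset.range k, algebraMap ℂ S (coeff r f) * y ^ r := by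
  obtain ⟨g, hg⟩ := map_series_eq (nev y hy) f k
  rw [hg, nev_X, hk, zero_mul, add_zero]
  simp

variable (N : ℕ)

open Classical in
/-- The value of the normalizing series at a nilpotent element. -/
def gam (y : S) : S := if hy : IsNilpotent y then nev y hy (gSeries N) else 0

theorem gam_eq {y : S} (hy : IsNilpotent y) : gam N y = nev y hy (gSeries N) := by
  rw [gam, dif_pos hy]

theorem gam_eq_of_hom {y : S} (hy : IsNilpotent y) {F : ℂ⟦X⟧ →+* S}
    (hC : ∀ b, F (PowerSeries.C b) = algebraMap ℂ S b) (hX : F X = y) :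
    gam N y = F (gSeries N) := by
  rw [gam_eq N hy, hom_eq_nev hy hC hX]

variable {N}

theorem gam_unitarity (hN : N ≠ 0) {y : S} (hy : IsNilpotent y) :
    gam N y * gam N (-y) * (1 - y ^ 2) = 1 := by
  have h := congrArg (nev y hy) (gSeries_unitarity hN)
  have h1 : gam N (-y) = nev y hy (negHom (gSeries N)) :=
    gam_eq_of_hom N hy.neg (F := (nev y hy).comp negHom) (fun b => by simp [negHom_C])
      (by simp [negHom_X])
  rw [map_mul, map_mul, map_sub, map_one, map_pow, nev_X, ← gam_eq, ← h1] at h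
  exact h

/-- For `y = h/w` and `z = h/w'` the relation is `w' = -w + hN`. The functional equation at `-w/h`
expresses `g(w'/h)` through `g(-w/h)`, and unitarity finishes. -/
theorem gam_crossing (hN : N ≠ 0) {y z : S} (hy : IsNilpotent y) (hz : IsNilpotent z)
    (h : y + z = N * (y * z)) : gam N y * gam N z = 1 := by
  obtain ⟨-, hg⟩ := gSeries_isNormalizing N hN
  have h1 : gam N z = nev (-y) hy.neg (shiftHom N (gSeries N)) := by
    refine gam_eq_of_hom N hz (F := (nev (-y) hy.neg).comp (shiftHom N))
      (fun b => by simp [shiftHom_C]) ?_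
    rw [RingHom.comp_apply, shiftHom_X]
    have hl := congrArg (nev (-y) hy.neg) (linInv_one_mul (N : ℂ))
    rw [map_mul, map_add, map_one, map_mul, nev_C, nev_X] at hl
    have hu : IsUnit (1 + algebraMap ℂ S N * -y) :=
      ((Commute.all _ _).isNilpotent_mul_left hy.neg).isUnit_one_add
    refine hu.mul_right_cancel ?_
    rw [hl, map_natCast]
    linear_combination -h
  have h2 : shiftHom N (gSeries N) = gSeries N * (1 - X ^ 2) := by
    rw [← hg]; exact subInvHom_apply _ _ _
  have h3 := gam_unitarity hN hy
  rw [h1, h2, map_mul, ← gam_eq, map_sub, map_one, map_pow, nev_X, neg_sq, ← mul_assoc, h3]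

/-! ### Families of values of the `R`-matrix -/

/-- The denominators `w₀ + (k c / 2 - d) η` with `c = - N / 2`. -/
def famDen (N : ℕ) (w η : S) (k d : ℤ) : S :=
  w + algebraMap ℂ S (-(d : ℂ) - k * N / 4) * η

/-- The quotient of `η` by `famDen`. -/
def famVal (N : ℕ) (w η : S) (k d : ℤ) : S := η * Ring.inverse (famDen N w η k d)

/-- The data of the `R`-matrices at the points of a family. -/
def famP (N : ℕ) (w η : S) (k d : ℤ) : S × S := (gam N (famVal N w η k d), famVal N w η k d)

/-- The data of the `R`-matrices at the opposite points. -/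
def famQ (N : ℕ) (w η : S) (k d : ℤ) : S × S := (gam N (-famVal N w η k d), -famVal N w η k d)

variable {w η : S} (hw : IsUnit w) (hη : IsNilpotent η)

include hη

theorem isNilpotent_famVal (k d : ℤ) : IsNilpotent (famVal N w η k d) :=
  (Commute.all _ _).isNilpotent_mul_right hη

include hw

theorem isUnit_famDen (k d : ℤ) : IsUnit (famDen N w η k d) :=
  IsNilpotent.isUnit_add_left_of_commute ((Commute.all _ _).isNilpotent_mul_left hη) hw
    (Commute.all _ _)

theorem famVal_mul (k d : ℤ) : famVal N w η k d * famDen N w η k d = η := by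
  rw [famVal, mul_assoc, Ring.inverse_mul_cancel _ (isUnit_famDen hw hη k d), mul_one]

theorem eq_famVal {k d : ℤ} {y : S} (h : y * famDen N w η k d = η) : y = famVal N w η k d :=
  (isUnit_famDen hw hη k d).mul_right_cancel (h.trans (famVal_mul hw hη k d).symm)

/-- Both types of relations between values follow from affine relations between denominators:
lowering `k` by 4 adds `Nη`, the crossing shift, and a change of `d` adds an integral multiple of
`η`. The unit denominators are cleared. -/
theorem isRFamily_fam (hN : N ≠ 0) : IsRFamily N (famP N w η) (famQ N w η) := by
  have hc : ∀ k d, -famVal N w η k d + famVal N w η (k - 4) d =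
      N * (-famVal N w η k d * famVal N w η (k - 4) d) := by
    intro k d
    have h1 := famVal_mul hw hη (N := N) k d
    have h2 := famVal_mul hw hη (N := N) (k - 4) d
    refine (isUnit_famDen hw hη (N := N) k d).mul_right_cancel
      ((isUnit_famDen hw hη (N := N) (k - 4) d).mul_right_cancel ?_)
    have h3 : famDen N w η (k - 4) d = famDen N w η k d + N * η := by
      rw [famDen, famDen, add_assoc, ← map_natCast (algebraMap ℂ S) N, ← add_mul, ← map_add]
      congr 3
      push_cast; ring
    generalize famVal N w η k d = a at *
    generalize famVal N w η (k - 4) d = b at *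
    generalize famDen N w η k d = A at *
    generalize famDen N w η (k - 4) d = B at *
    linear_combination (-B + N * b * B) * h1 + (A + N * η) * h2 - η * h3
  refine ⟨fun k d e => ?_, fun k d => rfl, fun k d => gam_unitarity hN (isNilpotent_famVal hη k d),
    fun k d => gam_crossing hN (isNilpotent_famVal hη k d).neg (isNilpotent_famVal hη _ d) (hc k d),
    hc⟩
  show famVal N w η k d - famVal N w η k e = _ * (famVal N w η k d * famVal N w η k e)
  have h1 := famVal_mul hw hη (N := N) k d
  have h2 := famVal_mul hw hη (N := N) k e
  refine (isUnit_famDen hw hη (N := N) k d).mul_right_cancel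
    ((isUnit_famDen hw hη (N := N) k e).mul_right_cancel ?_)
  have h3 : famDen N w η k e = famDen N w η k d + ((d - e : ℤ) : S) * η := by
    rw [famDen, famDen, add_assoc, ← map_intCast (algebraMap ℂ S) (d - e), ← add_mul, ← map_add]
    congr 3
    push_cast; ring
  generalize famVal N w η k d = a at *
  generalize famVal N w η k e = b at *
  generalize famDen N w η k d = A at *
  generalize famDen N w η k e = B at *
  generalize ((d - e : ℤ) : S) = D at *
  linear_combination (B - D * b * B) * h1 + (-A - D * η) * h2 + η * h3

end Nilpotent

/-! ### Two factors -/

section TwoLegs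

variable {N n : ℕ} {R : Type*} [Ring R]

theorem ite_eq_ite {α : Type*} {P Q : Prop} {hP : Decidable P} {hQ : Decidable Q} (hPQ : P ↔ Q)
    (x y : α) : (if P then x else y) = if Q then x else y := by
  by_cases hp : P
  · rw [if_pos hp, if_pos (hPQ.1 hp)]
  · rw [if_neg hp, if_neg (mt hPQ.2 hp)]

theorem leg_eq_legOn (i : Fin n) (M : Matrix (Fin N) (Fin N) R) : leg i M = legOn i M := by
  ext a b
  exact ite_eq_ite Iff.rfl _ _

theorem leg₂_permP {i j : Fin n} (hij : i ≠ j) :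
    leg₂ i j (permP N R) = permOn R N (Equiv.swap i j) := by
  ext a b
  rw [permOn_swap_apply hij]
  simp only [leg₂, permP, Matrix.of_apply, ← ite_and]
  exact ite_eq_ite ⟨fun h => ⟨h.2.1, h.2.2.symm ▸ rfl, h.1⟩, fun h => ⟨h.2.2, h.1, h.2.1.symm ▸ rfl⟩⟩
    _ _

theorem leg₂_ptranspose_permP {i j : Fin n} :
    leg₂ i j (ptranspose (permP N R)) = qOn R N i j := by
  ext a b
  simp only [leg₂, ptranspose, permP, qOn, Matrix.of_apply, ← ite_and]
  exact ite_eq_ite ⟨fun h => ⟨h.2.2.symm, h.2.1, h.1⟩, fun h => ⟨h.2.2, h.2.1, h.1.symm⟩⟩ _ _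

theorem leg₂_one (i j : Fin n) :
    leg₂ i j (1 : Matrix (Fin N × Fin N) (Fin N × Fin N) R) = 1 := by
  ext a b
  simp only [leg₂, Matrix.of_apply, Matrix.one_apply, Prod.mk.injEq, ← ite_and]
  refine if_congr ⟨fun h => funext fun k => ?_, fun h => by simp [h]⟩ rfl rfl
  by_cases hi : k = i
  · subst hi; exact h.2.1
  · by_cases hj : k = j
    · subst hj; exact h.2.2
    · exact h.1 k hi hj

theorem leg₂_smul (i j : Fin n) (z : R) (M : Matrix (Fin N × Fin N) (Fin N × Fin N) R) :
    leg₂ i j (z • M) = z • leg₂ i j M := by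
  ext a b
  simp only [leg₂, Matrix.of_apply, Matrix.smul_apply]
  split_ifs <;> simp

theorem leg₂_sub (i j : Fin n) (M M' : Matrix (Fin N × Fin N) (Fin N × Fin N) R) :
    leg₂ i j (M - M') = leg₂ i j M - leg₂ i j M' := by
  ext a b
  simp only [leg₂, Matrix.of_apply, Matrix.sub_apply]
  split_ifs <;> simp

theorem leg₂_smul_one_sub {i j : Fin n} (hij : i ≠ j) (γ y : R) :
    leg₂ i j (γ • (1 - y • permP N R)) = γ • (1 - y • permOn R N (Equiv.swap i j)) := by
  rw [leg₂_smul, leg₂_sub, leg₂_smul, leg₂_one, leg₂_permP hij]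

theorem leg₂_ptranspose_smul_one_sub {i j : Fin n} (γ y : R) :
    leg₂ i j (ptranspose (γ • (1 - y • permP N R))) = γ • (1 - y • qOn R N i j) := by
  have h : ptranspose (γ • (1 - y • permP N R)) = γ • (1 - y • ptranspose (permP N R)) := by
    ext p q
    simp only [ptranspose, Matrix.of_apply, Matrix.smul_apply, Matrix.sub_apply, Matrix.one_apply,
      Prod.ext_iff]
    congr 2
    exact if_congr ⟨fun h => ⟨h.1.symm, h.2⟩, fun h => ⟨h.1.symm, h.2⟩⟩ rfl rfl
  rw [h, leg₂_smul, leg₂_sub, leg₂_smul, leg₂_one, leg₂_ptranspose_permP]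

theorem map_smul_one_sub {R' : Type*} [Ring R'] (φ : R →+* R') {ι : Type*} [Fintype ι]
    [DecidableEq ι] (γ y : R) (M : Matrix ι ι R) :
    (γ • (1 - y • M)).map φ = φ γ • (1 - φ y • M.map φ) := by
  ext a b
  simp only [Matrix.map_apply, Matrix.smul_apply, Matrix.sub_apply, Matrix.one_apply, smul_eq_mul,
    map_mul, map_sub]
  split_ifs <;> simp

theorem map_smul_one_sub_smul {R' : Type*} [Ring R'] (φ : R →+* R') {ι : Type*} [Fintype ι]
    [DecidableEq ι] (s t : R) (M : Matrix ι ι R) :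
    (s • 1 - t • M).map φ = φ s • 1 - φ t • M.map φ := by
  ext a b
  simp only [Matrix.map_apply, Matrix.smul_apply, Matrix.sub_apply, Matrix.one_apply, smul_eq_mul,
    map_mul, map_sub]
  split_ifs <;> simp

variable {p q : Matrix (Fin N) (Fin N) R} (s t : R)

theorem exchange_left_apply (a b : Fin 2 → Fin N) :
    ((s • 1 - t • permOn R N (Equiv.swap (0 : Fin 2) 1)) * legOn 0 p * legOn 1 q : TMat (Fin 2) N R) a b =
      s * (p (a 0) (b 0) * q (a 1) (b 1)) - t * (p (a 1) (b 0) * q (a 0) (b 1)) := by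
  have h : ∀ a : Fin 2 → Fin N, (legOn 0 p * legOn 1 q : TMat (Fin 2) N R) a b =
      p (a 0) (b 0) * q (a 1) (b 1) := by
    intro a
    rw [legOn_mul_apply, Finset.sum_eq_single (b 0)]
    · congr 1
      rw [legOn, Matrix.of_apply, if_pos]
      · simp
      · intro k hk
        have : k = 0 := by fin_cases k <;> simp_all
        subst this; simp
    · intro x _ hx
      rw [legOn, Matrix.of_apply, if_neg, mul_zero]
      intro h; exact hx (by simpa using h 0 (by simp))
    · simp
  rw [mul_assoc, sub_mul, Matrix.sub_apply, smul_mul_assoc, smul_mul_assoc, one_mul,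
    Matrix.smul_apply, Matrix.smul_apply, permOn_mul_apply, h, h, smul_eq_mul, smul_eq_mul]
  simp

variable {s t} (hs : ∀ x, Commute s x) (ht : ∀ x, Commute t x)

include hs ht

theorem exchange_right_apply (a b : Fin 2 → Fin N) :
    (legOn 1 q * legOn 0 p * (s • 1 - t • permOn R N (Equiv.swap (0 : Fin 2) 1)) : TMat (Fin 2) N R) a b =
      s * (q (a 1) (b 1) * p (a 0) (b 0)) - t * (q (a 1) (b 0) * p (a 0) (b 1)) := by
  have h : ∀ b : Fin 2 → Fin N, (legOn 1 q * legOn 0 p : TMat (Fin 2) N R) a b =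
      q (a 1) (b 1) * p (a 0) (b 0) := by
    intro b
    rw [legOn_mul_apply, Finset.sum_eq_single (b 1)]
    · congr 1
      rw [legOn, Matrix.of_apply, if_pos]
      · simp
      · intro k hk
        have : k = 1 := by fin_cases k <;> simp_all
        subst this; simp
    · intro x _ hx
      rw [legOn, Matrix.of_apply, if_neg, mul_zero]
      intro h; exact hx (by simpa using h 1 (by simp))
    · simp
  have hz : ∀ (z : R), (∀ x, Commute z x) → ∀ M M' : TMat (Fin 2) N R, (M * z • M') = z • (M * M') := by
    intro z hz M M'
    ext a b
    simp only [Matrix.mul_apply, Matrix.smul_apply, smul_eq_mul, Finset.mul_sum]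
    exact Finset.sum_congr rfl fun x _ => by rw [← mul_assoc, ← (hz _).eq, mul_assoc]
  rw [mul_sub, Matrix.sub_apply, hz s hs, hz t ht, mul_one,
    Matrix.smul_apply, Matrix.smul_apply, mul_permOn_apply, h, h, smul_eq_mul, smul_eq_mul]
  simp

/-- In coordinates an RTT relation can be divided, and transported along homomorphisms, entry by
entry. -/
theorem exchange_iff :
    ((s • 1 - t • permOn R N (Equiv.swap (0 : Fin 2) 1)) * legOn 0 p * legOn 1 q : TMat (Fin 2) N R) =
      legOn 1 q * legOn 0 p * (s • 1 - t • permOn R N (Equiv.swap (0 : Fin 2) 1)) ↔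
    ∀ i j k l, s * (p i j * q k l) - t * (p k j * q i l) = s * (q k l * p i j) - t * (q k j * p i l) := by
  constructor
  · intro h i j k l
    have := congrFun (congrFun h ![i, k]) ![j, l]
    rw [exchange_left_apply, exchange_right_apply hs ht] at this
    simpa using this
  · intro h
    ext a b
    rw [exchange_left_apply, exchange_right_apply hs ht]
    exact h _ _ _ _

end TwoLegs

/-- The embedding of two factors. -/
def twoLegs {ι : Type*} (i j : ι) : Fin 2 → ι := ![i, j]

theorem twoLegs_injective {ι : Type*} {i j : ι} (h : i ≠ j) : Function.Injective (twoLegs i j) := by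
  intro a b hab
  fin_cases a <;> fin_cases b <;> simp_all [twoLegs]

/-! ### The defining relations in an algebra -/

section Relations

variable {N : ℕ} {E : Type*} [Ring E] [Algebra K E] (ρ : FreeGen N →ₐ[K] E)

/-- The change of coefficients in series in two variables. -/
abbrev map₂ : (FreeGen N)⟦X⟧⟦X⟧ →+* E⟦X⟧⟦X⟧ :=
  PowerSeries.map (PowerSeries.map (ρ : FreeGen N →+* E))

theorem TMatrix_map (t : Fin N → Fin N → ℕ → FreeGen N) :
    (TMatrix t).map (PowerSeries.map (ρ : FreeGen N →+* E)) = TMatrix fun i j r => ρ (t i j r) := by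
  ext i j m
  simp only [TMatrix, tauMatrix, Matrix.map_apply, Matrix.add_apply, Matrix.smul_apply,
    Matrix.of_apply, coeff_map, map_add, coeff_mk, Matrix.one_apply, coeff_smul]
  split_ifs <;> simp [coeff_one]

theorem TPlusMatrix_map (t : Fin N → Fin N → ℕ → FreeGen N) :
    (TPlusMatrix t).map (PowerSeries.map (ρ : FreeGen N →+* E)) =
      TPlusMatrix fun i j r => ρ (t i j r) := by
  ext i j m
  simp only [TPlusMatrix, tauPlusMatrix, Matrix.map_apply, Matrix.sub_apply, Matrix.smul_apply,
    Matrix.of_apply, coeff_map, map_sub, coeff_mk, Matrix.one_apply, coeff_smul]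
  split_ifs <;> simp [coeff_one]

theorem map₂_inFst (f : (FreeGen N)⟦X⟧) :
    map₂ ρ (inFst f) = inFst (f.map (ρ : FreeGen N →+* E)) := by
  ext r s
  simp [inFst, coeff_C]

theorem map₂_inSnd (f : (FreeGen N)⟦X⟧) :
    map₂ ρ (inSnd f) = inSnd (f.map (ρ : FreeGen N →+* E)) := by
  simp [inSnd]

variable {ρ}

theorem map₂_eq_of_coeff {M M' : TwoVar N}
    (h : ∀ a b r s, ρ (coeff s (coeff r (M a b))) = ρ (coeff s (coeff r (M' a b)))) :
    M.map (map₂ ρ) = M'.map (map₂ ρ) := by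
  ext a b r s
  simpa using h a b r s

/-- The factor of `R̄(u - v + b)`. -/
def mixedFactor (N : ℕ) (b : E) : E⟦X⟧⟦X⟧ :=
  subInv 1 (PowerSeries.C b - X) ((gScaled N).map (algebraMap K E⟦X⟧))

/-- The coefficient `h / (u - v + b)`. -/
def mixedCoeff (b : E) : E⟦X⟧⟦X⟧ := h • linInv 1 (PowerSeries.C b - X)

theorem RbarShift_map (b : FreeGen N) :
    (RbarShift N b).map (map₂ ρ) = mixedFactor N (ρ b) •
      (1 - mixedCoeff (ρ b) • permOn E⟦X⟧⟦X⟧ N (Equiv.swap (0 : Fin 2) 1)) := by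
  rw [RbarShift, Rbar, leg₂_smul_one_sub (by decide), map_smul_one_sub, permOn_map]
  have h1 : PowerSeries.map (ρ : FreeGen N →+* E) (PowerSeries.C b - X) = PowerSeries.C (ρ b) - X := by
    simp
  congr 1
  · rw [map₂, subInv_map, h1, map_one, mixedFactor]
    congr 1
    ext r s
    simp [PowerSeries.algebraMap_apply, coeff_C]
  · congr 2
    rw [mixedCoeff, map₂, ← h1, ← map_one (PowerSeries.map (ρ : FreeGen N →+* E)), ← linInv_map]
    ext r s
    simp

variable (hρ : ∀ x y, DYRel N x y → ρ x = ρ y)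

include hρ

theorem mixed_relation {b : E} (hb : ρ (halfC N) = b) :
    mixedFactor N b • (1 - mixedCoeff b • permOn E⟦X⟧⟦X⟧ N (Equiv.swap (0 : Fin 2) 1)) *
        legOn 0 ((TMatrix fun i j r => ρ (freePos N i j r)).map inFst) *
        legOn 1 ((TPlusMatrix fun i j r => ρ (freeNeg N i j r)).map inSnd) =
      legOn 1 ((TPlusMatrix fun i j r => ρ (freeNeg N i j r)).map inSnd) *
        legOn 0 ((TMatrix fun i j r => ρ (freePos N i j r)).map inFst) *
        mixedFactor N (-b) • (1 - mixedCoeff (-b) • permOn E⟦X⟧⟦X⟧ N (Equiv.swap (0 : Fin 2) 1)) := by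
  have h1 := map₂_eq_of_coeff (ρ := ρ) (M := rttMixedLeft N) (M' := rttMixedRight N)
    fun a b r s => hρ _ _ (DYRel.rttMixed a b r s)
  have hT : ((TMatrix (freePos N)).map inFst).map (map₂ ρ) =
      (TMatrix fun i j r => ρ (freePos N i j r)).map inFst := by
    rw [← TMatrix_map]
    ext1 i j
    simp only [Matrix.map_apply, map₂_inFst]
  have hP : ((TPlusMatrix (freeNeg N)).map inSnd).map (map₂ ρ) =
      (TPlusMatrix fun i j r => ρ (freeNeg N i j r)).map inSnd := by
    rw [← TPlusMatrix_map]
    ext1 i j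
    simp only [Matrix.map_apply, map₂_inSnd]
  simp only [rttMixedLeft, rttMixedRight, Matrix.map_mul, leg_eq_legOn, legOn_map, RbarShift_map,
    map_neg, hb, hT, hP] at h1
  exact h1

theorem plus_relation (i j k l : Fin N) :
    let p := TPlusMatrix fun i j r => ρ (freeNeg N i j r)
    (X - PowerSeries.C X) * (inFst (p i j) * inSnd (p k l)) -
        algebraMap K E⟦X⟧⟦X⟧ h * (inFst (p k j) * inSnd (p i l)) =
      (X - PowerSeries.C X) * (inSnd (p k l) * inFst (p i j)) -
        algebraMap K E⟦X⟧⟦X⟧ h * (inSnd (p k j) * inFst (p i l)) := by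
  intro p
  have hp : p = (TPlusMatrix (freeNeg N)).map (PowerSeries.map (ρ : FreeGen N →+* E)) :=
    (TPlusMatrix_map ρ _).symm
  have h1 := map₂_eq_of_coeff (ρ := ρ) (M := rttPlusLeft N) (M' := rttPlusRight N)
    fun a b r s => hρ _ _ (DYRel.rttPlus a b r s)
  have hF : ((TPlusMatrix (freeNeg N)).map inFst).map (map₂ ρ) = p.map inFst := by
    rw [hp]
    ext1 i j
    simp only [Matrix.map_apply, map₂_inFst]
  have hP : ((TPlusMatrix (freeNeg N)).map inSnd).map (map₂ ρ) = p.map inSnd := by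
    rw [hp]
    ext1 i j
    simp only [Matrix.map_apply, map₂_inSnd]
  have hR : (clearedR N).map (map₂ ρ) = (X - PowerSeries.C X : E⟦X⟧⟦X⟧) • 1 -
      algebraMap K E⟦X⟧⟦X⟧ h • permOn E⟦X⟧⟦X⟧ N (Equiv.swap (0 : Fin 2) 1) := by
    rw [clearedR, leg₂_permP (by decide), map_smul_one_sub_smul, permOn_map]
    congr 2
    · rw [map_sub, map₂_inFst, map₂_inSnd]
      simp [inFst, inSnd]
    · rw [Algebra.algebraMap_eq_smul_one]
      ext r s
      simp [coeff_one, apply_ite (coeff (R := FreeGen N) s), apply_ite ρ,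
        apply_ite (coeff (R := E) s)]
  simp only [rttPlusLeft, rttPlusRight, Matrix.map_mul, leg_eq_legOn, legOn_map, hF, hP, hR] at h1
  have hX : ∀ x : E⟦X⟧⟦X⟧, Commute (X - PowerSeries.C X) x := fun x =>
    ((commute_X x).symm).sub_left (by
      ext r
      rw [coeff_C_mul, coeff_mul_C, (commute_X _).eq])
  exact (exchange_iff hX fun x => Algebra.commutes _ _).1 h1 i j k l

end Relations

/-! ### Evaluation of series in `u` at central points -/

section PlusEvaluation

variable {E : Type*} [Ring E]

/-- A central power series with nilpotent constant coefficient. -/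
structure IsPoint (v : E⟦X⟧) : Prop where
  nil : IsNilpotent (coeff 0 v)
  comm : ∀ f, Commute f v

/-- The substitution of a point into power series. -/
def plusEval {v : E⟦X⟧} (hv : IsPoint v) : E⟦X⟧ →+* E⟦X⟧ :=
  ev PowerSeries.C (isSmall_of_isNilpotent hv.nil) fun _ => hv.comm _

variable {v w : E⟦X⟧} (hv : IsPoint v) (hw : IsPoint w)

@[simp] theorem plusEval_C (b : E) : plusEval hv (PowerSeries.C b) = PowerSeries.C b := ev_C _ _ _

@[simp] theorem plusEval_X : plusEval hv X = v := ev_X _ _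

include hv in
theorem IsPoint.neg : IsPoint (-v) :=
  ⟨by simpa using hv.nil.neg, fun f => (hv.comm f).neg_right⟩

theorem plusEval_negVar (f : E⟦X⟧) : plusEval hv (negVar f) = plusEval hv.neg f :=
  ev_negVar _ _ _ _ f

/-- The substitution of two points into power series in two variables. -/
def plusEval₂ : E⟦X⟧⟦X⟧ →+* E⟦X⟧ :=
  ev (plusEval hw) (isSmall_of_isNilpotent hv.nil) fun _ => hv.comm _

@[simp] theorem plusEval₂_inSnd (f : E⟦X⟧) : plusEval₂ hv hw (inSnd f) = plusEval hw f := ev_C _ _ _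

@[simp] theorem plusEval₂_C (f : E⟦X⟧) : plusEval₂ hv hw (PowerSeries.C f) = plusEval hw f :=
  ev_C _ _ _

@[simp] theorem plusEval₂_X : plusEval₂ hv hw X = v := ev_X _ _

@[simp] theorem plusEval₂_inFst (f : E⟦X⟧) : plusEval₂ hv hw (inFst f) = plusEval hv f := by
  have : (plusEval₂ hv hw).comp (PowerSeries.map PowerSeries.C) = plusEval hv := by
    refine hom_eq_of_isSmall ?_ (fun b => ?_) ?_
    · simpa using isSmall_of_isNilpotent hv.nil
    · simp
    · simp
  exact RingHom.congr_fun this f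

/-- The divided difference `(f(u) - f(v)) / (u - v)`. -/
def divDiff (f : E⟦X⟧) : E⟦X⟧⟦X⟧ :=
  PowerSeries.mk fun i => PowerSeries.mk fun j => coeff (i + j + 1) f

theorem inFst_sub_inSnd (f : E⟦X⟧) :
    inFst f - inSnd f = (X - PowerSeries.C X) * divDiff f := by
  ext r s
  rw [sub_mul, map_sub, map_sub, map_sub, map_sub, coeff_C_mul]
  rcases r with _ | r <;> rcases s with _ | s <;>
    simp [inFst, inSnd, divDiff, coeff_succ_X_mul, coeff_C, add_assoc, add_comm 1]

theorem commute_X_sub (x : E⟦X⟧⟦X⟧) : Commute (X - PowerSeries.C X) x :=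
  ((commute_X x).symm).sub_left (by
    ext r
    rw [coeff_C_mul, coeff_mul_C, (commute_X _).eq])

/-- Compare coefficients in the outer variable from the lowest one up: each time the inner variable
times the next coefficient of the difference vanishes. -/
theorem X_sub_mul_cancel {f g : E⟦X⟧⟦X⟧}
    (h : (X - PowerSeries.C X) * f = (X - PowerSeries.C X) * g) : f = g := by
  rw [← sub_eq_zero, ← mul_sub] at h
  rw [← sub_eq_zero]
  set d := f - g
  have hX : ∀ x : E⟦X⟧, X * x = 0 → x = 0 := fun x hx => by
    ext r
    have := congrArg (coeff (r + 1)) hx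
    rwa [coeff_succ_X_mul] at this
  ext1 r
  induction r with
  | zero =>
    have := congrArg (coeff 0) h
    rw [sub_mul, map_sub, coeff_C_mul, coeff_zero_X_mul, zero_sub, map_zero, neg_eq_zero] at this
    rw [map_zero]
    exact hX _ this
  | succ r ih =>
    have := congrArg (coeff (r + 1)) h
    rw [sub_mul, map_sub, coeff_C_mul, coeff_succ_X_mul, ih, map_zero, map_zero, zero_sub,
      neg_eq_zero] at this
    rw [map_zero]
    exact hX _ this

variable {N : ℕ} [Algebra K E] {ρ : FreeGen N →ₐ[K] E} (hρ : ∀ x y, DYRel N x y → ρ x = ρ y)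

include hρ

/-- The RTT relation says that `u - v` times the commutator is `h` times an expression vanishing at
`u = v`; written with divided differences, this expression contains the factor `u - v`. The factor
must be cancelled in two independent variables, for after the substitution of points a multiple of
`h` apart it is no longer cancellable. -/
theorem plus_relation_div (i j k l : Fin N) :
    let p := TPlusMatrix fun i j r => ρ (freeNeg N i j r)
    inFst (p i j) * inSnd (p k l) - inSnd (p k l) * inFst (p i j) =
      algebraMap K E⟦X⟧⟦X⟧ h *
        (divDiff (p k j) * inSnd (p i l) - inSnd (p k j) * divDiff (p i l)) := by
  intro p
  refine X_sub_mul_cancel ?_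
  have h1 := plus_relation hρ i j k l
  change (X - PowerSeries.C X) * (inFst (p i j) * inSnd (p k l)) -
        algebraMap K E⟦X⟧⟦X⟧ h * (inFst (p k j) * inSnd (p i l)) =
      (X - PowerSeries.C X) * (inSnd (p k l) * inFst (p i j)) -
        algebraMap K E⟦X⟧⟦X⟧ h * (inSnd (p k j) * inFst (p i l)) at h1
  have h2 : ∀ a b c e : E⟦X⟧⟦X⟧, (X - PowerSeries.C X) * (algebraMap K E⟦X⟧⟦X⟧ h * (a * b - c * e)) =
      algebraMap K E⟦X⟧⟦X⟧ h * (((X - PowerSeries.C X) * a) * b - c * ((X - PowerSeries.C X) * e)) := by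
    intro a b c e
    rw [← mul_assoc c, ← (commute_X_sub c).eq, ← mul_assoc, (commute_X_sub _).eq, mul_assoc, mul_sub,
      mul_assoc, mul_assoc]
  rw [h2, ← inFst_sub_inSnd, ← inFst_sub_inSnd, mul_sub, sub_eq_iff_eq_add.1 h1]
  noncomm_ring

theorem plusEval_relation (i j k l : Fin N) :
    let p := TPlusMatrix fun i j r => ρ (freeNeg N i j r)
    (v - w) * (plusEval hv (p i j) * plusEval hw (p k l)) -
        algebraMap K E⟦X⟧ h * (plusEval hv (p k j) * plusEval hw (p i l)) =
      (v - w) * (plusEval hw (p k l) * plusEval hv (p i j)) -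
        algebraMap K E⟦X⟧ h * (plusEval hw (p k j) * plusEval hv (p i l)) := by
  intro p
  have h1 := congrArg (plusEval₂ hv hw) (plus_relation hρ i j k l)
  have h2 : plusEval₂ hv hw (algebraMap K E⟦X⟧⟦X⟧ h) = algebraMap K E⟦X⟧ h := by
    rw [PowerSeries.algebraMap_apply, plusEval₂_C, PowerSeries.algebraMap_apply, plusEval_C]
  simpa [h2] using h1

/-- Multiplying the divided relation by `m` turns the factor `h` into `v - w`, which converts the
divided differences back into differences of values. -/
theorem plusEval_relation_div {m : ℤ} (hm : v - w = m * algebraMap K E⟦X⟧ h) (i j k l : Fin N) :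
    let p := TPlusMatrix fun i j r => ρ (freeNeg N i j r)
    (m : E⟦X⟧) * (plusEval hv (p i j) * plusEval hw (p k l)) -
        1 * (plusEval hv (p k j) * plusEval hw (p i l)) =
      m * (plusEval hw (p k l) * plusEval hv (p i j)) -
        1 * (plusEval hw (p k j) * plusEval hv (p i l)) := by
  intro p
  have h1 := congrArg (plusEval₂ hv hw) (plus_relation_div hρ i j k l)
  have h2 : plusEval₂ hv hw (algebraMap K E⟦X⟧⟦X⟧ h) = algebraMap K E⟦X⟧ h := by
    rw [PowerSeries.algebraMap_apply, plusEval₂_C, PowerSeries.algebraMap_apply, plusEval_C]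
  have h3 : ∀ f, plusEval hv f - plusEval hw f = (v - w) * plusEval₂ hv hw (divDiff f) := by
    intro f
    simpa using congrArg (plusEval₂ hv hw) (inFst_sub_inSnd f)
  simp only [map_sub, map_mul, plusEval₂_inFst, plusEval₂_inSnd, h2] at h1
  change plusEval hv (p i j) * plusEval hw (p k l) - plusEval hw (p k l) * plusEval hv (p i j) =
    algebraMap K E⟦X⟧ h * (plusEval₂ hv hw (divDiff (p k j)) * plusEval hw (p i l) -
      plusEval hw (p k j) * plusEval₂ hv hw (divDiff (p i l))) at h1
  have hc : ∀ f, Commute (v - w) f := fun f => ((hv.comm f).sub_right (hw.comm f)).symm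
  have h4 : (m : E⟦X⟧) * (plusEval hv (p i j) * plusEval hw (p k l)) -
      m * (plusEval hw (p k l) * plusEval hv (p i j)) =
      plusEval hv (p k j) * plusEval hw (p i l) - plusEval hw (p k j) * plusEval hv (p i l) := by
    rw [← mul_sub, h1, ← mul_assoc, ← hm, mul_sub, ← mul_assoc, ← h3, ← mul_assoc,
      (hc (plusEval hw (p k j))).eq, mul_assoc, ← h3]
    noncomm_ring
  rw [one_mul, one_mul]
  rw [sub_eq_sub_iff_add_eq_add] at h4 ⊢
  rw [h4, add_comm]

end PlusEvaluation

/-! ### Laurent series in `u` and power series in `z⁻¹` -/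

section Laurent

variable (E : Type*) [Ring E] [Algebra ℂ E] [Algebra K E] [IsScalarTower ℂ K E]

/-- Power series in `z⁻¹` over Laurent series in `u`. -/
abbrev LaurentRing : Type _ := (HahnSeries ℤ E)⟦X⟧

/-- The central elements. -/
def LaurentCenter : Type _ := Subalgebra.center ℂ (LaurentRing E)

instance : CommRing (LaurentCenter E) :=
  inferInstanceAs (CommRing (Subalgebra.center ℂ (LaurentRing E)))

instance : Algebra ℂ (LaurentCenter E) :=
  inferInstanceAs (Algebra ℂ (Subalgebra.center ℂ (LaurentRing E)))

variable {E}

/-- The inclusion of the center. -/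
def ofCenter : LaurentCenter E →+* LaurentRing E :=
  ((Subalgebra.center ℂ (LaurentRing E)).val : Subalgebra.center ℂ (LaurentRing E) →+* LaurentRing E)

theorem ofCenter_comm (s : LaurentCenter E) (f : LaurentRing E) :
    ofCenter s * f = f * ofCenter s :=
  (Subalgebra.mem_center_iff.1 s.2 f).symm

theorem ofCenter_injective : Function.Injective (ofCenter : LaurentCenter E → LaurentRing E) :=
  Subtype.val_injective

instance : Algebra (LaurentCenter E) (LaurentRing E) := ofCenter.toAlgebra' ofCenter_comm

theorem algebraMap_center (s : LaurentCenter E) : algebraMap _ (LaurentRing E) s = ofCenter s := rfl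

theorem ofCenter_algebraMap (r : ℂ) :
    ofCenter (algebraMap ℂ (LaurentCenter E) r) = algebraMap ℂ (LaurentRing E) r := rfl

theorem commute_single_one (m : ℤ) (f : HahnSeries ℤ E) :
    Commute (HahnSeries.single m (1 : E)) f := by
  ext r
  have h1 := HahnSeries.coeff_single_mul_add (r := (1 : E)) (x := f) (a := r - m) (b := m)
  have h2 := HahnSeries.coeff_mul_single_add (r := (1 : E)) (x := f) (a := r - m) (b := m)
  rw [sub_add_cancel] at h1 h2
  rw [h1, h2, one_mul, mul_one]

theorem commute_C_of_commute {R : Type*} [Ring R] {z : R} (hz : ∀ f, Commute z f) (f : R⟦X⟧) :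
    Commute (PowerSeries.C z) f := by
  ext r
  rw [coeff_C_mul, coeff_mul_C, (hz _).eq]

/-- A central element. -/
def centralElement (z : LaurentRing E) (hz : ∀ f, Commute z f) : LaurentCenter E :=
  ⟨z, Subalgebra.mem_center_iff.2 fun f => (hz f).eq.symm⟩

/-- The variable `z⁻¹`. -/
def cX : LaurentCenter E := centralElement X fun f => (commute_X f).symm

/-- The powers of the variable `u`. -/
def cU (m : ℤ) : LaurentCenter E :=
  centralElement (PowerSeries.C (HahnSeries.single m 1)) (commute_C_of_commute (commute_single_one m))

/-- The structure homomorphism of the center. -/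
def cK : K →+* LaurentCenter E where
  toFun k := centralElement (algebraMap K _ k) (Algebra.commutes k)
  map_one' := ofCenter_injective (map_one (algebraMap K (LaurentRing E)))
  map_mul' := fun x y => ofCenter_injective (map_mul (algebraMap K (LaurentRing E)) x y)
  map_zero' := ofCenter_injective (map_zero (algebraMap K (LaurentRing E)))
  map_add' := fun x y => ofCenter_injective (map_add (algebraMap K (LaurentRing E)) x y)

@[simp] theorem coe_cX : ofCenter (cX : LaurentCenter E) = X := rfl

@[simp] theorem coe_cU (m : ℤ) :
    ofCenter (cU m : LaurentCenter E) = PowerSeries.C (HahnSeries.single m 1) := rfl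

@[simp] theorem coe_cK (k : K) :
    ofCenter (cK k : LaurentCenter E) = algebraMap K _ k := rfl

theorem algebraMap_cst (r : ℂ) : algebraMap K E (cst r) = algebraMap ℂ E r := by
  rw [IsScalarTower.algebraMap_apply ℂ K E]; rfl

theorem cK_cst (r : ℂ) : (cK (cst r) : LaurentCenter E) = algebraMap ℂ _ r := by
  refine ofCenter_injective ?_
  rw [coe_cK, ofCenter_algebraMap, PowerSeries.algebraMap_apply, PowerSeries.algebraMap_apply, HahnSeries.algebraMap_apply,
    HahnSeries.algebraMap_apply, algebraMap_cst]

theorem cU_mul (m m' : ℤ) : (cU m * cU m' : LaurentCenter E) = cU (m + m') := by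
  refine ofCenter_injective ?_
  rw [map_mul, coe_cU, coe_cU, coe_cU, ← map_mul, HahnSeries.single_mul_single, one_mul]

theorem cU_zero : (cU 0 : LaurentCenter E) = 1 := rfl

theorem isUnit_cU (m : ℤ) : IsUnit (cU m : LaurentCenter E) :=
  IsUnit.of_mul_eq_one (cU (-m)) (by rw [cU_mul, add_neg_cancel, cU_zero])

/-- The inverse exists among power series in `z⁻¹`, and the inverse of a central unit is central. -/
theorem isUnit_of_cX (x : LaurentCenter E) : IsUnit (1 + x * cX) := by
  have h : IsUnit (ofCenter (1 + x * cX)) := by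
    rw [PowerSeries.isUnit_iff_constantCoeff]
    have : constantCoeff (ofCenter (1 + x * cX)) = 1 := by simp
    rw [this]
    exact isUnit_one
  obtain ⟨w, hw⟩ := h
  have hc : ∀ f : LaurentRing E, Commute (↑w⁻¹ : LaurentRing E) f := fun f => by
    have : Commute (w : LaurentRing E) f := by
      rw [hw]; exact ofCenter_comm _ f
    exact this.units_inv_left
  refine IsUnit.of_mul_eq_one (centralElement _ hc) (ofCenter_injective ?_)
  rw [map_mul, ← hw, map_one]
  exact Units.mul_inv w

/-- Power series in `u` as constant power series in `z⁻¹`. -/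
def ofPlus : E⟦X⟧ →+* LaurentRing E :=
  (PowerSeries.C).comp (HahnSeries.ofPowerSeries ℤ E)

/-- Power series in `z⁻¹` with constant coefficients. -/
def ofMinus : E⟦X⟧ →+* LaurentRing E := PowerSeries.map HahnSeries.C

theorem ofPlus_C (b : E) : ofPlus (PowerSeries.C b) = PowerSeries.C (HahnSeries.C b) := by
  rw [ofPlus, RingHom.comp_apply, HahnSeries.ofPowerSeries_C]

theorem ofPlus_algebraMap (k : K) : ofPlus (algebraMap K E⟦X⟧ k) = algebraMap K _ k := by
  rw [PowerSeries.algebraMap_apply, ofPlus_C, PowerSeries.algebraMap_apply,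
    HahnSeries.algebraMap_apply]

theorem ofPlus_X : ofPlus (X : E⟦X⟧) = ofCenter (cU 1 : LaurentCenter E) := by
  rw [ofPlus, RingHom.comp_apply, HahnSeries.ofPowerSeries_X]; rfl

end Laurent

theorem subInvHom_C {B : Type*} [Ring B] {a β : B} (ha : ∀ b, Commute a b) (hβ : ∀ b, Commute β b)
    (b : B) : subInvHom a β ha hβ (PowerSeries.C b) = PowerSeries.C b := ev_C _ _ _

theorem subInvHom_X {B : Type*} [Ring B] {a β : B} (ha : ∀ b, Commute a b)
    (hβ : ∀ b, Commute β b) : subInvHom a β ha hβ X = linInv a β := ev_X _ _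

/-- Informally `h2` is `x⁻¹ = a/t + k` (recall `a² = 1`) and `h1` is `l⁻¹ = x⁻¹ + b - s`. The
conclusion adds them up in a form that needs neither inverses nor commutativity of `l` and `x`. -/
theorem smul_shift_eq {S R : Type*} [CommRing S] [Ring R] [Algebra S R] {a k b s t : S} {l x : R}
    (ha : a * a = 1) (h1 : l + (b - s) • (l * x) = x) (h2 : x + (a * k * t) • x = (a * t) • 1) :
    (a + (k + b - s) * t) • l = t • 1 := by
  have h3 : l * x + (a * k * t) • (l * x) = (a * t) • l := by
    rw [← mul_smul_comm, ← mul_add, h2, mul_smul_comm, mul_one]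
  linear_combination (norm := module) (a * (1 + a * k * t)) • h1 - (a * (b - s)) • h3 + a • h2 +
    ha • ((-k * t) • l - ((b - s) * t) • l + t • (1 : R))

/-! ### Substitution of points into the mixed RTT relation. -/

section Mixed

variable {E : Type*} [Ring E] [Algebra ℂ E] [Algebra K E] [IsScalarTower ℂ K E]
variable {v : E⟦X⟧} (hv : IsPoint v) (α β : K)

theorem commute_linInv_algebraMap {R : Type*} [Ring R] [Algebra K R] (f : R) :
    Commute (PowerSeries.C f) (linInv (algebraMap K R α) (algebraMap K R β)) :=
  commute_C_linInv (Algebra.commutes α) (Algebra.commutes β) f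

/-- The substitution of `α⁻¹ z + β` for the first variable and `v` for the second one. -/
def mixedEval : E⟦X⟧⟦X⟧ →+* LaurentRing E :=
  ev (ofPlus.comp (plusEval hv))
    (x := linInv (algebraMap K (HahnSeries ℤ E) α) (algebraMap K (HahnSeries ℤ E) β))
    (isSmall_of_coeff_zero (linInv_constCoeff _ _)) fun _ => commute_linInv_algebraMap α β _

theorem mixedEval_inSnd (f : E⟦X⟧) : mixedEval hv α β (inSnd f) = ofPlus (plusEval hv f) :=
  ev_C _ _ _

theorem mixedEval_C (f : E⟦X⟧) :
    mixedEval hv α β (PowerSeries.C f) = ofPlus (plusEval hv f) :=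
  ev_C _ _ _

theorem mixedEval_X : mixedEval hv α β X =
    linInv (algebraMap K (HahnSeries ℤ E) α) (algebraMap K (HahnSeries ℤ E) β) :=
  ev_X _ _

theorem mixedEval_inFst (f : E⟦X⟧) : mixedEval hv α β (inFst f) =
    ofMinus (subInv (algebraMap K E α) (algebraMap K E β) f) := by
  have hl : ofMinus (linInv (algebraMap K E α) (algebraMap K E β)) =
      linInv (algebraMap K (HahnSeries ℤ E) α) (algebraMap K (HahnSeries ℤ E) β) := by
    rw [ofMinus, linInv_map, HahnSeries.algebraMap_apply, HahnSeries.algebraMap_apply]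
  have : (mixedEval hv α β).comp (PowerSeries.map PowerSeries.C) = ofMinus.comp
      (subInvHom (algebraMap K E α) (algebraMap K E β) (Algebra.commute_algebraMap_left α)
        (Algebra.commute_algebraMap_left β)) := by
    refine hom_eq_of_isSmall ?_ (fun b => ?_) ?_
    · rw [RingHom.comp_apply, map_X, mixedEval_X]
      exact isSmall_of_coeff_zero (linInv_constCoeff _ _)
    · rw [RingHom.comp_apply, map_C, mixedEval_C, plusEval_C, ofPlus_C, RingHom.comp_apply,
        subInvHom_C, ofMinus, map_C]
    · rw [RingHom.comp_apply, map_X, mixedEval_X, RingHom.comp_apply, subInvHom_X, hl]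
  rw [← subInvHom_apply (Algebra.commute_algebraMap_left α) (Algebra.commute_algebraMap_left β)]
  exact RingHom.congr_fun this f

variable {α} (hα : α * α = 1) (kb : K) {sv y : LaurentCenter E}
  (hsv : ofCenter sv = ofPlus v)
  (hy : y * (cK α + (cK (β + kb) - sv) * cX) = cK h * cX)

include hα in
theorem mixedDen_isUnit : IsUnit (cK α + (cK (β + kb) - sv) * cX : LaurentCenter E) := by
  have h1 : (cK α + (cK (β + kb) - sv) * cX : LaurentCenter E) =
      cK α * (1 + (cK α * (cK (β + kb) - sv)) * cX) := by
    rw [mul_add, mul_one, ← mul_assoc, ← mul_assoc, ← map_mul, hα, map_one, one_mul]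
  rw [h1]
  exact (IsUnit.of_mul_eq_one (cK α) (by rw [← map_mul, hα, map_one])).mul (isUnit_of_cX _)

include hα hsv hy

/-- The hypothesis `hy` characterizes `y` as `h` divided by the value of `u - v + b` at the two
points, numerator and denominator being multiplied by `z⁻¹`. That denominator is a unit, so it can
be cancelled. -/
theorem mixedEval_mixedCoeff :
    mixedEval hv α β (mixedCoeff (algebraMap K E kb)) = ofCenter y := by
  set d : LaurentCenter E := cK α + (cK (β + kb) - sv) * cX
  have hd : IsUnit d := mixedDen_isUnit β hα kb
  have hcomm : Commute (1 : E⟦X⟧) (PowerSeries.C (algebraMap K E kb) - X) := Commute.one_left _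
  have h2 := congrArg (mixedEval hv α β) (linInv_mul hcomm)
  set l := mixedEval hv α β (linInv 1 (PowerSeries.C (algebraMap K E kb) - X)) with hl
  have h0 : ofPlus (PowerSeries.C (algebraMap K E kb)) = algebraMap K (LaurentRing E) kb := by
    rw [← PowerSeries.algebraMap_apply, ofPlus_algebraMap]
  rw [map_mul, map_add, map_one, map_one, one_mul, one_mul, map_mul, mixedEval_C, mixedEval_X,
    map_sub, plusEval_C, plusEval_X, map_sub, h0, ← hsv, ← hl] at h2
  set x := linInv (algebraMap K (HahnSeries ℤ E) α) (algebraMap K (HahnSeries ℤ E) β)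
  have h3 : x * (1 + algebraMap K (LaurentRing E) (α * β) * X) =
      algebraMap K (LaurentRing E) α * X := by
    have := linInv_mul (Algebra.commutes α (algebraMap K (HahnSeries ℤ E) β))
    rwa [← map_mul, ← PowerSeries.algebraMap_apply, ← PowerSeries.algebraMap_apply] at this
  have h4 : d • l = (cX : LaurentCenter E) • (1 : LaurentRing E) := by
    have e1 : (cK α * cK α : LaurentCenter E) = 1 := by rw [← map_mul, hα, map_one]
    have e2 : l + (cK kb - sv) • (l * x) = x := by
      rw [Algebra.smul_def, algebraMap_center, ← mul_assoc, ofCenter_comm, mul_assoc, ← mul_one_add,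
        map_sub, coe_cK]
      exact h2
    have e3 : x + (cK α * cK β * cX : LaurentCenter E) • x = (cK α * cX : LaurentCenter E) • 1 := by
      rw [Algebra.smul_def, algebraMap_center, ofCenter_comm, ← mul_one_add, Algebra.smul_def, mul_one,
        ← map_mul cK, algebraMap_center, map_mul ofCenter, map_mul ofCenter, coe_cK, coe_cK, coe_cX]
      exact h3
    have := smul_shift_eq e1 e2 e3
    rwa [← map_add] at this
  have h1 : mixedEval hv α β (mixedCoeff (algebraMap K E kb)) = (cK h : LaurentCenter E) • l := by
    rw [mixedCoeff, Algebra.smul_def, map_mul, PowerSeries.algebraMap_apply, mixedEval_C,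
      PowerSeries.algebraMap_apply, plusEval_C, ← PowerSeries.algebraMap_apply, ofPlus_algebraMap,
      Algebra.smul_def, algebraMap_center, coe_cK]
  have h5 : d • ((cK h : LaurentCenter E) • l) = d • (y • (1 : LaurentRing E)) := by
    rw [smul_comm, h4, smul_smul, ← hy, smul_smul, mul_comm]
  rw [h1, hd.smul_left_cancel.1 h5, Algebra.smul_def, mul_one, algebraMap_center]

/-- Rescaling by `h`, substituting and evaluating is one homomorphism from `ℂ[[X]]`, and it sends
`X` to the nilpotent `y`. Hence it is evaluation at `y`. -/
theorem mixedEval_mixedFactor (N : ℕ) (hy0 : IsNilpotent y) :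
    mixedEval hv α β (mixedFactor N (algebraMap K E kb)) = ofCenter (gam N y) := by
  have hb : ∀ f : E⟦X⟧, Commute (PowerSeries.C (algebraMap K E kb) - X) f := fun f =>
    (commute_C_of_commute (Algebra.commutes kb) f).sub_left (commute_X f).symm
  set F : ℂ⟦X⟧ →+* LaurentRing E := ((mixedEval hv α β).comp
    (subInvHom (1 : E⟦X⟧) (PowerSeries.C (algebraMap K E kb) - X) (fun _ => Commute.one_left _) hb)).comp
    ((PowerSeries.map (algebraMap K E⟦X⟧)).comp ((PowerSeries.rescale h).comp
      (PowerSeries.map (PowerSeries.C (R := ℂ)))))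
  have hF : F = ofCenter.comp (nev y hy0) := by
    have hX : F X = ofCenter y := by
      rw [← mixedEval_mixedCoeff hv β hα kb hsv hy]
      simp only [F, RingHom.comp_apply, map_X]
      rw [PowerSeries.rescale_X, map_mul, map_C, map_X, map_mul, subInvHom_C, subInvHom_X, mixedCoeff,
        Algebra.smul_def]
      congr 2
      rw [PowerSeries.algebraMap_apply (A := E), PowerSeries.algebraMap_apply (A := E⟦X⟧),
        PowerSeries.algebraMap_apply (A := E)]
    refine hom_eq_of_isNilpotent ?_ (fun b => ?_) ?_
    · rw [hX]; exact hy0.map ofCenter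
    · simp only [F, RingHom.comp_apply, map_C]
      have : PowerSeries.rescale h (PowerSeries.C (cst b)) = PowerSeries.C (cst b) := by
        ext r
        rw [coeff_rescale, coeff_C]
        split_ifs with h0
        · simp [h0]
        · simp
      rw [this, map_C, subInvHom_C, mixedEval_C, PowerSeries.algebraMap_apply, plusEval_C,
        ← PowerSeries.algebraMap_apply, ofPlus_algebraMap]
      rw [← coe_cK, cK_cst, nev_C]
    · rw [hX, RingHom.comp_apply, nev_X]
  have hg : gScaled N = PowerSeries.rescale h (PowerSeries.map (PowerSeries.C (R := ℂ)) (gSeries N)) := by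
    ext1 k
    rw [gScaled, coeff_mk, coeff_rescale, coeff_map, mul_comm]
  rw [gam_eq N hy0, mixedFactor, hg, ← subInvHom_apply (fun _ => Commute.one_left _) hb]
  exact RingHom.congr_fun hF (gSeries N)

end Mixed

/-! ### The relations at the critical level -/

section CriticalRelations

variable {N : ℕ} {E : Type*} [Ring E] [Algebra ℂ E] [Algebra K E] [IsScalarTower ℂ K E]
  (hh : IsNilpotent (algebraMap K E h))

/-- The point `u + h d`. -/
def plusPoint (E : Type*) [Ring E] [Algebra K E] (d : ℤ) : E⟦X⟧ :=
  X + algebraMap K E⟦X⟧ (h * cst d)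

include hh in
theorem isPoint_plusPoint (d : ℤ) : IsPoint (plusPoint E d) := by
  refine ⟨?_, fun f => (commute_X f).add_right (Algebra.commute_algebraMap_right _ _)⟩
  rw [plusPoint, map_add, coeff_zero_X, zero_add, PowerSeries.algebraMap_apply, coeff_zero_C, map_mul]
  exact (Algebra.commute_algebraMap_left _ _).isNilpotent_mul_right hh

/-- The point `u + h d` as a central element. -/
def cPoint (d : ℤ) : LaurentCenter E := cU 1 + cK (h * cst d)

theorem ofCenter_cPoint (d : ℤ) : ofCenter (cPoint d : LaurentCenter E) = ofPlus (plusPoint E d) := by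
  rw [cPoint, plusPoint, map_add, map_add, ofPlus_X, coe_cK, ofPlus_algebraMap]

theorem ofCenter_neg_cPoint (d : ℤ) :
    ofCenter (-cPoint d : LaurentCenter E) = ofPlus (-plusPoint E d) := by
  rw [map_neg, map_neg, ofCenter_cPoint]

include hh in
theorem isNilpotent_cK : IsNilpotent (cK h : LaurentCenter E) := by
  obtain ⟨k, hk⟩ := hh
  refine ⟨k, ofCenter_injective ?_⟩
  rw [map_pow, coe_cK, PowerSeries.algebraMap_apply, HahnSeries.algebraMap_apply, ← map_pow,
    ← map_pow, hk, map_zero, map_zero, map_zero]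

include hh in
theorem isNilpotent_cK_mul_cX : IsNilpotent (cK h * cX : LaurentCenter E) :=
  (Commute.all _ _).isNilpotent_mul_right (isNilpotent_cK hh)

/-- The value of `z - u` multiplied by `z⁻¹`. -/
def denA (E : Type*) [Ring E] [Algebra ℂ E] [Algebra K E] [IsScalarTower ℂ K E] : LaurentCenter E :=
  1 - cU 1 * cX

/-- The value of `-z - u` multiplied by `z⁻¹`. -/
def denB (E : Type*) [Ring E] [Algebra ℂ E] [Algebra K E] [IsScalarTower ℂ K E] : LaurentCenter E :=
  -1 - cU 1 * cX

/-- The value of `-2 u`. -/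
def denC (E : Type*) [Ring E] [Algebra ℂ E] [Algebra K E] [IsScalarTower ℂ K E] : LaurentCenter E :=
  -2 * cU 1

theorem isUnit_denA : IsUnit (denA E) := by
  have : denA E = 1 + (-cU 1) * cX := by rw [denA]; ring
  rw [this]; exact isUnit_of_cX _

theorem isUnit_denB : IsUnit (denB E) := by
  have : denB E = -(1 + cU 1 * cX) := by rw [denB]; ring
  rw [this]; exact (isUnit_of_cX _).neg

theorem isUnit_denC : IsUnit (denC E) := by
  refine IsUnit.mul (IsUnit.neg ?_) (isUnit_cU 1)
  have : (2 : LaurentCenter E) = algebraMap ℂ _ 2 := (map_ofNat (algebraMap ℂ (LaurentCenter E)) 2).symm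
  rw [this]
  exact (isUnit_iff_ne_zero.2 two_ne_zero).map (algebraMap ℂ (LaurentCenter E))

theorem cK_h_cst (r : ℂ) : (cK (h * cst r) : LaurentCenter E) = algebraMap ℂ _ r * cK h := by
  rw [map_mul, cK_cst, mul_comm]

/-- The matrix `T⁺(v)`. -/
def plusMatrix (t : Fin N → Fin N → ℕ → E) {v : E⟦X⟧} (hv : IsPoint v) :
    Matrix (Fin N) (Fin N) (LaurentRing E) :=
  (TPlusMatrix t).map (ofPlus.comp (plusEval hv))

/-- The matrix `T(α⁻¹ z + β)`. -/
def minusMatrix (t : Fin N → Fin N → ℕ → E) (α β : K) : Matrix (Fin N) (Fin N) (LaurentRing E) :=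
  ((TMatrix t).map (subInv (algebraMap K E α) (algebraMap K E β))).map ofMinus

theorem famVal_mul_eq {w η D : LaurentCenter E} (hw : IsUnit w) (hη : IsNilpotent η) {k d : ℤ}
    (hD : D = famDen N w η k d) : famVal N w η k d * D = η := by
  rw [hD, famVal_mul hw hη]

theorem neg_famVal_mul_eq {w η D : LaurentCenter E} (hw : IsUnit w) (hη : IsNilpotent η) {k d : ℤ}
    (hD : D = -famDen N w η k d) : -famVal N w η k d * D = η := by
  rw [hD, neg_mul_neg, famVal_mul hw hη]

theorem famDen_eq (w η : LaurentCenter E) {k d : ℤ} {r : ℂ} (hr : -(d : ℂ) - k * N / 4 = r) :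
    famDen N w η k d = w + algebraMap ℂ _ r * η := by rw [famDen, hr]

theorem plusPoint_sub {E : Type*} [Ring E] [Algebra K E] (d e : ℤ) :
    plusPoint E d - plusPoint E e = ((d - e : ℤ) : E⟦X⟧) * algebraMap K E⟦X⟧ h := by
  rw [plusPoint, plusPoint, add_sub_add_left_eq_sub, ← map_sub, ← mul_sub, ← map_sub, mul_comm,
    map_mul, ← Int.cast_sub, map_intCast, map_intCast]

variable {ι : Type*} [Fintype ι] [DecidableEq ι]

theorem center_smul (s : LaurentCenter E) (f : LaurentRing E) : s • f = ofCenter s * f :=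
  Algebra.smul_def s f

theorem RP_eq_map (i j : ι) (y : LaurentCenter E) : RP N (LaurentRing E) i j (gam N y, y) =
    ofCenter (gam N y) • (1 - ofCenter y • permOn (LaurentRing E) N (Equiv.swap i j)) := by
  ext1 a b
  simp only [RP, Matrix.smul_apply, Matrix.sub_apply, center_smul, smul_eq_mul]

variable {ρ : FreeGen N →ₐ[K] E} (hρ : ∀ x y, DYRel N x y → ρ x = ρ y)
  {c : ℂ} (hC : ρ (freeC N) = algebraMap K E (cst c))

include hρ

include hC in
theorem mixed_exchange {v : E⟦X⟧} (hv : IsPoint v) {α : K} (β : K) (hα : α * α = 1)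
    {sv y y' : LaurentCenter E} (hsv : ofCenter sv = ofPlus v)
    (hy : y * (cK α + (cK (β + h * cst (c / 2)) - sv) * cX) = cK h * cX)
    (hy' : y' * (cK α + (cK (β + -(h * cst (c / 2))) - sv) * cX) = cK h * cX)
    (hn : IsNilpotent y) (hn' : IsNilpotent y') {i j : ι} (hij : i ≠ j) :
    RP N (LaurentRing E) i j (gam N y, y) * legOn i (minusMatrix (fun i j r => ρ (freePos N i j r)) α β) *
        legOn j (plusMatrix (fun i j r => ρ (freeNeg N i j r)) hv) =
      legOn j (plusMatrix (fun i j r => ρ (freeNeg N i j r)) hv) *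
        legOn i (minusMatrix (fun i j r => ρ (freePos N i j r)) α β) *
        RP N (LaurentRing E) i j (gam N y', y') := by
  have hb : ρ (halfC N) = algebraMap K E (h * cst (c / 2)) := by
    rw [halfC, map_smul, hC, Algebra.smul_def, ← map_mul, mul_assoc, ← map_mul]
    congr 3
    ring_nf
  have h1 := congrArg (fun M : Matrix _ _ _ => M.map (mixedEval hv α β)) (mixed_relation hρ hb)
  have hT : ((TMatrix fun i j r => ρ (freePos N i j r)).map inFst).map (mixedEval hv α β) =
      minusMatrix (fun i j r => ρ (freePos N i j r)) α β := by
    ext1 i j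
    simp only [Matrix.map_apply, mixedEval_inFst, minusMatrix]
  have hP : ((TPlusMatrix fun i j r => ρ (freeNeg N i j r)).map inSnd).map (mixedEval hv α β) =
      plusMatrix (fun i j r => ρ (freeNeg N i j r)) hv := by
    ext1 i j
    simp only [Matrix.map_apply, mixedEval_inSnd, plusMatrix, RingHom.comp_apply]
  rw [← map_neg] at h1
  simp only [Matrix.map_mul, legOn_map, map_smul_one_sub, permOn_map, hT, hP,
    mixedEval_mixedCoeff hv β hα _ hsv hy, mixedEval_mixedCoeff hv β hα _ hsv hy',
    mixedEval_mixedFactor hv β hα _ hsv hy N hn,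
    mixedEval_mixedFactor hv β hα _ hsv hy' N hn', ← RP_eq_map] at h1
  have h2 := congrArg (embOn (twoLegs i j)) h1
  have hi := twoLegs_injective hij
  simp only [embOn_mul hi, embOn_legOn hi, embOn_RP hi (show (0 : Fin 2) ≠ 1 by decide)] at h2
  exact h2

theorem plus_exchange {v w : E⟦X⟧} (hv : IsPoint v) (hw : IsPoint w) {m : ℤ}
    (hm : v - w = m * algebraMap K E⟦X⟧ h) {i j : ι} (hij : i ≠ j) :
    (m • 1 - permOn (LaurentRing E) N (Equiv.swap i j)) *
        legOn i (plusMatrix (fun i j r => ρ (freeNeg N i j r)) hv) *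
        legOn j (plusMatrix (fun i j r => ρ (freeNeg N i j r)) hw) =
      legOn j (plusMatrix (fun i j r => ρ (freeNeg N i j r)) hw) *
        legOn i (plusMatrix (fun i j r => ρ (freeNeg N i j r)) hv) *
        (m • 1 - permOn (LaurentRing E) N (Equiv.swap i j)) := by
  have h1 := (exchange_iff (p := plusMatrix (fun i j r => ρ (freeNeg N i j r)) hv)
    (q := plusMatrix (fun i j r => ρ (freeNeg N i j r)) hw) (s := (m : LaurentRing E)) (t := 1)
    (fun x => Int.cast_commute _ _) (fun x => Commute.one_left x)).2 fun i j k l => by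
      simpa [plusMatrix] using congrArg ofPlus (plusEval_relation_div hv hw hρ hm i j k l)
  have h3 : ((m : LaurentRing E) • 1 - (1 : LaurentRing E) •
      permOn (LaurentRing E) N (Equiv.swap (0 : Fin 2) 1)) =
      m • 1 - permOn (LaurentRing E) N (Equiv.swap (0 : Fin 2) 1) := by
    rw [one_smul, Int.cast_smul_eq_zsmul]
  rw [h3] at h1
  have h2 := congrArg (embOn (twoLegs i j)) h1
  have hi := twoLegs_injective hij
  simp only [embOn_mul hi, embOn_legOn hi, embOn_sub, embOn_smul, embOn_one,
    embOn_permOn hi (show (0 : Fin 2) ≠ 1 by decide)] at h2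
  exact h2

/-- In contrast to `plus_exchange`, the difference `s` of the points is a unit here, so that `h/s`
makes sense and the relation holds with the R-matrix itself. This serves `T⁺(-u)` against `T⁺(u)`,
whose arguments differ by about `-2u`. -/
theorem plus_exchange' {v w : E⟦X⟧} (hv : IsPoint v) (hw : IsPoint w) {s y : LaurentCenter E}
    (hs : ofCenter s = ofPlus (v - w)) (hsu : IsUnit s) (hy : y * s = cK h) {i j : ι} (hij : i ≠ j) :
    RP N (LaurentRing E) i j (gam N y, y) *
        legOn i (plusMatrix (fun i j r => ρ (freeNeg N i j r)) hv) *
        legOn j (plusMatrix (fun i j r => ρ (freeNeg N i j r)) hw) =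
      legOn j (plusMatrix (fun i j r => ρ (freeNeg N i j r)) hw) *
        legOn i (plusMatrix (fun i j r => ρ (freeNeg N i j r)) hv) *
        RP N (LaurentRing E) i j (gam N y, y) := by
  have h1 := (exchange_iff (p := plusMatrix (fun i j r => ρ (freeNeg N i j r)) hv)
    (q := plusMatrix (fun i j r => ρ (freeNeg N i j r)) hw) (s := ofCenter s) (t := ofCenter (cK h : LaurentCenter E))
    (ofCenter_comm _) (ofCenter_comm _)).2 fun i j k l => by
      have := congrArg ofPlus (plusEval_relation hv hw hρ i j k l)
      simp only [map_sub, map_mul, ofPlus_algebraMap] at this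
      rw [← map_sub ofPlus, ← hs] at this
      simpa [plusMatrix] using this
  have h3 : (ofCenter s • 1 - ofCenter (cK h : LaurentCenter E) •
      permOn (LaurentRing E) N (Equiv.swap (0 : Fin 2) 1)) =
      s • (1 - y • permOn (LaurentRing E) N (Equiv.swap (0 : Fin 2) 1)) := by
    ext1 a b
    simp only [Matrix.smul_apply, Matrix.sub_apply, center_smul, smul_eq_mul, ← hy, mul_comm y,
      map_mul, mul_sub, mul_assoc]
  rw [h3] at h1
  have h4 := congrArg (embOn (twoLegs i j)) h1
  have hi := twoLegs_injective hij
  simp only [embOn_mul hi, embOn_legOn hi, embOn_sub, embOn_smul, embOn_one,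
    embOn_permOn hi (show (0 : Fin 2) ≠ 1 by decide), smul_mul_assoc, mul_smul_comm] at h4
  have h5 := hsu.smul_left_cancel.1 h4
  rw [RP, smul_mul_assoc, smul_mul_assoc, mul_smul_comm]
  exact congrArg (gam N y • ·) h5

/-- The level enters through `hc/2 = -hN/4`, which makes the shifts of the mixed relation steps of
the first index of the families. Each mixed relation then reduces to identifying a denominator. -/
theorem isCriticalSystem (hN : N ≠ 0) (hC : ρ (freeC N) = algebraMap K E (cst (critLevel N)))
    (n : ℕ) :
    IsCriticalSystem n (famP N (denA E) (cK h * cX)) (famQ N (denA E) (cK h * cX))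
      (famP N (denB E) (cK h * cX)) (famQ N (denB E) (cK h * cX))
      (famP N (denC E) (cK h)) (famQ N (denC E) (cK h))
      (minusMatrix (fun i j r => ρ (freePos N i j r)) 1 (h * cst (critLevel N)))
      (minusMatrix (fun i j r => ρ (freePos N i j r)) (-1) 0)
      (fun d => plusMatrix (fun i j r => ρ (freeNeg N i j r)) (isPoint_plusPoint hh d))
      (fun d => plusMatrix (fun i j r => ρ (freeNeg N i j r)) (isPoint_plusPoint hh d).neg) := by
  have hη := isNilpotent_cK hh
  have hηX := isNilpotent_cK_mul_cX hh
  refine ⟨isRFamily_fam isUnit_denA hηX hN, isRFamily_fam isUnit_denB hηX hN,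
    isRFamily_fam isUnit_denC hη hN, fun k l d e => ?_, fun i j hij d => ?_, fun i j hij d => ?_,
    fun i j hij d => ?_, fun i j hij d => ?_, fun i j hij x y hxy => ?_, fun i j hij x y hxy => ?_,
    fun i j hij d e => ?_⟩
  · show famVal N _ _ k d * famVal N _ _ l e =
      famVal N _ _ (k + l) (d + e) * (famVal N _ _ k d + famVal N _ _ l e)
    have h1 := famVal_mul isUnit_denA hηX (N := N) k d
    have h2 := famVal_mul isUnit_denB hηX (N := N) l e
    have h3 := famVal_mul isUnit_denC hη (N := N) (k + l) (d + e)
    have u1 := isUnit_famDen isUnit_denA hηX (N := N) k d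
    have u2 := isUnit_famDen isUnit_denB hηX (N := N) l e
    have u3 := isUnit_famDen isUnit_denC hη (N := N) (k + l) (d + e)
    -- This is `(z - u) + (-z - u) = -2u`, where the first two denominators carry the factor `z⁻¹`
    -- and the third does not.
    have h4 : famDen N (denA E) (cK h * cX) k d + famDen N (denB E) (cK h * cX) l e =
        cX * famDen N (denC E) (cK h) (k + l) (d + e) := by
      have := congrArg (algebraMap ℂ (LaurentCenter E))
        (show -((d + e : ℤ) : ℂ) - ((k + l : ℤ) : ℂ) * N / 4 =
          (-(d : ℂ) - k * N / 4) + (-(e : ℂ) - l * N / 4) by push_cast; ring)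
      rw [famDen, famDen, famDen, this, map_add, denA, denB, denC]
      ring
    refine u1.mul_right_cancel (u2.mul_right_cancel (u3.mul_right_cancel ?_))
    generalize famVal N (denA E) (cK h * cX) k d = a at *
    generalize famVal N (denB E) (cK h * cX) l e = b at *
    generalize famVal N (denC E) (cK h) (k + l) (d + e) = c at *
    generalize famDen N (denA E) (cK h * cX) k d = A at *
    generalize famDen N (denB E) (cK h * cX) l e = B at *
    generalize famDen N (denC E) (cK h) (k + l) (d + e) = C at *
    linear_combination (b * B * C - c * C * B) * h1 + (cK h * cX * C - c * C * A) * h2 -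
      (cK h * cX * (A + B)) * h3 - cK h * cK h * cX * h4
  · refine mixed_exchange hρ hC (isPoint_plusPoint hh d) _ (one_mul 1) (ofCenter_cPoint d) ?_ ?_
      (isNilpotent_famVal hηX _ _) (isNilpotent_famVal hηX _ _) hij
    · refine famVal_mul_eq isUnit_denA hηX ?_
      rw [famDen_eq (r := critLevel N + critLevel N / 2 - d) _ _ (by rw [critLevel]; push_cast; ring)]
      simp only [cPoint, denA, map_add, map_sub, cK_h_cst, map_one]
      ring
    · refine famVal_mul_eq isUnit_denA hηX ?_
      rw [famDen_eq (r := critLevel N - critLevel N / 2 - d) _ _ (by rw [critLevel]; push_cast; ring)]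
      simp only [cPoint, denA, map_add, map_sub, map_neg, cK_h_cst, map_one]
      ring
  · refine mixed_exchange hρ hC (isPoint_plusPoint hh d) _ (by ring) (ofCenter_cPoint d) ?_ ?_
      (isNilpotent_famVal hηX _ _) (isNilpotent_famVal hηX _ _) hij
    · refine famVal_mul_eq isUnit_denB hηX ?_
      rw [famDen_eq (r := critLevel N / 2 - d) _ _ (by rw [critLevel]; push_cast; ring)]
      simp only [cPoint, denB, map_add, map_sub, map_neg, map_zero, cK_h_cst, map_one]
      ring
    · refine famVal_mul_eq isUnit_denB hηX ?_
      rw [famDen_eq (r := -(critLevel N / 2) - d) _ _ (by rw [critLevel]; push_cast; ring)]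
      simp only [cPoint, denB, map_add, map_sub, map_neg, map_zero, cK_h_cst, map_one]
      ring
  · refine mixed_exchange hρ hC (isPoint_plusPoint hh d).neg _ (one_mul 1) (ofCenter_neg_cPoint d)
      ?_ ?_ (isNilpotent_famVal hηX _ _).neg (isNilpotent_famVal hηX _ _).neg hij
    · refine neg_famVal_mul_eq isUnit_denB hηX ?_
      rw [famDen_eq (r := -critLevel N - critLevel N / 2 - d) _ _ (by rw [critLevel]; push_cast; ring)]
      simp only [cPoint, denB, map_add, map_sub, map_neg, cK_h_cst, map_one]
      ring
    · refine neg_famVal_mul_eq isUnit_denB hηX ?_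
      rw [famDen_eq (r := -critLevel N + critLevel N / 2 - d) _ _ (by rw [critLevel]; push_cast; ring)]
      simp only [cPoint, denB, map_add, map_sub, map_neg, cK_h_cst, map_one]
      ring
  · refine mixed_exchange hρ hC (isPoint_plusPoint hh d).neg _ (by ring) (ofCenter_neg_cPoint d)
      ?_ ?_ (isNilpotent_famVal hηX _ _).neg (isNilpotent_famVal hηX _ _).neg hij
    · refine neg_famVal_mul_eq isUnit_denA hηX ?_
      rw [famDen_eq (r := -(critLevel N / 2) - d) _ _ (by rw [critLevel]; push_cast; ring)]
      simp only [cPoint, denA, map_add, map_sub, map_neg, map_zero, cK_h_cst, map_one]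
      ring
    · refine neg_famVal_mul_eq isUnit_denA hηX ?_
      rw [famDen_eq (r := critLevel N / 2 - d) _ _ (by rw [critLevel]; push_cast; ring)]
      simp only [cPoint, denA, map_add, map_sub, map_neg, map_zero, cK_h_cst, map_one]
      ring
  · exact plus_exchange hρ _ _ (plusPoint_sub x y) hij
  · refine plus_exchange hρ _ _ ?_ hij
    rw [neg_sub_neg, plusPoint_sub]
  · refine plus_exchange' hρ _ _ (s := famDen N (denC E) (cK h) 0 (d + e)) ?_
      (isUnit_famDen isUnit_denC hη _ _) (famVal_mul isUnit_denC hη _ _) hij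
    have : famDen N (denC E) (cK h) 0 (d + e) = -cPoint d - cPoint e := by
      rw [famDen_eq (r := -(d : ℂ) - e) _ _ (by push_cast; ring), cPoint, cPoint, denC]
      simp only [map_sub, map_neg, cK_h_cst]
      ring
    rw [this, map_sub, ofCenter_neg_cPoint, ofCenter_cPoint, map_sub]

end CriticalRelations

/-! ### The `h`-adic topology -/

section HAdicTopology

open Filter Topology

variable (M : Type*) [AddCommGroup M] [Module K M]

/-- The submodule `h^k M`. -/
def hPow (k : ℕ) : Submodule K M := LinearMap.range ((h ^ k) • (LinearMap.id : M →ₗ[K] M))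

variable {M}

theorem mem_hPow {k : ℕ} {x : M} : x ∈ hPow M k ↔ ∃ y, h ^ k • y = x := by
  simp [hPow]

theorem smul_mem_hPow (k : ℕ) (x : M) : h ^ k • x ∈ hPow M k := mem_hPow.2 ⟨x, rfl⟩

theorem hPow_anti {k l : ℕ} (hkl : k ≤ l) : hPow M l ≤ hPow M k := by
  intro x hx
  obtain ⟨y, rfl⟩ := mem_hPow.1 hx
  exact mem_hPow.2 ⟨h ^ (l - k) • y, by rw [smul_smul, ← pow_add, Nat.add_sub_cancel' hkl]⟩

theorem hIdeal_pow_smul_top (k : ℕ) : hIdeal ^ k • (⊤ : Submodule K M) = hPow M k := by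
  ext x
  rw [Ideal.span_singleton_pow, Submodule.ideal_span_singleton_smul,
    Submodule.mem_smul_pointwise_iff_exists, mem_hPow]
  simp

variable (M) in
/-- Series `∑ h^j v_j` converge. -/
def HComplete : Prop :=
  ∀ v : ℕ → M, ∃ s, ∀ k, s - ∑ j ∈ Finset.range k, h ^ j • v j ∈ hPow M k

variable (M) in
/-- The `h`-adic topology is separated. -/
def HSeparated : Prop := ∀ x : M, (∀ k, x ∈ hPow M k) → x = 0

theorem hasBasis_nhds_hPow (x : M) :
    (@nhds M (hIdeal.adicModuleTopology M) x).HasBasis (fun _ : ℕ => True)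
      fun k => {y | y - x ∈ hPow M k} := by
  let := hIdeal.adicModuleTopology M
  let := hIdeal.adic_basis.topology
  have := (hIdeal.ringFilterBasis.moduleFilterBasis
    (hIdeal.adic_module_basis M)).toAddGroupFilterBasis.nhds_hasBasis x
  refine ⟨fun U => (this.mem_iff (t := U)).trans ⟨?_, ?_⟩⟩
  · rintro ⟨_, ⟨k, rfl⟩, hU⟩
    refine ⟨k, trivial, fun y hy => hU ⟨y - x, ?_, by simp⟩⟩
    show y - x ∈ hIdeal ^ k • (⊤ : Submodule K M)
    rwa [hIdeal_pow_smul_top]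
  · rintro ⟨k, -, hU⟩
    refine ⟨_, ⟨k, rfl⟩, ?_⟩
    rintro _ ⟨y, hy, rfl⟩
    change y ∈ hIdeal ^ k • (⊤ : Submodule K M) at hy
    rw [hIdeal_pow_smul_top] at hy
    exact hU (by simpa using hy)

variable {ι : Type*} {f : ι → M}

theorem sum_sub_sum_mem {k : ℕ} {F s : Finset ι} (hF : ∀ i ∉ F, f i ∈ hPow M k) (hs : F ⊆ s) :
    ∑ i ∈ s, f i - ∑ i ∈ F, f i ∈ hPow M k := by
  classical
  rw [← Finset.sum_sdiff hs, add_sub_cancel_right]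
  exact Submodule.sum_mem _ fun i hi => hF i (Finset.mem_sdiff.1 hi).2

/-- The sums over the finite sets of terms outside `h^k M` increase with `k` by elements `h^k v_k`,
and completeness sums these increments. -/
theorem hsummable_of_finite (hM : HComplete M) (hf : ∀ k, {i | f i ∉ hPow M k}.Finite) :
    HSummable f := by
  have hF : ∀ k, ∀ i ∉ (hf k).toFinset, f i ∈ hPow M k := by
    intro k i hi
    simpa using hi
  have hmono : ∀ k, (hf k).toFinset ⊆ (hf (k + 1)).toFinset := by
    intro k i hi
    simp only [Set.Finite.mem_toFinset, Set.mem_ofPred_eq] at hi ⊢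
    exact fun h' => hi (hPow_anti (Nat.le_succ k) h')
  choose v hv using fun k => mem_hPow.1 (sum_sub_sum_mem (hF k) (hmono k))
  obtain ⟨s, hs⟩ := hM v
  let := hIdeal.adicModuleTopology M
  refine ⟨s + ∑ i ∈ (hf 0).toFinset, f i, ?_⟩
  rw [HasSum, (hasBasis_nhds_hPow _).tendsto_right_iff]
  intro k _
  filter_upwards [eventually_ge_atTop (hf k).toFinset] with t ht
  have h1 := sum_sub_sum_mem (hF k) ht
  have h2 := hs k
  simp only [hv, Finset.sum_range_sub (fun k => ∑ i ∈ (hf k).toFinset, f i)] at h2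
  have h3 := Submodule.sub_mem _ h1 h2
  show _ ∈ hPow M k
  convert h3 using 1
  abel

theorem hsum_sub_sum_mem (hs : HSummable f) {k : ℕ} {F : Finset ι}
    (hF : ∀ i ∉ F, f i ∈ hPow M k) : hsum f - ∑ i ∈ F, f i ∈ hPow M k := by
  let := hIdeal.adicModuleTopology M
  have h1 : HasSum f (hsum f) := Summable.hasSum hs
  rw [HasSum, (hasBasis_nhds_hPow _).tendsto_right_iff] at h1
  obtain ⟨t, ht1, ht2⟩ := ((h1 k trivial).and (eventually_ge_atTop F)).exists
  have h2 := Submodule.sub_mem _ (sum_sub_sum_mem hF ht2) ht1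
  convert h2 using 1
  abel

/-! #### Operators on complete modules -/

variable (hM : HComplete M) (hM' : HSeparated M)

/-- The sum of the series `∑ h^j v_j`. -/
def hSer (hM : HComplete M) (v : ℕ → M) : M := (hM v).choose

theorem hSer_spec (v : ℕ → M) (k : ℕ) :
    hSer hM v - ∑ j ∈ Finset.range k, h ^ j • v j ∈ hPow M k := (hM v).choose_spec k

include hM' in
theorem eq_hSer {v : ℕ → M} {s : M}
    (hs : ∀ k, s - ∑ j ∈ Finset.range k, h ^ j • v j ∈ hPow M k) : s = hSer hM v := by
  rw [← sub_eq_zero]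
  refine hM' _ fun k => ?_
  have := Submodule.sub_mem _ (hs k) (hSer_spec hM v k)
  rwa [sub_sub_sub_cancel_right] at this

include hM hM' in
-- Series of operators are summed pointwise; separatedness makes the pointwise sum unique, hence
-- linear in the vector.
theorem hComplete_end : HComplete (Module.End K M) := by
  intro v
  have key : ∀ v : ℕ → Module.End K M, ∃ s : Module.End K M, ∀ x, s x = hSer hM fun j => v j x := by
    intro v
    refine ⟨⟨⟨fun x => hSer hM fun j => v j x, fun x y => ?_⟩, fun z x => ?_⟩, fun x => rfl⟩
    · refine (eq_hSer hM hM' fun k => ?_).symm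
      have := Submodule.add_mem _ (hSer_spec hM (fun j => v j x) k) (hSer_spec hM (fun j => v j y) k)
      convert this using 1
      simp only [map_add, smul_add, Finset.sum_add_distrib]
      abel
    · refine (eq_hSer hM hM' fun k => ?_).symm
      have := Submodule.smul_mem _ z (hSer_spec hM (fun j => v j x) k)
      convert this using 1
      simp only [map_smul, smul_sub, Finset.smul_sum, smul_comm z, RingHom.id_apply]
  obtain ⟨s, hs⟩ := key v
  refine ⟨s, fun k => ?_⟩
  -- The remainder after `k` terms must be `h^k` times a single operator: the sum of the series with
  -- indices shifted by `k`.
  obtain ⟨t, ht⟩ := key fun j => v (j + k)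
  refine mem_hPow.2 ⟨t, ?_⟩
  rw [eq_sub_iff_add_eq]
  ext x
  rw [LinearMap.add_apply, LinearMap.smul_apply, hs, ht]
  refine eq_hSer hM hM' fun l => ?_
  have h1 := hSer_spec hM (fun j => v (j + k) x) l
  obtain ⟨y, hy⟩ := mem_hPow.1 h1
  have h2 : h ^ k • (hSer hM fun j => v (j + k) x) + (∑ j ∈ Finset.range k, h ^ j • v j) x -
      ∑ j ∈ Finset.range (k + l), h ^ j • v j x = h ^ (k + l) • y := by
    rw [pow_add, mul_smul, hy, Finset.sum_range_add, smul_sub, Finset.smul_sum, LinearMap.sum_apply]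
    simp only [smul_smul, ← pow_add, LinearMap.smul_apply, add_comm k]
    abel
  have h3 : ∑ j ∈ Finset.range (k + l), h ^ j • v j x - ∑ j ∈ Finset.range l, h ^ j • v j x ∈
      hPow M l := by
    rw [← Finset.sum_range_add_sum_Ico _ (Nat.le_add_left l k), add_sub_cancel_left]
    exact Submodule.sum_mem _ fun j hj => hPow_anti (Finset.mem_Ico.1 hj).1 (smul_mem_hPow j _)
  have h4 := hPow_anti (Nat.le_add_left l k) (smul_mem_hPow (k + l) y)
  rw [← h2] at h4
  simpa using Submodule.add_mem _ h4 h3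

end HAdicTopology

theorem hSeparated_vac (N : ℕ) (c : ℂ) : HSeparated (Vac N c) := by
  have := (AdicCompletion.isAdicComplete (M := PreVac N c) (I := hIdeal)
    (Submodule.fg_span_singleton h)).toIsHausdorff
  intro x hx
  refine this.haus x fun k => ?_
  rw [SModEq.zero, hIdeal_pow_smul_top]
  exact hx k

theorem hComplete_vac (N : ℕ) (c : ℂ) : HComplete (Vac N c) := by
  have := (AdicCompletion.isAdicComplete (M := PreVac N c) (I := hIdeal)
    (Submodule.fg_span_singleton h)).toIsPrecomplete
  intro v
  obtain ⟨s, hs⟩ := this.prec (f := fun k => ∑ j ∈ Finset.range k, h ^ j • v j) fun {m n} hmn => by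
    rw [SModEq.sub_mem, hIdeal_pow_smul_top, ← neg_mem_iff, neg_sub,
      ← Finset.sum_range_add_sum_Ico _ hmn, add_sub_cancel_left]
    exact Submodule.sum_mem _ fun j hj => hPow_anti (Finset.mem_Ico.1 hj).1 (smul_mem_hPow j _)
  refine ⟨s, fun k => ?_⟩
  have := hs k
  rw [SModEq.sub_mem, hIdeal_pow_smul_top] at this
  rwa [← neg_mem_iff, neg_sub]

/-! ### Reduction modulo powers of `h` -/

section Reduction

variable (R : Type*) [Ring R] [Algebra K R] (k : ℕ)

/-- The two-sided ideal `h^k R`. -/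
def hPowIdeal : Ideal R where
  carrier := hPow R k
  zero_mem' := Submodule.zero_mem _
  add_mem' := Submodule.add_mem _
  smul_mem' := by
    intro r x hx
    obtain ⟨y, rfl⟩ := mem_hPow.1 hx
    exact mem_hPow.2 ⟨r * y, by rw [smul_eq_mul, mul_smul_comm]⟩

instance : (hPowIdeal R k).IsTwoSided where
  mul_mem_of_left := by
    intro x r hx
    obtain ⟨y, rfl⟩ := mem_hPow.1 hx
    exact mem_hPow.2 ⟨y * r, by rw [smul_mul_assoc]⟩

/-- The quotient `R / h^k R`. -/
def RedRing : Type _ := R ⧸ hPowIdeal R k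

instance : Ring (RedRing R k) := inferInstanceAs (Ring (R ⧸ hPowIdeal R k))

instance : Algebra K (RedRing R k) := inferInstanceAs (Algebra K (R ⧸ hPowIdeal R k))

instance : Algebra ℂ (RedRing R k) :=
  ((algebraMap K (RedRing R k)).comp (PowerSeries.C (R := ℂ))).toAlgebra'
    fun z x => Algebra.commutes (cst z) x

instance : IsScalarTower ℂ K (RedRing R k) := IsScalarTower.of_algebraMap_eq' rfl

/-- The projection to the quotient. -/
def redMap : R →ₐ[K] RedRing R k := Ideal.Quotient.mkₐ K (hPowIdeal R k)

variable {R} {k}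

theorem redMap_eq_zero {x : R} : redMap R k x = 0 ↔ x ∈ hPow R k :=
  Ideal.Quotient.eq_zero_iff_mem

theorem redMap_surjective : Function.Surjective (redMap R k) := Ideal.Quotient.mk_surjective

theorem isNilpotent_redRing : IsNilpotent (algebraMap K (RedRing R k) h) := by
  refine ⟨k, ?_⟩
  rw [← map_pow, ← (redMap R k).commutes, redMap_eq_zero, Algebra.algebraMap_eq_smul_one]
  exact smul_mem_hPow k 1

/-! #### Two-sided series and their reductions -/

/-- The two-sided series `f` becomes a Laurent series modulo `h^k`, whose coefficients come from the
subalgebra `A`. -/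
def IsRed (A : Subalgebra K R) (k : ℕ) (f : ℤ → R) (z : LaurentRing (RedRing R k)) : Prop :=
  ∃ l : HahnSeries ℤ (RedRing R k), z = PowerSeries.C l ∧ ∀ m, redMap R k (f m) = l.coeff m ∧
    ∃ x ∈ A, redMap R k x = l.coeff m

variable {A : Subalgebra K R} {k : ℕ}

theorem isRed_zero : IsRed A k (fun _ => 0) 0 :=
  ⟨0, (map_zero _).symm, fun m => ⟨by simp, 0, A.zero_mem, by simp⟩⟩

theorem IsRed.add {f g : ℤ → R} {z w : LaurentRing (RedRing R k)} (hf : IsRed A k f z)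
    (hg : IsRed A k g w) : IsRed A k (fun m => f m + g m) (z + w) := by
  obtain ⟨l, rfl, hl⟩ := hf
  obtain ⟨l', rfl, hl'⟩ := hg
  refine ⟨l + l', (map_add _ _ _).symm, fun m => ⟨?_, ?_⟩⟩
  · rw [map_add, (hl m).1, (hl' m).1, HahnSeries.coeff_add]
  · obtain ⟨x, hx, h1⟩ := (hl m).2
    obtain ⟨y, hy, h2⟩ := (hl' m).2
    exact ⟨x + y, A.add_mem hx hy, by rw [map_add, h1, h2, HahnSeries.coeff_add]⟩

theorem IsRed.sum {α : Type*} {f : α → ℤ → R} {z : α → LaurentRing (RedRing R k)} {s : Finset α}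
    (hf : ∀ i ∈ s, IsRed A k (f i) (z i)) : IsRed A k (fun m => ∑ i ∈ s, f i m) (∑ i ∈ s, z i) := by
  classical
  induction s using Finset.induction_on with
  | empty => simpa using isRed_zero
  | insert a s ha ih =>
    simp only [Finset.sum_insert ha]
    exact (hf a (Finset.mem_insert_self _ _)).add
      (ih fun i hi => hf i (Finset.mem_insert_of_mem hi))

/-- For Laurent series only finitely many pairs of exponents contribute to a coefficient, so all
other products of the two-sided series lie in `h^k R`. -/
theorem IsRed.coeff_mul {f g : ℤ → R} {l l' : HahnSeries ℤ (RedRing R k)}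
    (hl : ∀ m, redMap R k (f m) = l.coeff m) (hl' : ∀ m, redMap R k (g m) = l'.coeff m) (m : ℤ) :
    ∃ F : Finset ℤ, (∀ j ∉ F, f (m - j) * g j ∈ hPow R k) ∧
      (l * l').coeff m = ∑ j ∈ F, l.coeff (m - j) * l'.coeff j := by
  classical
  have hD : ∀ p : ℤ × ℤ, p ∈ Finset.antidiagonal l.isPWO_support l'.isPWO_support m ↔
      l.coeff p.1 ≠ 0 ∧ l'.coeff p.2 ≠ 0 ∧ p.1 + p.2 = m := by
    intro p
    rw [Finset.mem_antidiagonal]; rfl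
  refine ⟨(Finset.antidiagonal l.isPWO_support l'.isPWO_support m).image Prod.snd, ?_, ?_⟩
  · intro j hj
    rw [← redMap_eq_zero, map_mul, hl, hl']
    by_contra hne
    refine hj (Finset.mem_image.2 ⟨(m - j, j), (hD _).2 ⟨?_, ?_, by simp⟩, rfl⟩)
    · intro h0; exact hne (by rw [h0, zero_mul])
    · intro h0; exact hne (by rw [h0, mul_zero])
  · rw [HahnSeries.coeff_mul, Finset.sum_image]
    · refine Finset.sum_congr rfl fun p hp => ?_
      have := ((hD p).1 hp).2.2
      rw [← this, add_sub_cancel_right]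
    · intro p hp q hq hpq
      have h1 := ((hD p).1 hp).2.2
      have h2 := ((hD q).1 hq).2.2
      ext
      · omega
      · exact hpq

/-- The product of two-sided series exists because modulo every `h^k` it is a product of Laurent
series. Representatives in `A` multiply along, which later places the coefficients in the module of
the twisted Yangian. -/
theorem isRed_mul (hR : HComplete R) {f g : ℤ → R} {z w : ∀ k, LaurentRing (RedRing R k)}
    (hf : ∀ k, IsRed A k f (z k)) (hg : ∀ k, IsRed A k g (w k)) :
    (∀ m, HSummable fun j => f (m - j) * g j) ∧
      ∀ k, IsRed A k (fun m => hsum fun j => f (m - j) * g j) (z k * w k) := by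
  have hs : ∀ m, HSummable fun j => f (m - j) * g j := by
    intro m
    refine hsummable_of_finite hR fun k => ?_
    obtain ⟨l, -, hl⟩ := hf k
    obtain ⟨l', -, hl'⟩ := hg k
    obtain ⟨F, hF, -⟩ := IsRed.coeff_mul (fun m => (hl m).1) (fun m => (hl' m).1) m
    exact F.finite_toSet.subset fun j hj => by
      by_contra hjF
      exact hj (hF j hjF)
  refine ⟨hs, fun k => ?_⟩
  obtain ⟨l, hz, hl⟩ := hf k
  obtain ⟨l', hw, hl'⟩ := hg k
  refine ⟨l * l', by rw [hz, hw, map_mul], fun m => ?_⟩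
  obtain ⟨F, hF, hm⟩ := IsRed.coeff_mul (fun m => (hl m).1) (fun m => (hl' m).1) m
  constructor
  · have := hsum_sub_sum_mem (hs m) hF
    rw [← redMap_eq_zero, map_sub, sub_eq_zero, map_sum] at this
    rw [this, hm]
    exact Finset.sum_congr rfl fun j _ => by rw [map_mul, (hl _).1, (hl' _).1]
  · choose x hx h1 using fun m => (hl m).2
    choose y hy h2 using fun m => (hl' m).2
    refine ⟨∑ j ∈ F, x (m - j) * y j, A.sum_mem fun j _ => A.mul_mem (hx _) (hy _), ?_⟩
    rw [hm, map_sum]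
    exact Finset.sum_congr rfl fun j _ => by rw [map_mul, h1, h2]

end Reduction

/-! #### Matrices of two-sided series -/

section BiMatrices

variable {N n : ℕ} {c : ℂ}

/-- The matrix `F` of two-sided series has the reductions `M`. -/
def IsRedMat (A : Subalgebra K (VacEnd N c)) (F : BiMatrix N c n) (M : ∀ k, TMat (Fin n) N (LaurentRing (RedRing (VacEnd N c) k))) :
    Prop :=
  ∀ k a b, IsRed A k (F a b) (M k a b)

variable {A : Subalgebra K (VacEnd N c)}

theorem hComplete_vacEnd : HComplete (VacEnd N c) :=
  hComplete_end (hComplete_vac N c) (hSeparated_vac N c)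

theorem isRed_one (k : ℕ) : IsRed A k (fun m => if m = 0 then 1 else 0) 1 := by
  refine ⟨1, (map_one _).symm, fun m => ?_⟩
  rw [HahnSeries.coeff_one]
  beta_reduce
  split_ifs
  · exact ⟨map_one _, 1, A.one_mem, map_one _⟩
  · exact ⟨map_zero _, 0, A.zero_mem, map_zero _⟩

theorem isRedMat_one : IsRedMat A (BiMatrix.one : BiMatrix N c n) fun _ => 1 := by
  intro k a b
  by_cases hab : a = b
  · subst hab
    simpa [BiMatrix.one] using isRed_one (A := A) k
  · simpa [BiMatrix.one, hab] using isRed_zero (A := A) (k := k)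

variable {F H : BiMatrix N c n} {M M' : ∀ k, TMat (Fin n) N (LaurentRing (RedRing (VacEnd N c) k))}

theorem IsRedMat.mulConverges (hF : IsRedMat A F M) (hH : IsRedMat A H M') :
    BiMatrix.MulConverges F H := fun a d b m =>
  (isRed_mul hComplete_vacEnd (fun k => hF k a d) fun k => hH k d b).1 m

theorem IsRedMat.mul (hF : IsRedMat A F M) (hH : IsRedMat A H M') :
    IsRedMat A (BiMatrix.mul F H) fun k => M k * M' k := by
  intro k a b
  show IsRed A k (F.mul H a b) ((M k * M' k) a b)
  rw [Matrix.mul_apply]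
  exact IsRed.sum fun d _ =>
    (isRed_mul hComplete_vacEnd (fun k => hF k a d) fun k => hH k d b).2 k

theorem IsRedMat.listProd
    {l : List (BiMatrix N c n × ∀ k, TMat (Fin n) N (LaurentRing (RedRing (VacEnd N c) k)))}
    (hl : ∀ p ∈ l, IsRedMat A p.1 p.2) :
    BiMatrix.ListConverges (l.map Prod.fst) ∧
      IsRedMat A (BiMatrix.listProd (l.map Prod.fst)) fun k => (l.map fun p => p.2 k).prod := by
  induction l with
  | nil => exact ⟨trivial, isRedMat_one⟩
  | cons p l ih =>
    have hp := hl p List.mem_cons_self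
    obtain ⟨h1, h2⟩ := ih fun q hq => hl q (List.mem_cons_of_mem _ hq)
    refine ⟨⟨hp.mulConverges h2, h1⟩, ?_⟩
    simp only [List.map_cons, List.prod_cons]
    exact hp.mul h2

end BiMatrices

/-! ### Scalar series in `u / h` -/

section Scalars

variable (A : Type*) [Ring A] [Algebra K A]

/-- The homomorphism `f(u) ↦ f(u / h)` for power series in `u⁻¹`. -/
def scaleHom : ℂ⟦X⟧ →+* A⟦X⟧ :=
  (PowerSeries.map (algebraMap K A)).comp
    ((PowerSeries.rescale h).comp (PowerSeries.map (PowerSeries.C (R := ℂ))))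

variable {A}

theorem coeff_scaleHom (f : ℂ⟦X⟧) (m : ℕ) :
    coeff m (scaleHom A f) = algebraMap K A (h ^ m * cst (coeff m f)) := by
  rw [scaleHom, RingHom.comp_apply, coeff_map, RingHom.comp_apply, coeff_rescale, coeff_map]

theorem scaleHom_gSeries (N : ℕ) :
    scaleHom A (gSeries N) = (gScaled N).map (algebraMap K A) := by
  ext m
  rw [coeff_scaleHom, coeff_map, gScaled, coeff_mk, mul_comm]

theorem scaleHom_C (b : ℂ) : scaleHom A (PowerSeries.C b) = PowerSeries.C (algebraMap K A (cst b)) := by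
  ext m
  rw [coeff_scaleHom, coeff_C, coeff_C]
  split_ifs with hm
  · rw [hm, pow_zero, one_mul]
  · show algebraMap K A (h ^ m * PowerSeries.C (0 : ℂ)) = 0
    rw [map_zero, mul_zero, map_zero]

theorem commute_scaleHom (f : ℂ⟦X⟧) (g : A⟦X⟧) : Commute (scaleHom A f) g := by
  ext m
  rw [coeff_mul, coeff_mul, ← Finset.Nat.sum_antidiagonal_swap]
  refine Finset.sum_congr rfl fun p _ => ?_
  rw [Prod.fst_swap, Prod.snd_swap, coeff_scaleHom]
  exact Algebra.commutes _ _

theorem scaleHom_linInv (a b : ℂ) : scaleHom A (linInv a b) =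
    h • linInv (algebraMap K A (cst a)) (algebraMap K A (h * cst b)) := by
  ext m
  rw [coeff_scaleHom, coeff_smul, linInv, linInv, coeff_mk, coeff_mk]
  rcases m with _ | m
  · simp
  · rw [if_neg (Nat.succ_ne_zero m), if_neg (Nat.succ_ne_zero m), Algebra.smul_def,
      ← map_neg, ← map_pow (algebraMap K A), ← map_pow (algebraMap K A), ← map_mul (algebraMap K A),
      ← map_mul (algebraMap K A)]
    congr 1
    rw [cst, cst, cst, map_mul, map_pow, map_pow, map_neg, Nat.add_sub_cancel]
    ring

theorem scaleHom_subInv (a b : ℂ) (f : ℂ⟦X⟧) : scaleHom A (subInv a b f) =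
    subInv (algebraMap K A (cst a)) (algebraMap K A (h * cst b)) (scaleHom A f) := by
  rw [← subInvHom_apply (Commute.all a) (Commute.all b),
    ← subInvHom_apply (Algebra.commute_algebraMap_left _) (Algebra.commute_algebraMap_left _)]
  have hX : scaleHom A X = h • X := by
    ext m
    rw [coeff_scaleHom, coeff_smul, coeff_X, coeff_X]
    split_ifs with hm
    · rw [hm, Algebra.smul_def]; simp
    · simp
  have key : (scaleHom A).comp (subInvHom a b (Commute.all a) (Commute.all b)) =
      (subInvHom (algebraMap K A (cst a)) (algebraMap K A (h * cst b))
        (Algebra.commute_algebraMap_left _) (Algebra.commute_algebraMap_left _)).comp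
          (scaleHom A) := by
    refine hom_eq_of_isSmall (isSmall_of_coeff_zero ?_) (fun z => ?_) ?_
    · rw [RingHom.comp_apply, subInvHom_X, coeff_scaleHom, linInv_constCoeff, cst, map_zero, mul_zero,
        map_zero]
    · rw [RingHom.comp_apply, RingHom.comp_apply, subInvHom_C, scaleHom_C, subInvHom_C]
    · rw [RingHom.comp_apply, RingHom.comp_apply, subInvHom_X, hX, Algebra.smul_def, map_mul,
        PowerSeries.algebraMap_apply, subInvHom_C, subInvHom_X, scaleHom_linInv, Algebra.smul_def,
        PowerSeries.algebraMap_apply]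
  exact RingHom.congr_fun key f

/-- The data of `R̄ᵗ((-2 u + b) / h)` as series in the variable `h / u`. -/
def scaledPair (N : ℕ) (b : ℂ) : ℂ⟦X⟧ × ℂ⟦X⟧ :=
  (subInv (-1 / 2) b (gSeries N), linInv (-1 / 2) b)

/-- After scaling, `R̄ᵗ(-2u + hb)` depends on `u/h` only, so it comes from a matrix over `ℂ[[X]]`
with `X = h/u`. Modulo `h^k` this variable is nilpotent. -/
theorem RbarT_eq (N : ℕ) (c : ℂ) {n : ℕ} (i j : Fin n) (b : ℂ) :
    RbarT N c i j (h * cst b) =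
      (RT N ℂ⟦X⟧ i j (scaledPair N b)).map (scaleHom (DYc N c)) := by
  rw [RbarT, Rbar, leg₂_ptranspose_smul_one_sub, RT, map_smul_one_sub, qOn_map, scaledPair,
    scaleHom_subInv, scaleHom_linInv, scaleHom_gSeries]

/-- With `y = h/u`, `w = -2u` and `η = h`, the condition `y w = -2η` identifies `h/(-2u + hb)` with
the corresponding value of the family. -/
theorem nev_scaledPair {S : Type*} [CommRing S] [Algebra ℂ S] {N : ℕ} {w η y : S} (hw : IsUnit w)
    (hη : IsNilpotent η) (hy : IsNilpotent y) (hyw : y * w = -2 * η) {k d : ℤ} {b : ℂ}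
    (hb : b = -(d : ℂ) - k * N / 4) :
    (nev y hy (scaledPair N b).1, nev y hy (scaledPair N b).2) = famP N w η k d := by
  have h2 : nev y hy (linInv (-1 / 2) b) = famVal N w η k d := by
    refine eq_famVal hw hη ?_
    have hl := congrArg (nev y hy) (linInv_mul (Commute.all (-1 / 2) b))
    rw [map_mul, map_add, map_one, map_mul, map_mul, map_mul, map_mul, nev_C, nev_C, nev_X] at hl
    have e1 : (algebraMap ℂ S (-1 / 2)) * -2 = 1 := by
      rw [← map_ofNat (algebraMap ℂ S) 2, ← map_neg, ← map_mul]
      norm_num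
    rw [famDen, ← hb]
    generalize nev y hy (linInv (-1 / 2) b) = l at *
    generalize algebraMap ℂ S (-1 / 2) = a at *
    generalize algebraMap ℂ S b = b' at *
    linear_combination w * hl + (a - l * a * b') * hyw + (η - l * b' * η) * e1
  refine Prod.ext ?_ h2
  show nev y hy (subInv (-1 / 2) b (gSeries N)) = gam N (famVal N w η k d)
  rw [← subInvHom_apply (Commute.all _) (Commute.all b)]
  refine (gam_eq_of_hom N (isNilpotent_famVal hη k d) (F := (nev y hy).comp
    (subInvHom _ _ (Commute.all (-1 / 2)) (Commute.all b))) (fun z => ?_) ?_).symm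
  · rw [RingHom.comp_apply, subInvHom_C, nev_C]
  · rw [RingHom.comp_apply, subInvHom_X, h2]

end Scalars

/-! ### Ordered products -/

section OrderedProducts

variable {α A B : Type*} [Ring A] [Ring B]

/-- `∏_i (F_i ∏_{j > i} R_{ij})`. -/
def brProd (F : α → A) (R : α → α → A) : List α → A
  | [] => 1
  | i :: l => F i * fwd (R i) l * brProd F R l

theorem map_brProd (φ : A →+* B) (F : α → A) (R : α → α → A) (l : List α) :
    φ (brProd F R l) = brProd (fun i => φ (F i)) (fun i j => φ (R i j)) l := by
  induction l with
  | nil => exact map_one φ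
  | cons i l ih => rw [brProd, brProd, map_mul, map_mul, ih, fwd, map_list_prod, List.map_map]; rfl

theorem brProd_congr {F F' : α → A} {R R' : α → α → A} {l : List α}
    (hl : l.Nodup) (hF : ∀ i ∈ l, F i = F' i) (hR : ∀ i ∈ l, ∀ j ∈ l, i ≠ j → R i j = R' i j) :
    brProd F R l = brProd F' R' l := by
  induction l with
  | nil => rfl
  | cons i l ih =>
    obtain ⟨hi, hl⟩ := List.nodup_cons.1 hl
    rw [brProd, brProd, ih hl (fun j hj => hF j (by simp [hj]))
      fun j hj k hk => hR j (by simp [hj]) k (by simp [hk]), hF i (by simp), fwd, fwd,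
      List.map_congr_left fun j hj => hR i (by simp) j (by simp [hj]) (by rintro rfl; exact hi hj)]

theorem prod_flatMap_eq_brProd [LinearOrder α] (F : α → A) (R : α → α → A) {l : List α}
    (hl : l.Pairwise (· < ·)) :
    (l.flatMap fun i => F i :: ((l.filter (i < ·)).map (R i))).prod = brProd F R l := by
  -- The filter runs over the whole list, so the induction keeps the processed prefix; as the list
  -- is increasing, filtering removes exactly the prefix and the current entry.
  have key : ∀ l₁ l₂ : List α, (l₁ ++ l₂).Pairwise (· < ·) →
      (l₂.flatMap fun i => F i :: (((l₁ ++ l₂).filter (i < ·)).map (R i))).prod =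
        brProd F R l₂ := by
    intro l₁ l₂
    induction l₂ generalizing l₁ with
    | nil => intro _; rfl
    | cons i l₂ ih =>
      intro hp
      have h1 := ih (l₁ ++ [i]) (by simpa using hp)
      have h2 : (l₁ ++ i :: l₂).filter (i < ·) = l₂ := by
        rw [List.pairwise_append, List.pairwise_cons] at hp
        rw [List.filter_append, List.filter_cons_of_neg (by simp), List.filter_eq_nil_iff.2,
          List.filter_eq_self.2, List.nil_append]
        · intro j hj; simpa using hp.2.1.1 j hj
        · intro j hj; simpa using (hp.2.2 j hj i (by simp)).le
      rw [List.append_assoc, List.singleton_append] at h1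
      rw [List.flatMap_cons, List.prod_append, h1, h2, List.prod_cons, brProd, fwd]
  exact key [] l hl

theorem isUnit_brProd {F : α → A} {R : α → α → A} (hF : ∀ i, IsUnit (F i))
    (hR : ∀ i j, IsUnit (R i j)) (l : List α) : IsUnit (brProd F R l) := by
  induction l with
  | nil => exact isUnit_one
  | cons i l ih =>
    refine ((hF i).mul ?_).mul ih
    exact List.prod_isUnit fun x hx => by
      obtain ⟨j, -, rfl⟩ := List.mem_map.1 hx
      exact hR i j

end OrderedProducts

section OrderedProducts

variable {ι α : Type*} [Fintype ι] [DecidableEq ι] {N : ℕ} {S Z : Type*} [CommRing S] [Ring Z]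
  [Algebra S Z]

theorem sProd_eq_brProd (e : α → ι) (M : α → Matrix (Fin N) (Fin N) Z) (r : α → α → S × S)
    (l : List α) : sProd e M r l =
      brProd (fun i => legOn (e i) (M i)) (fun i j => RT N Z (e i) (e j) (r i j)) l := by
  induction l with
  | nil => rfl
  | cons i l ih => rw [sProd, brProd, ih]

theorem gProd_eq_brProd (e : α → ι) (G : Matrix (Fin N) (Fin N) Z) (r : α → α → S × S)
    (l : List α) : gProd e G r l =
      brProd (fun i => legOn (e i) G) (fun i j => RT N Z (e i) (e j) (r i j)) l := by
  induction l with
  | nil => rfl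
  | cons i l ih => rw [gProd, brProd, ih]

end OrderedProducts

/-! ### Invertible matrices of power series -/

section MatrixUnits

variable {m : Type*} [Fintype m] [DecidableEq m] {A : Type*} [Ring A]

/-- Power series of matrices as matrices of power series. -/
def matrixSeries : (Matrix m m A)⟦X⟧ →+* Matrix m m A⟦X⟧ where
  toFun f := Matrix.of fun a b => PowerSeries.mk fun r => coeff r f a b
  map_one' := by
    ext a b r
    simp only [Matrix.of_apply, coeff_mk, coeff_one, Matrix.one_apply]
    by_cases hr : r = 0 <;> by_cases hab : a = b <;> simp [hr, hab, coeff_one, Matrix.one_apply]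
  map_mul' f g := by
    ext a b r
    simp only [Matrix.of_apply, coeff_mk, Matrix.mul_apply, coeff_mul, map_sum, Matrix.sum_apply]
    rw [Finset.sum_comm]
  map_zero' := by
    ext a b r
    simp
  map_add' f g := by
    ext a b r
    simp

/-- A matrix of series is a series of matrices, which is invertible once its constant term is. -/
theorem isUnit_of_map_constantCoeff {M : Matrix m m A⟦X⟧}
    (hM : IsUnit (M.map (constantCoeff (R := A)))) : IsUnit M := by
  set f : (Matrix m m A)⟦X⟧ := PowerSeries.mk fun r => M.map (coeff r) with hf
  have h1 : matrixSeries f = M := by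
    ext a b r
    simp [matrixSeries, hf]
  have h2 : IsUnit f := by
    rw [PowerSeries.isUnit_iff_constantCoeff]
    convert hM
    ext a b
    simp [hf]
  rw [← h1]
  exact h2.map matrixSeries

end MatrixUnits

/-! ### Reductions of operators on the vacuum module -/

section ReducedAction

variable (N : ℕ) (c : ℂ) (k : ℕ)

/-- The operators on the vacuum module modulo `h^k`. -/
abbrev RedEnd : Type _ := RedRing (VacEnd N c) k

/-- The action of the double Yangian modulo `h^k`. -/
def redAct : DYc N c →ₐ[K] RedEnd N c k := (redMap (VacEnd N c) k).comp (act N c)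

/-- The action of the free algebra modulo `h^k`. -/
def redRep : FreeGen N →ₐ[K] RedEnd N c k := (redAct N c k).comp (toDYc N c)

/-- The change of coefficients in power series. -/
abbrev redSeries : (DYc N c)⟦X⟧ →+* (RedEnd N c k)⟦X⟧ :=
  PowerSeries.map (redAct N c k : DYc N c →+* RedEnd N c k)

variable {N c k}

theorem coeff_plusPoint_pow {E : Type*} [Ring E] [Algebra K E] (d : ℤ) (r i : ℕ) :
    coeff i (plusPoint E d ^ r) =
      algebraMap K E ((r.choose i : K) * (h * cst d) ^ (r - i)) := by
  have h1 : plusPoint E d = PowerSeries.map (algebraMap K E)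
      (((Polynomial.X + Polynomial.C (h * cst d) : Polynomial K) : K⟦X⟧)) := by
    rw [plusPoint, Polynomial.coe_add, Polynomial.coe_X, Polynomial.coe_C, map_add, map_X, map_C,
      PowerSeries.algebraMap_apply]
  rw [h1, ← map_pow, ← Polynomial.coe_pow, coeff_map, Polynomial.coeff_coe,
    Polynomial.coeff_X_add_C_pow, mul_comm]

theorem shiftTerm_mem_hPow (d : ℤ) (f : (DYc N c)⟦X⟧) {m r : ℕ} (hr : m + k ≤ r) :
    shiftTerm (h * cst d) f m r ∈ hPow (VacEnd N c) k := by
  refine mem_hPow.2 ⟨((r.choose m : K) * (h ^ (r - m - k) * cst d ^ (r - m))) •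
    act N c (coeff r f), ?_⟩
  rw [shiftTerm, smul_smul]
  congr 1
  have : r - m = k + (r - m - k) := by omega
  rw [mul_pow, mul_left_comm, ← mul_assoc (h ^ k), ← pow_add, ← this]

theorem hsummable_shiftTerm (d : ℤ) (f : (DYc N c)⟦X⟧) (m : ℕ) :
    HSummable (shiftTerm (h * cst d) f m) := by
  refine hsummable_of_finite hComplete_vacEnd fun k =>
    (Finset.range (m + k)).finite_toSet.subset fun r hr => ?_
  by_contra hr'
  exact hr (shiftTerm_mem_hPow d f (by simpa using hr'))

theorem h_pow_redRing : algebraMap K (RedEnd N c k) h ^ k = 0 := by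
  rw [← map_pow, ← (redMap (VacEnd N c) k).commutes, redMap_eq_zero,
    Algebra.algebraMap_eq_smul_one]
  exact smul_mem_hPow k 1

theorem algebraMap_redRing_eq_zero {r : ℕ} (hr : k ≤ r) (z : K) :
    algebraMap K (RedEnd N c k) (h ^ r * z) = 0 := by
  rw [map_mul, map_pow, ← Nat.add_sub_of_le hr, pow_add, h_pow_redRing, zero_mul, zero_mul]

theorem coeff_plusEval_plusPoint (hp : IsPoint (plusPoint (RedEnd N c k) d)) (f : (DYc N c)⟦X⟧)
    (m : ℕ) : coeff m (plusEval hp (redSeries N c k f)) =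
      redMap _ k (∑ r ∈ Finset.range (m + k), shiftTerm (h * cst d) f m r) := by
  rw [plusEval, coeff_ev _ _ _ m (R := m + k), map_sum]
  · refine Finset.sum_congr rfl fun r _ => ?_
    rw [coeff_C_mul, coeff_plusPoint_pow, coeff_map, shiftTerm, map_smul, ← Algebra.commutes,
      Algebra.smul_def]
    rfl
  · intro i hi r hr
    rw [coeff_plusPoint_pow, mul_pow, mul_left_comm]
    exact algebraMap_redRing_eq_zero (by omega) _

variable {B : Subalgebra K (DYc N c)}

/-- In the coefficient of `u^m` the terms with `r ≥ m + k` are divisible by `h^k`; the remaining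
finite sum lies in the image of `B` and is the representative required by `IsRed`. -/
theorem isRed_ofPosSeriesShift (d : ℤ) {f : (DYc N c)⟦X⟧} (hf : ∀ r, coeff r f ∈ B)
    (hp : IsPoint (plusPoint (RedEnd N c k) d)) :
    IsRed (B.map (act N c)) k (ofPosSeriesShift (h * cst d) f)
      (ofPlus (plusEval hp (redSeries N c k f))) := by
  refine ⟨_, rfl, fun m => ?_⟩
  rw [PowerSeries.coeff_coe, ofPosSeriesShift]
  by_cases hm : m < 0
  · rw [if_pos hm, if_neg (not_le.2 hm)]
    exact ⟨map_zero _, 0, Subalgebra.zero_mem _, map_zero _⟩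
  · obtain ⟨m, rfl⟩ := Int.eq_ofNat_of_zero_le (not_lt.1 hm)
    rw [if_neg hm, if_pos (not_lt.1 hm), Int.toNat_natCast, Int.natAbs_natCast,
      coeff_plusEval_plusPoint]
    refine ⟨?_, _, ?_, rfl⟩
    · rw [← sub_eq_zero, ← map_sub, redMap_eq_zero]
      exact hsum_sub_sum_mem (hsummable_shiftTerm d f m) fun r hr =>
        shiftTerm_mem_hPow d f (by simpa using hr)
    · exact Subalgebra.sum_mem _ fun r _ => Subalgebra.smul_mem _
        (Subalgebra.mem_map.2 ⟨_, hf r, rfl⟩) _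

/-- The element `h / u`. -/
def hOverU (E : Type*) [Ring E] [Algebra ℂ E] [Algebra K E] [IsScalarTower ℂ K E] :
    LaurentCenter E := cK h * cU (-1)

theorem isNilpotent_hOverU : IsNilpotent (hOverU (RedEnd N c k)) :=
  (Commute.all _ _).isNilpotent_mul_right (isNilpotent_cK isNilpotent_redRing)

theorem ofCenter_hOverU_pow {E : Type*} [Ring E] [Algebra ℂ E] [Algebra K E]
    [IsScalarTower ℂ K E] (r : ℕ) (b : ℂ) :
    ofCenter (algebraMap ℂ _ b * hOverU E ^ r) =
      PowerSeries.C (HahnSeries.single (-r : ℤ) (algebraMap K E (h ^ r * cst b))) := by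
  have hU : ∀ r : ℕ, (cU (-1) : LaurentCenter E) ^ r = cU (-r : ℤ) := by
    intro r
    induction r with
    | zero => rw [pow_zero, Nat.cast_zero, neg_zero, cU_zero]
    | succ r ih => rw [pow_succ, ih, cU_mul]; congr 1; push_cast; ring
  rw [hOverU, mul_pow, hU, ← cK_cst, ← map_pow, ← mul_assoc, ← map_mul, map_mul, coe_cK, coe_cU,
    mul_comm (cst b), PowerSeries.algebraMap_apply, HahnSeries.algebraMap_apply, ← map_mul,
    HahnSeries.C_apply, HahnSeries.single_mul_single, zero_add, mul_one]

theorem hOverU_pow : hOverU (RedEnd N c k) ^ k = 0 := by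
  have := ofCenter_hOverU_pow (E := RedEnd N c k) k 1
  rw [map_one, one_mul, algebraMap_redRing_eq_zero le_rfl, map_zero, map_zero] at this
  exact ofCenter_injective (this.trans (map_zero _).symm)

/-- A series in `h/u` is infinite in `u⁻¹`, but modulo `h^k` its terms vanish from the `k`-th on,
leaving a Laurent polynomial. -/
theorem isRed_ofNegSeries (f : ℂ⟦X⟧) (A : Subalgebra K (VacEnd N c)) :
    IsRed A k (ofNegSeries (scaleHom (DYc N c) f))
      (ofCenter (nev (hOverU (RedEnd N c k)) isNilpotent_hOverU f)) := by
  refine ⟨∑ r ∈ Finset.range k,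
    HahnSeries.single (-r : ℤ) (algebraMap K (RedEnd N c k) (h ^ r * cst (coeff r f))), ?_, ?_⟩
  · rw [nev_eq_sum _ _ hOverU_pow, map_sum, map_sum]
    exact Finset.sum_congr rfl fun r _ => ofCenter_hOverU_pow r _
  · intro m
    have h1 : redMap (VacEnd N c) k (ofNegSeries (scaleHom (DYc N c) f) m) =
        (∑ r ∈ Finset.range k, HahnSeries.single (-r : ℤ)
          (algebraMap K (RedEnd N c k) (h ^ r * cst (coeff r f)))).coeff m := by
      rw [HahnSeries.coeff_sum, ofNegSeries]
      split_ifs with hm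
      · obtain ⟨r, hr⟩ := Int.eq_ofNat_of_zero_le (neg_nonneg.2 hm)
        obtain rfl : m = -(r : ℤ) := by rw [← neg_neg m, hr]
        rw [neg_neg, Int.toNat_natCast, coeff_scaleHom, AlgHom.commutes, AlgHom.commutes]
        by_cases hk : r < k
        · rw [Finset.sum_eq_single_of_mem r (Finset.mem_range.2 hk), HahnSeries.coeff_single_same]
          intro s _ hs
          exact HahnSeries.coeff_single_of_ne (by simpa using hs.symm)
        · rw [algebraMap_redRing_eq_zero (not_lt.1 hk), Finset.sum_eq_zero]
          intro s hs
          refine HahnSeries.coeff_single_of_ne ?_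
          rw [Finset.mem_range] at hs
          omega
      · rw [map_zero, Finset.sum_eq_zero]
        intro s hs
        exact HahnSeries.coeff_single_of_ne (by omega)
    refine ⟨h1, _, ?_, h1⟩
    rw [ofNegSeries]
    split_ifs
    · rw [coeff_scaleHom, AlgHom.commutes]
      exact Subalgebra.algebraMap_mem _ _
    · exact Subalgebra.zero_mem _

theorem RT_map_center {ι S' : Type*} [Fintype ι] [DecidableEq ι] [CommRing S'] {E : Type*} [Ring E]
    [Algebra ℂ E] [Algebra K E] [IsScalarTower ℂ K E] (φ : S' →+* LaurentCenter E) (i j : ι)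
    (p : S' × S') : (RT N S' i j p).map (ofCenter.comp φ) =
      RT N (LaurentRing E) i j (φ p.1, φ p.2) := by
  rw [RT, map_smul_one_sub, qOn_map]
  ext1 a b
  simp only [RT, Matrix.smul_apply, Matrix.sub_apply, center_smul, smul_eq_mul, RingHom.comp_apply]

theorem isRedMat_RbarT {n : ℕ} (A : Subalgebra K (VacEnd N c)) (i j : Fin n) (d : ℤ) :
    IsRedMat A ((RbarT N c i j (h * cst (-(d : ℂ)))).map ofNegSeries) fun k =>
      RT N (LaurentRing (RedEnd N c k)) i j (famP N (denC (RedEnd N c k)) (cK h) 0 d) := by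
  intro k a b
  have hU := cU_mul (E := RedEnd N c k) (-1) 1
  rw [neg_add_cancel, cU_zero] at hU
  have h1 := RT_map_center (N := N) (nev (hOverU (RedEnd N c k)) isNilpotent_hOverU) i j
    (scaledPair N (-(d : ℂ)))
  rw [nev_scaledPair (k := 0) (d := d) (w := denC (RedEnd N c k)) (η := cK h) isUnit_denC
    (isNilpotent_cK isNilpotent_redRing) isNilpotent_hOverU
    (by rw [hOverU, denC]; linear_combination (-2 * cK h) * hU) (by simp)] at h1
  show IsRed A k (ofNegSeries (RbarT N c i j (h * cst (-(d : ℂ))) a b)) (RT N _ i j _ a b)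
  rw [← congrFun (congrFun h1 a) b, RbarT_eq]
  exact isRed_ofNegSeries _ _

/-! #### The factors `S⁺` -/

variable (G : Matrix (Fin N) (Fin N) ℂ)

theorem coeff_constMatrix_mem (a b : Fin N) (r : ℕ) :
    coeff r (constMatrix G (DYc N c) a b) ∈ B := by
  rw [constMatrix, Matrix.map_apply, PowerSeries.algebraMap_apply, coeff_C]
  split_ifs
  · exact Subalgebra.algebraMap_mem _ _
  · exact Subalgebra.zero_mem _

theorem coeff_SPlusMatrix_mem (a b : Fin N) (r : ℕ) :
    coeff r (SPlusMatrix N c G a b) ∈ Asub N c G := by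
  have h1 : coeff r (sigmaPlusMatrix N c G a b) ∈ Asub N c G :=
    Algebra.subset_adjoin (Or.inr ⟨a, b, r, rfl⟩)
  rw [SPlusMatrix_eq, Matrix.sub_apply, Matrix.smul_apply, map_sub, coeff_smul]
  exact Subalgebra.sub_mem _ (coeff_constMatrix_mem G a b r) (Subalgebra.smul_mem _ h1 _)

theorem TPlusMatrix_redSeries : (TPlusMatrix (tNeg N c)).map (redSeries N c k) =
    TPlusMatrix fun i j r => redRep N c k (freeNeg N i j r) := by
  have h1 : TPlusMatrix (tNeg N c) = (TPlusMatrix (freeNeg N)).map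
      (PowerSeries.map (toDYc N c : FreeGen N →+* DYc N c)) := (TPlusMatrix_map _ _).symm
  rw [h1, ← TPlusMatrix_map, Matrix.map_map, redSeries, ← RingHom.coe_comp, ← PowerSeries.map_comp]
  rfl

theorem TMatrix_redSeries : (TMatrix (tPos N c)).map (redSeries N c k) =
    TMatrix fun i j r => redRep N c k (freePos N i j r) := by
  have h1 : TMatrix (tPos N c) = (TMatrix (freePos N)).map
      (PowerSeries.map (toDYc N c : FreeGen N →+* DYc N c)) := (TMatrix_map _ _).symm
  rw [h1, ← TMatrix_map, Matrix.map_map, redSeries, ← RingHom.coe_comp, ← PowerSeries.map_comp]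
  rfl

theorem redSeries_negVar (f : (DYc N c)⟦X⟧) :
    redSeries N c k (negVar f) = negVar (redSeries N c k f) := by
  ext r
  simp [negVar]

/-- The matrix `G` over the ring of series. -/
abbrev formMatrix (E : Type*) [Ring E] [Algebra ℂ E] [Algebra K E] [IsScalarTower ℂ K E] :
    Matrix (Fin N) (Fin N) (LaurentRing E) := G.map (algebraMap ℂ (LaurentRing E))

theorem constMatrix_map (φ : (DYc N c)⟦X⟧ →+* LaurentRing (RedEnd N c k))
    (hφ : ∀ z : K, φ (algebraMap K _ z) = algebraMap K _ z) :
    (constMatrix G (DYc N c)).map φ = formMatrix G (RedEnd N c k) := by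
  ext1 a b
  show φ (algebraMap K _ (cst (G a b))) = algebraMap ℂ _ (G a b)
  rw [hφ, ← coe_cK, cK_cst, ofCenter_algebraMap]

theorem redSeries_algebraMap (z : K) :
    redSeries N c k (algebraMap K _ z) = algebraMap K _ z := by
  rw [PowerSeries.algebraMap_apply, map_C, PowerSeries.algebraMap_apply]
  exact congrArg PowerSeries.C ((redAct N c k).commutes z)

theorem plusMatrix_eq_map {v : (RedEnd N c k)⟦X⟧} (hv : IsPoint v) :
    plusMatrix (fun i j r => redRep N c k (freeNeg N i j r)) hv =
      (TPlusMatrix (tNeg N c)).map ((ofPlus.comp (plusEval hv)).comp (redSeries N c k)) := by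
  rw [plusMatrix, ← TPlusMatrix_redSeries]
  ext1 a b
  simp only [Matrix.map_apply, RingHom.comp_apply]

theorem SPlusMatrix_red {v : (RedEnd N c k)⟦X⟧} (hv : IsPoint v) :
    (SPlusMatrix N c G).map ((ofPlus.comp (plusEval hv)).comp (redSeries N c k)) =
      plusMatrix (fun i j r => redRep N c k (freeNeg N i j r)) hv * formMatrix G (RedEnd N c k) *
        (plusMatrix (fun i j r => redRep N c k (freeNeg N i j r)) hv.neg).transpose := by
  have h1 : (constMatrix G (DYc N c)).map ((ofPlus.comp (plusEval hv)).comp (redSeries N c k)) =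
      formMatrix G (RedEnd N c k) := by
    refine constMatrix_map G _ fun z => ?_
    rw [RingHom.comp_apply, redSeries_algebraMap, RingHom.comp_apply, PowerSeries.algebraMap_apply,
      plusEval_C, ← PowerSeries.algebraMap_apply, ofPlus_algebraMap]
  have h2 : ((TPlusMatrix (tNeg N c)).transpose.map negVar).map
      ((ofPlus.comp (plusEval hv)).comp (redSeries N c k)) =
      ((TPlusMatrix (tNeg N c)).map
        ((ofPlus.comp (plusEval hv.neg)).comp (redSeries N c k))).transpose := by
    ext1 a b
    simp only [Matrix.map_apply, Matrix.transpose_apply, RingHom.comp_apply,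
      redSeries_negVar, plusEval_negVar]
  rw [SPlusMatrix, Matrix.map_mul, Matrix.map_mul, h1, h2, plusMatrix_eq_map, plusMatrix_eq_map]

/-- The reduction of the matrix `S⁺(u + h d)`. -/
def redSPlus (k : ℕ) (d : ℤ) : Matrix (Fin N) (Fin N) (LaurentRing (RedEnd N c k)) :=
  plusMatrix (fun i j r => redRep N c k (freeNeg N i j r))
      (isPoint_plusPoint isNilpotent_redRing d) * formMatrix G (RedEnd N c k) *
    (plusMatrix (fun i j r => redRep N c k (freeNeg N i j r))
      (isPoint_plusPoint isNilpotent_redRing d).neg).transpose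

theorem isRedMat_leg {n : ℕ} (i : Fin n) (d : ℤ) :
    IsRedMat ((Asub N c G).map (act N c))
      (Matrix.of fun a b m => if ∀ k, k ≠ i → a k = b k then
        ofPosSeriesShift (h * cst d) (SPlusMatrix N c G (a i) (b i)) m else 0 : BiMatrix N c n)
      fun k => legOn i (redSPlus G k d) := by
  intro k a b
  have h1 : redSPlus (c := c) G k d = (SPlusMatrix N c G).map ((ofPlus.comp
      (plusEval (isPoint_plusPoint isNilpotent_redRing d))).comp (redSeries N c k)) :=
    (SPlusMatrix_red G _).symm
  simp only [h1, legOn, Matrix.of_apply]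
  split_ifs
  · exact isRed_ofPosSeriesShift d (coeff_SPlusMatrix_mem G _ _) _
  · exact isRed_zero

theorem isRedMat_SPlusBracket {n : ℕ} (w : Fin n → ℤ) :
    BiMatrix.ListConverges (SPlusFactors N c G fun i => h * cst (w i)) ∧
      IsRedMat ((Asub N c G).map (act N c)) (SPlusBracket N c G fun i => h * cst (w i)) fun k =>
        sProd id (fun i => redSPlus G k (w i))
          (fun i j => famP N (denC (RedEnd N c k)) (cK h) 0 (w i + w j)) (List.finRange n) := by
  -- Each factor is paired with its reductions, so that convergence and the value modulo every `h^k`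
  -- are obtained in one induction over the list.
  let l : List (BiMatrix N c n × ∀ k, TMat (Fin n) N (LaurentRing (RedEnd N c k))) :=
    (List.finRange n).flatMap fun i =>
      ((Matrix.of fun a b m => if ∀ k, k ≠ i → a k = b k then
        ofPosSeriesShift (h * cst (w i)) (SPlusMatrix N c G (a i) (b i)) m else 0),
        fun k => legOn i (redSPlus G k (w i))) ::
      ((List.finRange n).filter (i < ·)).map fun j =>
        ((RbarT N c i j (h * cst (-((w i + w j : ℤ) : ℂ)))).map ofNegSeries, fun k =>
          RT N (LaurentRing (RedEnd N c k)) i j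
            (famP N (denC (RedEnd N c k)) (cK h) 0 (w i + w j)))
  have hl : ∀ p ∈ l, IsRedMat ((Asub N c G).map (act N c)) p.1 p.2 := by
    intro p hp
    obtain ⟨i, -, hp⟩ := List.mem_flatMap.1 hp
    rcases List.mem_cons.1 hp with rfl | hp
    · exact isRedMat_leg G i (w i)
    · obtain ⟨j, -, rfl⟩ := List.mem_map.1 hp
      exact isRedMat_RbarT _ i j _
  have h1 : l.map Prod.fst = SPlusFactors N c G fun i => h * cst (w i) := by
    simp only [l, List.map_flatMap, List.map_cons, List.map_map, SPlusFactors, Function.comp_def]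
    congr 1
    ext1 i
    congr 3
    ext1 j
    congr 2
    rw [← mul_neg, ← mul_sub, ← map_neg, ← map_sub]
    congr 2
    push_cast; ring
  have h2 : ∀ k, (l.map fun p => p.2 k).prod = sProd id (fun i => redSPlus G k (w i))
      (fun i j => famP N (denC (RedEnd N c k)) (cK h) 0 (w i + w j)) (List.finRange n) := by
    intro k
    rw [sProd_eq_brProd]
    simp only [l, List.map_flatMap, List.map_cons, List.map_map, Function.comp_def]
    exact prod_flatMap_eq_brProd _ _ (List.pairwise_lt_finRange n)
  have h3 := IsRedMat.listProd hl
  simp only [h1, h2] at h3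
  exact h3

end ReducedAction

/-! ### The annihilator of the vacuum vector -/

section VacuumSeries

variable (N : ℕ) (c : ℂ)

/-- The series with coefficients in the left ideal `vacIdeal`. -/
def vacSeries : Submodule (DYc N c)⟦X⟧ (DYc N c)⟦X⟧ where
  carrier := {f | ∀ r, coeff r f ∈ vacIdeal N c}
  zero_mem' := fun r => by simp
  add_mem' := fun hf hg r => by
    rw [map_add]
    exact Submodule.add_mem _ (hf r) (hg r)
  smul_mem' := fun g f hf r => by
    rw [smul_eq_mul, coeff_mul]
    exact Submodule.sum_mem _ fun p _ => Submodule.smul_mem _ _ (hf p.2)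

variable {N c}

theorem mul_mem_vacSeries {f g : (DYc N c)⟦X⟧} (hf : f ∈ vacSeries N c) (hg : ∀ x, Commute g x) :
    f * g ∈ vacSeries N c := by
  rw [← (hg f).eq]
  exact Submodule.smul_mem _ g hf

theorem subInv_mem_vacSeries {f : (DYc N c)⟦X⟧} (hf : f ∈ vacSeries N c) (a b : K) :
    subInv (algebraMap K _ a) (algebraMap K _ b) f ∈ vacSeries N c := by
  intro r
  rw [subInv, coeff_mk]
  refine Submodule.sum_mem _ fun s _ => ?_
  rw [← linInv_map, ← map_pow, coeff_map, ← Algebra.commutes]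
  exact Submodule.smul_mem _ _ (hf s)

theorem act_vac_eq_zero {x : DYc N c} (hx : x ∈ vacIdeal N c) : act N c x (vac N c) = 0 := by
  show AdicCompletion.map hIdeal (Algebra.lsmul K K (PreVac N c) x)
    (AdicCompletion.of hIdeal (PreVac N c) (Submodule.Quotient.mk 1)) = 0
  rw [AdicCompletion.map_of]
  have : Algebra.lsmul K K (PreVac N c) x (Submodule.Quotient.mk 1) = 0 := by
    show x • (Submodule.Quotient.mk 1 : PreVac N c) = 0
    rw [← Submodule.Quotient.mk_smul, smul_eq_mul, mul_one]
    exact (Submodule.Quotient.mk_eq_zero _).2 hx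
  rw [this, map_zero]

variable {m : Type*} [Fintype m]

/-- Matrices with entries in `vacSeries`. -/
def IsVacMat (D : Matrix m m (DYc N c)⟦X⟧) : Prop := ∀ a b, D a b ∈ vacSeries N c

variable {D D' M : Matrix m m (DYc N c)⟦X⟧}

theorem IsVacMat.add (hD : IsVacMat D) (hD' : IsVacMat D') : IsVacMat (D + D') := fun a b =>
  Submodule.add_mem _ (hD a b) (hD' a b)

theorem IsVacMat.neg (hD : IsVacMat D) : IsVacMat (-D) := fun a b =>
  Submodule.neg_mem _ (hD a b)

theorem IsVacMat.mul_left (hD : IsVacMat D) : IsVacMat (M * D) := fun a b => by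
  rw [Matrix.mul_apply]
  exact Submodule.sum_mem _ fun d _ => Submodule.smul_mem _ _ (hD d b)

theorem IsVacMat.mul_right (hD : IsVacMat D) (hM : IsScalar M) : IsVacMat (D * M) := fun a b => by
  rw [Matrix.mul_apply]
  exact Submodule.sum_mem _ fun d _ => mul_mem_vacSeries (hD a d) (hM d b)

theorem isVacMat_TMatrix (a b : K) :
    IsVacMat ((TMatrix (tPos N c)).map (subInv (algebraMap K _ a) (algebraMap K _ b)) - 1) := by
  rw [TMatrix_map_subInv, add_sub_cancel_left]
  intro i j
  rw [Matrix.smul_apply, Matrix.map_apply, Algebra.smul_def]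
  refine Submodule.smul_mem _ _ (subInv_mem_vacSeries (fun r => ?_) a b)
  rw [tauMatrix, Matrix.of_apply, coeff_mk]
  split_ifs
  · exact Submodule.zero_mem _
  · exact Submodule.subset_span ⟨_, _, _, rfl⟩

variable (G : Matrix (Fin N) (Fin N) ℂ)

theorem isScalar_constMatrix : IsScalar (constMatrix G (DYc N c)) := fun a b z =>
  Algebra.commute_algebraMap_left (cst (G a b)) z

/-- `S - G` equals `T G (Tᵗ - 1) + (T - 1) G`; the first term ends in the left ideal, and in the
second the factor on the right is scalar. -/
theorem isVacMat_SMatrix : IsVacMat (SMatrix N c G - constMatrix G (DYc N c)) := by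
  have h1 := isVacMat_TMatrix (N := N) (c := c) 1 (h * cst c)
  have h2 := isVacMat_TMatrix (N := N) (c := c) (-1) 0
  rw [map_one] at h1
  rw [map_neg, map_one, map_zero] at h2
  have h3 : IsVacMat ((TMatrix (tPos N c)).transpose.map (subInv (-1) 0) - 1) := fun a b => by
    have := h2 b a
    rwa [Matrix.sub_apply, ← Matrix.transpose_apply 1, Matrix.transpose_one] at this
  have h4 := (h3.mul_left (M := (TMatrix (tPos N c)).map
    (subInv 1 (algebraMap K (DYc N c) (h * cst c))) * constMatrix G (DYc N c))).add
      (h1.mul_right (isScalar_constMatrix G))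
  rw [mul_sub, sub_mul, one_mul, mul_one, sub_add_sub_cancel] at h4
  exact h4

theorem isVacMat_SMatrix_shift (b : K) : IsVacMat
    ((SMatrix N c G).map (subInv 1 (algebraMap K (DYc N c) b)) - constMatrix G (DYc N c)) := by
  intro i j
  have h1 := subInv_mem_vacSeries (isVacMat_SMatrix (c := c) G i j) 1 b
  rw [map_one, ← subInvHom_apply (fun _ => Commute.one_left _)
      (Algebra.commute_algebraMap_left b),
    Matrix.sub_apply, map_sub, constMatrix, Matrix.map_apply, PowerSeries.algebraMap_apply,
    subInvHom_C, subInvHom_apply, ← PowerSeries.algebraMap_apply] at h1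
  exact h1

theorem constantCoeff_subInv {B : Type*} [Ring B] (a b : B) (f : B⟦X⟧) :
    constantCoeff (subInv a b f) = constantCoeff f := by
  rw [← coeff_zero_eq_constantCoeff_apply, subInv, coeff_mk]
  simp

theorem SMatrix_shift_constantCoeff (b : K) :
    ((SMatrix N c G).map (subInv 1 (algebraMap K (DYc N c) b))).map (constantCoeff (R := DYc N c)) =
      G.map fun z => algebraMap K (DYc N c) (cst z) := by
  have hT : ∀ a b : DYc N c, ((TMatrix (tPos N c)).map (subInv a b)).map
      (constantCoeff (R := DYc N c)) = 1 := by
    intro a b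
    ext i j
    simp only [Matrix.map_apply, constantCoeff_subInv, TMatrix, Matrix.add_apply, Matrix.smul_apply,
      tauMatrix, Matrix.of_apply, map_add, Matrix.one_apply]
    rw [← coeff_zero_eq_constantCoeff_apply, ← coeff_zero_eq_constantCoeff_apply, coeff_smul,
      coeff_mk]
    split_ifs <;> simp_all
  have hT' : ((TMatrix (tPos N c)).transpose.map (subInv (-1) 0)).map
      (constantCoeff (R := DYc N c)) = 1 := by
    rw [← Matrix.transpose_one, ← hT (-1) 0]
    rfl
  have h1 : ((SMatrix N c G).map (subInv 1 (algebraMap K (DYc N c) b))).map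
      (constantCoeff (R := DYc N c)) = (SMatrix N c G).map (constantCoeff (R := DYc N c)) := by
    ext i j
    simp only [Matrix.map_apply, constantCoeff_subInv]
  rw [h1, SMatrix, Matrix.map_mul, Matrix.map_mul, hT, hT', one_mul, mul_one]
  ext i j
  simp [constMatrix, PowerSeries.algebraMap_apply]

end VacuumSeries

/-! ### The product `S_{[n]}` -/

section Bracket

variable {N n : ℕ}

theorem isUnit_legOn {ι R : Type*} [Fintype ι] [DecidableEq ι] [Ring R] {M : Matrix (Fin N) (Fin N) R}
    (hM : IsUnit M) (i : ι) : IsUnit (legOn i M) := by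
  obtain ⟨u, rfl⟩ := hM
  exact ⟨⟨legOn i u, legOn i ↑u⁻¹, by rw [← legOn_mul, Units.mul_inv, legOn_one],
    by rw [← legOn_mul, Units.inv_mul, legOn_one]⟩, rfl⟩

theorem isUnit_map {ι R R' : Type*} [Fintype ι] [DecidableEq ι] [Ring R] [Ring R'] (φ : R →+* R')
    {M : Matrix ι ι R} (hM : IsUnit M) : IsUnit (M.map φ) := hM.map φ.mapMatrix

theorem isUnit_RT_scaledPair {ι : Type*} [Fintype ι] [DecidableEq ι] (i j : ι) (b : ℂ) :
    IsUnit (RT N ℂ⟦X⟧ i j (scaledPair N b)) := by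
  refine isUnit_of_map_constantCoeff ?_
  have h0 : constantCoeff (linInv (-1 / 2) b) = 0 :=
    (coeff_zero_eq_constantCoeff_apply _).symm.trans (linInv_constCoeff _ _)
  have h1 : constantCoeff (gSeries N) = 1 := by
    rw [← coeff_zero_eq_constantCoeff_apply, gSeries, coeff_mk, normCoeff]
  rw [RT, map_smul_one_sub, scaledPair, h0, constantCoeff_subInv, h1, zero_smul, sub_zero, one_smul]
  exact isUnit_one

variable (G : Matrix (Fin N) (Fin N) ℂ)

/-- The value of `S_{[n]}` on the vacuum vector, as a matrix of series in `h / u`. -/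
def scalarBracket (w : Fin n → ℤ) : TMat (Fin n) N ℂ⟦X⟧ :=
  brProd (fun i => legOn i (G.map (PowerSeries.C (R := ℂ))))
    (fun i j => RT N ℂ⟦X⟧ i j (scaledPair N (N - (w i + w j : ℤ)))) (List.finRange n)

variable {G}

theorem isUnit_scalarBracket (hG : IsUnit G) (w : Fin n → ℤ) : IsUnit (scalarBracket G w) :=
  isUnit_brProd (fun i => isUnit_legOn (isUnit_map _ hG) i)
    (fun i j => isUnit_RT_scaledPair i j _) _

variable (G) in
theorem SBracket_eq (w : Fin n → ℤ) :
    SBracket N (critLevel N) G (fun i => h * cst (w i) - h * cst ((N : ℂ) / 4)) =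
      brProd (fun i => legOn i ((SMatrix N (critLevel N) G).map (subInv 1
          (algebraMap K _ (h * cst (w i) - h * cst ((N : ℂ) / 4))))))
        (fun i j => (RT N ℂ⟦X⟧ i j (scaledPair N (N - (w i + w j : ℤ)))).map (scaleHom _))
        (List.finRange n) := by
  -- The two shifts by `N/4` and `-c = N/2` add up to `N`, the crossing shift.
  have hb : ∀ i j, -(h * cst (w i) - h * cst ((N : ℂ) / 4)) -
      (h * cst (w j) - h * cst ((N : ℂ) / 4)) - h * cst (critLevel N) =
      h * cst ((N : ℂ) - (w i + w j : ℤ)) := by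
    intro i j
    simp only [← mul_sub, ← map_sub, ← mul_neg, ← map_neg]
    congr 2
    rw [critLevel]
    push_cast; ring
  rw [SBracket, ← prod_flatMap_eq_brProd _ _ (List.pairwise_lt_finRange n)]
  simp only [hb, RbarT_eq, leg_eq_legOn]

theorem isUnit_SMatrix_shift (hG : IsUnit G) (c : ℂ) (b : K) :
    IsUnit ((SMatrix N c G).map (subInv 1 (algebraMap K (DYc N c) b))) := by
  refine isUnit_of_map_constantCoeff ?_
  rw [SMatrix_shift_constantCoeff]
  exact isUnit_map ((algebraMap K (DYc N c)).comp (PowerSeries.C (R := ℂ))) hG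

theorem isUnit_SBracket (hG : IsUnit G) (w : Fin n → ℤ) :
    IsUnit (SBracket N (critLevel N) G (fun i => h * cst (w i) - h * cst ((N : ℂ) / 4))) := by
  rw [SBracket_eq]
  exact isUnit_brProd (fun i => isUnit_legOn (isUnit_SMatrix_shift hG _ _) i)
    (fun i j => isUnit_map _ (isUnit_RT_scaledPair i j _)) _

theorem isScalar_map_scaleHom {ι A : Type*} [Ring A] [Algebra K A] (M : Matrix ι ι ℂ⟦X⟧) :
    IsScalar (M.map (scaleHom A)) := fun a b z => commute_scaleHom (M a b) z

variable (G) in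
theorem legOn_map_scaleHom {A : Type*} [Ring A] [Algebra K A] (i : Fin n) :
    (legOn i (G.map (PowerSeries.C (R := ℂ)))).map (scaleHom A) = legOn i (constMatrix G A) := by
  rw [legOn_map]
  congr 1
  ext1 a b
  rw [Matrix.map_apply, Matrix.map_apply, scaleHom_C, constMatrix, Matrix.map_apply,
    PowerSeries.algebraMap_apply]

theorem isVacMat_legOn {c : ℂ} (i : Fin n) {M M' : Matrix (Fin N) (Fin N) (DYc N c)⟦X⟧}
    (hM : IsVacMat (M - M')) : IsVacMat (legOn i M - legOn i M') := by
  intro a b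
  simp only [Matrix.sub_apply, legOn, Matrix.of_apply]
  split_ifs
  · exact hM _ _
  · rw [sub_zero]
    exact Submodule.zero_mem _

/-- For a product, `F X - F' X' = F (X - X') + (F - F') X'`; the second term stays in the left ideal
because `X'` is scalar, which is why scalarity is carried along. -/
theorem isVacMat_brProd {ι α : Type*} [Fintype ι] [DecidableEq ι] {c : ℂ}
    {F F' : α → Matrix ι ι (DYc N c)⟦X⟧} {R : α → α → Matrix ι ι (DYc N c)⟦X⟧}
    (hF : ∀ i, IsVacMat (F i - F' i)) (hF' : ∀ i, IsScalar (F' i)) (hR : ∀ i j, IsScalar (R i j))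
    (l : List α) : IsVacMat (brProd F R l - brProd F' R l) ∧ IsScalar (brProd F' R l) := by
  induction l with
  | nil =>
    refine ⟨fun a b => ?_, IsScalar.one⟩
    rw [brProd, brProd, sub_self]
    exact Submodule.zero_mem _
  | cons i l ih =>
    have h1 := IsScalar.fwd (f := R i) (l := l) fun j _ => hR i j
    refine ⟨?_, ((hF' i).mul h1).mul ih.2⟩
    have h2 := (ih.1.mul_left (M := F i * fwd (R i) l)).add ((hF i).mul_right (h1.mul ih.2))
    rw [mul_sub, sub_mul, ← mul_assoc, ← mul_assoc, sub_add_sub_cancel] at h2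
    exact h2

variable (G) in
theorem isVacMat_SBracket (w : Fin n → ℤ) :
    IsVacMat (SBracket N (critLevel N) G (fun i => h * cst (w i) - h * cst ((N : ℂ) / 4)) -
      (scalarBracket G w).map (scaleHom _)) := by
  have h1 : (scalarBracket G w).map (scaleHom (DYc N (critLevel N))) =
      brProd (fun i => legOn i (constMatrix G _))
        (fun i j => (RT N ℂ⟦X⟧ i j (scaledPair N (N - (w i + w j : ℤ)))).map (scaleHom _))
        (List.finRange n) := by
    have := map_brProd (scaleHom (DYc N (critLevel N))).mapMatrix
      (fun i : Fin n => legOn i (G.map (PowerSeries.C (R := ℂ))))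
      (fun i j => RT N ℂ⟦X⟧ i j (scaledPair N (N - (w i + w j : ℤ)))) (List.finRange n)
    simp only [RingHom.mapMatrix_apply, legOn_map_scaleHom] at this
    exact this
  rw [h1, SBracket_eq]
  exact (isVacMat_brProd (fun i => isVacMat_legOn i (isVacMat_SMatrix_shift G _))
    (fun i => (isScalar_constMatrix G).legOn i) (fun i j => isScalar_map_scaleHom _) _).1

/-- `Y⁻¹ - V⁻¹ = -Y⁻¹ (Y - V) V⁻¹`, where the left ideal absorbs `Y⁻¹` and the scalar matrix `V⁻¹`
commutes to the left. -/
theorem isVacMat_inverse (hG : IsUnit G) (w : Fin n → ℤ) :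
    IsVacMat (Ring.inverse (SBracket N (critLevel N) G
        (fun i => h * cst (w i) - h * cst ((N : ℂ) / 4))) -
      (Ring.inverse (scalarBracket G w)).map (scaleHom _)) := by
  have h1 := Ring.inverse_mul_cancel _ (isUnit_SBracket hG w)
  have h2 := congrArg (fun M : TMat _ _ _ => M.map (scaleHom (DYc N (critLevel N))))
    (Ring.mul_inverse_cancel _ (isUnit_scalarBracket hG w))
  have h3 := isVacMat_SBracket G w
  set Y := SBracket N (critLevel N) G (fun i => h * cst (w i) - h * cst ((N : ℂ) / 4))
  set V := scalarBracket G w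
  simp only [Matrix.map_mul] at h2
  have h4 := ((h3.mul_left (M := Ring.inverse Y)).mul_right
    (isScalar_map_scaleHom (A := DYc N (critLevel N)) (Ring.inverse V))).neg
  have h5 : (1 : TMat (Fin n) N ℂ⟦X⟧).map (scaleHom (DYc N (critLevel N))) = 1 :=
    map_one (scaleHom (DYc N (critLevel N))).mapMatrix
  rw [mul_sub, h1, sub_mul, mul_assoc, h2, h5, one_mul, mul_one, neg_sub] at h4
  exact h4

/-- The factor `h ^ j` in front of the vacuum makes the series defining `𝕄_ν(u)` converge. -/
theorem act_inverse_vac (hG : IsUnit G) (w : Fin n → ℤ) (j : ℕ) (a b : Fin n → Fin N) :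
    act N (critLevel N) (coeff j (Ring.inverse (SBracket N (critLevel N) G
        (fun i => h * cst (w i) - h * cst ((N : ℂ) / 4))) a b)) (vac N (critLevel N)) =
      (h ^ j * cst (coeff j (Ring.inverse (scalarBracket G w) a b))) • vac N (critLevel N) := by
  have h1 := act_vac_eq_zero (isVacMat_inverse hG w a b j)
  rw [Matrix.sub_apply, map_sub, map_sub, LinearMap.sub_apply, sub_eq_zero, Matrix.map_apply,
    coeff_scaleHom, AlgHom.commutes, Module.algebraMap_end_apply] at h1
  exact h1

/-! #### The inverse over Laurent series -/

variable {E : Type*} [Ring E] [Algebra ℂ E] [Algebra K E] [IsScalarTower ℂ K E]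

theorem scalarBracket_map (hh : IsNilpotent (algebraMap K E h)) (hy : IsNilpotent (hOverU E))
    (w : Fin n → ℤ) :
    (scalarBracket G w).map (ofCenter.comp (nev (hOverU E) hy)) =
      gProd id (formMatrix G E) (fun i j => famP N (denC E) (cK h) (-4) (w i + w j))
        (List.finRange n) := by
  have hU := cU_mul (E := E) (-1) 1
  rw [neg_add_cancel, cU_zero] at hU
  have h1 := map_brProd (ofCenter.comp (nev (hOverU E) hy)).mapMatrix
      (fun i : Fin n => legOn i (G.map (PowerSeries.C (R := ℂ))))
      (fun i j => RT N ℂ⟦X⟧ i j (scaledPair N (N - (w i + w j : ℤ)))) (List.finRange n)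
  rw [gProd_eq_brProd]
  refine h1.trans (brProd_congr (List.nodup_finRange n) (fun i _ => ?_) fun i _ j _ _ => ?_)
  · rw [RingHom.mapMatrix_apply, legOn_map]
    congr 1
    ext1 a b
    rw [Matrix.map_apply, Matrix.map_apply, RingHom.comp_apply, nev_C, ofCenter_algebraMap]
    rfl
  · rw [RingHom.mapMatrix_apply, RT_map_center,
      -- Level -4, because the constant `N - (w i + w j)` is `-d - kN/4` at `d = w i + w j` and `k =
      -- -4`.
      nev_scaledPair (k := -4) (d := w i + w j) (w := denC E) (η := cK h) isUnit_denC
        (isNilpotent_cK hh) hy (by rw [hOverU, denC]; linear_combination (-2 * cK h) * hU)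
        (by push_cast; ring)]
    rfl

/-- By crossing, the R-matrices at level -4 are inverted by those at the points opposite to level 0;
uniqueness of inverses identifies the two expressions. -/
theorem inverse_scalarBracket_map (hN : N ≠ 0) (hG : IsUnit G)
    (hh : IsNilpotent (algebraMap K E h)) (hy : IsNilpotent (hOverU E))
    {G' : Matrix (Fin N) (Fin N) (LaurentRing E)} (hG' : G' * formMatrix G E = 1) (w : Fin n → ℤ) :
    (Ring.inverse (scalarBracket G w)).map (ofCenter.comp (nev (hOverU E) hy)) =
      gInv id G' (fun i j => famQ N (denC E) (cK h) 0 (w i + w j)) (List.finRange n) := by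
  have h1 := congrArg (fun M : TMat _ _ _ => M.map (ofCenter.comp (nev (hOverU E) hy)))
    (Ring.mul_inverse_cancel _ (isUnit_scalarBracket hG w))
  have h2 : (1 : TMat (Fin n) N ℂ⟦X⟧).map (ofCenter.comp (nev (hOverU E) hy)) = 1 :=
    map_one (ofCenter.comp (nev (hOverU E) hy)).mapMatrix
  simp only [Matrix.map_mul, h2, scalarBracket_map hh hy] at h1
  have h3 := gInv_mul_gProd (e := (id : Fin n → Fin n)) hG' (List.nodup_finRange n)
    (r := fun i j => famP N (denC E) (cK h) (-4) (w i + w j))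
    (r' := fun i j => famQ N (denC E) (cK h) 0 (w i + w j)) fun i _ j _ hij =>
      (isRFamily_fam isUnit_denC (isNilpotent_cK hh) hN).RT_mul hij 0 (w i + w j)
  exact (left_inv_eq_right_inv h3 h1).symm

end Bracket

/-! ### The image of the Young idempotent -/

section Young

variable {N n : ℕ} {Z : Type*} [Ring Z] [Algebra ℂ Z]

/-- The embedding of tensor factors as a homomorphism of algebras. -/
def embHom {ι κ : Type*} [Fintype ι] [DecidableEq ι] [Fintype κ] [DecidableEq κ] {f : κ → ι}
    (hf : Function.Injective f) : TMat κ N Z →ₐ[ℂ] TMat ι N Z :=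
  AlgHom.ofLinearMap
    { toFun := embOn f
      map_add' := embOn_add f
      map_smul' := embOn_smul f }
    (embOn_one f) (embOn_mul hf)

theorem embOn_some_permOn (σ : Equiv.Perm (Fin n)) :
    embOn some (permOn Z N σ) = permOn Z N (Equiv.optionCongr σ) := by
  ext a b
  simp only [embOn, permOn, Matrix.of_apply, ← ite_and]
  refine ite_eq_ite ⟨fun h => funext fun o => ?_, fun h => ⟨fun o ho => ?_, funext fun i => ?_⟩⟩ _ _
  · cases o with
    | none => exact h.1 none (by simp)
    | some i => exact congrFun h.2 i
  · cases o with
    | none => exact congrFun h none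
    | some i => exact absurd rfl (ho i)
  · exact congrFun h (some i)

/-- The idempotent is by definition the Jucys–Murphy projector of the group algebra, and algebra
homomorphisms preserve such projectors. -/
theorem embOn_youngOperator {ν : YoungDiagram} (U : StdTableau ν n) :
    embOn some ((youngOperator N U).map (algebraMap ℂ Z)) =
      jmProjector (permRep Z n N) U.content := by
  have h1 : youngIdempotent U =
      jmProjector (MonoidAlgebra.of ℂ (Equiv.Perm (Fin n))) U.content := rfl
  let φ : MonoidAlgebra ℂ (Equiv.Perm (Fin n)) →ₐ[ℂ] TMat (Option (Fin n)) N Z :=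
    ((embHom (Option.some_injective (Fin n))).comp (Algebra.ofId ℂ Z).mapMatrix).comp
      (MonoidAlgebra.lift ℂ _ _ (permAction N n))
  have h2 := jmProjector_map (ρ := MonoidAlgebra.of ℂ (Equiv.Perm (Fin n))) φ U.content
  rw [← h1] at h2
  refine h2.trans ?_
  congr 1
  ext1 σ
  have h3 : MonoidAlgebra.lift ℂ _ _ (permAction N n) (MonoidAlgebra.of ℂ _ σ) = permOn ℂ N σ := by
    rw [MonoidAlgebra.lift_of]; rfl
  show embOn some (((MonoidAlgebra.lift ℂ _ _ (permAction N n)) (MonoidAlgebra.of ℂ _ σ)).map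
    (algebraMap ℂ Z)) = permOn Z N (Equiv.optionCongr σ)
  rw [h3, permOn_map, embOn_some_permOn]

end Young

/-! ### The left ideal annihilating the vacuum vector -/

section VacuumLaurent

variable (N : ℕ) (c : ℂ) (k : ℕ)

/-- The left ideal of operators which annihilate the vacuum vector modulo `h^k`. -/
def redVacIdeal : Submodule (RedEnd N c k) (RedEnd N c k) where
  carrier := {e | ∃ φ, redMap (VacEnd N c) k φ = e ∧ φ (vac N c) ∈ hPow (Vac N c) k}
  zero_mem' := ⟨0, map_zero _, Submodule.zero_mem _⟩
  add_mem' := by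
    rintro _ _ ⟨φ, rfl, h1⟩ ⟨ψ, rfl, h2⟩
    exact ⟨φ + ψ, map_add _ _ _, Submodule.add_mem _ h1 h2⟩
  smul_mem' := by
    rintro e _ ⟨φ, rfl, h1⟩
    obtain ⟨ψ, rfl⟩ := redMap_surjective e
    obtain ⟨y, hy⟩ := mem_hPow.1 h1
    exact ⟨ψ * φ, map_mul _ _ _, mem_hPow.2 ⟨ψ y, by rw [Module.End.mul_apply, ← hy, map_smul]⟩⟩

/-- The left ideal of series with coefficients in `redVacIdeal`. -/
def laurentVacIdeal :
    Submodule (LaurentRing (RedEnd N c k)) (LaurentRing (RedEnd N c k)) where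
  carrier := {f | ∀ r m, (coeff r f).coeff m ∈ redVacIdeal N c k}
  zero_mem' := fun r m => by
    rw [map_zero, HahnSeries.coeff_zero]
    exact Submodule.zero_mem _
  add_mem' := fun hf hg r m => by
    rw [map_add, HahnSeries.coeff_add]
    exact Submodule.add_mem _ (hf r m) (hg r m)
  smul_mem' := fun g f hf r m => by
    rw [smul_eq_mul, coeff_mul, HahnSeries.coeff_sum]
    refine Submodule.sum_mem _ fun p _ => ?_
    rw [HahnSeries.coeff_mul]
    exact Submodule.sum_mem _ fun q _ => Submodule.smul_mem _ _ (hf p.2 q.2)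

variable {N c k}

theorem redMap_mem_redVacIdeal {φ : VacEnd N c} (h : redMap _ k φ ∈ redVacIdeal N c k) :
    φ (vac N c) ∈ hPow (Vac N c) k := by
  obtain ⟨ψ, h1, h2⟩ := h
  rw [← sub_eq_zero, ← map_sub, redMap_eq_zero] at h1
  obtain ⟨χ, hχ⟩ := mem_hPow.1 h1
  have h3 : φ = ψ - h ^ k • χ := by rw [hχ, sub_sub_cancel]
  rw [h3, LinearMap.sub_apply, LinearMap.smul_apply]
  exact Submodule.sub_mem _ h2 (smul_mem_hPow k _)

theorem mem_laurentVacIdeal {f : (DYc N c)⟦X⟧} (hf : f ∈ vacSeries N c) :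
    ofMinus (redSeries N c k f) ∈ laurentVacIdeal N c k := by
  intro r m
  rw [ofMinus, coeff_map, coeff_map, HahnSeries.C_apply, HahnSeries.coeff_single]
  split_ifs
  · refine ⟨act N c (coeff r f), rfl, ?_⟩
    rw [act_vac_eq_zero (hf r)]
    exact Submodule.zero_mem _
  · exact Submodule.zero_mem _

theorem SMatrix_red (G : Matrix (Fin N) (Fin N) ℂ) :
    (SMatrix N c G).map (ofMinus.comp (redSeries N c k)) =
      minusMatrix (fun i j r => redRep N c k (freePos N i j r)) 1 (h * cst c) *
        formMatrix G (RedEnd N c k) *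
        (minusMatrix (fun i j r => redRep N c k (freePos N i j r)) (-1) 0).transpose := by
  have hT : ∀ a b : K, ((TMatrix (tPos N c)).map (subInv (algebraMap K _ a) (algebraMap K _ b))).map
      (ofMinus.comp (redSeries N c k)) =
      minusMatrix (fun i j r => redRep N c k (freePos N i j r)) a b := by
    intro a b
    rw [minusMatrix, ← TMatrix_redSeries]
    ext1 i j
    simp only [Matrix.map_apply, RingHom.comp_apply, redSeries, subInv_map]
    congr 2
  have h1 := hT 1 (h * cst c)
  have h2 := hT (-1) 0
  rw [map_one] at h1
  rw [map_neg, map_one, map_zero] at h2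
  have h3 : ((TMatrix (tPos N c)).transpose.map (subInv (-1) 0)).map
      (ofMinus.comp (redSeries N c k)) =
      (minusMatrix (fun i j r => redRep N c k (freePos N i j r)) (-1) 0).transpose := by
    rw [← h2]; rfl
  rw [SMatrix, Matrix.map_mul, Matrix.map_mul, h1, h3, constMatrix_map]
  intro z
  rw [RingHom.comp_apply, redSeries_algebraMap, PowerSeries.algebraMap_apply, ofMinus, map_C,
    PowerSeries.algebraMap_apply, HahnSeries.algebraMap_apply]

end VacuumLaurent

/-! ### The operators `𝔸_ν` modulo powers of `h` -/

section Operators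

variable {R : Type*} [Ring R] [Algebra K R] {k : ℕ} {A : Subalgebra K R} {f : ℤ → R}
  {z : LaurentRing (RedRing R k)}

theorem IsRed.smul (hf : IsRed A k f z) (κ : K) :
    IsRed A k (fun m => κ • f m) (algebraMap K _ κ * z) := by
  obtain ⟨l, rfl, hl⟩ := hf
  refine ⟨HahnSeries.C (algebraMap K _ κ) * l, ?_, fun m => ?_⟩
  · rw [PowerSeries.algebraMap_apply, HahnSeries.algebraMap_apply, ← map_mul]
  · rw [HahnSeries.C_apply, HahnSeries.coeff_single_zero_mul, ← Algebra.smul_def, ← (hl m).1,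
      ← map_smul]
    obtain ⟨x, hx, h1⟩ := (hl m).2
    exact ⟨rfl, κ • x, A.smul_mem hx κ, by rw [map_smul, h1, map_smul, (hl m).1]⟩

theorem IsRed.smul_single (hf : IsRed A k f z) (κ : K) (j : ℕ) :
    IsRed A k (fun m => κ • f (m + j))
      (z * PowerSeries.C (HahnSeries.single (-j : ℤ) (algebraMap K _ κ))) := by
  obtain ⟨l, rfl, hl⟩ := hf
  refine ⟨l * HahnSeries.single (-j : ℤ) (algebraMap K _ κ), by rw [← map_mul], fun m => ?_⟩
  have h1 := HahnSeries.coeff_mul_single_add (x := l) (r := algebraMap K (RedRing R k) κ)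
    (a := m + j) (b := -j)
  rw [add_neg_cancel_right] at h1
  rw [h1, ← Algebra.commutes, ← Algebra.smul_def, ← (hl _).1, ← map_smul]
  obtain ⟨x, hx, h2⟩ := (hl (m + j)).2
  exact ⟨rfl, κ • x, A.smul_mem hx κ, by rw [map_smul, h2, map_smul, (hl _).1]⟩

variable {N n : ℕ} (G : Matrix (Fin N) (Fin N) ℂ) {ν : YoungDiagram} (U : StdTableau ν n)

/-- The coefficient of `u^m` in `𝔸_ν(u)` modulo `h^k`, where the inverse of `S_{[n]}` is replaced by
its value on the vacuum vector. -/
def truncatedANu (k : ℕ) (m : ℤ) : VacEnd N (critLevel N) :=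
  ∑ a, ∑ b, cst (youngOperator N U a b) • ∑ d, ∑ j ∈ Finset.range k,
    (h ^ j * cst (coeff j (Ring.inverse (scalarBracket G U.content) d a))) •
      SPlusBracket N (critLevel N) G (nuShift U) b d (m + j)

/-- The reduction of `𝔸_ν(u)`. -/
def redANu (k : ℕ) (G' : Matrix (Fin N) (Fin N) (LaurentRing (RedEnd N (critLevel N) k))) :
    LaurentRing (RedEnd N (critLevel N) k) :=
  ((youngOperator N U).map (algebraMap ℂ _) *
    (sProd id (fun i => redSPlus G k (U.content i))
        (fun i j => famP N (denC (RedEnd N (critLevel N) k)) (cK h) 0 (U.content i + U.content j))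
        (List.finRange n) *
      gInv id G' (fun i j => famQ N (denC (RedEnd N (critLevel N) k)) (cK h) 0
        (U.content i + U.content j)) (List.finRange n))).trace

variable {G}

/-- Modulo `h^k` the inverse acts on the vacuum as a polynomial in `h/u`, whose monomials shift the
exponents of `u`. So the finite sums of operators are the coefficients of the trace over Laurent
series. -/
theorem isRed_truncatedANu (hN : N ≠ 0) (hG : IsUnit G) (k : ℕ)
    {G' : Matrix (Fin N) (Fin N) (LaurentRing (RedEnd N (critLevel N) k))}
    (hG' : G' * formMatrix G (RedEnd N (critLevel N) k) = 1) :
    IsRed ((Asub N (critLevel N) G).map (act N (critLevel N))) k (truncatedANu G U k)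
      (redANu G U k G') := by
  have h1 := (isRedMat_SPlusBracket (c := critLevel N) G U.content).2 k
  rw [redANu, Matrix.trace]
  simp only [Matrix.diag_apply]
  refine IsRed.sum fun a _ => ?_
  rw [Matrix.mul_apply]
  refine IsRed.sum fun b _ => ?_
  rw [Matrix.map_apply, ← ofCenter_algebraMap, ← cK_cst, coe_cK, Matrix.mul_apply]
  refine IsRed.smul (IsRed.sum fun d _ => ?_) _
  rw [← inverse_scalarBracket_map hN hG isNilpotent_redRing isNilpotent_hOverU hG',
    Matrix.map_apply, RingHom.comp_apply, nev_eq_sum _ _ hOverU_pow, map_sum, Finset.mul_sum]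
  refine IsRed.sum fun j _ => ?_
  rw [ofCenter_hOverU_pow]
  exact (h1 b d).smul_single _ j

end Operators

/-! ### The invariance of `𝕄_ν(u)` -/

section Invariance

variable {N n : ℕ} {G : Matrix (Fin N) (Fin N) ℂ} {ν : YoungDiagram} (U : StdTableau ν n)

theorem toDYc_rel {c : ℂ} {x y : FreeGen N} (hxy : DYRel N x y) : toDYc N c x = toDYc N c y := by
  have h1 : RingQuot.mkAlgHom K (DYRel N) x = RingQuot.mkAlgHom K (DYRel N) y :=
    RingQuot.mkAlgHom_rel K hxy
  exact congrArg (fun z => RingQuot.mkAlgHom K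
    (fun x y : DY N => x = toDY N (freeC N) ∧ y = algebraMap K (DY N) (cst c))
    (RingQuot.mkAlgHom K (fun x y : PreDY N => ∃ k : ℕ, h ^ k • x = h ^ k • y) z)) h1

theorem toDYc_freeC (c : ℂ) : toDYc N c (freeC N) = algebraMap K _ (cst c) := by
  have h1 : RingQuot.mkAlgHom K
      (fun x y : DY N => x = toDY N (freeC N) ∧ y = algebraMap K (DY N) (cst c))
      (toDY N (freeC N)) = RingQuot.mkAlgHom K _ (algebraMap K (DY N) (cst c)) :=
    RingQuot.mkAlgHom_rel K ⟨rfl, rfl⟩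
  exact h1.trans (AlgHom.commutes _ _)

theorem redRep_rel {c : ℂ} {k : ℕ} (x y : FreeGen N) (hxy : DYRel N x y) :
    redRep N c k x = redRep N c k y := by
  rw [redRep, AlgHom.comp_apply, AlgHom.comp_apply, toDYc_rel hxy]

theorem redRep_freeC (c : ℂ) (k : ℕ) : redRep N c k (freeC N) = algebraMap K _ (cst c) := by
  rw [redRep, AlgHom.comp_apply, toDYc_freeC, AlgHom.commutes]

theorem formMatrix_mul {E : Type*} [Ring E] [Algebra ℂ E] [Algebra K E] [IsScalarTower ℂ K E]
    {G G' : Matrix (Fin N) (Fin N) ℂ} (h : G * G' = 1) : formMatrix G E * formMatrix G' E = 1 := by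
  rw [← Matrix.map_mul, h]
  exact map_one (algebraMap ℂ (LaurentRing E)).mapMatrix

theorem isForm_formMatrix {E : Type*} [Ring E] [Algebra ℂ E] [Algebra K E] [IsScalarTower ℂ K E]
    (hsymm : G.transpose = G ∨ G.transpose = -G) : IsForm (formMatrix G E) := by
  refine ⟨fun a b z => Algebra.commute_algebraMap_left (G a b) z, ?_⟩
  rw [formMatrix, ← Matrix.transpose_map]
  refine hsymm.imp (fun h => by rw [h]) fun h => ?_
  rw [h]
  ext1 a b
  simp

/-- Here `IsCriticalSystem.trace_mem` is applied over the operators modulo `h^k`, to the left ideal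
annihilating the vacuum, with the inverse of `G` in the place of `G'`. -/
theorem redANu_mem (hN : N ≠ 0) (hG : IsUnit G.det) (hsymm : G.transpose = G ∨ G.transpose = -G)
    (k : ℕ) (i j : Fin N) :
    (ofMinus.comp (redSeries N (critLevel N) k)) (SMatrix N (critLevel N) G i j) *
        redANu G U k (formMatrix G⁻¹ _) -
      algebraMap ℂ _ (G i j) * redANu G U k (formMatrix G⁻¹ _) ∈
        laurentVacIdeal N (critLevel N) k := by
  have h1 := (isCriticalSystem (E := RedEnd N (critLevel N) k) (ρ := redRep N (critLevel N) k)
    isNilpotent_redRing redRep_rel hN (redRep_freeC _ _) n).trace_mem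
      U.content (isForm_formMatrix hsymm) (formMatrix_mul (Matrix.mul_nonsing_inv G hG))
      (formMatrix_mul (Matrix.nonsing_inv_mul G hG)) (IsScalar.map_algebraMap _)
      (laurentVacIdeal N (critLevel N) k) (fun a b => ?_)
      (E := (youngOperator N U).map (algebraMap ℂ _)) (IsScalar.map_algebraMap _)
      (embOn_youngOperator U) i j
  · rw [← SMatrix_red] at h1
    exact h1
  · rw [← SMatrix_red]
    have h2 := mem_laurentVacIdeal (k := k) (isVacMat_SMatrix (c := critLevel N) G a b)
    have h3 : ofMinus (redSeries N (critLevel N) k (constMatrix G _ a b)) =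
        algebraMap ℂ (LaurentRing (RedEnd N (critLevel N) k)) (G a b) := by
      rw [constMatrix, Matrix.map_apply, redSeries_algebraMap, PowerSeries.algebraMap_apply, ofMinus,
        map_C, ← ofCenter_algebraMap, ← cK_cst, coe_cK, PowerSeries.algebraMap_apply,
        HahnSeries.algebraMap_apply]
    rw [Matrix.sub_apply, map_sub, map_sub, h3] at h2
    exact h2

theorem truncatedANu_invariant (hN : N ≠ 0) (hG : IsUnit G.det)
    (hsymm : G.transpose = G ∨ G.transpose = -G) (k : ℕ) (m : ℤ) (i j : Fin N) (r : ℕ) :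
    (act N (critLevel N) (coeff r (SMatrix N (critLevel N) G i j)) * truncatedANu G U k m -
      if r = 0 then cst (G i j) • truncatedANu G U k m else 0) (vac N (critLevel N)) ∈
        hPow (Vac N (critLevel N)) k := by
  have h1 := redANu_mem U hN hG hsymm k i j
  obtain ⟨l, hl, hm⟩ := isRed_truncatedANu U hN ((Matrix.isUnit_iff_isUnit_det G).2 hG) k
    (formMatrix_mul (Matrix.nonsing_inv_mul G hG))
  rw [hl] at h1
  -- The congruence of series is read off at `z^{-r} u^m`; since the trace does not involve `z`, the
  -- coefficients of `S(z)` separate.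
  have h2 := h1 r m
  refine redMap_mem_redVacIdeal ?_
  convert h2 using 1
  rw [map_sub (coeff r), coeff_mul_C, HahnSeries.coeff_sub, map_sub, map_mul, (hm m).1,
    RingHom.comp_apply, ofMinus, coeff_map, coeff_map, HahnSeries.C_apply,
    HahnSeries.coeff_single_zero_mul]
  congr 1
  rw [← ofCenter_algebraMap, ← cK_cst, coe_cK, PowerSeries.algebraMap_apply, ← map_mul, coeff_C]
  split_ifs
  · rw [HahnSeries.algebraMap_apply, HahnSeries.C_apply, HahnSeries.coeff_single_zero_mul, map_smul,
      (hm m).1, Algebra.smul_def]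
  · rw [map_zero, HahnSeries.coeff_zero]

theorem ATerm_vac (hG : IsUnit G) (m : ℤ) (a b d : Fin n → Fin N) (j : ℕ) :
    ATerm N G U m (vac N (critLevel N)) a b d j =
      (h ^ j * cst (coeff j (Ring.inverse (scalarBracket G U.content) d a))) •
        SPlusBracket N (critLevel N) G (nuShift U) b d (m + j) (vac N (critLevel N)) := by
  have h1 := act_inverse_vac hG U.content j d a
  rw [ATerm]
  change SPlusBracket N (critLevel N) G (nuShift U) b d (m + j) (act N (critLevel N)
    (coeff j (Ring.inverse (SBracket N (critLevel N) G
      (fun i => h * cst (U.content i) - h * cst ((N : ℂ) / 4))) d a)) _) = _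
  rw [h1, map_smul]

theorem ATerm_mem_hPow (hG : IsUnit G) (m : ℤ) (a b d : Fin n → Fin N) {j k : ℕ} (hj : k ≤ j) :
    ATerm N G U m (vac N (critLevel N)) a b d j ∈ hPow (Vac N (critLevel N)) k := by
  rw [ATerm_vac U hG, mul_smul]
  exact hPow_anti hj (smul_mem_hPow j _)

theorem hsummable_ATerm (hG : IsUnit G) (m : ℤ) (a b d : Fin n → Fin N) :
    HSummable (ATerm N G U m (vac N (critLevel N)) a b d) := by
  refine hsummable_of_finite (hComplete_vac _ _) fun k =>
    (Finset.range k).finite_toSet.subset fun j hj => ?_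
  by_contra hj'
  exact hj (ATerm_mem_hPow U hG m a b d (by simpa using hj'))

theorem MNu_sub_mem (hG : IsUnit G) (m : ℤ) (k : ℕ) :
    MNu N G U m - truncatedANu G U k m (vac N (critLevel N)) ∈ hPow (Vac N (critLevel N)) k := by
  rw [MNu, ANu, truncatedANu]
  simp only [LinearMap.sum_apply, LinearMap.smul_apply, Finset.smul_sum, ← Finset.sum_sub_distrib]
  refine Submodule.sum_mem _ fun a _ => Submodule.sum_mem _ fun b _ => Submodule.sum_mem _
    fun d _ => ?_
  rw [← Finset.smul_sum, ← smul_sub]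
  refine Submodule.smul_mem _ _ ?_
  have h1 := hsum_sub_sum_mem (hsummable_ATerm U hG m a b d) (k := k) (F := Finset.range k)
    fun j hj => ATerm_mem_hPow U hG m a b d (by simpa using hj)
  simpa only [ATerm_vac U hG] using h1

theorem MNu_mem_MVac (hN : N ≠ 0) (hG : IsUnit G.det) (m : ℤ) :
    MNu N G U m ∈ MVac N (critLevel N) G := by
  intro k
  obtain ⟨l, -, hm⟩ := isRed_truncatedANu U hN ((Matrix.isUnit_iff_isUnit_det G).2 hG) k
    (formMatrix_mul (Matrix.nonsing_inv_mul G hG))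
  obtain ⟨x, hx, h1⟩ := (hm m).2
  obtain ⟨y, hy, rfl⟩ := Subalgebra.mem_map.1 hx
  rw [← (hm m).1, ← sub_eq_zero, ← map_sub, redMap_eq_zero] at h1
  obtain ⟨χ, hχ⟩ := mem_hPow.1 h1
  obtain ⟨v, hv⟩ := mem_hPow.1 (MNu_sub_mem U ((Matrix.isUnit_iff_isUnit_det G).2 hG) m k)
  -- The approximating vector lies in the cyclic module itself, so no power of `h` is needed for
  -- saturation; the error combines the reduction of the operator and the truncation of the series.
  refine ⟨act N (critLevel N) y (vac N (critLevel N)), ⟨0, ?_⟩, v - χ (vac N (critLevel N)), ?_⟩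
  · rw [pow_zero, one_smul]
    exact ⟨y, hy, rfl⟩
  · have h2 := congrArg (fun φ : VacEnd N (critLevel N) => φ (vac N (critLevel N))) hχ
    simp only [LinearMap.smul_apply, LinearMap.sub_apply] at h2
    rw [smul_sub, hv, h2]
    exact (sub_sub_sub_cancel_right _ _ _).symm

theorem MNu_invariant (hN : N ≠ 0) (hG : IsUnit G.det)
    (hsymm : G.transpose = G ∨ G.transpose = -G) (m : ℤ) (i j : Fin N) (r : ℕ) :
    act N (critLevel N) (coeff r (SMatrix N (critLevel N) G i j)) (MNu N G U m) =
      if r = 0 then cst (G i j) • MNu N G U m else 0 := by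
  rw [← sub_eq_zero]
  refine hSeparated_vac _ _ _ fun k => ?_
  have h1 := truncatedANu_invariant U hN hG hsymm k m i j r
  obtain ⟨v, hv⟩ := mem_hPow.1 (MNu_sub_mem U ((Matrix.isUnit_iff_isUnit_det G).2 hG) m k)
  -- `MNu` is rewritten as its truncation plus `h^k v`: the truncation is invariant modulo `h^k`,
  -- and the rest contributes a multiple of `h^k`.
  rw [← eq_sub_iff_add_eq.2 (sub_add_cancel (MNu N G U m) _), eq_comm, sub_eq_iff_eq_add] at hv
  rw [hv, map_add, map_smul]
  rw [LinearMap.sub_apply, Module.End.mul_apply] at h1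
  have h2 := Submodule.add_mem _ (smul_mem_hPow k
    (act N (critLevel N) (coeff r (SMatrix N (critLevel N) G i j)) v -
      if r = 0 then cst (G i j) • v else 0)) h1
  convert h2 using 1
  split_ifs
  · rw [LinearMap.smul_apply, smul_sub, smul_add, smul_comm (h ^ k) (cst (G i j))]
    abel
  · rw [LinearMap.zero_apply, sub_zero, sub_zero, sub_zero]

theorem mNuWellDefined (hG : IsUnit G) : MNuWellDefined N G U :=
  ⟨isUnit_SBracket hG U.content, fun k _ _ m => hsummable_shiftTerm (U.content k) _ m,
    (isRedMat_SPlusBracket G U.content).1, fun m a b d => hsummable_ATerm U hG m a b d⟩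

end Invariance

end TwistedYangian

end

theorem corollary4p4 (N : ℕ) (hN : 2 ≤ N) (G : Matrix (Fin N) (Fin N) ℂ) (hG : IsUnit G.det)
    (hsymm : G.transpose = G ∨ G.transpose = -G) (ν : YoungDiagram) (hν : ν.colLen 0 ≤ N)
    (n : ℕ) (U : TwistedYangian.StdTableau ν n) :
    TwistedYangian.MNuWellDefined N G U ∧
      ∀ m : ℤ, TwistedYangian.MNu N G U m ∈
        TwistedYangian.invariants N (TwistedYangian.critLevel N) G := by
  have hN' : N ≠ 0 := by omega
  exact ⟨TwistedYangian.mNuWellDefined U ((Matrix.isUnit_iff_isUnit_det G).2 hG), fun m =>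
    ⟨TwistedYangian.MNu_mem_MVac U hN' hG m,
      TwistedYangian.MNu_invariant U hN' hG hsymm m⟩⟩
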